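/- **Setting.** Let $R=\hat{\mathbb Z}=\prod_p\mathbb Z_p\subset\mathbb A_f$, $\Gamma=\mathrm{SL}_2(\mathbb Z)$, $Y=M_2(R)\times\mathbb H$, on which $g=\begin{pmatrix}a&b\\c&d\end{pmatrix}\in \mathrm{GL}_2^+(\mathbb Q)$ acts partially by $g(\rho,\tau)=(g\rho,\frac{a\tau+b}{c\tau+d})$, the product $g\rho$ being taken in $M_2(\mathbb A_f)$. Let $Z$ be the quotient of $\{(g,y)\in \mathrm{GL}_2^+(\mathbb Q)\times Y: gy\in Y\}$ ($\mathrm{GL}_2^+(\mathbb Q)$ discrete) by the action $(g,y)\mapsto(\gamma_1g\gamma_2^{-1},\gamma_2y)$ of $\Gamma\times\Gamma$. The space $\mathcal A=C_c(Z)$ is an involutive algebra for $$(f_1*f_2)(g,y)=\sum_{h\in\Gamma\backslash \mathrm{GL}_2^+(\mathbb Q),\ hy\in Y}f_1(gh^{-1},hy)f_2(h,y),\qquad f^*(g,y)=\overline{f(g^{-1},gy)}.$$ For $y\in Y$ let $G_y=\{g\in \mathrm{GL}_2^+(\mathbb Q): gy\in Y\}$, $\mathcal H_y=\ell^2(\Gamma\backslash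 G_y)$, and let $\pi_y$ be the representation $(\pi_y(f)\xi)(g)=\sum_{h\in\Gamma\backslash G_y}f(gh^{-1},hy)\xi(h)$. Let $A$ be the $C^*$-completion of $\mathcal A$ for $\|f\|=\sup_{y\in Y}\|\pi_y(f)\|$, with the time evolution determined by $\sigma_t(f)(g,y)=\mathrm{Det}(g)^{it}f(g,y)$. Let $H_y$ be the diagonal operator $(H_y\xi)(g)=\log(\mathrm{Det}\,g)\,\xi(g)$ on $\mathcal H_y$. A $\mathbb Q$-lattice is a pair $l=(\Lambda,\phi)$ of a lattice $\Lambda\subset\mathbb C$ and a homomorphism $\phi:\mathbb Q^2/\mathbb Z^2\to\mathbb Q\Lambda/\Lambda$; it is invertible if $\phi$ is an isomorphism. Up to scaling by $\mathbb C^*$ every invertible $\mathbb Q$-lattice is of the form $\theta(\rho,\tau)=(\mathbb Z+\mathbb Z\tau,\ x\mapsto\rho_1(x)-\tau\rho_2(x))$ with $y=(\rho,\tau)\in Y$; one then writes $\pi_l$ for $\pi_y$. A KMS$_\beta$ state is a state $\varphi$ on $A$ (a positive linear form of norm $1$) such that for all $a,b\in A$ there is a function $F$, bounded and continuous on $\{0\le\mathrm{Im}\,z\le\beta\}$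 and holomorphic in the interior, with $F(t)=\varphi(a\sigma_t(b))$ and $F(t+i\beta)=\varphi(\sigma_t(b)a)$ for all $t\in\mathbb R$; it is extremal if it is an extreme point of the convex set of KMS$_\beta$ states. **Theorem.** 1. For each invertible $\mathbb Q$-lattice $l$, the representation $\pi_l$ is a positive energy representation of $(A,\sigma_t)$: the evolution is implemented in $\pi_l$ by a strongly continuous one-parameter unitary group with positive generator; moreover the eigenvalues $\log\mathrm{Det}(g)$, $g\in\Gamma\backslash G_y$, of $H_y$ are non-negative. 2. Let $\beta>2$. For every invertible $\mathbb Q$-lattice $l$, given up to scaling by $(\rho,\tau)\in Y$, the formula $$\varphi_{\beta,l}(f)=Z^{-1}\sum_{m\in\Gamma\backslash M_2(\mathbb Z)^+}f(1,m\rho,m(\tau))\,\mathrm{Det}(m)^{-\beta}\qquad(f\in C_c(Z)),$$ where $M_2(\mathbb Z)^+$ is the set of integral $2\times2$ matrices with positive determinant and $Z=\zeta(\beta)\zeta(\beta-1)$, defines an extremal KMS$_\beta$ state $\varphi_{\beta,l}$ on $(A,\sigma_t)$, and $Z=\mathrm{Trace}(e^{-\beta H_y})$ is the partition function. 3. For $\beta>2$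 the map $l\mapsto\varphi_{\beta,l}$ is a bijection from the space of invertible $\mathbb Q$-lattices up to scaling onto the set $\mathcal E_\beta$ of extremal KMS$_\beta$ states on $(A,\sigma_t)$. Moreover the space of invertible $\mathbb Q$-lattices up to scaling is identified with $\mathrm{GL}_2(\mathbb Q)\backslash \mathrm{GL}_2(\mathbb A)/\mathbb C^*$: there is a bijection sending the class of $(\alpha,\rho)\in \mathrm{GL}_2^+(\mathbb R)\times \mathrm{GL}_2(R)$ to the class of $\theta(\rho,\alpha(i))$, where $a+ib\in\mathbb C^*$ is embedded in $\mathrm{GL}_2(\mathbb R)$ as $\begin{pmatrix}a&b\\-b&a\end{pmatrix}$. -/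

import Mathlib

open scoped MatrixGroups UpperHalfPlane CompactlySupported ENNReal
open IsDedekindDomain

namespace GL2System
noncomputable section

/-- The group `GL₂⁺(ℚ)`. -/
abbrev G : Type := GL(2, ℚ)⁺

/-- The subgroup `Γ = SL₂(ℤ)` of `GL₂⁺(ℚ)`. -/
def Gam : Subgroup G :=
  (Matrix.SpecialLinearGroup.toGLPos.comp
    (Matrix.SpecialLinearGroup.map (n := Fin 2) (Int.castRingHom ℚ))).range

/-- The ring `𝔸_f` of finite adeles of `ℚ`. -/
abbrev Af : Type := FiniteAdeleRing ℤ ℚ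

/-- The ring `R = ∏_p ℤ_p` of integral finite adeles, as a subset of `𝔸_f`. -/
def R : Set Af := {a | ∀ v : HeightOneSpectrum ℤ, a v ∈ v.adicCompletionIntegers ℚ}

/-- The space `M₂(𝔸_f) × ℍ`. -/
abbrev AfH : Type := Matrix (Fin 2) (Fin 2) Af × ℍ

/-- The action `g(ρ, τ) = (gρ, (aτ+b)/(cτ+d))` of `GL₂⁺(ℚ)` on `M₂(𝔸_f) × ℍ`. -/
instance : MulAction G AfH where
  smul g y := ((Matrix.GeneralLinearGroup.map (algebraMap ℚ Af) g.1).1 * y.1,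
    Matrix.GeneralLinearGroup.map (algebraMap ℚ ℝ) g.1 • y.2)
  one_smul y := by
    refine Prod.ext ?_ ?_
    · change (Matrix.GeneralLinearGroup.map (algebraMap ℚ Af) (1 : GL (Fin 2) ℚ)).1 * y.1 = y.1
      simp
    · change Matrix.GeneralLinearGroup.map (algebraMap ℚ ℝ) (1 : GL (Fin 2) ℚ) • y.2 = y.2
      simp
  mul_smul g h y := by
    refine Prod.ext ?_ ?_
    · change (Matrix.GeneralLinearGroup.map (algebraMap ℚ Af) (g.1 * h.1)).1 * y.1 = 
        (Matrix.GeneralLinearGroup.map (algebraMap ℚ Af) g.1).1 *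
        ((Matrix.GeneralLinearGroup.map (algebraMap ℚ Af) h.1).1 * y.1)
      rw [map_mul, Units.val_mul, Matrix.mul_assoc]
    · change Matrix.GeneralLinearGroup.map (algebraMap ℚ ℝ) (g.1 * h.1) • y.2 =
        Matrix.GeneralLinearGroup.map (algebraMap ℚ ℝ) g.1 •
        (Matrix.GeneralLinearGroup.map (algebraMap ℚ ℝ) h.1 • y.2)
      rw [map_mul, mul_smul]

/-- The space `Y = M₂(R) × ℍ`. -/
def Y : Set AfH := {y | ∀ i j, y.1 i j ∈ R}

/-- The space `{(g, y) ∈ GL₂⁺(ℚ) × Y | g y ∈ Y}`, with `GL₂⁺(ℚ)` discrete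
(the topology of a sigma type is that of the disjoint union of its fibres). -/
abbrev PreZ : Type := Σ g : G, {y : AfH // y ∈ Y ∧ g • y ∈ Y}

/-- The orbit relation of the action `(g, y) ↦ (γ₁ g γ₂⁻¹, γ₂ y)` of `Γ × Γ`. -/
def zSetoid : Setoid PreZ where
  r p q := ∃ γ₁ ∈ Gam, ∃ γ₂ ∈ Gam, q.1 = γ₁ * p.1 * γ₂⁻¹ ∧ q.2.1 = γ₂ • p.2.1
  iseqv :=
    { refl := fun p => ⟨1, one_mem _, 1, one_mem _, by simp, by simp⟩
      symm := by
        rintro p q ⟨a, ha, b, hb, h1, h2⟩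
        exact ⟨a⁻¹, inv_mem ha, b⁻¹, inv_mem hb, by rw [h1]; group, by rw [h2]; simp⟩
      trans := by
        rintro p q r ⟨a, ha, b, hb, h1, h2⟩ ⟨c, hc, d, hd, h3, h4⟩
        exact ⟨c * a, mul_mem hc ha, d * b, mul_mem hd hb, by rw [h3, h1]; group,
          by rw [h4, h2, mul_smul]⟩ }

/-- The locally compact space `Z`, with the quotient topology. -/
abbrev Z : Type := Quotient zSetoid

/-- The convolution algebra `𝒜 = C_c(Z)` as a space of functions. -/
abbrev CcZ : Type := C_c(Z, ℂ)

open Classical in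
/-- The value `f(g, y)`, for `y ∈ Y` and `g y ∈ Y`; it is taken to be `0` elsewhere. -/
def val (f : CcZ) (g : G) (y : AfH) : ℂ :=
  if h : y ∈ Y ∧ g • y ∈ Y then f (Quotient.mk zSetoid ⟨g, y, h⟩) else 0

lemma R_add {a b : Af} (ha : a ∈ R) (hb : b ∈ R) : a + b ∈ R :=
  fun v => add_mem (ha v) (hb v)
lemma R_mul {a b : Af} (ha : a ∈ R) (hb : b ∈ R) : a * b ∈ R :=
  fun v => mul_mem (ha v) (hb v)
lemma R_int (n : ℤ) : algebraMap ℚ Af n ∈ R := by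
  intro v
  have : (algebraMap ℚ Af n) v = ((n : v.adicCompletion ℚ)) := by
    rw [FiniteAdeleRing.algebraMap_apply]
    exact map_intCast (algebraMap ℚ (v.adicCompletion ℚ)) n
  rw [this]
  exact intCast_mem _ n


/-- The semigroup `M₂(ℤ)⁺` of integral matrices with positive determinant, inside `GL₂⁺(ℚ)`. -/
def M2Zplus : Set G := {g | ∃ m : Matrix (Fin 2) (Fin 2) ℤ, ∀ i j, g.1.1 i j = m i j}

lemma M2Zplus_smul_mem {g : G} (hg : g ∈ M2Zplus) {y : AfH} (hy : y ∈ Y) : g • y ∈ Y := by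
  obtain ⟨m, hm⟩ := hg
  intro i j
  change (((Matrix.GeneralLinearGroup.map (algebraMap ℚ Af) g.1).1 * y.1) i j) ∈ R
  rw [Matrix.mul_apply, Fin.sum_univ_two]
  have h : ∀ k, (Matrix.GeneralLinearGroup.map (algebraMap ℚ Af) g.1).1 i k ∈ R := by
    intro k
    rw [Matrix.GeneralLinearGroup.map_apply, hm]
    exact R_int _
  exact R_add (R_mul (h 0) (hy 0 j)) (R_mul (h 1) (hy 1 j))

lemma Gam_le_M2Zplus {γ : G} (hγ : γ ∈ Gam) : γ ∈ M2Zplus := by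
  obtain ⟨s, rfl⟩ := hγ
  exact ⟨s.1, fun i j => rfl⟩

lemma Gam_smul_mem {γ : G} (hγ : γ ∈ Gam) {y : AfH} (hy : y ∈ Y) : γ • y ∈ Y :=
  M2Zplus_smul_mem (Gam_le_M2Zplus hγ) hy

lemma Gam_smul_mem_iff {γ : G} (hγ : γ ∈ Gam) {y : AfH} : γ • y ∈ Y ↔ y ∈ Y :=
  ⟨fun h => by simpa using Gam_smul_mem (inv_mem hγ) h, Gam_smul_mem hγ⟩

lemma val_invariant (f : CcZ) {a b : G} (ha : a ∈ Gam) (hb : b ∈ Gam) (g : G) (y : AfH) :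
    val f (a * g * b⁻¹) (b • y) = val f g y := by
  have key : (b • y ∈ Y ∧ (a * g * b⁻¹) • b • y ∈ Y) ↔ (y ∈ Y ∧ g • y ∈ Y) := by
    have : (a * g * b⁻¹) • b • y = a • g • y := by simp [mul_smul]
    rw [this, Gam_smul_mem_iff ha, Gam_smul_mem_iff hb]
  unfold val
  by_cases h : y ∈ Y ∧ g • y ∈ Y
  · rw [dif_pos h, dif_pos (key.2 h)]
    congr 1
    exact Quotient.sound ⟨a⁻¹, inv_mem ha, b⁻¹, inv_mem hb, by dsimp only; group, by simp⟩
  · rw [dif_neg h, dif_neg (fun h' => h (key.1 h'))]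

/-- The equivalence relation `g ∼ γ g`, `γ ∈ Γ`, on a subset `S` of `GL₂⁺(ℚ)`. -/
def cosetSetoid (S : Set G) : Setoid S where
  r g h := ∃ γ ∈ Gam, (h : G) = γ * g
  iseqv :=
    { refl := fun p => ⟨1, one_mem _, by simp⟩
      symm := by
        rintro p q ⟨a, ha, h⟩
        exact ⟨a⁻¹, inv_mem ha, by rw [h]; group⟩
      trans := by
        rintro p q r ⟨a, ha, h⟩ ⟨b, hb, h'⟩
        exact ⟨b * a, mul_mem hb ha, by rw [h', h, mul_assoc]⟩ }

/-- The set of cosets `Γ \ S`. -/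
abbrev Cosets (S : Set G) : Type := Quotient (cosetSetoid S)

/-- The set `G_y = {g ∈ GL₂⁺(ℚ) | g y ∈ Y}`. -/
def Gy (y : AfH) : Set G := {g | g • y ∈ Y}

/-- The determinant of an element of `GL₂⁺(ℚ)`, as a real number. -/
def detR (g : G) : ℝ := ((g.1.1.det : ℚ) : ℝ)

lemma detR_pos (g : G) : 0 < detR g := by
  have h : 0 < g.1.1.det := g.2
  exact Rat.cast_pos.2 h

lemma detR_mul (g h : G) : detR (g * h) = detR g * detR h := by
  simp [detR, Matrix.det_mul]

lemma detR_one : detR 1 = 1 := by simp [detR]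

lemma detR_inv (g : G) : detR g⁻¹ = (detR g)⁻¹ :=
  eq_inv_of_mul_eq_one_left (by rw [← detR_mul, inv_mul_cancel, detR_one])

lemma detR_Gam {γ : G} (hγ : γ ∈ Gam) : detR γ = 1 := by
  obtain ⟨s, rfl⟩ := hγ
  have := (Matrix.SpecialLinearGroup.map (n := Fin 2) (Int.castRingHom ℚ) s).2
  change (((Matrix.SpecialLinearGroup.map (n := Fin 2) (Int.castRingHom ℚ) s).1.det : ℚ) : ℝ) = 1
  rw [this]; simp

/-- The determinant on `Γ \ S`. -/
def cosetDet {S : Set G} (x : Cosets S) : ℝ :=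
  Quotient.lift (fun g : S => detR g) (by
    rintro g h ⟨γ, hγ, e⟩
    simp [e, detR_mul, detR_Gam hγ]) x

lemma cosetDet_pos {S : Set G} (x : Cosets S) : 0 < cosetDet x :=
  Quotient.inductionOn x fun g => detR_pos g

/-- The matrix coefficient `f(g h⁻¹, h y)`, as a function on `Γ \ G_y × Γ \ G_y`. -/
def kernel (f : CcZ) (y : AfH) (p q : Cosets (Gy y)) : ℂ :=
  Quotient.liftOn₂ p q (fun g h => val f ((g : G) * (h : G)⁻¹) ((h : G) • y)) (by
    rintro g h g' h' ⟨a, ha, e⟩ ⟨b, hb, e'⟩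
    simp only [e, e']
    rw [← val_invariant f ha hb, mul_smul]
    congr 1
    group)

/-- The Hilbert space `ℋ_y = ℓ²(Γ \ G_y)`. -/
abbrev Hy (y : AfH) : Type := lp (fun _ : Cosets (Gy y) => ℂ) 2

section Operators

variable {I : Type*}

/-- A matrix with uniformly bounded entries and at most `N` non-zero entries in each row and
in each column. -/
structure IsBand (N : ℕ) (M : ℝ) (K : I → I → ℂ) : Prop where
  row : ∀ i, ∃ s : Finset I, s.card ≤ N ∧ ∀ j, K i j ≠ 0 → j ∈ s
  col : ∀ j, ∃ s : Finset I, s.card ≤ N ∧ ∀ i, K i j ≠ 0 → i ∈ s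
  bound : ∀ i j, ‖K i j‖ ≤ M

lemma IsBand.sum_le {N : ℕ} {M : ℝ} {K : I → I → ℂ} (h : IsBand N M K)
    (x : lp (fun _ : I => ℂ) 2) (F : Finset I) :
    ∑ i ∈ F, ‖∑' j, K i j * x j‖ ^ 2 ≤ (M * N * ‖x‖) ^ 2 := by
  classical
  choose s hs hs' using h.row
  choose t ht ht' using h.col
  have hx : ∀ E : Finset I, ∑ j ∈ E, ‖x j‖ ^ 2 ≤ ‖x‖ ^ 2 := by
    intro E
    have := lp.sum_rpow_le_norm_rpow (p := 2) (by norm_num) x E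
    simpa using this
  rcases F.eq_empty_or_nonempty with rfl | ⟨i₀, -⟩
  · simp; positivity
  have hM : 0 ≤ M := (norm_nonneg _).trans (h.bound i₀ i₀)
  have h1 : ∀ i, ‖∑' j, K i j * x j‖ ^ 2 ≤
      M ^ 2 * N * ∑ j ∈ s i, if K i j ≠ 0 then ‖x j‖ ^ 2 else 0 := by
    intro i
    rw [tsum_eq_sum (s := s i) (fun j hj => by
      by_contra hne
      exact hj (hs' i j (left_ne_zero_of_mul hne)))]
    calc ‖∑ j ∈ s i, K i j * x j‖ ^ 2
        ≤ (∑ j ∈ s i, M * (if K i j ≠ 0 then ‖x j‖ else 0)) ^ 2 := by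
          gcongr
          refine (norm_sum_le _ _).trans (Finset.sum_le_sum fun j _ => ?_)
          split_ifs with hk
          · rw [norm_mul]
            gcongr
            exact h.bound i j
          · simp [not_not.1 hk]
      _ ≤ (s i).card * ∑ j ∈ s i, (M * (if K i j ≠ 0 then ‖x j‖ else 0)) ^ 2 :=
          sq_sum_le_card_mul_sum_sq
      _ ≤ N * ∑ j ∈ s i, (M * (if K i j ≠ 0 then ‖x j‖ else 0)) ^ 2 := by
          gcongr
          exact hs i
      _ = _ := by
          rw [mul_comm (M ^ 2), mul_assoc, Finset.mul_sum (a := M ^ 2)]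
          congr 1
          refine Finset.sum_congr rfl fun j _ => ?_
          split_ifs <;> ring
  calc ∑ i ∈ F, ‖∑' j, K i j * x j‖ ^ 2
      ≤ ∑ i ∈ F, M ^ 2 * N * ∑ j ∈ s i, if K i j ≠ 0 then ‖x j‖ ^ 2 else 0 :=
        Finset.sum_le_sum fun i _ => h1 i
    _ ≤ ∑ i ∈ F, M ^ 2 * N * ∑ j ∈ F.biUnion s, if K i j ≠ 0 then ‖x j‖ ^ 2 else 0 := by
        refine Finset.sum_le_sum fun i hi => mul_le_mul_of_nonneg_left ?_ (by positivity)
        refine Finset.sum_le_sum_of_subset_of_nonneg (Finset.subset_biUnion_of_mem s hi) ?_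
        intros; positivity
    _ = M ^ 2 * N * ∑ j ∈ F.biUnion s, ∑ i ∈ F, if K i j ≠ 0 then ‖x j‖ ^ 2 else 0 := by
        rw [← Finset.mul_sum, Finset.sum_comm]
    _ ≤ M ^ 2 * N * ∑ j ∈ F.biUnion s, N * ‖x j‖ ^ 2 := by
        gcongr with j _
        rw [← Finset.sum_filter, Finset.sum_const, nsmul_eq_mul]
        gcongr
        refine (Finset.card_le_card fun i hi => ?_).trans (ht j)
        exact ht' j i (Finset.mem_filter.1 hi).2
    _ ≤ M ^ 2 * N * (N * ‖x‖ ^ 2) := by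
        rw [← Finset.mul_sum]
        gcongr
        exact hx _
    _ = _ := by ring

lemma IsBand.summable {N : ℕ} {M : ℝ} {K : I → I → ℂ} (h : IsBand N M K) (x : I → ℂ) (i : I) :
    Summable fun j => K i j * x j := by
  obtain ⟨s, -, hs⟩ := h.row i
  exact summable_of_ne_finset_zero (s := s) fun j hj => by
    by_contra hne
    exact hj (hs j (left_ne_zero_of_mul hne))

/-- The bounded operator on `ℓ²` with a given matrix. -/
def kernelOp {N : ℕ} {M : ℝ} (K : I → I → ℂ) (h : IsBand N M K) :
    lp (fun _ : I => ℂ) 2 →L[ℂ] lp (fun _ : I => ℂ) 2 :=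
  LinearMap.mkContinuous
    { toFun := fun x => ⟨fun i => ∑' j, K i j * x j, memℓp_gen' (C := (M * N * ‖x‖) ^ 2) (by
        intro F
        simpa using h.sum_le x F)⟩
      map_add' := fun x y => by
        ext i
        change ∑' j, K i j * (x j + y j) = ∑' j, K i j * x j + ∑' j, K i j * y j
        rw [← (h.summable x i).tsum_add (h.summable y i)]
        simp [mul_add]
      map_smul' := fun c x => by
        ext i
        change ∑' j, K i j * (c * x j) = c * ∑' j, K i j * x j
        rw [← tsum_mul_left]
        congr 1; ext j; ring }
    (|M| * N)
    (fun x => by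
      refine lp.norm_le_of_forall_sum_le (by norm_num) (by positivity) fun F => ?_
      refine le_of_eq_of_le (by simp) ((h.sum_le x F).trans ?_)
      simp only [ENNReal.toReal_ofNat, Real.rpow_ofNat]
      rw [mul_assoc, mul_assoc, mul_pow, mul_pow |M|, sq_abs])

lemma kernelOp_apply {N : ℕ} {M : ℝ} (K : I → I → ℂ) (h : IsBand N M K)
    (x : lp (fun _ : I => ℂ) 2) (i : I) : kernelOp K h x i = ∑' j, K i j * x j := rfl

lemma norm_kernelOp_le {N : ℕ} {M : ℝ} (K : I → I → ℂ) (h : IsBand N M K) :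
    ‖kernelOp K h‖ ≤ |M| * N :=
  LinearMap.mkContinuous_norm_le _ (by positivity) _

/-- The diagonal operator with entries `c i` of absolute value one. -/
def diagOp (c : I → ℂ) (hc : ∀ i, ‖c i‖ = 1) :
    lp (fun _ : I => ℂ) 2 →L[ℂ] lp (fun _ : I => ℂ) 2 :=
  LinearMap.mkContinuous
    { toFun := fun x => ⟨fun i => c i * x i, memℓp_gen (by
        simpa [hc] using (lp.memℓp x).summable (by norm_num))⟩
      map_add' := fun x y => by
        ext i
        exact mul_add _ _ _
      map_smul' := fun a x => by
        ext i
        exact mul_left_comm _ _ _ }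
    1
    (fun x => by
      refine lp.norm_le_of_forall_sum_le (by norm_num) (by positivity) fun F => ?_
      rw [one_mul]
      refine le_of_eq_of_le ?_ (lp.sum_rpow_le_norm_rpow (p := 2) (by norm_num) x F)
      refine Finset.sum_congr rfl fun i _ => ?_
      change ‖c i * x i‖ ^ _ = _
      rw [norm_mul, hc, one_mul])

lemma diagOp_apply (c : I → ℂ) (hc : ∀ i, ‖c i‖ = 1) (x : lp (fun _ : I => ℂ) 2) (i : I) :
    diagOp c hc x i = c i * x i := rfl

lemma norm_diagOp_le (c : I → ℂ) (hc : ∀ i, ‖c i‖ = 1) : ‖diagOp c hc‖ ≤ 1 :=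
  LinearMap.mkContinuous_norm_le _ zero_le_one _

end Operators

section Finiteness

/-- The quotient `Γ \ GL₂⁺(ℚ)`. -/
abbrev RC : Type := Quotient (QuotientGroup.rightRel Gam)

lemma rc_eq {a b : G} : (Quotient.mk _ a : RC) = Quotient.mk _ b ↔ b * a⁻¹ ∈ Gam := by
  rw [Quotient.eq]
  exact QuotientGroup.rightRel_apply

lemma finite_rc (g : G) : {x : RC | ∃ γ ∈ Gam, x = Quotient.mk _ (g * γ)}.Finite := by
  obtain ⟨N, hN, h⟩ := CongruenceSubgroup.exists_Gamma_le_conj g.1 1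
  have : NeZero N := ⟨hN⟩
  let ι : Matrix.SpecialLinearGroup (Fin 2) ℤ →* G := Matrix.SpecialLinearGroup.toGLPos.comp
    (Matrix.SpecialLinearGroup.map (n := Fin 2) (Int.castRingHom ℚ))
  let φ : Matrix.SpecialLinearGroup (Fin 2) ℤ → RC := fun s => Quotient.mk _ (g * ι s)
  let r := Matrix.SpecialLinearGroup.map (n := Fin 2) (Int.castRingHom (ZMod N))
  have hφ : Function.FactorsThrough φ r := by
    intro a b hab
    refine rc_eq.2 ?_
    have hm : b * a⁻¹ ∈ CongruenceSubgroup.Gamma N := by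
      change r (b * a⁻¹) = 1
      rw [map_mul, map_inv, hab, mul_inv_cancel]
    obtain ⟨c, -, hc⟩ := h _ hm
    refine ⟨c, ?_⟩
    have e : g * ι b * (g * ι a)⁻¹ = g * ι (b * a⁻¹) * g⁻¹ := by
      rw [map_mul, map_inv]; group
    rw [e]
    exact Subtype.ext hc
  refine ((Set.finite_range (Function.extend r φ fun _ => Quotient.mk _ 1))).subset ?_
  rintro x ⟨γ, ⟨s, rfl⟩, rfl⟩
  exact ⟨r s, hφ.extend_apply _ s⟩

/-- The double coset `Γ g Γ` of a point of `Z`. -/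
def zCoset (z : Z) : DoubleCoset.Quotient (Gam : Set G) Gam :=
  Quotient.lift (fun p : PreZ => DoubleCoset.mk Gam Gam p.1) (by
    rintro p q ⟨a, ha, b, hb, h, -⟩
    exact (DoubleCoset.eq Gam Gam _ _).2 ⟨a, ha, b⁻¹, inv_mem hb, h⟩) z

lemma finite_support (f : CcZ) :
    ∃ D : Set (DoubleCoset.Quotient (Gam : Set G) Gam), D.Finite ∧
      ∀ g y, val f g y ≠ 0 → DoubleCoset.mk Gam Gam g ∈ D := by
  let _ : TopologicalSpace (DoubleCoset.Quotient (Gam : Set G) Gam) := ⊥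
  have : DiscreteTopology (DoubleCoset.Quotient (Gam : Set G) Gam) := ⟨rfl⟩
  have hc : Continuous zCoset := by
    refine Continuous.quotient_lift ?_ _
    exact continuous_sigma fun g => continuous_const (y := DoubleCoset.mk Gam Gam g)
  refine ⟨zCoset '' tsupport f, (f.hasCompactSupport.isCompact.image hc).finite_of_discrete, ?_⟩
  intro g y h
  unfold val at h
  split_ifs at h with h'
  · exact ⟨_, subset_tsupport _ h, rfl⟩
  · exact absurd rfl h

lemma exists_finsets (f : CcZ) : ∃ F F' : Finset RC, ∀ g y, val f g y ≠ 0 →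
    Quotient.mk _ g ∈ F ∧ Quotient.mk _ g⁻¹ ∈ F' := by
  obtain ⟨D, hD, h⟩ := finite_support f
  have h1 : (⋃ q ∈ D, {x : RC | ∃ γ ∈ Gam, x = Quotient.mk _ (q.out * γ)}).Finite :=
    hD.biUnion fun q _ => finite_rc _
  have h2 : (⋃ q ∈ D, {x : RC | ∃ γ ∈ Gam, x = Quotient.mk _ (q.out⁻¹ * γ)}).Finite :=
    hD.biUnion fun q _ => finite_rc _
  refine ⟨h1.toFinset, h2.toFinset, fun g y hg => ?_⟩
  obtain ⟨a, b, ha, hb, e⟩ := DoubleCoset.mk_out_eq_mul Gam Gam g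
  rw [Set.Finite.mem_toFinset, Set.Finite.mem_toFinset]
  simp only [Set.mem_iUnion]
  refine ⟨⟨_, h g y hg, b⁻¹, inv_mem hb, ?_⟩, ⟨_, h g y hg, a, ha, ?_⟩⟩
  · refine rc_eq.2 ?_
    rw [e]
    convert ha using 1
    group
  · refine rc_eq.2 ?_
    rw [e]
    convert inv_mem hb using 1
    group

/-- Right translation `Γ g ↦ Γ g h⁻¹`. -/
def translate {S : Set G} (h : G) (x : Cosets S) : RC :=
  Quotient.lift (fun g : S => (Quotient.mk _ ((g : G) * h⁻¹) : RC)) (by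
    rintro g g' ⟨a, ha, e⟩
    refine rc_eq.2 ?_
    rw [e]
    convert ha using 1
    group) x

lemma translate_injective {S : Set G} (h : G) :
    Function.Injective (translate h : Cosets S → RC) := by
  intro x y
  refine Quotient.inductionOn₂ x y fun a b e => ?_
  have := rc_eq.1 e
  refine Quotient.sound ⟨_, this, ?_⟩
  group

lemma exists_finset {S : Set G} (h : G) (F : Finset RC) (P : Cosets S → Prop)
    (hP : ∀ x, P x → translate h x ∈ F) :
    ∃ s : Finset (Cosets S), s.card ≤ F.card ∧ ∀ x, P x → x ∈ s := by
  classical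
  refine ⟨F.preimage (translate h) (translate_injective h).injOn, ?_, fun x hx => ?_⟩
  · exact Finset.card_le_card_of_injOn (translate h) (fun x hx => Finset.mem_preimage.1 hx)
      (translate_injective h).injOn
  · exact Finset.mem_preimage.2 (hP x hx)

lemma exists_band (f : CcZ) : ∃ (N : ℕ) (M : ℝ), ∀ y, IsBand N M (kernel f y) := by
  obtain ⟨F, F', hF⟩ := exists_finsets f
  obtain ⟨M, hM⟩ := f.hasCompactSupport.exists_bound_of_continuous f.continuous
  refine ⟨max F.card F'.card, max M 0, fun y => ⟨fun i => ?_, fun j => ?_, fun i j => ?_⟩⟩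
  · refine Quotient.inductionOn i fun g => ?_
    obtain ⟨s, hs, hs'⟩ := exists_finset (S := Gy y) g F'
      (fun j => kernel f y (Quotient.mk _ g) j ≠ 0) (fun j => Quotient.inductionOn j fun h hk => by
        have := (hF _ _ hk).2
        rwa [mul_inv_rev, inv_inv] at this)
    exact ⟨s, hs.trans (le_max_right _ _), hs'⟩
  · refine Quotient.inductionOn j fun h => ?_
    obtain ⟨s, hs, hs'⟩ := exists_finset (S := Gy y) h F
      (fun i => kernel f y i (Quotient.mk _ h) ≠ 0) (fun i => Quotient.inductionOn i fun g hk =>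
        (hF _ _ hk).1)
    exact ⟨s, hs.trans (le_max_left _ _), hs'⟩
  · refine Quotient.inductionOn₂ i j fun g h => ?_
    change ‖val f _ _‖ ≤ _
    unfold val
    split_ifs
    · exact (hM _).trans (le_max_left _ _)
    · simp

end Finiteness

/-- The operator `π_y(f)` on `ℋ_y`,
`(π_y(f) ξ)(g) = ∑_{h ∈ Γ \ G_y} f(g h⁻¹, h y) ξ(h)`. -/
def piOp (f : CcZ) (y : AfH) : Hy y →L[ℂ] Hy y :=
  kernelOp (kernel f y) ((exists_band f).choose_spec.choose_spec y)

lemma piOp_apply (f : CcZ) (y : AfH) (ξ : Hy y) (g : Cosets (Gy y)) :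
    piOp f y ξ g = ∑' h, kernel f y g h * ξ h := rfl

/-- The C⋆-algebra of uniformly bounded families of operators on the spaces `ℋ_y`, `y ∈ Y`,
with the norm `‖T‖ = sup_y ‖T_y‖`. -/
def Ambient : Type := lp (fun y : Y => Hy y.1 →L[ℂ] Hy y.1) ∞

instance : NonUnitalCStarAlgebra Ambient :=
  inferInstanceAs (NonUnitalCStarAlgebra (lp (fun y : Y => Hy y.1 →L[ℂ] Hy y.1) ∞))

instance : CoeFun Ambient fun _ => ∀ y : Y, Hy y.1 →L[ℂ] Hy y.1 := ⟨fun T => T.1⟩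

lemma Ambient.ext {S T : Ambient} (h : ∀ y, S y = T y) : S = T := Subtype.ext (funext h)

lemma Ambient.norm_apply_le (T : Ambient) (y : Y) : ‖T y‖ ≤ ‖T‖ :=
  lp.norm_apply_le_norm (by simp) (show lp (fun y : Y => Hy y.1 →L[ℂ] Hy y.1) ∞ from T) y

/-- The family `(π_y(f))_{y ∈ Y}`. -/
def piAll (f : CcZ) : Ambient :=
  ⟨fun y => piOp f y.1, memℓp_infty ⟨_, by
    rintro _ ⟨y, rfl⟩
    exact norm_kernelOp_le _ _⟩⟩

/-- The C⋆-algebra `A` of the `GL₂`-system: the completion of `𝒜 = C_c(Z)` for the norm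
`‖f‖ = sup_{y ∈ Y} ‖π_y(f)‖`, that is, the closed `⋆`-algebra of families of operators generated
by the `(π_y(f))_y`. The product and the adjoint of operators induce on `C_c(Z)` the convolution
`(f₁ * f₂)(g, y) = ∑_{h ∈ Γ \ G_y} f₁(g h⁻¹, h y) f₂(h, y)` and the involution
`f^*(g, y) = conj f(g⁻¹, g y)`. -/
def A : NonUnitalStarSubalgebra ℂ Ambient :=
  (NonUnitalStarAlgebra.adjoin ℂ (Set.range piAll)).topologicalClosure

/-- `A` is closed, so that it is a C⋆-algebra. -/
instance : IsClosed (A : Set Ambient) := NonUnitalStarSubalgebra.isClosed_topologicalClosure _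

/-- The element of `A` given by a function `f ∈ C_c(Z)`. -/
def toA (f : CcZ) : A :=
  ⟨piAll f, _root_.subset_closure (NonUnitalStarAlgebra.subset_adjoin ℂ _ ⟨f, rfl⟩)⟩

/-- The representation `π_y` of `A` on `ℋ_y`. -/
def rep (y : Y) : A →⋆ₙₐ[ℂ] (Hy y.1 →L[ℂ] Hy y.1) where
  toFun a := a.1 y
  map_smul' _ _ := rfl
  map_zero' := rfl
  map_add' _ _ := rfl
  map_mul' _ _ := rfl
  map_star' _ := rfl

/-- The scalar `d ^ (it)`. -/
def phase (d t : ℝ) : ℂ := (d : ℂ) ^ ((t : ℂ) * Complex.I)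

lemma norm_phase {d : ℝ} (hd : 0 < d) (t : ℝ) : ‖phase d t‖ = 1 := by
  rw [phase, Complex.norm_cpow_eq_rpow_re_of_pos hd]
  simp

lemma phase_add {d : ℝ} (hd : 0 < d) (s t : ℝ) : phase d (s + t) = phase d s * phase d t := by
  rw [phase, phase, phase, ← Complex.cpow_add _ _ (by exact_mod_cast hd.ne')]
  push_cast
  ring_nf

lemma phase_zero (d : ℝ) : phase d 0 = 1 := by simp [phase]

lemma phase_mul {c d : ℝ} (hc : 0 < c) (hd : 0 < d) (t : ℝ) :
    phase (c * d) t = phase c t * phase d t := by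
  rw [phase, phase, phase, Complex.ofReal_mul, Complex.mul_cpow_ofReal_nonneg hc.le hd.le]

lemma phase_inv {d : ℝ} (hd : 0 < d) (t : ℝ) : phase d⁻¹ t = phase d (-t) := by
  have h1 : phase d⁻¹ t * phase d t = 1 := by
    rw [← phase_mul (inv_pos.2 hd) hd, inv_mul_cancel₀ hd.ne']
    simp [phase]
  have h2 : phase d (-t) * phase d t = 1 := by
    rw [← phase_add hd, neg_add_cancel, phase_zero]
  have h3 : phase d t ≠ 0 := right_ne_zero_of_mul_eq_one h1
  exact mul_right_cancel₀ h3 (h1.trans h2.symm)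

lemma conj_phase {d : ℝ} (hd : 0 < d) (t : ℝ) :
    (starRingEnd ℂ) (phase d t) = phase d (-t) := by
  have h2 : phase d (-t) * phase d t = 1 := by
    rw [← phase_add hd, neg_add_cancel, phase_zero]
  have h1 : (starRingEnd ℂ) (phase d t) * phase d t = 1 := by
    rw [mul_comm, Complex.mul_conj, Complex.normSq_eq_norm_sq, norm_phase hd]
    simp
  exact mul_right_cancel₀ (right_ne_zero_of_mul_eq_one h1) (h1.trans h2.symm)

/-- The unitary `e^{itH_y}` of `ℋ_y`, where `H_y` is the diagonal operator with
`(H_y ξ)(g) = log(Det g) ξ(g)`. -/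
def timeU (y : AfH) (t : ℝ) : Hy y →L[ℂ] Hy y :=
  diagOp (fun x => phase (cosetDet x) t) (fun x => norm_phase (cosetDet_pos x) t)

lemma timeU_apply (y : AfH) (t : ℝ) (ξ : Hy y) (x : Cosets (Gy y)) :
    timeU y t ξ x = phase (cosetDet x) t * ξ x := rfl

lemma timeU_add (y : AfH) (s t : ℝ) : timeU y (s + t) = timeU y s * timeU y t := by
  ext ξ x
  change phase _ _ * _ = phase _ _ * (phase _ _ * _)
  rw [phase_add (cosetDet_pos x), mul_assoc]

lemma timeU_zero (y : AfH) : timeU y 0 = 1 := by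
  ext ξ x
  change phase _ _ * _ = _
  rw [phase_zero, one_mul]
  rfl

lemma timeU_neg_mul (y : AfH) (t : ℝ) : timeU y (-t) * timeU y t = 1 := by
  rw [← timeU_add, neg_add_cancel, timeU_zero]

lemma star_timeU (y : AfH) (t : ℝ) : star (timeU y t) = timeU y (-t) := by
  rw [ContinuousLinearMap.star_eq_adjoint]
  symm
  rw [ContinuousLinearMap.eq_adjoint_iff]
  intro ξ η
  rw [lp.inner_eq_tsum, lp.inner_eq_tsum]
  congr 1
  ext x
  rw [timeU_apply, timeU_apply, RCLike.inner_apply, RCLike.inner_apply, map_mul,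
    conj_phase (cosetDet_pos x), neg_neg]
  ring

lemma norm_timeU_le (y : AfH) (t : ℝ) : ‖timeU y t‖ ≤ 1 :=
  norm_diagOp_le _ _

lemma norm_conj_le (y : AfH) (t : ℝ) (T : Hy y →L[ℂ] Hy y) :
    ‖timeU y t * T * timeU y (-t)‖ ≤ ‖T‖ := by
  calc ‖timeU y t * T * timeU y (-t)‖ ≤ ‖timeU y t‖ * ‖T‖ * ‖timeU y (-t)‖ := 
        (norm_mul_le _ _).trans (by gcongr; exact norm_mul_le _ _)
    _ ≤ 1 * ‖T‖ * 1 := by gcongr <;> exact norm_timeU_le _ _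
    _ = ‖T‖ := by ring

/-- The one-parameter group `T ↦ (e^{itH_y} T_y e^{-itH_y})_y` on families of operators. -/
def ambientEvolution (t : ℝ) : Ambient →⋆ₙₐ[ℂ] Ambient where
  toFun T := ⟨fun y => timeU y.1 t * T y * timeU y.1 (-t), memℓp_infty ⟨‖T‖, by
    rintro _ ⟨y, rfl⟩
    exact (norm_conj_le _ _ _).trans (T.norm_apply_le y)⟩⟩
  map_smul' c T := by
    refine Ambient.ext fun y => ?_
    change timeU y.1 t * (c • T y) * timeU y.1 (-t) = c • (timeU y.1 t * T y * timeU y.1 (-t))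
    rw [mul_smul_comm, smul_mul_assoc]
  map_zero' := by
    refine Ambient.ext fun y => ?_
    change timeU y.1 t * 0 * timeU y.1 (-t) = 0
    rw [mul_zero, zero_mul]
  map_add' S T := by
    refine Ambient.ext fun y => ?_
    change timeU y.1 t * (S y + T y) * timeU y.1 (-t) =
      timeU y.1 t * S y * timeU y.1 (-t) + timeU y.1 t * T y * timeU y.1 (-t)
    rw [mul_add, add_mul]
  map_mul' S T := by
    refine Ambient.ext fun y => ?_
    change timeU y.1 t * (S y * T y) * timeU y.1 (-t) =
      (timeU y.1 t * S y * timeU y.1 (-t)) * (timeU y.1 t * T y * timeU y.1 (-t))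
    have h := timeU_neg_mul y.1 t
    calc _ = timeU y.1 t * S y * 1 * T y * timeU y.1 (-t) := by rw [mul_one]; simp only [mul_assoc]
      _ = _ := by rw [← h]; simp only [mul_assoc]
  map_star' T := by
    refine Ambient.ext fun y => ?_
    change timeU y.1 t * star (T y) * timeU y.1 (-t) = star (timeU y.1 t * T y * timeU y.1 (-t))
    rw [star_mul, star_mul, star_timeU, star_timeU, neg_neg, mul_assoc]

lemma continuous_ambientEvolution (t : ℝ) : Continuous (ambientEvolution t) := by
  refine AddMonoidHomClass.continuous_of_bound (ambientEvolution t) 1 fun T => ?_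
  rw [one_mul]
  exact lp.norm_le_of_forall_le (norm_nonneg _) fun y =>
    (norm_conj_le _ _ _).trans (T.norm_apply_le y)

/-- The determinant as a function on `Z`. -/
def zDet (z : Z) : ℝ :=
  Quotient.lift (fun p : PreZ => detR p.1) (by
    rintro p q ⟨a, ha, b, hb, h, -⟩
    simp [h, detR_mul, detR_inv, detR_Gam ha, detR_Gam hb]) z

/-- The time evolution `σ_t(f)(g, y) = (Det g)^{it} f(g, y)` on `C_c(Z)`. -/
def sigmaFun (t : ℝ) (f : CcZ) : CcZ where
  toFun z := phase (zDet z) t * f z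
  continuous_toFun := by
    refine Continuous.mul ?_ f.continuous
    have : Continuous zDet := by
      refine Continuous.quotient_lift ?_ _
      exact continuous_sigma fun g => continuous_const (y := detR g)
    have hpos : ∀ z, 0 < zDet z := fun z => Quotient.inductionOn z fun p => detR_pos p.1
    refine Continuous.cpow (Complex.continuous_ofReal.comp this) continuous_const fun z => ?_
    exact Or.inl (by simpa using hpos z)
  hasCompactSupport' := f.hasCompactSupport.mul_left

lemma val_sigmaFun (t : ℝ) (f : CcZ) (g : G) (y : AfH) :
    val (sigmaFun t f) g y = phase (detR g) t * val f g y := by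
  unfold val
  split_ifs
  · rfl
  · simp

lemma ambientEvolution_piAll (t : ℝ) (f : CcZ) :
    ambientEvolution t (piAll f) = piAll (sigmaFun t f) := by
  refine Ambient.ext fun y => ?_
  ext ξ x
  change phase (cosetDet x) t * (∑' h, kernel f y.1 x h * (phase (cosetDet h) (-t) * ξ h)) =
    ∑' h, kernel (sigmaFun t f) y.1 x h * ξ h
  rw [← tsum_mul_left]
  congr 1
  funext h
  suffices kernel (sigmaFun t f) y.1 x h =
      phase (cosetDet x) t * phase (cosetDet h) (-t) * kernel f y.1 x h by rw [this]; ring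
  refine Quotient.inductionOn₂ x h fun a b => ?_
  change val _ _ _ = phase (detR a) t * phase (detR b) (-t) * val _ _ _
  rw [val_sigmaFun, detR_mul, phase_mul (detR_pos _) (detR_pos _), detR_inv,
    phase_inv (detR_pos _)]

lemma ambientEvolution_mem (t : ℝ) (a : A) : ambientEvolution t a.1 ∈ A := by
  have h : A ≤ NonUnitalStarSubalgebra.comap (ambientEvolution t) A := by
    refine NonUnitalStarSubalgebra.topologicalClosure_minimal _ ?_ ?_
    · refine NonUnitalStarAlgebra.adjoin_le ?_
      rintro _ ⟨f, rfl⟩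
      change ambientEvolution t (piAll f) ∈ A
      rw [ambientEvolution_piAll]
      exact (toA _).2
    · exact (NonUnitalStarSubalgebra.isClosed_topologicalClosure _).preimage
        (continuous_ambientEvolution t)
  exact h a.2

/-- The time evolution `σ_t` on `A`. -/
def sigma (t : ℝ) : A →⋆ₙₐ[ℂ] A where
  toFun a := ⟨ambientEvolution t a.1, ambientEvolution_mem t a⟩
  map_smul' c a := Subtype.ext (map_smul (ambientEvolution t) c a.1)
  map_zero' := Subtype.ext (map_zero (ambientEvolution t))
  map_add' a b := Subtype.ext (map_add (ambientEvolution t) a.1 b.1)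
  map_mul' a b := Subtype.ext (map_mul (ambientEvolution t) a.1 b.1)
  map_star' a := Subtype.ext (map_star (ambientEvolution t) a.1)

/-- On functions, `σ_t` is given by `σ_t(f)(g, y) = (Det g)^{it} f(g, y)`. -/
lemma sigma_toA (t : ℝ) (f : CcZ) : sigma t (toA f) = toA (sigmaFun t f) :=
  Subtype.ext (ambientEvolution_piAll t f)

section States

variable {B : Type*} [NonUnitalCStarAlgebra B]

/-- A state on a (not necessarily unital) C⋆-algebra. -/
def IsState (φ : B →L[ℂ] ℂ) : Prop :=
  ‖φ‖ = 1 ∧ ∀ a, 0 ≤ (φ (star a * a)).re ∧ (φ (star a * a)).im = 0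

/-- The KMS condition at inverse temperature `β > 0` for the evolution `σ`: for all `a, b` there is
a function `F`, bounded and continuous on the closed strip `0 ≤ Im z ≤ β` and holomorphic in its
interior, with `F(t) = φ(a σ_t(b))` and `F(t + iβ) = φ(σ_t(b) a)` for all real `t`. -/
def IsKMS (σ : ℝ → B → B) (β : ℝ) (φ : B →L[ℂ] ℂ) : Prop :=
  ∀ a b : B, ∃ F : ℂ → ℂ,
    (∃ C : ℝ, ∀ z : ℂ, 0 ≤ z.im → z.im ≤ β → ‖F z‖ ≤ C) ∧
    ContinuousOn F {z : ℂ | 0 ≤ z.im ∧ z.im ≤ β} ∧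
    DifferentiableOn ℂ F {z : ℂ | 0 < z.im ∧ z.im < β} ∧
    ∀ t : ℝ, F t = φ (a * σ t b) ∧ F (t + β * Complex.I) = φ (σ t b * a)

/-- The set of KMS`_β` states. -/
def kmsStates (σ : ℝ → B → B) (β : ℝ) : Set (B →L[ℂ] ℂ) := {φ | IsState φ ∧ IsKMS σ β φ}

/-- The set of extremal KMS`_β` states: the extreme points of the convex set of KMS`_β` states. -/
def extremalKMS (σ : ℝ → B → B) (β : ℝ) : Set (B →L[ℂ] ℂ) :=
  (kmsStates σ β).extremePoints ℝ

/-- A representation `π` of a C⋆-dynamical system has positive energy if the evolution is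
implemented, `π(σ_t(a)) = e^{itH} π(a) e^{-itH}`, by a strongly continuous one-parameter group of
unitaries `U_t = e^{itH}` with a positive generator `H`. -/
def IsPositiveEnergy (σ : ℝ → B → B) {E : Type*} [NormedAddCommGroup E] [InnerProductSpace ℂ E]
    [CompleteSpace E] (π : B →⋆ₙₐ[ℂ] (E →L[ℂ] E)) : Prop :=
  ∃ U : ℝ → unitary (E →L[ℂ] E),
    (∀ s t, U (s + t) = U s * U t) ∧
    (∀ ξ : E, Continuous fun t => (U t : E →L[ℂ] E) ξ) ∧
    (∀ t a, π (σ t a) = (U t : E →L[ℂ] E) * π a * (star (U t) : E →L[ℂ] E)) ∧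
    -- here `η = H ξ`, for `ξ` in the domain of `H`
    ∀ ξ η : E, HasDerivAt (fun t => (U t : E →L[ℂ] E) ξ) (Complex.I • η) 0 →
      0 ≤ (inner ℂ ξ η).re

end States

/-- The subgroup `ℤ²` of `ℚ²`. -/
def Z2 : AddSubgroup (Fin 2 → ℚ) where
  carrier := {x | ∀ i, ∃ n : ℤ, x i = n}
  zero_mem' := fun _ => ⟨0, by simp⟩
  add_mem' := fun hx hy i => by
    obtain ⟨m, hm⟩ := hx i
    obtain ⟨n, hn⟩ := hy i
    exact ⟨m + n, by simp [hm, hn]⟩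
  neg_mem' := fun hx i => by
    obtain ⟨m, hm⟩ := hx i
    exact ⟨-m, by simp [hm]⟩

/-- The group `ℚΛ`, for a subgroup `Λ` of `ℂ`. -/
def QSpan (L : Submodule ℤ ℂ) : AddSubgroup ℂ := (Submodule.span ℚ (L : Set ℂ)).toAddSubgroup

/-- The group `ℚΛ / Λ`. -/
abbrev QQuot (L : Submodule ℤ ℂ) : Type :=
  QSpan L ⧸ (L.toAddSubgroup.addSubgroupOf (QSpan L))

/-- A `ℚ`-lattice `(Λ, φ)` in `ℂ`. -/
structure QLattice where
  /-- the lattice `Λ` -/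
  lat : Submodule ℤ ℂ
  discrete : DiscreteTopology lat
  span_top : Submodule.span ℝ (lat : Set ℂ) = ⊤
  /-- the homomorphism `φ` from `ℚ² / ℤ²` to `ℚΛ / Λ` -/
  φ : ((Fin 2 → ℚ) ⧸ Z2) →+ QQuot lat

namespace QLattice

/-- The complex number `z` is a representative of `φ(x mod ℤ²)` in `ℚΛ`. -/
def Lifts (l : QLattice) (x : Fin 2 → ℚ) (z : ℂ) : Prop :=
  ∃ hz : z ∈ QSpan l.lat, l.φ (QuotientAddGroup.mk x) = QuotientAddGroup.mk ⟨z, hz⟩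

/-- `(Λ, φ)` is invertible if `φ` is an isomorphism. -/
def IsInvertible (l : QLattice) : Prop := Function.Bijective l.φ

/-- `l' = c l`, that is, `Λ' = cΛ` and `φ' = cφ`. -/
def IsScaling (c : ℂ) (l l' : QLattice) : Prop :=
  (∀ z, z ∈ l.lat ↔ c * z ∈ l'.lat) ∧ ∀ x z, l.Lifts x z ↔ l'.Lifts x (c * z)

/-- The `ℚ`-lattice `l` is, up to scaling, the `ℚ`-lattice `θ(ρ, τ) = (ℤ + ℤτ, φ)` with
`φ(x) = ρ₁(x) - τ ρ₂(x)`. Here `ρ x ∈ (ℚ/ℤ)² = (𝔸_f/R)²` for `x ∈ ℚ²/ℤ²`, and `q ∈ ℚ²` is a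
representative of `ρ x`. -/
def IsTheta (l : QLattice) (y : AfH) : Prop :=
  ∃ c : ℂ, c ≠ 0 ∧
    (∀ z : ℂ, z ∈ l.lat ↔ ∃ m n : ℤ, z = c * (m + n * (y.2 : ℂ))) ∧
    ∀ x q : Fin 2 → ℚ,
      (∀ i, y.1.mulVec (fun j => algebraMap ℚ Af (x j)) i - algebraMap ℚ Af (q i) ∈ R) →
      l.Lifts x (c * (q 0 - (y.2 : ℂ) * q 1))

end QLattice

/-- Invertible `ℚ`-lattices. -/
abbrev InvQLattice : Type := {l : QLattice // l.IsInvertible}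

/-- The equivalence relation on invertible `ℚ`-lattices given by scaling by `ℂ^*`. -/
def scalingSetoid : Setoid InvQLattice where
  r l l' := ∃ c : ℂ, c ≠ 0 ∧ QLattice.IsScaling c l.1 l'.1
  iseqv :=
    { refl := fun l => ⟨1, one_ne_zero, by simp [QLattice.IsScaling]⟩
      symm := by
        rintro l l' ⟨c, hc, h1, h2⟩
        refine ⟨c⁻¹, inv_ne_zero hc, fun z => ?_, fun x z => ?_⟩
        · rw [h1, mul_inv_cancel_left₀ hc]
        · rw [h2, mul_inv_cancel_left₀ hc]
      trans := by
        rintro l l' l'' ⟨c, hc, h1, h2⟩ ⟨d, hd, h3, h4⟩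
        refine ⟨d * c, mul_ne_zero hd hc, fun z => ?_, fun x z => ?_⟩
        · rw [h1, h3, mul_assoc]
        · rw [h2, h4, mul_assoc] }

/-- The space of invertible `ℚ`-lattices up to scaling. -/
abbrev InvQLatticeClass : Type := Quotient scalingSetoid

/-- The ring `𝔸 = ℝ × 𝔸_f` of adeles of `ℚ`. -/
abbrev Adele : Type := ℝ × Af

/-- The group `GL₂(ℚ)`, diagonally embedded in `GL₂(𝔸)`. -/
def ratGL : Subgroup (GL (Fin 2) Adele) :=
  (Matrix.GeneralLinearGroup.map (algebraMap ℚ Adele)).range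

/-- The subgroup `ℂ^*` of `GL₂(ℝ) ⊆ GL₂(𝔸)`, where `a + ib` is the matrix `[a, b; -b, a]`. -/
def complexGL : Set (GL (Fin 2) Adele) :=
  {g | ∃ a b : ℝ, (∀ i j, (g i j).1 = !![a, b; -b, a] i j) ∧
    ∀ i j, (g i j).2 = (1 : Matrix (Fin 2) (Fin 2) Af) i j}

/-- The double quotient `GL₂(ℚ) \ GL₂(𝔸) / ℂ^*`. -/
abbrev AdelicQuotient : Type := DoubleCoset.Quotient (ratGL : Set (GL (Fin 2) Adele)) complexGL

/-- The archimedean component of an element of `GL₂(𝔸)`. -/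
def archPart (g : GL (Fin 2) Adele) : GL (Fin 2) ℝ :=
  Matrix.GeneralLinearGroup.map (RingHom.fst ℝ Af) g

/-- The finite component of an element of `GL₂(𝔸)`. -/
def finPart (g : GL (Fin 2) Adele) : GL (Fin 2) Af :=
  Matrix.GeneralLinearGroup.map (RingHom.snd ℝ Af) g

/-- The term `f(1, m ρ, m(τ)) Det(m)^{-β}`, for `m ∈ Γ \ M₂(ℤ)⁺` and `y = (ρ, τ)`. -/
def gibbsTerm (β : ℝ) (f : CcZ) (y : AfH) (x : Cosets M2Zplus) : ℂ :=
  Quotient.lift (fun m : M2Zplus =>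
      val f 1 ((m : G) • y) * (((detR (m : G)) ^ (-β) : ℝ) : ℂ)) (by
    rintro m m' ⟨a, ha, e⟩
    have h := val_invariant f ha ha 1 ((m : G) • y)
    rw [mul_one, mul_inv_cancel] at h
    simp only [e, mul_smul, h, detR_mul, detR_Gam ha, one_mul]) x

/-- The eigenvalue `log (Det g)` of the Hamiltonian `H_y` on the basis vector of `ℋ_y` given by
`g ∈ Γ \ G_y`. -/
def energy {y : AfH} (x : Cosets (Gy y)) : ℝ := Real.log (cosetDet x)

end
end GL2System

open GL2System

/-! The whole argument runs on kernels `F g y` satisfying `IsKer`. These are exactly the functions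
in `C_c(Z)`, they are stable under convolution and involution, and their images `kA F` are dense in
`A`.

From states to functionals on the diagonal. On a kernel supported on elements of determinant d the
evolution is multiplication by d^{it}, so the KMS condition amounts to the identity φ(F a) = d^{-β}
φ(a F), called `Twisted`. It kills kernels with d ≠ 1. For determinant 1 and g outside Γ, an element
g moves the Γ-orbit of every point with ρ ≠ 0 (`eq_one_of_smul_eq`, `exists_sep`), so the kernel is
a finite sum of commutators with Γ-invariant functions, on which φ vanishes. Only points near ρ = 0
escape this, and the points divisible by 2^n have weight O(4^{-nβ}). Hence φ is determined by a
positive functional μ on the Γ-invariant functions of y (`Twisted.eq_diag`), and the twisted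
identity becomes the relation `IsHecke` for μ. Conversely a functional with `IsHecke` extends to a
positive functional on `A` whose norm is its mass, and it satisfies the KMS condition
(`IsHecke.toA`, `Twisted.isKMS`).

Hecke functionals. A point of `Y` is either m z, with m integral of determinant at most J, unique up
to right multiplication by Γ, and det z prime to all p ≤ J, or it is divisible by an integral matrix
with determinant in (J, J²] (`exists_cover`). Through the Hecke relation this says that μ(k) is
close to μ(1_{YJ} ψ k), where ψ k (y) is the sum of Det(m)^{-β} k(m y) over Γ\M₂(ℤ)⁺. The errors are
tails of the sum of Det(m)^{-β}, which converges to ζ(β)ζ(β-1) because β > 2 (`hasSum_partZ`, by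
Hermite normal forms). So μ is determined by its part on the invertible points, `unitPart μ`.

Extremality. Since ψ k satisfies the Hecke relation pointwise at invertible points
(`exists_psi_hecke`, an exchange of summations), reweighting `unitPart μ` by a function with values
in [0, 1] gives a Hecke functional below μ. If μ is extremal, this functional is proportional to μ,
which forces `unitPart μ` to be a point mass and μ to be a Gibbs sum (`IsExtHecke.exists_eq_gibbs`).
Conversely `unitPart` of a Gibbs sum is a multiple of the evaluation at its point, so Gibbs sums are
extremal and remember the point up to Γ.

Invertible points. If ρ is invertible, then g y lies in `Y` only for integral g, so determinants are
at least 1; this gives positive energy and the partition function. The quotient of `Y0` by Γ is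
identified with the invertible ℚ-lattices up to scaling by comparing bases and by passing to the
limit over the torsion points e_j/N. It is identified with the adelic quotient by removing the
primes dividing the determinant one at a time. -/

namespace GL2System
noncomputable section

/-! ### The ring of integral finite adeles -/

/-- The embedding of `ℚ` into the finite adeles. -/
abbrev qA : ℚ →+* Af := algebraMap ℚ Af

/-- The set `R` as a subring. -/
def RSub : Subring Af where
  carrier := R
  mul_mem' := R_mul
  add_mem' := R_add
  one_mem' := fun v => one_mem (v.adicCompletionIntegers ℚ)
  zero_mem' := fun v => zero_mem (v.adicCompletionIntegers ℚ)
  neg_mem' := fun h v => neg_mem (h v)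

lemma mem_RSub {a : Af} : a ∈ RSub ↔ a ∈ R := Iff.rfl

lemma Af_mul_apply (a b : Af) (v : HeightOneSpectrum ℤ) : (a * b) v = a v * b v := rfl
lemma Af_sub_apply (a b : Af) (v : HeightOneSpectrum ℤ) : (a - b) v = a v - b v := rfl

lemma qA_mem_iff {q : ℚ} : qA q ∈ R ↔ ∃ n : ℤ, q = n := by
  constructor
  · intro h
    obtain ⟨n, hn⟩ := HeightOneSpectrum.mem_integers_of_valuation_le_one (R := ℤ) ℚ q fun v => by
      have := h v
      rw [HeightOneSpectrum.mem_adicCompletionIntegers, FiniteAdeleRing.algebraMap_apply,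
        HeightOneSpectrum.valuedAdicCompletion_eq_valuation'] at this
      exact this
    exact ⟨n, by rw [← hn]; simp⟩
  · rintro ⟨n, rfl⟩
    exact R_int n

lemma isOpen_integers (v : HeightOneSpectrum ℤ) :
    IsOpen (v.adicCompletionIntegers ℚ : Set (v.adicCompletion ℚ)) :=
  Valued.isOpen_valuationSubring _

lemma R_eq_range : R = Set.range (RestrictedProduct.structureMap
    (fun v : HeightOneSpectrum ℤ => v.adicCompletion ℚ)
    (fun v => (v.adicCompletionIntegers ℚ : Set (v.adicCompletion ℚ))) Filter.cofinite) := by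
  ext a
  constructor
  · intro h
    exact ⟨fun v => ⟨a v, h v⟩, rfl⟩
  · rintro ⟨x, rfl⟩ v
    exact (x v).2

lemma isOpen_R : IsOpen R :=
  RestrictedProduct.isOpen_forall_mem (R := fun v : HeightOneSpectrum ℤ => v.adicCompletion ℚ)
    (A := fun v => (v.adicCompletionIntegers ℚ : Set (v.adicCompletion ℚ))) isOpen_integers

lemma isClosed_R : IsClosed R := by
  have : R = ⋂ v : HeightOneSpectrum ℤ, (fun a : Af => a v) ⁻¹'
      (v.adicCompletionIntegers ℚ : Set (v.adicCompletion ℚ)) := by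
    ext a; simp [R]
  rw [this]
  refine isClosed_iInter fun v => IsClosed.preimage ?_ ?_
  · exact RestrictedProduct.continuous_eval v
  · exact Valued.isClosed_valuationSubring _

lemma isClopen_R : IsClopen R := ⟨isClosed_R, isOpen_R⟩

/-- Transported from the p-adic integers along the identification of the completion at v with ℚ_p.
-/
instance compactSpace_integers (v : HeightOneSpectrum ℤ) :
    CompactSpace (v.adicCompletionIntegers ℚ : Set (v.adicCompletion ℚ)) := by
  have : Fact (Rat.HeightOneSpectrum.primesEquiv v).1.Prime :=
    ⟨(Rat.HeightOneSpectrum.primesEquiv v).2⟩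
  let e := Rat.HeightOneSpectrum.adicCompletion.padicEquiv v
  rw [← isCompact_iff_compactSpace]
  have hc : IsCompact (PadicInt.subring (Rat.HeightOneSpectrum.primesEquiv v).1 :
      Set ℚ_[(Rat.HeightOneSpectrum.primesEquiv v).1]) :=
    isCompact_iff_compactSpace.2 (PadicInt.compactSpace _)
  have himg := (Rat.HeightOneSpectrum.adicCompletion.padicEquiv_bijOn v).image_eq
  have : (v.adicCompletionIntegers ℚ : Set (v.adicCompletion ℚ)) = e.symm '' (PadicInt.subring
      (Rat.HeightOneSpectrum.primesEquiv v).1) := by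
    rw [← himg, ← Set.image_comp]
    ext x
    simp [e]
  rw [this]
  exact hc.image e.symm.continuous

lemma isCompact_R : IsCompact R := by
  rw [R_eq_range]
  refine isCompact_range ?_
  exact (RestrictedProduct.isEmbedding_structureMap).continuous

/-- The height one prime of `ℤ` given by a prime number. -/
def pv (p : ℕ) (hp : p.Prime) : HeightOneSpectrum ℤ where
  asIdeal := Ideal.span {(p : ℤ)}
  isPrime := (Ideal.span_singleton_prime (by exact_mod_cast hp.ne_zero)).2
    (Nat.prime_iff_prime_int.1 hp)
  ne_bot := by simpa using hp.ne_zero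

lemma exists_eq_pv (v : HeightOneSpectrum ℤ) : ∃ p, ∃ hp : p.Prime, v = pv p hp := by
  obtain ⟨n, hn⟩ := IsPrincipalIdealRing.principal v.asIdeal
  have hn' : v.asIdeal = Ideal.span {n} := hn
  have hprime : Prime n := by
    have h := v.isPrime
    rw [hn'] at h
    refine (Ideal.span_singleton_prime ?_).1 h
    rintro rfl
    exact v.ne_bot (by simp [hn'])
  refine ⟨n.natAbs, Int.prime_iff_natAbs_prime.1 hprime, ?_⟩
  ext1
  change v.asIdeal = Ideal.span {((n.natAbs : ℕ) : ℤ)}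
  rw [hn', Int.span_natAbs]

lemma valued_qA (v : HeightOneSpectrum ℤ) (q : ℚ) :
    Valued.v ((qA q) v) = v.valuation ℚ q := by
  rw [FiniteAdeleRing.algebraMap_apply, HeightOneSpectrum.valuedAdicCompletion_eq_valuation']

lemma valuation_pv_self (p : ℕ) (hp : p.Prime) :
    (pv p hp).valuation ℚ (p : ℚ) = WithZero.exp (-1 : ℤ) := by
  have h := (pv p hp).valuation_of_algebraMap (K := ℚ) (p : ℤ)
  simp only [eq_intCast, Int.cast_natCast] at h
  rw [h]
  exact (pv p hp).intValuation_singleton (by exact_mod_cast hp.ne_zero) rfl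

lemma valuation_pv_of_ne (p : ℕ) (hp : p.Prime) (v : HeightOneSpectrum ℤ) (hv : v ≠ pv p hp) :
    v.valuation ℚ (p : ℚ) = 1 := by
  have h := v.valuation_of_algebraMap (K := ℚ) (p : ℤ)
  simp only [eq_intCast, Int.cast_natCast] at h
  rw [h, HeightOneSpectrum.intValuation_eq_one_iff]
  intro hmem
  refine hv ?_
  have hle : (pv p hp).asIdeal ≤ v.asIdeal := by
    change Ideal.span {(p : ℤ)} ≤ _
    rwa [Ideal.span_singleton_le_iff_mem]
  have hmax : (pv p hp).asIdeal.IsMaximal := (pv p hp).isMaximal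
  ext1
  exact (hmax.eq_of_le v.isPrime.ne_top hle).symm

/-- The integer `N` divides `a` in `R`. -/
def Dvd (N : ℕ) (a : Af) : Prop := qA (N : ℚ)⁻¹ * a ∈ R

/-- At every other place p is a unit, so divisibility by p is a condition at one place only; as the
value group is ℤ, having valuation below 1 is the same as being divisible by the uniformizer p. -/
lemma dvd_prime_iff {p : ℕ} (hp : p.Prime) {a : Af} (ha : a ∈ R) :
    Dvd p a ↔ Valued.v (a (pv p hp)) < 1 := by
  have hkey : ∀ v : HeightOneSpectrum ℤ, (qA (p : ℚ)⁻¹ * a) v ∈ v.adicCompletionIntegers ℚ ↔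
      Valued.v (a v) ≤ v.valuation ℚ (p : ℚ) := by
    intro v
    have h0 : v.valuation ℚ (p : ℚ) ≠ 0 :=
      (Valuation.ne_zero_iff _).2 (by exact_mod_cast hp.ne_zero)
    rw [HeightOneSpectrum.mem_adicCompletionIntegers, Af_mul_apply, map_mul, valued_qA, map_inv₀,
      inv_mul_le_one₀ (zero_lt_iff.2 h0)]
  have hlt : ∀ x : WithZero (Multiplicative ℤ), x ≤ WithZero.exp (-1 : ℤ) ↔ x < 1 := by
    intro x
    rw [show (1 : WithZero (Multiplicative ℤ)) = WithZero.exp (-1 + 1 : ℤ) by simp]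
    rcases eq_or_ne x 0 with rfl | hx
    · simp
    · rw [← WithZero.exp_log hx, WithZero.exp_le_exp, WithZero.exp_lt_exp, Int.lt_add_one_iff]
  constructor
  · intro h
    rw [← hlt, ← valuation_pv_self p hp]
    exact (hkey _).1 (h _)
  · intro h v
    rw [hkey]
    by_cases hv : v = pv p hp
    · subst hv
      rw [valuation_pv_self, hlt]
      exact h
    · rw [valuation_pv_of_ne p hp v hv]
      exact ha v

/-- R/pR = ℤ/p: density of ℚ gives a rational approximation at p, which is p-integral and hence
congruent to an integer. -/
lemma exists_int_dvd_prime {p : ℕ} (hp : p.Prime) {a : Af} (ha : a ∈ R) :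
    ∃ n : ℤ, Dvd p (a - qA n) := by
  set v := pv p hp
  obtain ⟨q, hq⟩ : ∃ q : ℚ, Valued.v (a v - (qA q) v) < 1 := by
    have hd := HeightOneSpectrum.denseRange_algebraMap (R := ℤ) (K := ℚ) v
    have ho : IsOpen {x : v.adicCompletion ℚ | Valued.v (a v - x) < 1} := by
      have : IsOpen {x : v.adicCompletion ℚ | Valued.v x < 1} := by
        simpa using Valued.isOpen_ball (v.adicCompletion ℚ) 1
      exact this.preimage (by fun_prop : Continuous fun x => a v - x)
    obtain ⟨q, hq⟩ := hd.exists_mem_open ho ⟨a v, by simp⟩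
    exact ⟨q, hq⟩
  have hq1 : v.valuation ℚ q ≤ 1 := by
    rw [← valued_qA]
    have h : (qA q) v = a v - (a v - (qA q) v) := by ring
    rw [h]
    exact (Valuation.map_sub _ _ _).trans (max_le (ha v) hq.le)
  obtain ⟨n, hn⟩ := v.exists_valuation_sub_lt_of_integer hq1 1
  refine ⟨n, ?_⟩
  rw [dvd_prime_iff hp (mem_RSub.1 (sub_mem (mem_RSub.2 ha) (R_int n))), Af_sub_apply]
  have h : a v - (qA n) v = (a v - (qA q) v) - (qA (n - q)) v := by
    rw [map_sub, Af_sub_apply]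
    ring
  rw [h]
  refine lt_of_le_of_lt (Valuation.map_sub _ _ _) (max_lt hq ?_)
  rw [valued_qA]
  simpa using hn

lemma qA_inv_mul_cancel {q : ℚ} (hq : q ≠ 0) (a : Af) : qA q⁻¹ * (qA q * a) = a := by
  rw [← mul_assoc, ← map_mul, inv_mul_cancel₀ hq, map_one, one_mul]

/-- Digit by digit: subtract an integer to make a divisible by one prime factor p, then treat the
quotient modulo the remaining factor. -/
lemma exists_int_dvd {N : ℕ} (hN : N ≠ 0) {a : Af} (ha : a ∈ R) :
    ∃ n : ℤ, Dvd N (a - qA n) := by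
  induction N using induction_on_primes generalizing a with
  | zero => exact absurd rfl hN
  | one => exact ⟨0, by simpa [Dvd] using ha⟩
  | prime_mul p m hp ih =>
    obtain ⟨n, hn⟩ := exists_int_dvd_prime hp ha
    obtain ⟨k, hk⟩ := ih (right_ne_zero_of_mul hN) hn
    refine ⟨n + p * k, ?_⟩
    have hp0 : (p : ℚ) ≠ 0 := by exact_mod_cast hp.ne_zero
    unfold Dvd at hk ⊢
    convert hk using 1
    have : qA (p : ℚ)⁻¹ * (qA (p : ℚ) * qA k) = qA k := qA_inv_mul_cancel hp0 _
    have e1 : qA ((n + p * k : ℤ) : ℚ) = qA n + qA (p : ℚ) * qA k := by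
      rw [Int.cast_add, Int.cast_mul, Int.cast_natCast, map_add, map_mul]
    rw [Nat.cast_mul, mul_inv, map_mul, e1]
    linear_combination (-qA (m : ℚ)⁻¹) * this

/-- A finite adele is non-integral at finitely many places only; a denominator is cleared at each of
them in turn. -/
lemma exists_nat_mul_mem (a : Af) : ∃ N : ℕ, N ≠ 0 ∧ qA N * a ∈ R := by
  have hfin : {v : HeightOneSpectrum ℤ | ¬ a v ∈ v.adicCompletionIntegers ℚ}.Finite := a.2
  have key : ∀ s : Finset (HeightOneSpectrum ℤ), ∃ N : ℕ, N ≠ 0 ∧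
      ∀ v ∈ s, (qA N * a) v ∈ v.adicCompletionIntegers ℚ := by
    classical
    intro s
    induction s using Finset.induction_on with
    | empty => exact ⟨1, one_ne_zero, by simp⟩
    | insert w s _ ih =>
      obtain ⟨N, hN, h⟩ := ih
      obtain ⟨b, hb, hb'⟩ :=
        HeightOneSpectrum.adicCompletion.mul_nonZeroDivisor_mem_adicCompletionIntegers w (a w)
      have hb0 : b ≠ 0 := nonZeroDivisors.ne_zero hb
      have hbi : ∀ v : HeightOneSpectrum ℤ,
          (qA (b.natAbs : ℕ)) v ∈ v.adicCompletionIntegers ℚ := fun v => by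
        have := R_int (b.natAbs : ℕ) v
        simpa using this
      have hNi : ∀ v : HeightOneSpectrum ℤ, (qA N) v ∈ v.adicCompletionIntegers ℚ := fun v => by
        have := R_int (N : ℕ) v
        simpa using this
      refine ⟨b.natAbs * N, mul_ne_zero (by simpa using hb0) hN, fun v hv => ?_⟩
      rw [Nat.cast_mul, map_mul]
      rcases Finset.mem_insert.1 hv with rfl | hv
      · have e : (qA (b.natAbs : ℕ) * qA N * a) v = (qA N) v * ((qA (b.natAbs : ℕ)) v * a v) := by
          rw [Af_mul_apply, Af_mul_apply]; ring
        rw [e]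
        refine mul_mem (hNi v) ?_
        have e2 : algebraMap ℤ (v.adicCompletion ℚ) b = (qA (b : ℚ)) v := by
          rfl
        have hb'' : (qA (b : ℚ)) v * a v ∈ v.adicCompletionIntegers ℚ := by
          rw [← e2, mul_comm]
          exact hb'
        rcases Int.natAbs_eq b with hbb | hbb
        · have : ((b.natAbs : ℕ) : ℚ) = (b : ℚ) := by
            rw [← Int.cast_natCast, ← hbb]
          rw [this]; exact hb''
        · have : ((b.natAbs : ℕ) : ℚ) = -(b : ℚ) := by
            rw [← Int.cast_natCast]; rw [← Int.cast_neg]; congr 1; omega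
          rw [this, map_neg]
          have e3 : (-qA (b : ℚ)) v * a v = -((qA (b : ℚ)) v * a v) := neg_mul _ _
          rw [e3]
          exact neg_mem hb''
      · rw [mul_assoc, Af_mul_apply]
        exact mul_mem (hbi v) (h v hv)
  obtain ⟨N, hN, h⟩ := key hfin.toFinset
  refine ⟨N, hN, fun v => ?_⟩
  by_cases hv : a v ∈ v.adicCompletionIntegers ℚ
  · rw [Af_mul_apply]
    have := R_int (N : ℕ) v
    exact mul_mem (by simpa using this) hv
  · exact h v (by simpa using hv)

/-- This is 𝔸_f = ℚ + R, which makes 𝔸_f/R = ℚ/ℤ and gives sense to the action of ρ on torsion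
points. -/
lemma exists_rat_sub_mem (a : Af) : ∃ q : ℚ, a - qA q ∈ R := by
  obtain ⟨N, hN, h⟩ := exists_nat_mul_mem a
  obtain ⟨n, hn⟩ := exists_int_dvd hN h
  have hN0 : (N : ℚ) ≠ 0 := by exact_mod_cast hN
  refine ⟨(N : ℚ)⁻¹ * n, ?_⟩
  unfold Dvd at hn
  rwa [mul_sub, qA_inv_mul_cancel hN0, ← map_mul] at hn

/-- All components are local units by `dvd_prime_iff`, so the inverse exists in the restricted
product and is integral. -/
lemma exists_mul_eq_one {a : Af} (ha : a ∈ R) (h : ∀ p : ℕ, p.Prime → ¬ Dvd p a) :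
    ∃ b ∈ R, a * b = 1 := by
  have h1 : ∀ v : HeightOneSpectrum ℤ, Valued.v (a v) = 1 := by
    intro v
    obtain ⟨p, hp, rfl⟩ := exists_eq_pv v
    have := h p hp
    rw [dvd_prime_iff hp ha, not_lt] at this
    exact le_antisymm (ha _) this
  have hu : IsUnit a := by
    rw [FiniteAdeleRing.isUnit_iff]
    refine ⟨fun v h0 => ?_, Filter.Eventually.of_forall h1⟩
    have := h1 v
    rw [h0, map_zero] at this
    exact zero_ne_one this
  obtain ⟨b, hb⟩ := hu.exists_right_inv
  refine ⟨b, fun v => ?_, hb⟩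
  have e : Valued.v (a v) * Valued.v (b v) = 1 := by
    rw [← map_mul, ← Af_mul_apply, hb]
    exact map_one _
  rw [h1, one_mul] at e
  exact e.le

/-! ### The group `GL₂⁺(ℚ)` and its integral matrices -/

lemma smul_fst (g : G) (y : AfH) :
    (g • y).1 = (g.1.1.map qA) * y.1 := rfl

lemma smul_snd (g : G) (y : AfH) :
    (g • y).2 = Matrix.GeneralLinearGroup.map (algebraMap ℚ ℝ) g.1 • y.2 := rfl

/-- The inclusion of `SL₂(ℤ)` in `GL₂⁺(ℚ)`. -/
def iota : SL(2, ℤ) →* G := Matrix.SpecialLinearGroup.toGLPos.comp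
    (Matrix.SpecialLinearGroup.map (n := Fin 2) (Int.castRingHom ℚ))

lemma mem_Gam {γ : G} : γ ∈ Gam ↔ ∃ s, iota s = γ := Iff.rfl

lemma iota_mem (s : SL(2, ℤ)) : iota s ∈ Gam := ⟨s, rfl⟩

lemma iota_smul_snd (s : SL(2, ℤ)) (y : AfH) : (iota s • y).2 = s • y.2 := by
  rw [smul_snd, UpperHalfPlane.SLAction, MulAction.compHom_smul_def]
  refine congrArg (· • y.2) (Matrix.GeneralLinearGroup.ext fun i j => ?_)
  change ((((s.1 i j : ℤ) : ℚ)) : ℝ) = ((s.1 i j : ℤ) : ℝ)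
  norm_cast

lemma G_ext {g h : G} (e : ∀ i j, g.1.1 i j = h.1.1 i j) : g = h :=
  Subtype.ext (Units.ext (Matrix.ext e))

/-- The element of `GL₂⁺(ℚ)` given by a rational matrix with positive determinant. -/
def ofRat (m : Matrix (Fin 2) (Fin 2) ℚ) (h : 0 < m.det) : G :=
  ⟨Matrix.GeneralLinearGroup.mkOfDetNeZero m h.ne', h⟩

/-- The element of `GL₂⁺(ℚ)` given by an integral matrix with positive determinant. -/
def ofInt (m : Matrix (Fin 2) (Fin 2) ℤ) (h : 0 < m.det) : G :=
  ofRat (m.map (Int.castRingHom ℚ)) (by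
    rw [← RingHom.mapMatrix_apply, ← RingHom.map_det]
    simpa using h)

lemma ofInt_apply (m : Matrix (Fin 2) (Fin 2) ℤ) (h : 0 < m.det) (i j : Fin 2) :
    (ofInt m h).1.1 i j = m i j := rfl

lemma ofInt_mem (m : Matrix (Fin 2) (Fin 2) ℤ) (h : 0 < m.det) : ofInt m h ∈ M2Zplus :=
  ⟨m, fun _ _ => rfl⟩

lemma det_eq_of_entries {g : G} {m : Matrix (Fin 2) (Fin 2) ℤ} (hm : ∀ i j, g.1.1 i j = m i j) :
    g.1.1.det = m.det := by
  rw [Matrix.det_fin_two, Matrix.det_fin_two]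
  simp [hm]

lemma exists_ofInt {g : G} (hg : g ∈ M2Zplus) : ∃ m, ∃ h, g = ofInt m h := by
  obtain ⟨m, hm⟩ := hg
  have h0 : 0 < g.1.1.det := g.2
  rw [det_eq_of_entries hm] at h0
  exact ⟨m, by exact_mod_cast h0, G_ext hm⟩

lemma detR_ofInt (m : Matrix (Fin 2) (Fin 2) ℤ) (h : 0 < m.det) : detR (ofInt m h) = m.det := by
  rw [detR, det_eq_of_entries (g := ofInt m h) (m := m) (fun _ _ => rfl)]
  simp

lemma M2Zplus_mul {g h : G} (hg : g ∈ M2Zplus) (hh : h ∈ M2Zplus) : g * h ∈ M2Zplus := by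
  obtain ⟨m, hm⟩ := hg
  obtain ⟨n, hn⟩ := hh
  refine ⟨m * n, fun i j => ?_⟩
  change (g.1.1 * h.1.1) i j = _
  simp [Matrix.mul_apply, hm, hn]

/-- The integral matrices of determinant `j`. -/
def Mset (j : ℕ) : Set G := {g | g ∈ M2Zplus ∧ detR g = j}

lemma exists_detR_eq {g : G} (hg : g ∈ M2Zplus) : ∃ j : ℕ, 0 < j ∧ detR g = j := by
  obtain ⟨m, h, rfl⟩ := exists_ofInt hg
  refine ⟨m.det.toNat, by omega, ?_⟩
  rw [detR_ofInt]
  have : ((m.det.toNat : ℕ) : ℤ) = m.det := Int.toNat_of_nonneg h.le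
  exact_mod_cast this.symm

lemma one_le_detR {g : G} (hg : g ∈ M2Zplus) : 1 ≤ detR g := by
  obtain ⟨j, hj, h⟩ := exists_detR_eq hg
  rw [h]; exact_mod_cast hj

lemma mem_Gam_iff {g : G} : g ∈ Gam ↔ g ∈ M2Zplus ∧ detR g = 1 := by
  refine ⟨fun h => ⟨Gam_le_M2Zplus h, detR_Gam h⟩, ?_⟩
  rintro ⟨hg, h1⟩
  obtain ⟨m, h, rfl⟩ := exists_ofInt hg
  rw [detR_ofInt] at h1
  have h1 : m.det = 1 := by exact_mod_cast h1
  exact ⟨⟨m, h1⟩, G_ext fun i j => rfl⟩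

/-- A positive rational number as a scalar matrix. -/
def scal (q : ℚ) (hq : 0 < q) : G :=
  ofRat (q • (1 : Matrix (Fin 2) (Fin 2) ℚ)) (by simp; positivity)

lemma scal_apply (q : ℚ) (hq : 0 < q) (i j : Fin 2) :
    (scal q hq).1.1 i j = q * (1 : Matrix (Fin 2) (Fin 2) ℚ) i j := rfl

lemma scal_mul_apply (q : ℚ) (hq : 0 < q) (g : G) (i j : Fin 2) :
    (scal q hq * g).1.1 i j = q * g.1.1 i j := by
  change ((q • (1 : Matrix (Fin 2) (Fin 2) ℚ)) * g.1.1) i j = _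
  rw [smul_mul_assoc, one_mul]
  rfl

lemma mul_scal_apply (q : ℚ) (hq : 0 < q) (g : G) (i j : Fin 2) :
    (g * scal q hq).1.1 i j = q * g.1.1 i j := by
  change (g.1.1 * (q • (1 : Matrix (Fin 2) (Fin 2) ℚ))) i j = _
  rw [mul_smul_comm, mul_one]
  rfl

lemma scal_comm (q : ℚ) (hq : 0 < q) (g : G) : scal q hq * g = g * scal q hq :=
  G_ext fun i j => by rw [scal_mul_apply, mul_scal_apply]

lemma detR_scal (q : ℚ) (hq : 0 < q) : detR (scal q hq) = (q : ℝ) ^ 2 := by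
  unfold detR
  rw [Matrix.det_fin_two]
  simp only [scal_apply]
  simp [sq]

lemma scal_smul_fst (q : ℚ) (hq : 0 < q) (y : AfH) (i j : Fin 2) :
    (scal q hq • y).1 i j = qA q * y.1 i j := by
  rw [smul_fst, Matrix.mul_apply, Fin.sum_univ_two]
  fin_cases i <;> simp [scal_apply]

lemma scal_smul_snd (q : ℚ) (hq : 0 < q) (y : AfH) : (scal q hq • y).2 = y.2 := by
  rw [smul_snd]
  have hq' : (q : ℝ) ≠ 0 := by exact_mod_cast hq.ne'
  have : Matrix.GeneralLinearGroup.map (algebraMap ℚ ℝ) (scal q hq).1 =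
      Matrix.GeneralLinearGroup.scalar (Fin 2) (Units.mk0 (q : ℝ) hq') := by
    ext i j
    rw [Matrix.GeneralLinearGroup.map_apply]
    change algebraMap ℚ ℝ (q * (1 : Matrix (Fin 2) (Fin 2) ℚ) i j) = _
    fin_cases i <;> fin_cases j <;> simp
  rw [this, UpperHalfPlane.glScalar_smul]

lemma exists_scal_mul_mem (g : G) : ∃ N : ℕ, ∃ hN : (0 : ℚ) < N, scal N hN * g ∈ M2Zplus := by
  let N : ℕ := ∏ i : Fin 2, ∏ j : Fin 2, (g.1.1 i j).den
  have hN : (0 : ℚ) < N := by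
    have : 0 < N := Finset.prod_pos fun i _ => Finset.prod_pos fun j _ => (g.1.1 i j).den_pos
    exact_mod_cast this
  refine ⟨N, hN, ?_⟩
  have h : ∀ i j, ∃ n : ℤ, (N : ℚ) * g.1.1 i j = n := by
    intro i j
    have h1 : (g.1.1 i j).den ∣ N :=
      (Finset.dvd_prod_of_mem (fun j => (g.1.1 i j).den) (Finset.mem_univ j)).trans
        (Finset.dvd_prod_of_mem (fun i => ∏ j : Fin 2, (g.1.1 i j).den) (Finset.mem_univ i))
    obtain ⟨k, hk⟩ := h1
    refine ⟨k * (g.1.1 i j).num, ?_⟩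
    rw [hk]
    push_cast
    have := Rat.mul_den_eq_num (g.1.1 i j)
    linear_combination (k : ℚ) * this
  choose n hn using h
  exact ⟨Matrix.of n, fun i j => by rw [scal_mul_apply]; exact hn i j⟩

/-- The adjugate `j m⁻¹` of an integral matrix `m` of determinant `j` is integral. -/
lemma scal_mul_inv_mem {j : ℕ} (hj : (0 : ℚ) < j) {g : G} (hg : g ∈ Mset j) :
    scal j hj * g⁻¹ ∈ Mset j := by
  obtain ⟨⟨m, hm⟩, hd⟩ := hg
  have hd' : g.1.1.det = (j : ℚ) := by
    unfold detR at hd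
    exact_mod_cast hd
  constructor
  · refine ⟨m.adjugate, fun a b => ?_⟩
    rw [scal_mul_apply]
    have h1 : (g⁻¹).1.1 = (g.1.1)⁻¹ := Matrix.coe_units_inv g.1
    rw [h1, Matrix.inv_def, hd', Ring.inverse_eq_inv', Matrix.smul_apply, smul_eq_mul,
      mul_inv_cancel_left₀ hj.ne', Matrix.adjugate_fin_two, Matrix.adjugate_fin_two]
    fin_cases a <;> fin_cases b <;> simp [hm]
  · rw [detR_mul, detR_scal, detR_inv, hd]
    have : (j : ℝ) ≠ 0 := by exact_mod_cast hj.ne'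
    push_cast
    field_simp

/-! ### Heights -/

/-- All points of the orbit `Γ y` have imaginary part at most `T`. -/
def Ht (T : ℝ) (y : AfH) : Prop := ∀ γ ∈ Gam, (γ • y).2.im ≤ T

lemma Ht.mono {S T : ℝ} (h : S ≤ T) {y : AfH} (hy : Ht S y) : Ht T y :=
  fun γ hγ => (hy γ hγ).trans h

lemma Ht_smul_iff {T : ℝ} {γ : G} (hγ : γ ∈ Gam) {y : AfH} : Ht T (γ • y) ↔ Ht T y := by
  constructor
  · intro h δ hδ
    have := h (δ * γ⁻¹) (mul_mem hδ (inv_mem hγ))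
    rwa [smul_smul, inv_mul_cancel_right] at this
  · intro h δ hδ
    rw [smul_smul]
    exact h _ (mul_mem hδ hγ)

lemma Ht.pos {T : ℝ} {y : AfH} (h : Ht T y) : 0 < T :=
  y.2.im_pos.trans_le (by simpa using h 1 (one_mem _))

lemma im_smul_G (g : G) (y : AfH) : (g • y).2.im = detR g * y.2.im /
    Complex.normSq ((g.1.1 1 0 : ℝ) * (y.2 : ℂ) + (g.1.1 1 1 : ℝ)) := by
  rw [smul_snd, UpperHalfPlane.im_smul_eq_div_normSq]
  have h : (Matrix.GeneralLinearGroup.map (algebraMap ℚ ℝ) g.1).det.val = detR g := by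
    rw [Matrix.GeneralLinearGroup.val_det_apply]
    unfold detR
    have := RingHom.map_det (algebraMap ℚ ℝ) g.1.1
    rw [RingHom.mapMatrix_apply] at this
    exact this.symm
  rw [h, abs_of_pos (detR_pos g)]
  rfl

/-- Dividing the bottom row (c, d) of g by its gcd e gives the bottom row of some s in SL₂(ℤ), and
Im(gτ) = Det(g) e⁻² Im(sτ). -/
lemma im_smul_le_of_int {T : ℝ} {y : AfH} (hy : Ht T y) {g : G} (hg : g ∈ M2Zplus) :
    (g • y).2.im ≤ detR g * T := by
  obtain ⟨m, h, rfl⟩ := exists_ofInt hg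
  rw [im_smul_G, mul_div_assoc]
  refine mul_le_mul_of_nonneg_left ?_ (detR_pos _).le
  set c := m 1 0 with hc
  set d := m 1 1 with hd
  have hcd : 0 < Int.gcd c d := by
    rw [Int.gcd_pos_iff]
    by_contra hcon
    push Not at hcon
    rw [Matrix.det_fin_two, ← hc, ← hd, hcon.1, hcon.2] at h
    simp at h
  set e := Int.gcd c d with he
  have hcop : IsCoprime (c / e) (d / e) := by
    have := Int.isCoprime_iff_gcd_eq_one.2 (Int.gcd_ediv_gcd_ediv_gcd (i := c) (j := d) hcd)
    exact this
  obtain ⟨s, -, hs⟩ := ModularGroup.bottom_row_surj (R := ℤ)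
    (show (![c / e, d / e]) ∈ {cd : Fin 2 → ℤ | IsCoprime (cd 0) (cd 1)} from hcop)
  have h1 := hy (iota s) (iota_mem s)
  rw [im_smul_G, detR_Gam (iota_mem s), one_mul] at h1
  have hs0 : s.1 1 0 = c / e := congrFun hs 0
  have hs1 : s.1 1 1 = d / e := congrFun hs 1
  have e0 : ((iota s).1.1 1 0 : ℝ) = ((c / e : ℤ) : ℝ) := by
    rw [← hs0]
    change (((s.1 1 0 : ℤ) : ℚ) : ℝ) = _
    norm_cast
  have e1 : ((iota s).1.1 1 1 : ℝ) = ((d / e : ℤ) : ℝ) := by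
    rw [← hs1]
    change (((s.1 1 1 : ℤ) : ℚ) : ℝ) = _
    norm_cast
  rw [e0, e1] at h1
  refine le_trans ?_ h1
  have hce : (c : ℝ) = e * ((c / e : ℤ) : ℝ) := by
    have := Int.mul_ediv_cancel' (Int.gcd_dvd_left (a := c) (b := d))
    exact_mod_cast this.symm
  have hde : (d : ℝ) = e * ((d / e : ℤ) : ℝ) := by
    have := Int.mul_ediv_cancel' (Int.gcd_dvd_right (a := c) (b := d))
    exact_mod_cast this.symm
  have e2 : (((ofInt m h).1.1 1 0 : ℝ) * (y.2 : ℂ) + ((ofInt m h).1.1 1 1 : ℝ) : ℂ) =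
      (e : ℂ) * (((c / e : ℤ) : ℝ) * (y.2 : ℂ) + ((d / e : ℤ) : ℝ)) := by
    rw [ofInt_apply, ofInt_apply, ← hc, ← hd]
    have hce' := congrArg (fun x : ℝ => (x : ℂ)) hce
    have hde' := congrArg (fun x : ℝ => (x : ℂ)) hde
    push_cast at hce' hde' ⊢
    rw [hce', hde']
    ring
  rw [e2, map_mul]
  have hpos : 0 < Complex.normSq (((c / e : ℤ) : ℝ) * (y.2 : ℂ) + ((d / e : ℤ) : ℝ)) := by
    have := UpperHalfPlane.normSq_denom_pos (Matrix.SpecialLinearGroup.mapGL ℝ s) y.2.im_ne_zero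
    have e3 : UpperHalfPlane.denom (Matrix.SpecialLinearGroup.mapGL ℝ s) (y.2 : ℂ) =
        (((c / e : ℤ) : ℝ) * (y.2 : ℂ) + ((d / e : ℤ) : ℝ)) := by
      rw [← hs0, ← hs1]
      simp [UpperHalfPlane.denom]
    rwa [e3] at this
  have he1 : (1 : ℝ) ≤ Complex.normSq (e : ℂ) := by
    rw [Complex.normSq_natCast]
    have : (1 : ℝ) ≤ e := by exact_mod_cast hcd
    nlinarith
  refine div_le_div_of_nonneg_left y.2.im_pos.le hpos ?_
  nlinarith

lemma Ht.smul_int {T : ℝ} {y : AfH} (hy : Ht T y) {g : G} (hg : g ∈ M2Zplus) :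
    Ht (detR g * T) (g • y) := by
  intro γ hγ
  rw [smul_smul]
  refine (im_smul_le_of_int hy (M2Zplus_mul (Gam_le_M2Zplus hγ) hg)).trans ?_
  rw [detR_mul, detR_Gam hγ, one_mul]

lemma Ht_congr {T : ℝ} {y z : AfH} (h : y.2 = z.2) (hy : Ht T y) : Ht T z := fun γ hγ => by
  have := hy γ hγ
  rw [smul_snd, h, ← smul_snd] at this
  exact this

/-- Positive scalar matrices do not move τ, so g may be replaced by an integral multiple. -/
lemma exists_Ht_smul (g : G) : ∃ c : ℝ, 0 < c ∧ ∀ T y, Ht T y → Ht (c * T) (g • y) := by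
  obtain ⟨N, hN, h⟩ := exists_scal_mul_mem g
  refine ⟨_, detR_pos (scal N hN * g), fun T y hy => ?_⟩
  refine Ht_congr ?_ (hy.smul_int h)
  rw [mul_smul, scal_smul_snd]

/-- With t = Im τ and (c, d) the bottom row, |cτ + d|² is at least 1 if c = 0 and at least t²
otherwise, so t/|cτ + d|² is at most t or 1/t. -/
lemma exists_Ht (y : AfH) : Ht (max y.2.im y.2.im⁻¹) y := by
  rintro _ ⟨s, rfl⟩
  change (iota s • y).2.im ≤ _
  rw [im_smul_G, detR_Gam (iota_mem s), one_mul]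
  set t := y.2.im with ht
  have ht0 : 0 < t := y.2.im_pos
  have e0 : ((iota s).1.1 1 0 : ℝ) = ((s.1 1 0 : ℤ) : ℝ) := by
    change (((s.1 1 0 : ℤ) : ℚ) : ℝ) = _
    norm_cast
  have e1 : ((iota s).1.1 1 1 : ℝ) = ((s.1 1 1 : ℤ) : ℝ) := by
    change (((s.1 1 1 : ℤ) : ℚ) : ℝ) = _
    norm_cast
  rw [e0, e1]
  have hn : Complex.normSq (((s.1 1 0 : ℤ) : ℝ) * (y.2 : ℂ) + ((s.1 1 1 : ℤ) : ℝ)) =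
      (((s.1 1 0 : ℤ) : ℝ) * y.2.re + ((s.1 1 1 : ℤ) : ℝ)) ^ 2 + (((s.1 1 0 : ℤ) : ℝ) * t) ^ 2 := by
    rw [Complex.normSq_apply]
    simp [ht, sq]
  rw [hn]
  by_cases hc : s.1 1 0 = 0
  · refine le_trans ?_ (le_max_left _ _)
    have hd : s.1 1 1 ≠ 0 := by
      intro hd
      have := s.2
      rw [Matrix.det_fin_two, hc, hd] at this
      simp at this
    have : (1 : ℝ) ≤ ((s.1 1 1 : ℤ) : ℝ) ^ 2 := by
      have : (1 : ℤ) ≤ (s.1 1 1) ^ 2 := by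
        have := sq_pos_of_ne_zero hd; omega
      exact_mod_cast this
    rw [hc]
    rw [div_le_iff₀ (by simp; positivity)]
    simp
    nlinarith
  · refine le_trans ?_ (le_max_right _ _)
    have : (1 : ℝ) ≤ ((s.1 1 0 : ℤ) : ℝ) ^ 2 := by
      have : (1 : ℤ) ≤ (s.1 1 0) ^ 2 := by
        have := sq_pos_of_ne_zero hc; omega
      exact_mod_cast this
    have h2 : t ^ 2 ≤ (((s.1 1 0 : ℤ) : ℝ) * t) ^ 2 := by
      rw [mul_pow]; nlinarith [sq_nonneg t]
    rw [div_le_iff₀ (by positivity), inv_mul_eq_div, le_div_iff₀ ht0]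
    nlinarith [sq_nonneg (((s.1 1 0 : ℤ) : ℝ) * y.2.re + ((s.1 1 1 : ℤ) : ℝ))]

/-! ### Topology of `M₂(𝔸_f) × ℍ` -/

instance : ContinuousConstSMul G AfH where
  continuous_const_smul g := by
    refine Continuous.prodMk (f := fun y : AfH => (g • y).1) (g := fun y : AfH => (g • y).2) ?_ ?_
    · have hc : Continuous fun y : AfH => y.1 := continuous_fst
      change Continuous fun y : AfH => (g.1.1.map qA) * y.1
      exact Continuous.matrix_mul continuous_const hc
    · change Continuous fun y : AfH =>
        Matrix.GeneralLinearGroup.map (algebraMap ℚ ℝ) g.1 • y.2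
      have hc : Continuous fun y : AfH => y.2 := continuous_snd
      exact (continuous_const_smul (T := ℍ)
        (Matrix.GeneralLinearGroup.map (algebraMap ℚ ℝ) g.1)).comp hc

lemma isClopen_Y : IsClopen Y := by
  have : Y = ⋂ i : Fin 2, ⋂ j : Fin 2, (fun y : AfH => y.1 i j) ⁻¹' R := by
    ext y; simp [Y]
  rw [this]
  refine isClopen_iInter_of_finite fun i => isClopen_iInter_of_finite fun j => ?_
  have hc : Continuous fun y : AfH => y.1 := continuous_fst
  exact isClopen_R.preimage (hc.matrix_elem i j)

lemma isClosed_Ht (T : ℝ) : IsClosed {y | Ht T y} := by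
  have : {y | Ht T y} = ⋂ γ ∈ Gam, {y : AfH | (γ • y).2.im ≤ T} := by
    ext y; simp [Ht]
  rw [this]
  refine isClosed_biInter fun γ _ => ?_
  exact isClosed_le (UpperHalfPlane.continuous_im.comp
    (continuous_snd.comp (continuous_const_smul γ))) continuous_const

/-- A compact subset of `Y` whose `Γ`-translates cover the set of points of height at most `T`. -/
def KT (T : ℝ) : Set AfH := {y | y ∈ Y ∧ y.2 ∈ ModularGroup.truncatedFundamentalDomain T}

lemma isCompact_KT (T : ℝ) : IsCompact (KT T) := by
  have h1 : IsCompact {ρ : Matrix (Fin 2) (Fin 2) Af | ∀ i j, ρ i j ∈ R} := by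
    have : IsCompact (Set.pi Set.univ fun _ : Fin 2 => Set.pi Set.univ fun _ : Fin 2 => R) :=
      isCompact_univ_pi fun _ => isCompact_univ_pi fun _ => isCompact_R
    have e : {ρ : Matrix (Fin 2) (Fin 2) Af | ∀ i j, ρ i j ∈ R} =
        (Set.pi Set.univ fun _ : Fin 2 => Set.pi Set.univ fun _ : Fin 2 => R) := by
      refine Set.ext fun ρ => ⟨fun h i _ j _ => h i j, fun h i j => h i trivial j trivial⟩
    rw [e]
    exact this
  exact h1.prod (ModularGroup.isCompact_truncatedFundamentalDomain T)

lemma exists_smul_mem_KT {T : ℝ} {y : AfH} (hy : y ∈ Y) (h : Ht T y) :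
    ∃ γ ∈ Gam, γ • y ∈ KT T := by
  obtain ⟨s, hs⟩ := ModularGroup.exists_smul_mem_fd y.2
  refine ⟨iota s, iota_mem s, Gam_smul_mem (iota_mem s) hy, ?_⟩
  rw [iota_smul_snd]
  refine ⟨hs, ?_⟩
  rw [← iota_smul_snd]
  exact h _ (iota_mem s)

/-! ### Sums over `Γ \ GL₂⁺(ℚ)` -/

/-- The coset `Γ g`. -/
abbrev rc (g : G) : RC := Quotient.mk _ g

lemma rc_gam_mul {γ : G} (hγ : γ ∈ Gam) (g : G) : rc (γ * g) = rc g :=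
  rc_eq.2 (by simpa using inv_mem hγ)

lemma exists_out (g : G) : ∃ γ ∈ Gam, (rc g).out = γ * g := by
  have h : rc g = rc (rc g).out := (Quotient.out_eq _).symm
  exact ⟨_, rc_eq.1 h, by group⟩

/-- Invariance of a function on `GL₂⁺(ℚ)` under left translation by `Γ`. -/
def LeftInv {E : Type*} (u : G → E) : Prop := ∀ γ ∈ Gam, ∀ g, u (γ * g) = u g

lemma LeftInv.out {E : Type*} {u : G → E} (hu : LeftInv u) (g : G) : u (rc g).out = u g := by
  obtain ⟨γ, hγ, e⟩ := exists_out g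
  rw [e, hu γ hγ]

/-- The sum of a `Γ`-invariant function over `Γ \ GL₂⁺(ℚ)`. -/
def lsum {E : Type*} [AddCommMonoid E] [TopologicalSpace E] (u : G → E) : E :=
  ∑' x : RC, u x.out

/-- Right translation on `Γ \ GL₂⁺(ℚ)`. -/
def rcRight (b : G) : RC ≃ RC where
  toFun := Quotient.map (· * b) (by
    intro g h e
    have e' : rc g = rc h := Quotient.sound e
    refine Quotient.exact (rc_eq.2 ?_)
    have := rc_eq.1 e'
    convert this using 1
    group)
  invFun := Quotient.map (· * b⁻¹) (by
    intro g h e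
    have e' : rc g = rc h := Quotient.sound e
    refine Quotient.exact (rc_eq.2 ?_)
    have := rc_eq.1 e'
    convert this using 1
    group)
  left_inv x := by
    refine Quotient.inductionOn x fun g => ?_
    change rc (g * b * b⁻¹) = rc g
    rw [mul_inv_cancel_right]
  right_inv x := by
    refine Quotient.inductionOn x fun g => ?_
    change rc (g * b⁻¹ * b) = rc g
    rw [inv_mul_cancel_right]

lemma rcRight_rc (b g : G) : rcRight b (rc g) = rc (g * b) := rfl

lemma LeftInv.rcRight_out {E : Type*} {u : G → E} (hu : LeftInv u) (b : G) (x : RC) :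
    u (rcRight b x).out = u (x.out * b) := by
  conv_lhs => rw [← Quotient.out_eq x]
  exact hu.out _

lemma lsum_mul_right {E : Type*} [AddCommMonoid E] [TopologicalSpace E] {u : G → E}
    (hu : LeftInv u) (b : G) : lsum (fun h => u (h * b)) = lsum u := by
  unfold lsum
  rw [← (rcRight b).tsum_eq (fun x => u x.out)]
  exact tsum_congr fun x => (hu.rcRight_out b x).symm

/-- The inclusion of `Γ \ S` in `Γ \ GL₂⁺(ℚ)`. -/
def toRC {S : Set G} (x : Cosets S) : RC :=
  Quotient.lift (fun g : S => rc g) (by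
    rintro g h ⟨γ, hγ, e⟩
    rw [e, rc_gam_mul hγ]) x

lemma toRC_injective {S : Set G} : Function.Injective (toRC : Cosets S → RC) := by
  intro x y
  refine Quotient.inductionOn₂ x y fun a b e => ?_
  have := rc_eq.1 e
  exact Quotient.sound ⟨_, this, by group⟩

lemma lsum_eq_tsum_cosets {E : Type*} [AddCommMonoid E] [TopologicalSpace E] {S : Set G} {u : G → E}
    (hu : LeftInv u) (h0 : ∀ g, g ∉ S → u g = 0) {v : Cosets S → E}
    (hv : ∀ g : S, v (Quotient.mk _ g) = u g) : ∑' x, v x = lsum u := by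
  unfold lsum
  rw [← toRC_injective.tsum_eq (f := fun x : RC => u x.out)]
  · refine tsum_congr fun x => ?_
    refine Quotient.inductionOn x fun g => ?_
    rw [hv]
    exact (hu.out _).symm
  · intro x hx
    have : x.out ∈ S := by
      by_contra hn
      exact hx (h0 _ hn)
    exact ⟨Quotient.mk _ ⟨x.out, this⟩, Quotient.out_eq x⟩

/-- Here and in the next two lemmas, finiteness comes from `finite_rc`: a double coset of Γ is a
finite union of left cosets Γ h. This makes inverses and products of finitely supported kernels
finitely supported. -/
lemma finite_rc_mul {s : Set RC} (hs : s.Finite) :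
    {x : RC | ∃ y ∈ s, ∃ γ ∈ Gam, x = rc (y.out * γ)}.Finite := by
  have : {x : RC | ∃ y ∈ s, ∃ γ ∈ Gam, x = rc (y.out * γ)} =
      ⋃ y ∈ s, {x : RC | ∃ γ ∈ Gam, x = rc (y.out * γ)} := by
    ext x; simp
  rw [this]
  exact hs.biUnion fun y _ => finite_rc _

lemma finite_rc_inv {s : Set RC} (hs : s.Finite) : {x : RC | ∃ g, rc g ∈ s ∧ x = rc g⁻¹}.Finite := by
  have : {x : RC | ∃ g, rc g ∈ s ∧ x = rc g⁻¹} ⊆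
      ⋃ y ∈ s, {x : RC | ∃ γ ∈ Gam, x = rc (y.out⁻¹ * γ)} := by
    rintro x ⟨g, hg, rfl⟩
    simp only [Set.mem_iUnion]
    obtain ⟨γ, hγ, e⟩ := exists_out g
    refine ⟨rc g, hg, γ, hγ, ?_⟩
    rw [e]
    congr 1
    group
  exact (hs.biUnion fun y _ => finite_rc _).subset this

lemma finite_rc_mul_mul {s t : Set RC} (hs : s.Finite) (ht : t.Finite) :
    {x : RC | ∃ g h, rc g ∈ s ∧ rc h ∈ t ∧ x = rc (g * h)}.Finite := by
  have : {x : RC | ∃ g h, rc g ∈ s ∧ rc h ∈ t ∧ x = rc (g * h)} ⊆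
      ⋃ y ∈ t, rcRight y.out '' {x : RC | ∃ y ∈ s, ∃ γ ∈ Gam, x = rc (y.out * γ)} := by
    rintro x ⟨g, h, hg, hh, rfl⟩
    simp only [Set.mem_iUnion]
    obtain ⟨γ, hγ, e⟩ := exists_out g
    obtain ⟨δ, hδ, e'⟩ := exists_out h
    refine ⟨rc h, hh, rc ((rc g).out * δ⁻¹), ⟨rc g, hg, _, inv_mem hδ, rfl⟩, ?_⟩
    rw [rcRight_rc, e, e']
    have : γ * g * δ⁻¹ * (δ * h) = γ * (g * h) := by group
    rw [this, rc_gam_mul hγ]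
  exact (ht.biUnion fun y _ => (finite_rc_mul hs).image _).subset this

/-! ### Functions on `Z` as kernels -/

/-- The functions `(g, y) ↦ f(g, y)`, extended by zero, that are given by `f ∈ C_c(Z)`. -/
structure IsKer (F : G → AfH → ℂ) : Prop where
  inv : ∀ a ∈ Gam, ∀ b ∈ Gam, ∀ g y, F (a * g * b⁻¹) (b • y) = F g y
  supp : ∀ g y, F g y ≠ 0 → y ∈ Y ∧ g • y ∈ Y
  cont : ∀ g, Continuous (F g)
  fin : ∃ s : Set RC, s.Finite ∧ ∀ g y, F g y ≠ 0 → rc g ∈ s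
  ht : ∃ T, ∀ g y, F g y ≠ 0 → Ht T y

lemma IsKer.left {F : G → AfH → ℂ} (hF : IsKer F) {a : G} (ha : a ∈ Gam) (g : G) (y : AfH) :
    F (a * g) y = F g y := by
  simpa using hF.inv a ha 1 (one_mem _) g y

lemma IsKer.right {F : G → AfH → ℂ} (hF : IsKer F) {b : G} (hb : b ∈ Gam) (g : G) (y : AfH) :
    F g (b • y) = F (g * b) y := by
  have := hF.inv 1 (one_mem _) b hb (g * b) y
  simpa using this

/-! ### Kernels are the functions in C_c(Z). -/

section OfKer

lemma continuous_mkPreZ (g : G) :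
    Continuous fun y : {y : AfH // y ∈ Y ∧ g • y ∈ Y} => (⟨g, y⟩ : PreZ) :=
  continuous_sigmaMk (σ := fun g : G => {y : AfH // y ∈ Y ∧ g • y ∈ Y})

lemma isClopen_dom (g : G) : IsClopen {y : AfH | y ∈ Y ∧ g • y ∈ Y} := by
  have hc : Continuous fun y : AfH => g • y := continuous_const_smul g
  have h : IsClopen ((fun y : AfH => g • y) ⁻¹' Y) := isClopen_Y.preimage hc
  exact isClopen_Y.inter h

lemma isCompact_KT_fibre (T : ℝ) (g : G) :
    IsCompact {y : {y : AfH // y ∈ Y ∧ g • y ∈ Y} | y.1 ∈ KT T} := by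
  have hcl : IsClosed {y : AfH | y ∈ Y ∧ g • y ∈ Y} := (isClopen_dom g).1
  rw [Subtype.isCompact_iff]
  have e : Subtype.val '' {y : {y : AfH // y ∈ Y ∧ g • y ∈ Y} | y.1 ∈ KT T} =
      KT T ∩ {y : AfH | y ∈ Y ∧ g • y ∈ Y} := by
    ext y
    constructor
    · rintro ⟨z, hz, rfl⟩
      exact ⟨hz, z.2⟩
    · rintro ⟨h1, h2⟩
      exact ⟨⟨y, h2⟩, h1, rfl⟩
  rw [e]
  exact (isCompact_KT T).inter_right hcl

lemma mkZ_eq {p q : PreZ} {a b : G} (ha : a ∈ Gam) (hb : b ∈ Gam) (h1 : q.1 = a * p.1 * b⁻¹)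
    (h2 : q.2.1 = b • p.2.1) : Quotient.mk zSetoid p = Quotient.mk zSetoid q :=
  Quotient.sound ⟨a, ha, b, hb, h1, h2⟩

/-- A set of points of `Z` whose closedness and compactness are checked on representatives. -/
lemma isCompact_zSet {s : Set RC} (hs : s.Finite) (T : ℝ) :
    ∃ C : Set Z, IsCompact C ∧ IsClosed C ∧ ∀ p : PreZ, rc p.1 ∈ s → Ht T p.2.1 →
      Quotient.mk zSetoid p ∈ C := by
  -- Saturating `s` under right multiplication by Γ makes the set `P` below a union of Γ × Γ-orbits,
  -- so that closedness of its image can be tested on `P`.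
  set s' := {x : RC | ∃ y ∈ s, ∃ γ ∈ Gam, x = rc (y.out * γ)} with hs'
  have hfin : s'.Finite := finite_rc_mul hs
  have hright : ∀ g γ, γ ∈ Gam → rc g ∈ s' → rc (g * γ) ∈ s' := by
    rintro g γ hγ ⟨y, hy, δ, hδ, e⟩
    refine ⟨y, hy, δ * γ, mul_mem hδ hγ, ?_⟩
    have := congrArg (rcRight γ) e
    rwa [rcRight_rc, rcRight_rc, mul_assoc] at this
  set P : Set PreZ := {p | rc p.1 ∈ s' ∧ Ht T p.2.1} with hP
  have hpre : Quotient.mk zSetoid ⁻¹' (Quotient.mk zSetoid '' P) = P := by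
    ext q
    constructor
    · rintro ⟨p, ⟨hp1, hp2⟩, e⟩
      obtain ⟨a, ha, b, hb, h1, h2⟩ := Quotient.exact e
      refine ⟨?_, ?_⟩
      · rw [h1, mul_assoc, rc_gam_mul ha]
        exact hright _ _ (inv_mem hb) hp1
      · rw [h2, Ht_smul_iff hb]
        exact hp2
    · exact fun h => ⟨q, h, rfl⟩
  have hclosed : IsClosed (Quotient.mk zSetoid '' P) := by
    rw [← (isQuotientMap_quotient_mk' (s := zSetoid)).isClosed_preimage]
    change IsClosed (Quotient.mk zSetoid ⁻¹' (Quotient.mk zSetoid '' P))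
    rw [hpre, isClosed_sigma_iff]
    intro g
    by_cases hg : rc g ∈ s'
    · have hc := (isClosed_Ht T).preimage
        (continuous_subtype_val (p := fun y : AfH => y ∈ Y ∧ g • y ∈ Y))
      exact cast (congrArg IsClosed (Set.ext fun y => ⟨fun h => ⟨hg, h⟩, fun h => h.2⟩)) hc
    · exact cast (congrArg IsClosed (Set.ext fun y => ⟨fun h => h.elim, fun h => hg h.1⟩))
        isClosed_empty
  -- Up to Γ × Γ every point of `P` has its group element among finitely many representatives and
  -- its base point in `KT T`; hence the image of the compact set `K` covers the image of `P`.
  let K : Set PreZ := ⋃ x ∈ s', (fun y => ⟨x.out, y⟩) ''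
    {y : {y : AfH // y ∈ Y ∧ x.out • y ∈ Y} | y.1 ∈ KT T}
  have hKc : IsCompact K :=
    hfin.isCompact_biUnion fun x _ => (isCompact_KT_fibre T x.out).image (continuous_mkPreZ x.out)
  refine ⟨_, (hKc.image continuous_quotient_mk').of_isClosed_subset hclosed ?_, hclosed, ?_⟩
  · rintro _ ⟨⟨g, y, hy⟩, ⟨hg, hht⟩, rfl⟩
    obtain ⟨γ, hγ, hγy⟩ := exists_smul_mem_KT hy.1 hht
    obtain ⟨δ, hδ, e⟩ := exists_out (g * γ⁻¹)
    have hmem : γ • y ∈ Y ∧ (rc (g * γ⁻¹)).out • γ • y ∈ Y := by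
      refine ⟨Gam_smul_mem hγ hy.1, ?_⟩
      rw [e, smul_smul, mul_assoc, inv_mul_cancel_right, mul_smul]
      exact Gam_smul_mem hδ hy.2
    refine ⟨⟨(rc (g * γ⁻¹)).out, γ • y, hmem⟩, ?_, ?_⟩
    · refine Set.mem_iUnion₂.2 ⟨_, hright _ _ (inv_mem hγ) hg, ⟨γ • y, hmem⟩, hγy, rfl⟩
    · refine (mkZ_eq hδ hγ ?_ rfl).symm
      change (rc (g * γ⁻¹)).out = _
      rw [e, mul_assoc]
  · intro p hp hp'
    refine ⟨p, ⟨⟨_, hp, 1, one_mem _, ?_⟩, hp'⟩, rfl⟩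
    rw [mul_one]
    exact (Quotient.out_eq _).symm

/-- The element of `C_c(Z)` given by a kernel. -/
def ofKer (F : G → AfH → ℂ) (hF : IsKer F) : CcZ where
  toFun := Quotient.lift (fun p : PreZ => F p.1 p.2.1) (by
    rintro p q ⟨a, ha, b, hb, h1, h2⟩
    exact (hF.inv a ha b hb _ _).symm.trans (congrArg₂ F h1 h2).symm)
  continuous_toFun := by
    refine Continuous.quotient_lift ?_ _
    exact continuous_sigma fun g => (hF.cont g).comp continuous_subtype_val
  hasCompactSupport' := by
    obtain ⟨s, hs, h⟩ := hF.fin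
    obtain ⟨T, hT⟩ := hF.ht
    obtain ⟨C, hC, hC', h'⟩ := isCompact_zSet hs T
    refine HasCompactSupport.intro' hC hC' fun z => ?_
    refine Quotient.inductionOn z fun p hp => ?_
    by_contra h0
    exact hp (h' p (h _ _ h0) (hT _ _ h0))

lemma val_ofKer (F : G → AfH → ℂ) (hF : IsKer F) : val (ofKer F hF) = F := by
  funext g y
  unfold val
  split_ifs with h
  · rfl
  · by_contra h0
    exact h (hF.supp g y (Ne.symm h0))

lemma val_injective {f f' : CcZ} (h : val f = val f') : f = f' := by
  ext z
  refine Quotient.inductionOn z fun p => ?_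
  have := congrFun (congrFun h p.1) p.2.1
  unfold val at this
  rwa [dif_pos p.2.2, dif_pos p.2.2] at this

/-- The saturation of an open set is the union of its preimages under the homeomorphisms given by
pairs in Γ × Γ. -/
lemma isOpenMap_mk : IsOpenMap (Quotient.mk zSetoid) := by
  intro U hU
  rw [← (isQuotientMap_quotient_mk' (s := zSetoid)).isOpen_preimage]
  have hcont : ∀ a ∈ Gam, ∀ b ∈ Gam, ∃ φ : PreZ → PreZ, Continuous φ ∧
      ∀ p, (φ p).1 = a * p.1 * b⁻¹ ∧ (φ p).2.1 = b • p.2.1 := by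
    intro a ha b hb
    have hmem : ∀ p : PreZ, b • p.2.1 ∈ Y ∧ (a * p.1 * b⁻¹) • b • p.2.1 ∈ Y := fun p => by
      refine ⟨Gam_smul_mem hb p.2.2.1, ?_⟩
      rw [smul_smul, inv_mul_cancel_right, mul_smul]
      exact Gam_smul_mem ha p.2.2.2
    refine ⟨fun p => ⟨a * p.1 * b⁻¹, b • p.2.1, hmem p⟩, ?_, fun p => ⟨rfl, rfl⟩⟩
    refine continuous_sigma fun g => ?_
    have hc : Continuous fun y : {y : AfH // y ∈ Y ∧ g • y ∈ Y} =>
        (⟨b • y.1, hmem ⟨g, y⟩⟩ : {z : AfH // z ∈ Y ∧ (a * g * b⁻¹) • z ∈ Y}) :=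
      Continuous.subtype_mk (continuous_subtype_val.const_smul b) _
    exact (continuous_mkPreZ (a * g * b⁻¹)).comp hc
  choose φ hφ hφ' using hcont
  have : Quotient.mk' (s := zSetoid) ⁻¹' (Quotient.mk zSetoid '' U) =
      ⋃ a, ⋃ ha : a ∈ Gam, ⋃ b, ⋃ hb : b ∈ Gam, φ a ha b hb ⁻¹' U := by
    ext q
    simp only [Set.mem_preimage, Set.mem_image, Set.mem_iUnion]
    constructor
    · rintro ⟨p, hp, e⟩
      obtain ⟨a, ha, b, hb, h1, h2⟩ := Quotient.exact e
      refine ⟨a⁻¹, inv_mem ha, b⁻¹, inv_mem hb, ?_⟩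
      convert hp
      obtain ⟨h3, h4⟩ := hφ' a⁻¹ (inv_mem ha) b⁻¹ (inv_mem hb) q
      have e1 : (φ a⁻¹ (inv_mem ha) b⁻¹ (inv_mem hb) q).1 = p.1 := by rw [h3, h1]; group
      have e2 : (φ a⁻¹ (inv_mem ha) b⁻¹ (inv_mem hb) q).2.1 = p.2.1 := by rw [h4, h2, inv_smul_smul]
      rcases hh : φ a⁻¹ (inv_mem ha) b⁻¹ (inv_mem hb) q with ⟨g', y', hy'⟩
      rcases p with ⟨g, y, hy⟩
      rw [hh] at e1 e2
      dsimp only at e1 e2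
      subst e1 e2
      rfl
    · rintro ⟨a, ha, b, hb, h⟩
      obtain ⟨e1, e2⟩ := hφ' a ha b hb q
      exact ⟨_, h, (mkZ_eq ha hb e1 e2).symm⟩
  rw [this]
  exact isOpen_iUnion fun a => isOpen_iUnion fun ha => isOpen_iUnion fun b => isOpen_iUnion fun hb =>
    hU.preimage (hφ a ha b hb)

lemma continuous_dite_of_isClopen {X E : Type*} [TopologicalSpace X] [TopologicalSpace E] [Zero E]
    {D : Set X} (hD : IsClopen D) [DecidablePred (· ∈ D)] {φ : D → E} (hφ : Continuous φ) :
    Continuous fun x => if h : x ∈ D then φ ⟨x, h⟩ else 0 := by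
  rw [continuous_iff_continuousAt]
  intro x
  by_cases hx : x ∈ D
  · have h1 : ContinuousAt ((fun x => if h : x ∈ D then φ ⟨x, h⟩ else 0) ∘ Subtype.val)
        (⟨x, hx⟩ : D) := by
      have : ((fun x => if h : x ∈ D then φ ⟨x, h⟩ else 0) ∘ Subtype.val) = φ := by
        funext z; simp
      rw [this]
      exact hφ.continuousAt
    exact (hD.2.isOpenEmbedding_subtypeVal.continuousAt_iff (x := ⟨x, hx⟩)).1 h1
  · refine ContinuousAt.congr (f := fun _ => (0 : E)) continuousAt_const ?_
    filter_upwards [hD.1.isOpen_compl.mem_nhds hx] with z hz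
    rw [dif_neg hz]

lemma isKer_val (f : CcZ) : IsKer (val f) where
  inv a ha b hb g y := val_invariant f ha hb g y
  supp g y h := by
    unfold val at h
    split_ifs at h with h'
    · exact h'
    · exact absurd rfl h
  cont g := by
    classical
    have hD : IsClopen {y : AfH | y ∈ Y ∧ g • y ∈ Y} := isClopen_dom g
    have hc : Continuous fun y : {y : AfH | y ∈ Y ∧ g • y ∈ Y} => (⟨g, y.1, y.2⟩ : PreZ) :=
      continuous_mkPreZ g
    have := continuous_dite_of_isClopen hD
      (φ := fun y => f (Quotient.mk zSetoid ⟨g, y.1, y.2⟩))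
      (f.continuous.comp (continuous_quotient_mk'.comp hc))
    convert this using 2 with y
    unfold val
    congr
  fin := by
    obtain ⟨s, _, h⟩ := exists_finsets f
    exact ⟨s, s.finite_toSet, fun g y hg => (h g y hg).1⟩
  ht := by
    -- The sets `U n` are open because the quotient map is open; they increase and cover `Z`, so one
    -- of them contains the compact support, which bounds the heights.
    let U : ℕ → Set Z := fun n => Quotient.mk zSetoid ''
      {p : PreZ | max p.2.1.2.im p.2.1.2.im⁻¹ < n}
    have him : Continuous fun y : AfH => y.2.im :=
      UpperHalfPlane.continuous_im.comp continuous_snd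
    have hU : ∀ n, IsOpen (U n) := by
      intro n
      refine isOpenMap_mk _ ?_
      rw [isOpen_sigma_iff]
      intro g
      have hcont : Continuous fun y : AfH => max y.2.im y.2.im⁻¹ :=
        him.max (him.inv₀ fun y => y.2.im_pos.ne')
      exact (isOpen_lt hcont continuous_const).preimage continuous_subtype_val
    have hmono : Monotone U := by
      intro m n hmn
      refine Set.image_mono fun p hp => ?_
      have : (m : ℝ) ≤ n := by exact_mod_cast hmn
      exact lt_of_lt_of_le hp this
    obtain ⟨n, hn⟩ := f.hasCompactSupport.isCompact.elim_directed_cover U hU (by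
      intro z _
      refine Quotient.inductionOn z fun p => ?_
      obtain ⟨n, hn⟩ := exists_nat_gt (max p.2.1.2.im p.2.1.2.im⁻¹)
      exact Set.mem_iUnion.2 ⟨n, p, hn, rfl⟩) hmono.directed_le
    refine ⟨n, fun g y h => ?_⟩
    unfold val at h
    split_ifs at h with h'
    · obtain ⟨p, hp, e⟩ := hn (subset_tsupport _ h)
      obtain ⟨a, ha, b, hb, h1, h2⟩ := Quotient.exact e
      dsimp only at h2
      rw [h2, Ht_smul_iff hb]
      exact (exists_Ht _).mono (le_of_lt hp)
    · exact absurd rfl h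

end OfKer

/-! ### Matrix coefficients of operators on `ℓ²` -/

section MatrixCoefficients

variable {I : Type*}

open Classical in
/-- The basis vector of `ℓ²` given by an index. -/
def dvec (i : I) : lp (fun _ : I => ℂ) 2 := lp.single 2 i (1 : ℂ)

lemma dvec_self (i : I) : dvec i i = 1 := by
  classical exact lp.single_apply_self ..

lemma dvec_ne {i j : I} (h : j ≠ i) : dvec i j = 0 := by
  classical exact lp.single_apply_ne _ _ _ h

lemma norm_dvec (i : I) : ‖dvec i‖ = 1 := by
  classical
  unfold dvec
  rw [lp.norm_single (by norm_num)]
  simp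

/-- A matrix coefficient of an operator on `ℓ²`. -/
def mc (T : lp (fun _ : I => ℂ) 2 →L[ℂ] lp (fun _ : I => ℂ) 2) (p q : I) : ℂ := T (dvec q) p

lemma norm_apply_le_lp (x : lp (fun _ : I => ℂ) 2) (i : I) : ‖x i‖ ≤ ‖x‖ :=
  lp.norm_apply_le_norm (by norm_num) x i

/-- Evaluation of a square-summable function. -/
def evalL (p : I) : lp (fun _ : I => ℂ) 2 →L[ℂ] ℂ :=
  LinearMap.mkContinuous
    { toFun := fun x => x p
      map_add' := fun _ _ => rfl
      map_smul' := fun _ _ => rfl } 1 (fun x => by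
        rw [one_mul]; exact norm_apply_le_lp x p)

lemma hasSum_apply (T : lp (fun _ : I => ℂ) 2 →L[ℂ] lp (fun _ : I => ℂ) 2)
    (x : lp (fun _ : I => ℂ) 2) (p : I) : HasSum (fun r => mc T p r * x r) (T x p) := by
  classical
  have h := (lp.hasSum_single (p := 2) (by norm_num) x).mapL ((evalL p).comp T)
  change HasSum _ (T x p) at h
  refine h.congr_fun fun r => ?_
  have : lp.single 2 r (x r) = x r • dvec r := by
    unfold dvec
    rw [← lp.single_smul]
    simp
  rw [this, map_smul, smul_eq_mul, mul_comm]
  rfl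

lemma mc_ext {S T : lp (fun _ : I => ℂ) 2 →L[ℂ] lp (fun _ : I => ℂ) 2}
    (h : ∀ p q, mc S p q = mc T p q) : S = T := by
  ext x p
  have h1 := hasSum_apply S x p
  simp only [h] at h1
  exact h1.unique (hasSum_apply T x p)

lemma hasSum_mc_mul (S T : lp (fun _ : I => ℂ) 2 →L[ℂ] lp (fun _ : I => ℂ) 2) (p q : I) :
    HasSum (fun r => mc S p r * mc T r q) (mc (S * T) p q) :=
  hasSum_apply S (T (dvec q)) p

lemma mc_eq_inner (T : lp (fun _ : I => ℂ) 2 →L[ℂ] lp (fun _ : I => ℂ) 2) (p q : I) :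
    mc T p q = inner ℂ (dvec p) (T (dvec q)) := by
  classical
  unfold dvec
  rw [lp.inner_single_left]
  simp [mc, dvec]

lemma mc_star (T : lp (fun _ : I => ℂ) 2 →L[ℂ] lp (fun _ : I => ℂ) 2) (p q : I) :
    mc (star T) p q = (starRingEnd ℂ) (mc T q p) := by
  rw [mc_eq_inner, mc_eq_inner, ContinuousLinearMap.star_eq_adjoint,
    ContinuousLinearMap.adjoint_inner_right, inner_conj_symm]

lemma norm_mc_le (T : lp (fun _ : I => ℂ) 2 →L[ℂ] lp (fun _ : I => ℂ) 2) (p q : I) :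
    ‖mc T p q‖ ≤ ‖T‖ := by
  refine (norm_apply_le_lp _ _).trans ((T.le_opNorm _).trans ?_)
  rw [norm_dvec, mul_one]

lemma mc_kernelOp {N : ℕ} {M : ℝ} (K : I → I → ℂ) (h : IsBand N M K) (p q : I) :
    mc (kernelOp K h) p q = K p q := by
  unfold mc
  rw [kernelOp_apply, tsum_eq_single q]
  · rw [dvec_self, mul_one]
  · intro r hr
    rw [dvec_ne hr, mul_zero]

end MatrixCoefficients

lemma mc_piOp (f : CcZ) (y : AfH) (p q : Cosets (Gy y)) : mc (piOp f y) p q = kernel f y p q :=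
  mc_kernelOp _ _ _ _

lemma kernel_mk (f : CcZ) (y : AfH) (g h : Gy y) :
    kernel f y (Quotient.mk _ g) (Quotient.mk _ h) = val f ((g : G) * (h : G)⁻¹) ((h : G) • y) :=
  rfl

/-! ### Operations on kernels -/

/-- The convolution of kernels. -/
def conv (F F' : G → AfH → ℂ) (k : G) (y : AfH) : ℂ :=
  lsum fun h => F (k * h⁻¹) (h • y) * F' h y

/-- The involution on kernels. -/
def starK (F : G → AfH → ℂ) (g : G) (y : AfH) : ℂ := (starRingEnd ℂ) (F g⁻¹ (g • y))

lemma conv_leftInv {F F' : G → AfH → ℂ} (hF : IsKer F) (hF' : IsKer F') (k : G) (y : AfH) :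
    LeftInv fun h => F (k * h⁻¹) (h • y) * F' h y := by
  intro γ hγ h
  dsimp only
  rw [hF'.left hγ, mul_smul, hF.right hγ]
  congr 2
  group

lemma lsum_eq_sum {E : Type*} [AddCommMonoid E] [TopologicalSpace E] {u : G → E} {s : Set RC}
    (hs : s.Finite) (h : ∀ g, u g ≠ 0 → rc g ∈ s) : lsum u = ∑ x ∈ hs.toFinset, u x.out := by
  unfold lsum
  refine tsum_eq_sum fun x hx => ?_
  by_contra h0
  have := h _ h0
  rw [show rc x.out = x from Quotient.out_eq x] at this
  exact hx (hs.mem_toFinset.2 this)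

lemma exists_ne_of_lsum_ne {E : Type*} [AddCommMonoid E] [TopologicalSpace E] {u : G → E}
    (h : lsum u ≠ 0) : ∃ g, u g ≠ 0 := by
  by_contra h0
  push Not at h0
  exact h (by unfold lsum; simp [h0])

lemma IsKer.conv {F F' : G → AfH → ℂ} (hF : IsKer F) (hF' : IsKer F') : IsKer (conv F F') where
  inv a ha b hb k y := by
    unfold GL2System.conv
    rw [← lsum_mul_right (conv_leftInv hF hF' k y) b]
    congr 1
    funext h
    have e1 : F' h (b • y) = F' (h * b) y := hF'.right hb h y
    have e2 : F (a * k * b⁻¹ * h⁻¹) (h • b • y) = F (k * (h * b)⁻¹) ((h * b) • y) := by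
      rw [smul_smul, show a * k * b⁻¹ * h⁻¹ = a * (k * (h * b)⁻¹) by group, hF.left ha]
    rw [e1, e2]
  supp k y h := by
    obtain ⟨g, hg⟩ := exists_ne_of_lsum_ne h
    have h1 := hF.supp _ _ (left_ne_zero_of_mul hg)
    have h2 := hF'.supp _ _ (right_ne_zero_of_mul hg)
    refine ⟨h2.1, ?_⟩
    have := h1.2
    rwa [smul_smul, inv_mul_cancel_right] at this
  cont k := by
    obtain ⟨s, hs, h⟩ := hF'.fin
    have : GL2System.conv F F' k = fun y => ∑ x ∈ hs.toFinset,
        F (k * x.out⁻¹) (x.out • y) * F' x.out y := by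
      funext y
      exact lsum_eq_sum hs fun g hg => h g y (right_ne_zero_of_mul hg)
    rw [this]
    refine continuous_finsetSum _ fun x _ => ?_
    exact ((hF.cont _).comp (continuous_const_smul x.out)).mul (hF'.cont _)
  fin := by
    obtain ⟨s, hs, h⟩ := hF.fin
    obtain ⟨s', hs', h'⟩ := hF'.fin
    refine ⟨_, finite_rc_mul_mul hs hs', fun k y hk => ?_⟩
    obtain ⟨g, hg⟩ := exists_ne_of_lsum_ne hk
    exact ⟨k * g⁻¹, g, h _ _ (left_ne_zero_of_mul hg), h' _ _ (right_ne_zero_of_mul hg), by simp⟩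
  ht := by
    obtain ⟨T, hT⟩ := hF'.ht
    refine ⟨T, fun k y hk => ?_⟩
    obtain ⟨g, hg⟩ := exists_ne_of_lsum_ne hk
    exact hT _ _ (right_ne_zero_of_mul hg)

/-- Heights change by a factor bounded on finitely many cosets. This carries a height bound from g y
to y, as the involution requires. -/
lemma exists_Ht_of_finite {s : Set RC} (hs : s.Finite) (T : ℝ) :
    ∃ T', ∀ g y, rc g ∈ s → Ht T (g • y) → Ht T' y := by
  choose c hc hc' using fun x : RC => exists_Ht_smul x.out⁻¹
  obtain ⟨M, hM⟩ : ∃ M, ∀ x ∈ s, c x * T ≤ M := (hs.image fun x => c x * T).bddAbove.imp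
    fun M hM x hx => hM ⟨x, hx, rfl⟩
  refine ⟨M, fun g y hg hy => ?_⟩
  obtain ⟨γ, hγ, e⟩ := exists_out g
  have := hc' (rc g) T _ ((Ht_smul_iff hγ).2 hy)
  rw [e, smul_smul, smul_smul] at this
  have e2 : (γ * g)⁻¹ * γ * g = 1 := by group
  rw [e2, one_smul] at this
  exact this.mono (hM _ hg)

lemma IsKer.star {F : G → AfH → ℂ} (hF : IsKer F) : IsKer (starK F) where
  inv a ha b hb g y := by
    unfold starK
    have : (a * g * b⁻¹)⁻¹ = b * g⁻¹ * a⁻¹ := by group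
    rw [smul_smul, inv_mul_cancel_right, this, mul_smul, hF.inv b hb a ha]
  supp g y h := by
    have := hF.supp _ _ ((map_ne_zero _).1 h)
    rw [inv_smul_smul] at this
    exact this.symm
  cont g := Complex.continuous_conj.comp ((hF.cont _).comp (continuous_const_smul g))
  fin := by
    obtain ⟨s, hs, h⟩ := hF.fin
    refine ⟨_, finite_rc_inv hs, fun g y hg => ⟨g⁻¹, h _ _ ((map_ne_zero _).1 hg), by simp⟩⟩
  ht := by
    obtain ⟨s, hs, h⟩ := hF.fin
    obtain ⟨T, hT⟩ := hF.ht
    obtain ⟨T', hT'⟩ := exists_Ht_of_finite (finite_rc_inv hs) T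
    refine ⟨T', fun g y hg => ?_⟩
    have h0 := (map_ne_zero _).1 hg
    exact hT' g y ⟨g⁻¹, h _ _ h0, by simp⟩ (hT _ _ h0)

/-- Matrix coefficients are compared: translating the convolution sum on the right by h⁻¹ turns it
into the matrix product, and the terms with k outside `Gy y` vanish since the second kernel does. -/
lemma piOp_conv (f f' : CcZ) (y : AfH) :
    piOp (ofKer _ ((isKer_val f).conv (isKer_val f'))) y = piOp f y * piOp f' y := by
  refine mc_ext fun p q => ?_
  rw [← (hasSum_mc_mul _ _ p q).tsum_eq, mc_piOp]
  simp only [mc_piOp]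
  refine Quotient.inductionOn₂ p q fun g h => ?_
  rw [kernel_mk, val_ofKer]
  have hl := conv_leftInv (isKer_val f) (isKer_val f') ((g : G) * (h : G)⁻¹) ((h : G) • y)
  unfold conv
  rw [← lsum_mul_right hl (h : G)⁻¹]
  symm
  refine lsum_eq_tsum_cosets (S := Gy y) ?_ ?_ ?_
  · intro γ hγ k
    dsimp only
    rw [mul_assoc γ k]
    exact hl γ hγ _
  · intro k hk
    by_contra h0
    have := ((isKer_val f').supp _ _ (right_ne_zero_of_mul h0)).2
    rw [smul_smul, inv_mul_cancel_right] at this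
    exact hk this
  · intro k
    rw [kernel_mk, kernel_mk]
    have e1 : (g : G) * (h : G)⁻¹ * ((k : G) * (h : G)⁻¹)⁻¹ = g * (k : G)⁻¹ := by group
    rw [e1, smul_smul, inv_mul_cancel_right]

lemma piOp_star (f : CcZ) (y : AfH) :
    piOp (ofKer _ (isKer_val f).star) y = star (piOp f y) := by
  refine mc_ext fun p q => ?_
  rw [mc_star, mc_piOp, mc_piOp]
  refine Quotient.inductionOn₂ p q fun g h => ?_
  rw [kernel_mk, kernel_mk, val_ofKer]
  unfold starK
  rw [smul_smul, inv_mul_cancel_right, mul_inv_rev, inv_inv]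

lemma val_add (f f' : CcZ) (g : G) (y : AfH) : val (f + f') g y = val f g y + val f' g y := by
  unfold val
  split_ifs
  · rfl
  · rw [add_zero]

lemma val_smul (c : ℂ) (f : CcZ) (g : G) (y : AfH) : val (c • f) g y = c * val f g y := by
  unfold val
  split_ifs
  · rfl
  · rw [mul_zero]

lemma val_zero (g : G) (y : AfH) : val 0 g y = 0 := by
  unfold val
  split_ifs <;> rfl

lemma kernel_add (f f' : CcZ) (y : AfH) (p q : Cosets (Gy y)) :
    kernel (f + f') y p q = kernel f y p q + kernel f' y p q :=
  Quotient.inductionOn₂ p q fun _ _ => val_add _ _ _ _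

lemma kernel_smul (c : ℂ) (f : CcZ) (y : AfH) (p q : Cosets (Gy y)) :
    kernel (c • f) y p q = c * kernel f y p q :=
  Quotient.inductionOn₂ p q fun _ _ => val_smul _ _ _ _

lemma Ambient.ext_mc {S T : Ambient} (h : ∀ (y : Y) p q, mc (S y) p q = mc (T y) p q) : S = T :=
  Ambient.ext fun y => mc_ext (h y)

/-- `C_c(Z) → A` as a linear map. -/
def toAL : CcZ →ₗ[ℂ] A where
  toFun := toA
  map_add' f f' := by
    refine Subtype.ext (Ambient.ext_mc fun y p q => ?_)
    change mc (piOp (f + f') y) p q = mc (piOp f y) p q + mc (piOp f' y) p q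
    rw [mc_piOp, mc_piOp, mc_piOp, kernel_add]
  map_smul' c f := by
    refine Subtype.ext (Ambient.ext_mc fun y p q => ?_)
    change mc (piOp (c • f) y) p q = c * mc (piOp f y) p q
    rw [mc_piOp, mc_piOp, kernel_smul]

lemma toAL_apply (f : CcZ) : toAL f = toA f := rfl

lemma toA_add (f f' : CcZ) : toA (f + f') = toA f + toA f' := toAL.map_add f f'
lemma toA_smul (c : ℂ) (f : CcZ) : toA (c • f) = c • toA f := toAL.map_smul c f

/-- The element of `A` given by a kernel. -/
def kA (F : G → AfH → ℂ) (hF : IsKer F) : A := toA (ofKer F hF)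

lemma ofKer_val (f : CcZ) : ofKer (val f) (isKer_val f) = f := val_injective (val_ofKer _ _)

lemma toA_eq_kA (f : CcZ) : toA f = kA (val f) (isKer_val f) := by
  unfold kA
  rw [ofKer_val]

lemma kA_congr {F F' : G → AfH → ℂ} {hF : IsKer F} {hF' : IsKer F'} (h : F = F') :
    kA F hF = kA F' hF' := by subst h; rfl

lemma kA_mul {F F' : G → AfH → ℂ} (hF : IsKer F) (hF' : IsKer F') :
    kA F hF * kA F' hF' = kA (conv F F') (hF.conv hF') := by
  refine Subtype.ext (Ambient.ext fun y => ?_)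
  change piOp _ y * piOp _ y = piOp _ y
  rw [← piOp_conv]
  congr 1
  refine val_injective ?_
  rw [val_ofKer, val_ofKer, val_ofKer, val_ofKer]

lemma kA_star {F : G → AfH → ℂ} (hF : IsKer F) : star (kA F hF) = kA (starK F) hF.star := by
  refine Subtype.ext (Ambient.ext fun y => ?_)
  change star (piOp _ y) = piOp _ y
  rw [← piOp_star]
  congr 1
  refine val_injective ?_
  rw [val_ofKer, val_ofKer, val_ofKer]

/-- The image of `C_c(Z)` in the algebra of families of operators. -/
def rangePi : NonUnitalStarSubalgebra ℂ Ambient where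
  carrier := Set.range piAll
  add_mem' := by
    rintro _ _ ⟨f, rfl⟩ ⟨f', rfl⟩
    exact ⟨f + f', congrArg Subtype.val (toA_add f f')⟩
  zero_mem' := ⟨0, congrArg Subtype.val toAL.map_zero⟩
  mul_mem' := by
    rintro _ _ ⟨f, rfl⟩ ⟨f', rfl⟩
    exact ⟨_, Ambient.ext fun y => piOp_conv f f' y⟩
  smul_mem' := by
    rintro c _ ⟨f, rfl⟩
    exact ⟨c • f, congrArg Subtype.val (toA_smul c f)⟩
  star_mem' := by
    rintro _ ⟨f, rfl⟩
    exact ⟨_, Ambient.ext fun y => piOp_star f y⟩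

/-- The functions already form a ⋆-algebra of operators (`rangePi`), so generating an algebra from
them adds nothing before the closure. -/
lemma denseRange_toA : DenseRange toA := by
  intro a
  have h1 : NonUnitalStarAlgebra.adjoin ℂ (Set.range piAll) ≤ rangePi :=
    NonUnitalStarAlgebra.adjoin_le fun x hx => hx
  have h2 : (a : Ambient) ∈ closure (Set.range piAll) :=
    closure_mono (fun x hx => h1 hx) a.2
  have h3 : Subtype.val '' Set.range toA = Set.range piAll := (Set.range_comp _ _).symm
  rw [closure_subtype, h3]
  exact h2

/-! ### Invariant functions with compact support -/

/-- `Γ`-invariant continuous functions on `Y`, extended by zero, whose support is compact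
modulo `Γ`. -/
structure IsInv {E : Type*} [TopologicalSpace E] [Zero E] (k : AfH → E) : Prop where
  inv : ∀ a ∈ Gam, ∀ y, k (a • y) = k y
  supp : ∀ y, k y ≠ 0 → y ∈ Y
  cont : Continuous k
  ht : ∃ T, ∀ y, k y ≠ 0 → Ht T y

namespace IsInv

variable {E : Type*} [TopologicalSpace E]

lemma zero [Zero E] : IsInv (fun _ => 0 : AfH → E) :=
  ⟨fun _ _ _ => rfl, fun _ h => absurd rfl h, continuous_const, 0, fun _ h => absurd rfl h⟩

lemma comp {F : Type*} [TopologicalSpace F] [Zero E] [Zero F] {k : AfH → E} (hk : IsInv k)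
    {φ : E → F} (hφ : Continuous φ) (h0 : φ 0 = 0) : IsInv fun y => φ (k y) where
  inv a ha y := congrArg φ (hk.inv a ha y)
  supp y h := hk.supp y fun h' => h (by rw [h', h0])
  cont := hφ.comp hk.cont
  ht := hk.ht.imp fun T hT y h => hT y fun h' => h (by rw [h', h0])

lemma add [AddMonoid E] [ContinuousAdd E] {k k' : AfH → E} (hk : IsInv k) (hk' : IsInv k') :
    IsInv fun y => k y + k' y where
  inv a ha y := by rw [hk.inv a ha, hk'.inv a ha]
  supp y h := by
    by_contra hy
    have h1 : k y = 0 := by by_contra h0; exact hy (hk.supp y h0)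
    have h2 : k' y = 0 := by by_contra h0; exact hy (hk'.supp y h0)
    exact h (by rw [h1, h2, add_zero])
  cont := hk.cont.add hk'.cont
  ht := by
    obtain ⟨T, hT⟩ := hk.ht
    obtain ⟨T', hT'⟩ := hk'.ht
    refine ⟨max T T', fun y h => ?_⟩
    by_cases h0 : k y = 0
    · refine (hT' y fun h1 => h ?_).mono (le_max_right _ _)
      rw [h0, h1, add_zero]
    · exact (hT y h0).mono (le_max_left _ _)

lemma mul_left [MulZeroClass E] [ContinuousMul E] {b k : AfH → E} (hk : IsInv k)
    (hb : Continuous b) (hb' : ∀ a ∈ Gam, ∀ y, b (a • y) = b y) : IsInv fun y => b y * k y where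
  inv a ha y := by rw [hb' a ha, hk.inv a ha]
  supp y h := hk.supp y (right_ne_zero_of_mul h)
  cont := hb.mul hk.cont
  ht := hk.ht.imp fun T hT y h => hT y (right_ne_zero_of_mul h)

lemma mul [MulZeroClass E] [ContinuousMul E] {b k : AfH → E} (hb : IsInv b) (hk : IsInv k) :
    IsInv fun y => b y * k y :=
  hk.mul_left hb.cont hb.inv

lemma const_mul [MulZeroClass E] [ContinuousMul E] (c : E) {k : AfH → E} (hk : IsInv k) :
    IsInv fun y => c * k y :=
  hk.mul_left continuous_const fun _ _ _ => rfl

lemma sub {k k' : AfH → ℝ} (hk : IsInv k) (hk' : IsInv k') : IsInv fun y => k y - k' y := by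
  simpa [sub_eq_add_neg] using hk.add (hk'.const_mul (-1))

lemma sum {ι : Type*} [AddCommMonoid E] [ContinuousAdd E] {s : Finset ι} {k : ι → AfH → E}
    (hk : ∀ i ∈ s, IsInv (k i)) : IsInv fun y => ∑ i ∈ s, k i y := by
  classical
  induction s using Finset.induction_on with
  | empty => simpa using IsInv.zero
  | insert i s hi ih =>
    simp only [Finset.sum_insert hi]
    exact (hk i (Finset.mem_insert_self _ _)).add
      (ih fun j hj => hk j (Finset.mem_insert_of_mem hj))

lemma ofReal {k : AfH → ℝ} (hk : IsInv k) : IsInv fun y => (k y : ℂ) :=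
  hk.comp Complex.continuous_ofReal Complex.ofReal_zero

lemma re {k : AfH → ℂ} (hk : IsInv k) : IsInv fun y => (k y).re :=
  hk.comp Complex.continuous_re Complex.zero_re

lemma im {k : AfH → ℂ} (hk : IsInv k) : IsInv fun y => (k y).im :=
  hk.comp Complex.continuous_im Complex.zero_im

lemma exists_bound {E : Type*} [NormedAddCommGroup E] {k : AfH → E} (hk : IsInv k) :
    ∃ M, 0 ≤ M ∧ ∀ y, ‖k y‖ ≤ M := by
  obtain ⟨T, hT⟩ := hk.ht
  obtain ⟨M, hM⟩ := (isCompact_KT T).exists_bound_of_continuousOn hk.cont.continuousOn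
  refine ⟨max M 0, le_max_right _ _, fun y => ?_⟩
  by_cases h : k y = 0
  · rw [h, norm_zero]; exact le_max_right _ _
  · obtain ⟨γ, hγ, h'⟩ := exists_smul_mem_KT (hk.supp y h) (hT y h)
    rw [← hk.inv γ hγ]
    exact (hM _ h').trans (le_max_left _ _)

end IsInv

/-! ### Diagonal kernels. -/

open Classical in
/-- The kernel supported on the diagonal given by an invariant function. -/
def dg (k : AfH → ℂ) (g : G) (y : AfH) : ℂ := if g ∈ Gam then k y else 0

lemma dg_of_mem {g : G} (hg : g ∈ Gam) (k : AfH → ℂ) (y : AfH) : dg k g y = k y := if_pos hg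

lemma dg_of_notMem {g : G} (hg : g ∉ Gam) (k : AfH → ℂ) (y : AfH) : dg k g y = 0 := if_neg hg

lemma dg_ne {g : G} {k : AfH → ℂ} {y : AfH} (h : dg k g y ≠ 0) : g ∈ Gam ∧ k y ≠ 0 := by
  by_cases hg : g ∈ Gam
  · rw [dg_of_mem hg] at h; exact ⟨hg, h⟩
  · exact absurd (dg_of_notMem hg k y) h

lemma mul_mul_inv_mem_iff {a b g : G} (ha : a ∈ Gam) (hb : b ∈ Gam) :
    a * g * b⁻¹ ∈ Gam ↔ g ∈ Gam := by
  rw [Subgroup.mul_mem_cancel_right _ (inv_mem hb), Subgroup.mul_mem_cancel_left _ ha]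

lemma rc_of_mem {g : G} (hg : g ∈ Gam) : rc g = rc 1 := by
  rw [← mul_one g, rc_gam_mul hg]

lemma rc_eq_rc_iff {g h : G} : rc g = rc h ↔ h * g⁻¹ ∈ Gam := rc_eq

lemma IsInv.isKer {k : AfH → ℂ} (hk : IsInv k) : IsKer (dg k) where
  inv a ha b hb g y := by
    unfold dg
    rw [hk.inv b hb]
    by_cases hg : g ∈ Gam
    · rw [if_pos hg, if_pos ((mul_mul_inv_mem_iff ha hb).2 hg)]
    · rw [if_neg hg, if_neg fun h => hg ((mul_mul_inv_mem_iff ha hb).1 h)]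
  supp g y h := by
    obtain ⟨hg, h⟩ := dg_ne h
    exact ⟨hk.supp y h, Gam_smul_mem hg (hk.supp y h)⟩
  cont g := by
    unfold dg
    split_ifs
    · exact hk.cont
    · exact continuous_const
  fin := ⟨{rc 1}, Set.finite_singleton _, fun g y h => rc_of_mem (dg_ne h).1⟩
  ht := hk.ht.imp fun T hT g y h => hT y (dg_ne h).2

lemma lsum_eq_single {E : Type*} [AddCommMonoid E] [TopologicalSpace E] {u : G → E}
    (hu : LeftInv u) (g : G) (h : ∀ x, u x ≠ 0 → rc x = rc g) : lsum u = u g := by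
  unfold lsum
  rw [tsum_eq_single (rc g), hu.out]
  intro x hx
  by_contra h0
  have := h _ h0
  rw [show rc x.out = x from Quotient.out_eq x] at this
  exact hx this

lemma conv_dg_left {k : AfH → ℂ} (hk : IsInv k) {F : G → AfH → ℂ} (hF : IsKer F) :
    conv (dg k) F = fun g y => k (g • y) * F g y := by
  funext g y
  unfold conv
  rw [lsum_eq_single (conv_leftInv hk.isKer hF g y) g]
  · rw [mul_inv_cancel, dg_of_mem (one_mem _)]
  · intro h hh
    exact rc_eq_rc_iff.2 (dg_ne (left_ne_zero_of_mul hh)).1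

lemma conv_dg_right {k : AfH → ℂ} (hk : IsInv k) {F : G → AfH → ℂ} (hF : IsKer F) :
    conv F (dg k) = fun g y => F g y * k y := by
  funext g y
  unfold conv
  rw [lsum_eq_single (conv_leftInv hF hk.isKer g y) 1]
  · rw [inv_one, mul_one, one_smul, dg_of_mem (one_mem _)]
  · intro h hh
    exact rc_of_mem (dg_ne (right_ne_zero_of_mul hh)).1

lemma starK_dg {k : AfH → ℂ} (hk : IsInv k) :
    starK (dg k) = dg fun y => (starRingEnd ℂ) (k y) := by
  funext g y
  unfold starK
  by_cases hg : g ∈ Gam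
  · rw [dg_of_mem (inv_mem hg), dg_of_mem hg, hk.inv g hg]
  · rw [dg_of_notMem (fun h => hg (by simpa using inv_mem h)), dg_of_notMem hg, map_zero]

lemma IsKer.mul_fun {F : G → AfH → ℂ} (hF : IsKer F) {w : G → AfH → ℂ}
    (hw : ∀ a ∈ Gam, ∀ b ∈ Gam, ∀ g y, w (a * g * b⁻¹) (b • y) = w g y)
    (hc : ∀ g, Continuous (w g)) : IsKer fun g y => w g y * F g y where
  inv a ha b hb g y := by rw [hw a ha b hb, hF.inv a ha b hb]
  supp g y h := hF.supp g y (right_ne_zero_of_mul h)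
  cont g := (hc g).mul (hF.cont g)
  fin := hF.fin.imp fun s hs => ⟨hs.1, fun g y h => hs.2 g y (right_ne_zero_of_mul h)⟩
  ht := hF.ht.imp fun T hT g y h => hT g y (right_ne_zero_of_mul h)

lemma IsKer.add {F F' : G → AfH → ℂ} (hF : IsKer F) (hF' : IsKer F') :
    IsKer fun g y => F g y + F' g y := by
  have : (fun g y => F g y + F' g y) = val (ofKer F hF + ofKer F' hF') := by
    funext g y
    rw [val_add, val_ofKer, val_ofKer]
  rw [this]
  exact isKer_val _

lemma IsKer.zero : IsKer fun _ _ => 0 := by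
  have : (fun _ _ => 0 : G → AfH → ℂ) = val 0 := by
    funext g y
    rw [val_zero]
  rw [this]
  exact isKer_val _

lemma IsKer.sum {ι : Type*} {s : Finset ι} {F : ι → G → AfH → ℂ} (hF : ∀ i ∈ s, IsKer (F i)) :
    IsKer fun g y => ∑ i ∈ s, F i g y := by
  classical
  induction s using Finset.induction_on with
  | empty => simpa using IsKer.zero
  | insert i s hi ih =>
    simp only [Finset.sum_insert hi]
    exact (hF i (Finset.mem_insert_self _ _)).add
      (ih fun j hj => hF j (Finset.mem_insert_of_mem hj))

lemma kA_add {F F' : G → AfH → ℂ} (hF : IsKer F) (hF' : IsKer F') :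
    kA (fun g y => F g y + F' g y) (hF.add hF') = kA F hF + kA F' hF' := by
  unfold kA
  rw [← toA_add]
  congr 1
  refine val_injective ?_
  funext g y
  rw [val_add, val_ofKer, val_ofKer, val_ofKer]

lemma kA_smul (c : ℂ) {F : G → AfH → ℂ} (hF : IsKer F) (h : IsKer fun g y => c * F g y) :
    kA (fun g y => c * F g y) h = c • kA F hF := by
  unfold kA
  rw [← toA_smul]
  congr 1
  refine val_injective ?_
  funext g y
  rw [val_smul, val_ofKer, val_ofKer]

lemma kA_zero (h : IsKer fun _ _ => 0) : kA (fun _ _ => 0) h = 0 := by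
  rw [← toAL.map_zero, toAL_apply]
  unfold kA
  congr 1
  refine val_injective ?_
  funext g y
  rw [val_ofKer, val_zero]

lemma kA_sum {ι : Type*} {s : Finset ι} {F : ι → G → AfH → ℂ} (hF : ∀ i, IsKer (F i))
    (h : IsKer fun g y => ∑ i ∈ s, F i g y) :
    kA (fun g y => ∑ i ∈ s, F i g y) h = ∑ i ∈ s, kA (F i) (hF i) := by
  classical
  induction s using Finset.induction_on with
  | empty =>
    rw [Finset.sum_empty, ← kA_zero IsKer.zero]
    refine kA_congr ?_
    simp
  | insert i s hi ih =>
    rw [Finset.sum_insert hi, ← ih (IsKer.sum fun i _ => hF i), ← kA_add]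
    refine kA_congr ?_
    simp only [Finset.sum_insert hi]

lemma piOp_eq_kernelOp (f : CcZ) (y : AfH) {N : ℕ} {M : ℝ} (h : IsBand N M (kernel f y)) :
    piOp f y = kernelOp (kernel f y) h := by
  refine mc_ext fun p q => ?_
  rw [mc_piOp, mc_kernelOp]

/-- The operators are diagonal matrices with entries among the values of k, that is, band matrices
of width 1. -/
lemma norm_kA_dg_le {k : AfH → ℂ} (hk : IsInv k) {M : ℝ} (hM : ∀ y, ‖k y‖ ≤ M) (h0 : 0 ≤ M) :
    ‖kA (dg k) hk.isKer‖ ≤ M := by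
  change ‖piAll _‖ ≤ M
  refine lp.norm_le_of_forall_le h0 fun y => ?_
  change ‖piOp _ _‖ ≤ M
  have key : ∀ p q : Cosets (Gy y.1), kernel (ofKer (dg k) hk.isKer) y.1 p q ≠ 0 → p = q := by
    intro p q
    refine Quotient.inductionOn₂ p q fun g h hne => ?_
    rw [kernel_mk, val_ofKer] at hne
    have hm := (dg_ne hne).1
    exact (Quotient.sound (⟨_, hm, by group⟩ : ∃ γ ∈ Gam, (g : G) = γ * h)).symm
  have hb : IsBand 1 M (kernel (ofKer (dg k) hk.isKer) y.1) :=
    ⟨fun i => ⟨{i}, by simp, fun j hj => by rw [key i j hj]; simp⟩,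
      fun j => ⟨{j}, by simp, fun i hi => by rw [key i j hi]; simp⟩, fun p q => by
        refine Quotient.inductionOn₂ p q fun g h => ?_
        rw [kernel_mk, val_ofKer]
        by_cases hm : (g : G) * (h : G)⁻¹ ∈ Gam
        · rw [dg_of_mem hm]; exact hM _
        · rw [dg_of_notMem hm, norm_zero]; exact h0⟩
  rw [piOp_eq_kernelOp _ _ hb]
  refine (norm_kernelOp_le _ hb).trans ?_
  rw [abs_of_nonneg h0]
  simp

/-- The value f(1, y) is the diagonal matrix coefficient of π_y(f) at the coset of 1. This makes
restriction to the diagonal continuous for the norm of `A`. -/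
lemma norm_val_le (f : CcZ) {y : AfH} (hy : y ∈ Y) : ‖val f 1 y‖ ≤ ‖toA f‖ := by
  have h1 : ‖piAll f ⟨y, hy⟩‖ ≤ ‖piAll f‖ := Ambient.norm_apply_le _ _
  refine le_trans ?_ h1
  let o : Gy y := ⟨1, by change (1 : G) • y ∈ Y; rwa [one_smul]⟩
  have h2 := norm_mc_le (piOp f y) (Quotient.mk _ o) (Quotient.mk _ o)
  rw [mc_piOp, kernel_mk] at h2
  change ‖val f (1 * 1⁻¹) ((1 : G) • y)‖ ≤ _ at h2
  rwa [inv_one, mul_one, one_smul] at h2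

lemma IsKer.diag {F : G → AfH → ℂ} (hF : IsKer F) : IsInv (F 1) where
  inv a ha y := by
    have := hF.inv a ha a ha 1 y
    rwa [mul_one, mul_inv_cancel] at this
  supp y h := (hF.supp 1 y h).1
  cont := hF.cont 1
  ht := hF.ht.imp fun T hT y h => hT 1 y h

/-! ### Heights and bumps -/

/-- Near x all members of the family move by at most d x x', uniformly in the index, and so does
their supremum. -/
lemma continuous_iSup_of_local {ι X : Type*} [Nonempty ι] [TopologicalSpace X] (u : ι → X → ℝ)
    (d : X → X → ℝ) (hb : ∀ x, BddAbove (Set.range fun i => u i x))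
    (h : ∀ x, ∀ᶠ x' in nhds x, ∀ i, |u i x' - u i x| ≤ d x x')
    (hd : ∀ x, Filter.Tendsto (d x) (nhds x) (nhds 0)) : Continuous fun x => ⨆ i, u i x := by
  refine continuous_iff_continuousAt.2 fun x => ?_
  refine tendsto_iff_dist_tendsto_zero.2 (squeeze_zero' (.of_forall fun _ => dist_nonneg) ?_ (hd x))
  filter_upwards [h x] with x' hx'
  rw [Real.dist_eq, abs_sub_le_iff]
  constructor
  · rw [sub_le_iff_le_add]
    refine ciSup_le fun i => ?_
    have := le_ciSup (hb x) i
    have := (abs_le.1 (hx' i)).2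
    linarith
  · rw [sub_le_iff_le_add]
    refine ciSup_le fun i => ?_
    have := le_ciSup (hb x') i
    have := (abs_le.1 (hx' i)).1
    linarith

lemma dist_sl_smul (s : SL(2, ℤ)) (z w : ℍ) : dist (s • z) (s • w) = dist z w := by
  have e : ∀ z : ℍ, s • z = (Matrix.SpecialLinearGroup.map (Int.castRingHom ℝ) s) • z := fun z =>
    rfl
  rw [e, e]
  exact dist_smul _ _ _

/-- The logarithm of the largest imaginary part in the orbit of a point. -/
def logH (y : AfH) : ℝ := ⨆ s : SL(2, ℤ), Real.log (s • y.2).im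

lemma Ht_iff_sl {T : ℝ} {y : AfH} : Ht T y ↔ ∀ s : SL(2, ℤ), (s • y.2).im ≤ T := by
  constructor
  · intro h s
    rw [← iota_smul_snd]
    exact h _ (iota_mem s)
  · rintro h _ ⟨s, rfl⟩
    change (iota s • y).2.im ≤ T
    rw [iota_smul_snd]
    exact h s

lemma bddAbove_log (y : AfH) : BddAbove (Set.range fun s : SL(2, ℤ) => Real.log (s • y.2).im) := by
  refine ⟨Real.log (max y.2.im y.2.im⁻¹), ?_⟩
  rintro _ ⟨s, rfl⟩
  exact Real.log_le_log (UpperHalfPlane.im_pos _) (Ht_iff_sl.1 (exists_Ht y) s)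

lemma Ht_exp_iff {T : ℝ} {y : AfH} : Ht (Real.exp T) y ↔ logH y ≤ T := by
  rw [Ht_iff_sl]
  constructor
  · intro h
    refine ciSup_le fun s => ?_
    rw [Real.log_le_iff_le_exp (UpperHalfPlane.im_pos _)]
    exact h s
  · intro h s
    rw [← Real.log_le_iff_le_exp (UpperHalfPlane.im_pos _)]
    exact (le_ciSup (bddAbove_log y) s).trans h

lemma tendsto_dist_snd (y : AfH) :
    Filter.Tendsto (fun y' : AfH => dist y'.2 y.2) (nhds y) (nhds 0) := by
  have h : Continuous fun y' : AfH => dist y'.2 y.2 := continuous_snd.dist continuous_const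
  simpa using h.tendsto y

/-- The function log Im is 1-Lipschitz for the hyperbolic distance and SL₂(ℤ) acts by isometries, so
the supremum is 1-Lipschitz as well. -/
lemma continuous_logH : Continuous logH := by
  refine continuous_iSup_of_local _ (fun y y' => dist y'.2 y.2) bddAbove_log ?_ tendsto_dist_snd
  refine fun y => .of_forall fun y' s => ?_
  refine (UpperHalfPlane.dist_log_im_le _ _).trans ?_
  rw [dist_sl_smul]

lemma logH_smul {a : G} (ha : a ∈ Gam) (y : AfH) : logH (a • y) = logH y := by
  refine le_antisymm ?_ ?_
  · rw [← Ht_exp_iff, Ht_smul_iff ha, Ht_exp_iff]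
  · rw [← Ht_exp_iff, ← Ht_smul_iff ha, Ht_exp_iff]

lemma logH_congr {y z : AfH} (h : y.2 = z.2) : logH y = logH z := by
  unfold logH
  rw [h]

open Classical in
/-- An increasing sequence of functions with values in `[0, 1]`, converging to `1` on `Y`. -/
def bump (n : ℕ) (y : AfH) : ℝ := if y ∈ Y then max 0 (min 1 (n + 1 - logH y)) else 0

lemma bump_nonneg (n : ℕ) (y : AfH) : 0 ≤ bump n y := by
  unfold bump
  split_ifs
  · exact le_max_left _ _
  · exact le_rfl

lemma bump_le_one (n : ℕ) (y : AfH) : bump n y ≤ 1 := by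
  unfold bump
  split_ifs
  · exact max_le zero_le_one (min_le_left _ _)
  · exact zero_le_one

lemma bump_mono {m n : ℕ} (h : m ≤ n) (y : AfH) : bump m y ≤ bump n y := by
  unfold bump
  split_ifs
  · gcongr
  · exact le_rfl

lemma continuous_ite_Y {E : Type*} [TopologicalSpace E] [Zero E] {P : AfH → Prop}
    [DecidablePred P] (hP : IsClopen {y | P y}) {k : AfH → E} (hk : Continuous k) :
    Continuous fun y => if P y then k y else 0 := by
  refine continuous_if (fun a ha => ?_) hk.continuousOn continuousOn_const
  rw [hP.frontier_eq] at ha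
  exact absurd ha (Set.notMem_empty _)

lemma isInv_bump (n : ℕ) : IsInv (bump n) where
  inv a ha y := by
    unfold bump
    by_cases hy : y ∈ Y
    · rw [if_pos hy, if_pos (Gam_smul_mem ha hy), logH_smul ha]
    · rw [if_neg hy, if_neg fun h => hy ((Gam_smul_mem_iff ha).1 h)]
  supp y h := by
    by_contra hy
    exact h (if_neg hy)
  cont := by
    classical
    have hc : Continuous fun y => max 0 (min 1 ((n : ℝ) + 1 - logH y)) :=
      continuous_const.max (continuous_const.min (continuous_const.sub continuous_logH))
    have := continuous_ite_Y (P := fun y => y ∈ Y) isClopen_Y hc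
    unfold bump
    convert this
  ht := by
    refine ⟨Real.exp (n + 1), fun y h => Ht_exp_iff.2 ?_⟩
    by_contra h0
    push Not at h0
    refine h ?_
    unfold bump
    split_ifs
    · refine max_eq_left ((min_le_right _ _).trans (by linarith))
    · rfl

lemma bump_eq_one {n : ℕ} {y : AfH} (hy : y ∈ Y) (h : logH y ≤ n) : bump n y = 1 := by
  unfold bump
  rw [if_pos hy, min_eq_left (by linarith), max_eq_right zero_le_one]

lemma bump_congr (n : ℕ) {y z : AfH} (hy : y ∈ Y) (hz : z ∈ Y) (h : y.2 = z.2) :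
    bump n y = bump n z := by
  unfold bump
  rw [if_pos hy, if_pos hz, logH_congr h]

lemma exists_bump (T : ℝ) : ∃ n : ℕ, ∀ m, n ≤ m → ∀ y ∈ Y, Ht T y → bump m y = 1 := by
  obtain ⟨n, hn⟩ := exists_nat_ge (Real.log T)
  refine ⟨n, fun m hm y hy h => bump_eq_one hy ?_⟩
  have : logH y ≤ Real.log T := by
    rw [← Ht_exp_iff, Real.exp_log h.pos]
    exact h
  refine this.trans (hn.trans ?_)
  exact_mod_cast hm

/-! ### Separation of orbits -/

open Classical in
/-- A term of `sepFun`. -/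
def sepTerm (o : AfH) (N : ℕ) (ε : ℝ) (s : SL(2, ℤ)) (y : AfH) : ℝ :=
  if ∀ i j, Dvd N ((iota s • y).1 i j - o.1 i j) then max 0 (ε - dist (s • y.2) o.2) else 0

open Classical in
/-- A function on `Γ \ Y` supported near the orbit of the point `o`. -/
def sepFun (o : AfH) (N : ℕ) (ε : ℝ) (y : AfH) : ℝ :=
  if y ∈ Y then ⨆ s : SL(2, ℤ), sepTerm o N ε s y else 0

lemma sepTerm_nonneg (o : AfH) (N : ℕ) (ε : ℝ) (s : SL(2, ℤ)) (y : AfH) :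
    0 ≤ sepTerm o N ε s y := by
  unfold sepTerm
  split_ifs
  · exact le_max_left _ _
  · exact le_rfl

lemma sepTerm_eq_zero {o : AfH} {N : ℕ} {ε : ℝ} {s : SL(2, ℤ)} {y : AfH}
    (h : (∀ i j, Dvd N ((iota s • y).1 i j - o.1 i j)) → ε ≤ dist (s • y.2) o.2) :
    sepTerm o N ε s y = 0 := by
  unfold sepTerm
  split_ifs with h1
  · exact max_eq_left (by linarith [h h1])
  · rfl

lemma Dvd.add {N : ℕ} {a b : Af} (ha : Dvd N a) (hb : Dvd N b) : Dvd N (a + b) := by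
  unfold Dvd
  rw [mul_add]
  exact R_add ha hb

lemma Dvd.mul {N : ℕ} {a b : Af} (ha : a ∈ R) (hb : Dvd N b) : Dvd N (a * b) := by
  unfold Dvd
  rw [mul_left_comm]
  exact R_mul ha hb

lemma Dvd.neg {N : ℕ} {a : Af} (ha : Dvd N a) : Dvd N (-a) := by
  unfold Dvd
  rw [mul_neg]
  exact RSub.neg_mem ha

lemma isClopen_Dvd (N : ℕ) : IsClopen {a | Dvd N a} :=
  isClopen_R.preimage (continuous_const_mul _)

lemma smul_sub_Dvd {N : ℕ} {g : G} (hg : g ∈ M2Zplus) {y z : AfH}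
    (h : ∀ i j, Dvd N (y.1 i j - z.1 i j)) (i j : Fin 2) :
    Dvd N ((g • y).1 i j - (g • z).1 i j) := by
  obtain ⟨m, hm⟩ := hg
  rw [smul_fst, smul_fst, Matrix.mul_apply, Matrix.mul_apply, Fin.sum_univ_two, Fin.sum_univ_two,
    add_sub_add_comm, ← mul_sub, ← mul_sub]
  have hR : ∀ k, (g.1.1.map qA) i k ∈ R := fun k => by
    rw [Matrix.map_apply, hm]
    exact R_int _
  exact Dvd.add (Dvd.mul (hR 0) (h 0 j)) (Dvd.mul (hR 1) (h 1 j))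

lemma bddAbove_sep (o : AfH) (N : ℕ) {ε : ℝ} (hε : 0 ≤ ε) (y : AfH) :
    BddAbove (Set.range fun s => sepTerm o N ε s y) := by
  refine ⟨ε, ?_⟩
  rintro _ ⟨s, rfl⟩
  dsimp only [sepTerm]
  split_ifs
  · exact max_le hε (sub_le_self _ dist_nonneg)
  · exact hε

lemma eventually_Dvd (N : ℕ) (y : AfH) :
    ∀ᶠ y' in nhds y, ∀ i j, Dvd N (y'.1 i j - y.1 i j) := by
  rw [Filter.eventually_all]
  intro i
  rw [Filter.eventually_all]
  intro j
  have hc : Continuous fun y' : AfH => y'.1 i j - y.1 i j :=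
    ((continuous_apply_apply i j).comp continuous_fst).sub continuous_const
  refine (hc.tendsto y).eventually ((isClopen_Dvd N).isOpen.mem_nhds ?_)
  change Dvd N _
  unfold Dvd
  rw [sub_self, mul_zero]
  exact RSub.zero_mem

/-- Translation by Γ permutes the terms of the supremum. For continuity, nearby ρ are congruent
modulo N and remain so after any s in SL₂(ℤ), so all congruence conditions are locally constant at
once, while the distances vary isometrically. -/
lemma isInv_sepFun (o : AfH) (N : ℕ) {ε : ℝ} (hε : 0 < ε) : IsInv (sepFun o N ε) where
  inv a ha y := by
    obtain ⟨t, rfl⟩ := ha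
    change sepFun o N ε (iota t • y) = _
    have e : ∀ s, sepTerm o N ε s (iota t • y) = sepTerm o N ε (s * t) y := fun s => by
      unfold sepTerm
      rw [iota_smul_snd, smul_smul, smul_smul, map_mul]
    unfold sepFun
    simp only [e]
    by_cases hy : y ∈ Y
    · rw [if_pos hy, if_pos (Gam_smul_mem (iota_mem t) hy)]
      exact (Equiv.mulRight t).iSup_comp (g := fun s => sepTerm o N ε s y)
    · rw [if_neg hy, if_neg fun h => hy ((Gam_smul_mem_iff (iota_mem t)).1 h)]
  supp y h := by
    by_contra hy
    exact h (if_neg hy)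
  cont := by
    classical
    have : Continuous fun y : AfH => ⨆ s : SL(2, ℤ), sepTerm o N ε s y := by
      refine continuous_iSup_of_local _ (fun y y' => dist y'.2 y.2)
        (fun y => bddAbove_sep o N hε.le y) (fun y => ?_) tendsto_dist_snd
      filter_upwards [eventually_Dvd N y] with y' hy' s
      have e : (∀ i j, Dvd N ((iota s • y').1 i j - o.1 i j)) ↔
          ∀ i j, Dvd N ((iota s • y).1 i j - o.1 i j) := by
        have h1 := smul_sub_Dvd (Gam_le_M2Zplus (iota_mem s)) hy'
        constructor
        · intro h i j
          have := (h i j).add (h1 i j).neg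
          convert this using 1
          ring
        · intro h i j
          have := (h i j).add (h1 i j)
          convert this using 1
          ring
      unfold sepTerm
      simp only [e]
      split_ifs
      · have h1 := abs_max_sub_max_le_abs (ε - dist (s • y'.2) o.2) (ε - dist (s • y.2) o.2) 0
        rw [max_comm _ 0, max_comm _ 0] at h1
        refine h1.trans ?_
        rw [sub_sub_sub_cancel_left, abs_sub_comm]
        refine (abs_dist_sub_le _ _ _).trans ?_
        rw [dist_sl_smul]
      · rw [sub_self, abs_zero]; exact dist_nonneg
    unfold sepFun
    convert continuous_ite_Y (P := fun y => y ∈ Y) isClopen_Y this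
  ht := by
    refine ⟨Real.exp (logH o + ε), fun y h => Ht_exp_iff.2 ?_⟩
    have : ∃ s : SL(2, ℤ), dist (s • y.2) o.2 < ε := by
      by_contra h0
      push Not at h0
      refine h ?_
      unfold sepFun
      split_ifs
      · rw [iSup_congr fun s => sepTerm_eq_zero fun _ => h0 s, ciSup_const]
      · rfl
    obtain ⟨s, hs⟩ := this
    rw [← logH_smul (iota_mem s)]
    refine ciSup_le fun t => ?_
    have h1 := UpperHalfPlane.dist_log_im_le (t • (iota s • y).2) (t • o.2)
    rw [dist_sl_smul, iota_smul_snd, Real.dist_eq] at h1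
    have h2 := le_ciSup (bddAbove_log o) t
    have h3 := (abs_le.1 h1).2
    rw [iota_smul_snd]
    change _ ≤ logH o at h2
    linarith

lemma sepFun_self {o : AfH} (ho : o ∈ Y) (N : ℕ) {ε : ℝ} (hε : 0 < ε) : 0 < sepFun o N ε o := by
  unfold sepFun
  rw [if_pos ho]
  have := le_ciSup (bddAbove_sep o N hε.le o) 1
  refine lt_of_lt_of_le ?_ this
  unfold sepTerm
  rw [if_pos]
  · simpa using hε
  · intro i j
    rw [map_one, one_smul, sub_self]
    unfold Dvd
    rw [mul_zero]
    exact RSub.zero_mem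

lemma sepFun_nonneg (o : AfH) (N : ℕ) (ε : ℝ) (y : AfH) : 0 ≤ sepFun o N ε y := by
  unfold sepFun
  split_ifs
  · exact Real.iSup_nonneg fun s => sepTerm_nonneg o N ε s y
  · exact le_rfl

lemma sepFun_eq_zero {o : AfH} {N : ℕ} {ε : ℝ} {y : AfH}
    (h : ∀ s : SL(2, ℤ), (∀ i j, Dvd N ((iota s • y).1 i j - o.1 i j)) → ε ≤ dist (s • y.2) o.2) :
    sepFun o N ε y = 0 := by
  unfold sepFun
  split_ifs
  · rw [iSup_congr fun s => sepTerm_eq_zero (h s), ciSup_const]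
  · rfl

/-- Proper discontinuity of the action on ℍ. -/
lemma finite_sl_dist (z w : ℍ) : {s : SL(2, ℤ) | dist (s • z) w ≤ 1}.Finite := by
  have h := ProperlyDiscontinuousSMul.finite_disjoint_inter_image (Γ := 𝒮ℒ) (T := ℍ)
    (isCompact_singleton (x := z)) (ProperSpace.isCompact_closedBall w 1)
  have : Set.MapsTo (fun s : SL(2, ℤ) => (⟨_, s, rfl⟩ : 𝒮ℒ)) {s : SL(2, ℤ) | dist (s • z) w ≤ 1}
      {γ : 𝒮ℒ | ((γ • ·) '' {z} ∩ Metric.closedBall w 1).Nonempty} := by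
    intro s hs
    exact ⟨s • z, ⟨z, rfl, rfl⟩, hs⟩
  refine Set.Finite.of_injOn this ?_ h
  intro s _ t _ e
  exact Matrix.SpecialLinearGroup.mapGL_injective (congrArg Subtype.val e)

/-- If all integers divide an integral finite adele, it is zero. -/
lemma eq_zero_of_Dvd {a : Af} (h : ∀ N : ℕ, N ≠ 0 → Dvd N a) : a = 0 := by
  refine RestrictedProduct.ext _ _ fun v => ?_
  obtain ⟨p, hp, rfl⟩ := exists_eq_pv v
  change a (pv p hp) = 0
  by_contra h0
  have h1 : Valued.v (a (pv p hp)) ≠ 0 := (Valuation.ne_zero_iff _).2 h0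
  have h2 : ∀ n : ℕ, Valued.v (a (pv p hp)) ≤ WithZero.exp (-n : ℤ) := fun n => by
    have h3 := h (p ^ n) (pow_ne_zero _ hp.ne_zero) (pv p hp)
    rw [HeightOneSpectrum.mem_adicCompletionIntegers, Af_mul_apply, map_mul, valued_qA] at h3
    rw [map_inv₀, Nat.cast_pow, map_pow, valuation_pv_self] at h3
    have e : (WithZero.exp (-1 : ℤ)) ^ n = WithZero.exp (-n : ℤ) := by
      rw [← WithZero.exp_nsmul]; simp
    rw [e, ← WithZero.exp_neg, neg_neg] at h3
    calc Valued.v (a (pv p hp))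
        = WithZero.exp (-n : ℤ) * (WithZero.exp (n : ℤ) * Valued.v (a (pv p hp))) := by
          rw [← mul_assoc, ← WithZero.exp_add]; simp
      _ ≤ WithZero.exp (-n : ℤ) * 1 := by gcongr
      _ = _ := mul_one _
  have h3 := h2 ((WithZero.log (Valued.v (a (pv p hp)))).natAbs + 1)
  rw [← WithZero.exp_log h1, WithZero.exp_le_exp, WithZero.log_exp] at h3
  omega

/-- Only finitely many s bring τ_y within distance 1 of τ_o. Each of these either leaves a positive
distance ε or makes the τ-components agree, and then the ρ-components differ modulo some N. The
product of the N and the least ε, cut at 1, serve all s simultaneously. -/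
lemma exists_sep {o y : AfH} (ho : o ∈ Y) (h : ∀ γ ∈ Gam, γ • y ≠ o) :
    ∃ k : AfH → ℝ, IsInv k ∧ (∀ z, 0 ≤ k z) ∧ 0 < k o ∧ k y = 0 := by
  classical
  have hf := finite_sl_dist y.2 o.2
  have h1 : ∀ s : SL(2, ℤ), ∃ (N : ℕ) (ε : ℝ), N ≠ 0 ∧ 0 < ε ∧ ∀ (M : ℕ) (δ : ℝ), N ∣ M → M ≠ 0 →
      δ ≤ ε → (∀ i j, Dvd M ((iota s • y).1 i j - o.1 i j)) → δ ≤ dist (s • y.2) o.2 := by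
    intro s
    by_cases h2 : s • y.2 = o.2
    · have h3 : (iota s • y).1 ≠ o.1 := fun h3 =>
        h _ (iota_mem s) (Prod.ext h3 (by rw [iota_smul_snd]; exact h2))
      have h4 : ∃ i j, (iota s • y).1 i j - o.1 i j ≠ 0 := by
        by_contra h4
        push Not at h4
        exact h3 (by ext1 i j; exact sub_eq_zero.1 (h4 i j))
      obtain ⟨i, j, h4⟩ := h4
      have h5 : ∃ N : ℕ, N ≠ 0 ∧ ¬ Dvd N ((iota s • y).1 i j - o.1 i j) := by
        by_contra h5
        push Not at h5
        exact h4 (eq_zero_of_Dvd h5)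
      obtain ⟨N, hN, h5⟩ := h5
      refine ⟨N, 1, hN, one_pos, fun M δ hM hM0 hδ hd => absurd ?_ h5⟩
      obtain ⟨c, rfl⟩ := hM
      have := R_mul (R_int c) (hd i j)
      unfold Dvd
      convert this using 1
      rw [← mul_assoc, ← map_mul]
      congr 2
      have hc : (c : ℚ) ≠ 0 := by
        rintro hc
        simp_all
      have hN' : (N : ℚ) ≠ 0 := by exact_mod_cast hN
      push_cast
      field_simp
    · exact ⟨1, dist (s • y.2) o.2, one_ne_zero, dist_pos.2 h2, fun M δ _ _ hδ _ => hδ⟩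
  choose N ε hN hε h1 using h1
  let M := ∏ s ∈ hf.toFinset, N s
  obtain ⟨δ, hδ, hδ1, hδ2⟩ : ∃ δ : ℝ, 0 < δ ∧ δ ≤ 1 ∧ ∀ s ∈ hf.toFinset, δ ≤ ε s := by
    by_cases hne : hf.toFinset.Nonempty
    · refine ⟨min 1 (hf.toFinset.inf' hne ε), ?_, min_le_left _ _, fun s hs =>
        (min_le_right _ _).trans (Finset.inf'_le _ hs)⟩
      rw [lt_min_iff, Finset.lt_inf'_iff]
      exact ⟨one_pos, fun s _ => hε s⟩
    · rw [Finset.not_nonempty_iff_eq_empty] at hne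
      exact ⟨1, one_pos, le_rfl, fun s hs => absurd hs (by rw [hne]; exact Finset.notMem_empty s)⟩
  refine ⟨sepFun o M δ, isInv_sepFun o M hδ, sepFun_nonneg o M δ, sepFun_self ho M hδ,
    sepFun_eq_zero fun s hs => ?_⟩
  by_cases hm : s ∈ hf.toFinset
  · exact h1 s M δ (Finset.dvd_prod_of_mem _ hm) (Finset.prod_ne_zero_iff.2 fun s _ => hN s)
      (hδ2 s hm) hs
  · rw [Set.Finite.mem_toFinset] at hm
    exact hδ1.trans (not_le.1 hm).le

/-! ### Functions on a strip -/

lemma diffContOnCl_strip {β : ℝ} (hβ : 0 < β) {F : ℂ → ℂ}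
    (hc : ContinuousOn F {z : ℂ | 0 ≤ z.im ∧ z.im ≤ β})
    (hd : DifferentiableOn ℂ F {z : ℂ | 0 < z.im ∧ z.im < β}) :
    DiffContOnCl ℂ F (Complex.im ⁻¹' Set.Ioo 0 β) := by
  refine ⟨hd, ?_⟩
  rw [Complex.closure_preimage_im, closure_Ioo hβ.ne]
  exact hc

/-- A bounded holomorphic function on a strip is bounded by its values on the boundary. -/
lemma norm_le_of_strip {β : ℝ} (hβ : 0 < β) {F : ℂ → ℂ} {C M : ℝ}
    (hb : ∀ z : ℂ, 0 ≤ z.im → z.im ≤ β → ‖F z‖ ≤ C)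
    (hc : ContinuousOn F {z : ℂ | 0 ≤ z.im ∧ z.im ≤ β})
    (hd : DifferentiableOn ℂ F {z : ℂ | 0 < z.im ∧ z.im < β})
    (h0 : ∀ t : ℝ, ‖F t‖ ≤ M) (h1 : ∀ t : ℝ, ‖F (t + β * Complex.I)‖ ≤ M)
    {z : ℂ} (hz : 0 ≤ z.im) (hz' : z.im ≤ β) : ‖F z‖ ≤ M := by
  refine PhragmenLindelof.horizontal_strip (a := 0) (b := β) (diffContOnCl_strip hβ hc hd)
    ⟨0, by rw [sub_zero]; positivity, 0, ?_⟩ ?_ ?_ hz hz'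
  · refine Asymptotics.IsBigO.of_bound C ?_
    rw [Filter.eventually_inf_principal]
    refine .of_forall fun w hw => ?_
    simpa using hb w hw.1.le hw.2.le
  · intro w hw
    have : w = (w.re : ℂ) := Complex.ext rfl hw
    rw [this]
    exact h0 _
  · intro w hw
    have : w = (w.re : ℂ) + β * Complex.I := Complex.ext (by simp) (by simp [hw])
    rw [this]
    exact h1 _

/-- A bounded holomorphic function on a strip that vanishes on one side vanishes. -/
lemma eq_zero_of_strip {β : ℝ} (hβ : 0 < β) {F : ℂ → ℂ} {C : ℝ}
    (hb : ∀ z : ℂ, 0 ≤ z.im → z.im ≤ β → ‖F z‖ ≤ C)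
    (hc : ContinuousOn F {z : ℂ | 0 ≤ z.im ∧ z.im ≤ β})
    (hd : DifferentiableOn ℂ F {z : ℂ | 0 < z.im ∧ z.im < β})
    (h0 : ∀ t : ℝ, F t = 0) (t : ℝ) : F (t + β * Complex.I) = 0 := by
  have hC : 0 ≤ C := (norm_nonneg _).trans (hb 0 (by simp) (by simpa using hβ.le))
  have hint : ∀ z : ℂ, 0 < z.im → z.im < β → F z = 0 := by
    intro z hz hz'
    have e : ∀ w : ℂ, (w * Complex.I).im = w.re := fun w => by simp
    -- After a rotation the three lines theorem applies with bound 0 on one edge and C on the other;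
    -- the interpolated bound is 0 at every interior point.
    have h := Complex.HadamardThreeLines.norm_le_interp_of_mem_verticalClosedStrip'
      (f := fun w => F (w * Complex.I)) (z := z * -Complex.I) (a := 0) (b := C) (l := 0) (u := β)
      hβ ?_ ?_ ?_ ?_ ?_
    · have e2 : z * -Complex.I * Complex.I = z := by
        rw [mul_assoc, neg_mul, Complex.I_mul_I, neg_neg, mul_one]
      have e3 : (z * -Complex.I).re = z.im := by simp
      rw [e2, e3, Real.zero_rpow, zero_mul] at h
      · exact norm_le_zero_iff.1 h
      · rw [sub_zero, sub_zero]
        have : z.im / β < 1 := (div_lt_one hβ).2 hz'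
        linarith
    · change (z * -Complex.I).re ∈ Set.Icc 0 β
      simpa using And.intro hz.le hz'.le
    · refine ⟨?_, ?_⟩
      · refine hd.comp (by fun_prop) fun w hw => ?_
        change 0 < (w * Complex.I).im ∧ (w * Complex.I).im < β
        rw [e]
        exact hw
      · have : closure (Complex.HadamardThreeLines.verticalStrip 0 β) = Complex.re ⁻¹' Set.Icc 0 β := by
          rw [Complex.HadamardThreeLines.verticalStrip, Complex.closure_preimage_re,
            closure_Ioo hβ.ne]
        rw [this]
        refine hc.comp (by fun_prop) fun w hw => ?_
        change 0 ≤ (w * Complex.I).im ∧ (w * Complex.I).im ≤ β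
        rw [e]
        exact hw
    · refine ⟨C, ?_⟩
      rintro _ ⟨w, hw, rfl⟩
      exact hb _ (by rw [e]; exact hw.1) (by rw [e]; exact hw.2)
    · intro w hw
      have : w * Complex.I = ((-w.im : ℝ) : ℂ) := Complex.ext (by simp) (by
        rw [e]; simpa using hw)
      rw [this, h0, norm_zero]
    · intro w hw
      have hw' : w.re = β := hw
      exact hb _ (by rw [e, hw']; exact hβ.le) (by rw [e, hw'])
  -- The value on the far edge is the limit along the vertical segment, on which the function
  -- vanishes.
  have hl : Filter.Tendsto (fun s : ℝ => F (t + s * Complex.I)) (nhdsWithin β (Set.Ioo 0 β))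
      (nhds (F (t + β * Complex.I))) := by
    have h1 := hc (t + β * Complex.I) (by simp [hβ.le])
    refine h1.tendsto.comp (tendsto_nhdsWithin_iff.2 ⟨?_, ?_⟩)
    · have : Continuous fun s : ℝ => (t : ℂ) + s * Complex.I := by fun_prop
      exact (this.tendsto β).mono_left nhdsWithin_le_nhds
    · filter_upwards [self_mem_nhdsWithin] with s hs
      simpa using And.intro hs.1.le hs.2.le
  have hne : (nhdsWithin β (Set.Ioo 0 β)).NeBot := by
    rw [← mem_closure_iff_nhdsWithin_neBot, closure_Ioo hβ.ne]
    exact ⟨hβ.le, le_rfl⟩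
  refine tendsto_nhds_unique hl (tendsto_const_nhds.congr' ?_)
  filter_upwards [self_mem_nhdsWithin] with s hs
  exact (hint _ (by simpa using hs.1) (by simpa using hs.2)).symm

lemma norm_cpow_I_le {d β : ℝ} (hd : 0 < d) {z : ℂ} (hz : 0 ≤ z.im)
    (hz' : z.im ≤ β) : ‖(d : ℂ) ^ (z * Complex.I)‖ ≤ max 1 (d ^ (-β)) := by
  rw [Complex.norm_cpow_eq_rpow_re_of_pos hd]
  have : (z * Complex.I).re = -z.im := by simp
  rw [this]
  rcases le_total 1 d with h | h
  · refine le_max_of_le_left ?_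
    exact Real.rpow_le_one_of_one_le_of_nonpos h (by linarith)
  · refine le_max_of_le_right ?_
    exact Real.rpow_le_rpow_of_exponent_ge hd h (by linarith)

lemma cpow_add_beta {d : ℝ} (hd : 0 < d) (t β : ℝ) :
    (d : ℂ) ^ (((t : ℂ) + β * Complex.I) * Complex.I) = phase d t * ((d ^ (-β) : ℝ) : ℂ) := by
  have : ((t : ℂ) + β * Complex.I) * Complex.I = t * Complex.I + ((-β : ℝ) : ℂ) := by
    rw [add_mul, mul_assoc, Complex.I_mul_I]
    push_cast
    ring
  rw [this, Complex.cpow_add _ _ (by exact_mod_cast hd.ne'), phase, Complex.ofReal_cpow hd.le]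

lemma differentiable_cpow_I {d : ℝ} (hd : 0 < d) :
    Differentiable ℂ fun z : ℂ => (d : ℂ) ^ (z * Complex.I) := by
  intro z
  refine DifferentiableAt.const_cpow (by fun_prop) (Or.inl (by exact_mod_cast hd.ne'))

/-! ### The KMS condition on homogeneous elements -/

/-- The algebraic form of the KMS condition. -/
def Twisted (β : ℝ) (φ : A →L[ℂ] ℂ) : Prop :=
  ∀ (F : G → AfH → ℂ) (hF : IsKer F) (d : ℝ), 0 < d → (∀ g y, F g y ≠ 0 → detR g = d) →
    ∀ a : A, φ (kA F hF * a) = ((d ^ (-β) : ℝ) : ℂ) * φ (a * kA F hF)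

lemma sigma_kA {F : G → AfH → ℂ} (hF : IsKer F) {d : ℝ}
    (h : ∀ g y, F g y ≠ 0 → detR g = d) (t : ℝ) : sigma t (kA F hF) = phase d t • kA F hF := by
  unfold kA
  rw [sigma_toA, ← toA_smul]
  congr 1
  refine val_injective ?_
  funext g y
  rw [val_sigmaFun, val_smul, val_ofKer]
  by_cases h0 : F g y = 0
  · rw [h0, mul_zero, mul_zero]
  · rw [h g y h0]

/-- On the real line the function in the KMS condition equals d^{iz} φ(a F), which is entire and
bounded on the strip. The two then agree at iβ, where they take the values φ(F a) and d^{-β} φ(a F).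
-/
lemma IsKMS.twisted {β : ℝ} (hβ : 0 < β) {φ : A →L[ℂ] ℂ}
    (h : IsKMS (fun t (a : A) => sigma t a) β φ) : Twisted β φ := by
  intro F hF d hd hdet a
  obtain ⟨H, ⟨C, hC⟩, hc, hdiff, hH⟩ := h a (kA F hF)
  have e1 : ∀ t : ℝ, H t = phase d t * φ (a * kA F hF) := fun t => by
    rw [(hH t).1]
    dsimp only
    rw [sigma_kA hF hdet, mul_smul_comm, map_smul, smul_eq_mul]
  have e2 : H ((0 : ℝ) + β * Complex.I) = φ (kA F hF * a) := by
    rw [(hH 0).2]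
    dsimp only
    rw [sigma_kA hF hdet, phase_zero, one_smul]
  have key := eq_zero_of_strip hβ (F := fun z => H z - (d : ℂ) ^ (z * Complex.I) * φ (a * kA F hF))
    (C := C + max 1 (d ^ (-β)) * ‖φ (a * kA F hF)‖) ?_ ?_ ?_ ?_ 0
  · rw [e2, cpow_add_beta hd, phase_zero, one_mul] at key
    exact sub_eq_zero.1 key
  · intro z hz hz'
    refine (norm_sub_le _ _).trans (add_le_add (hC z hz hz') ?_)
    rw [norm_mul]
    gcongr
    exact norm_cpow_I_le hd hz hz'
  · exact hc.sub ((differentiable_cpow_I hd).continuous.mul continuous_const).continuousOn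
  · exact hdiff.sub ((differentiable_cpow_I hd).mul_const _).differentiableOn
  · intro t
    rw [e1]
    unfold phase
    rw [sub_self]

/-! ### Positive functionals -/

section Positive

variable {B : Type*} [NonUnitalCStarAlgebra B]

/-- Positivity of a functional. -/
def IsPos (φ : B →L[ℂ] ℂ) : Prop := ∀ a, 0 ≤ (φ (star a * a)).re ∧ (φ (star a * a)).im = 0

/-- Polarization: expand the vanishing imaginary parts at a + b and at a + ib. -/
lemma IsPos.conj {φ : B →L[ℂ] ℂ} (h : IsPos φ) (a b : B) :
    (starRingEnd ℂ) (φ (star b * a)) = φ (star a * b) := by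
  have h1 := (h (a + b)).2
  have h2 := (h (a + Complex.I • b)).2
  have ha := (h a).2
  have hb := (h b).2
  rw [star_add, add_mul, mul_add, mul_add, map_add, map_add, map_add] at h1
  rw [star_add, star_smul, add_mul, mul_add, mul_add, map_add, map_add, map_add, smul_mul_smul_comm,
    mul_smul_comm, smul_mul_assoc, map_smul, map_smul, map_smul] at h2
  simp only [Complex.add_im, smul_eq_mul, Complex.mul_im, Complex.star_def, Complex.conj_I,
    Complex.I_re, Complex.I_im, Complex.neg_im, neg_mul, Complex.I_mul_I, neg_neg,
    Complex.one_re, Complex.one_im, ha, hb] at h1 h2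
  refine Complex.ext ?_ ?_
  · rw [Complex.conj_re]
    linarith
  · rw [Complex.conj_im]
    linarith

/-- The semi-inner product given by a positive functional. -/
abbrev IsPos.core {φ : B →L[ℂ] ℂ} (h : IsPos φ) : PreInnerProductSpace.Core ℂ B where
  inner a b := φ (star a * b)
  conj_inner_symm a b := h.conj a b
  re_inner_nonneg a := (h a).1
  add_left a b c := by rw [star_add, add_mul, map_add]
  smul_left a b r := by
    rw [star_smul, smul_mul_assoc, map_smul]
    rfl

lemma IsPos.cauchy_schwarz {φ : B →L[ℂ] ℂ} (h : IsPos φ) (a b : B) :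
    ‖φ (star a * b)‖ ^ 2 ≤ (φ (star a * a)).re * (φ (star b * b)).re := by
  have h1 := @InnerProductSpace.Core.inner_mul_inner_self_le ℂ B _ _ _ h.core a b
  have h2 : ‖φ (star b * a)‖ = ‖φ (star a * b)‖ := by
    rw [← h.conj a b, RCLike.norm_conj]
  change ‖φ (star a * b)‖ * ‖φ (star b * a)‖ ≤ (φ (star a * a)).re * (φ (star b * b)).re at h1
  rwa [h2, ← sq] at h1

end Positive

/-! ### Freeness of the action -/

lemma coe_smul_mul (g : G) (y : AfH) : ((g • y).2 : ℂ) *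
    ((g.1.1 1 0 : ℝ) * (y.2 : ℂ) + (g.1.1 1 1 : ℝ)) =
    (g.1.1 0 0 : ℝ) * (y.2 : ℂ) + (g.1.1 0 1 : ℝ) := by
  have h : (Matrix.GeneralLinearGroup.map (algebraMap ℚ ℝ) g.1).det.val = detR g := by
    rw [Matrix.GeneralLinearGroup.val_det_apply]
    unfold detR
    have := RingHom.map_det (algebraMap ℚ ℝ) g.1.1
    rw [RingHom.mapMatrix_apply] at this
    exact this.symm
  rw [smul_snd, UpperHalfPlane.coe_smul_of_det_pos (by rw [h]; exact detR_pos g)]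
  exact div_mul_cancel₀ _ (UpperHalfPlane.denom_ne_zero _ _)

/-- From (g - 1)ρ = 0 with ρ ≠ 0 it follows that det(g - 1) = 0, so g has determinant 1 and trace 2.
Such a matrix fixes a point of ℍ only if it is the identity. -/
lemma eq_one_of_smul_eq {g : G} (hg : detR g = 1) {y : AfH} (hy : y.1 ≠ 0) (h : g • y = y) :
    g = 1 := by
  have hdet : g.1.1.det = 1 := by
    unfold detR at hg
    exact_mod_cast hg
  have h1 : (g.1.1.map qA - 1) * y.1 = 0 := by
    rw [sub_mul, one_mul, ← smul_fst, h, sub_self]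
  have h2 : (g.1.1 - 1).det = 0 := by
    -- A nonzero rational is invertible in 𝔸_f, so multiplying by the adjugate of g - 1 would give ρ
    -- = 0.
    by_contra hne
    refine hy ?_
    have e : (g.1.1.map qA - 1) = (g.1.1 - 1).map qA := by
      rw [Matrix.map_sub _ (map_sub qA), Matrix.map_one _ (map_zero _) (map_one _)]
    have e2 : ((g.1.1 - 1).map qA).adjugate * ((g.1.1.map qA - 1) * y.1) =
        qA (g.1.1 - 1).det • y.1 := by
      rw [e, ← Matrix.mul_assoc, Matrix.adjugate_mul, Matrix.smul_mul, Matrix.one_mul]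
      congr 1
      exact (RingHom.map_det qA _).symm
    rw [h1, Matrix.mul_zero] at e2
    ext1 i j
    have e3 : qA (g.1.1 - 1).det * y.1 i j = 0 := by
      have := congrFun (congrFun e2 i) j
      exact this.symm
    have := qA_inv_mul_cancel hne (y.1 i j)
    rw [e3, mul_zero] at this
    exact this.symm
  rw [Matrix.det_fin_two] at hdet h2
  simp only [Matrix.sub_apply, Matrix.one_apply_eq, ne_eq, zero_ne_one, not_false_eq_true,
    Matrix.one_apply_ne, one_ne_zero, sub_zero] at h2
  have h3 := coe_smul_mul g y
  rw [h] at h3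
  set a := g.1.1 0 0
  set b := g.1.1 0 1
  set c := g.1.1 1 0
  set d := g.1.1 1 1
  have hre := congrArg Complex.re h3
  have him := congrArg Complex.im h3
  simp only [Complex.mul_re, Complex.mul_im, Complex.add_re, Complex.add_im, Complex.ofReal_re,
    Complex.ofReal_im, zero_mul, sub_zero, add_zero, UpperHalfPlane.coe_re,
    UpperHalfPlane.coe_im] at hre him
  have hpos := y.2.im_pos
  set u := y.2.re
  set v := y.2.im
  have hd : d = 2 - a := by linarith
  have hbc : b * c = -(a - 1) ^ 2 := by rw [hd] at hdet; linarith
  have hbc' : (b : ℝ) * c = -((a : ℝ) - 1) ^ 2 := by exact_mod_cast hbc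
  have hd' : (d : ℝ) = 2 - a := by rw [hd]; push_cast; ring
  rw [hd'] at hre him
  have e1 : (c : ℝ) * u = a - 1 := by
    have : v * (2 * (c * u) - 2 * (a - 1)) = 0 := by linarith
    rcases mul_eq_zero.1 this with h | h
    · exact absurd h hpos.ne'
    · linarith
  have e2 : (c : ℝ) * v = 0 := by
    have : ((c : ℝ) * v) ^ 2 = 0 := by
      have : (c : ℝ) * b = c * (u * (c * u + (2 - a)) - v * (c * v)) - c * (a * u) := by
        linear_combination -(c : ℝ) * hre
      have e3 : ((c : ℝ) * u) ^ 2 = (a - 1) ^ 2 := by rw [e1]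
      nlinarith
    exact pow_eq_zero_iff (two_ne_zero) |>.1 this
  have hc : c = 0 := by
    rcases mul_eq_zero.1 e2 with h | h
    · exact_mod_cast h
    · exact absurd h hpos.ne'
  have ha : a = 1 := by
    have : (a : ℝ) = 1 := by rw [hc] at e1; push_cast at e1; linarith
    exact_mod_cast this
  have hb : b = 0 := by
    have : (b : ℝ) = 0 := by
      rw [hc, ha] at hre; push_cast at hre; linarith
    exact_mod_cast this
  have hd1 : d = 1 := by rw [hd, ha]; norm_num
  refine G_ext fun i j => ?_
  fin_cases i <;> fin_cases j
  · exact ha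
  · exact hb
  · exact hc
  · exact hd1

/-! ### The restriction of a KMS state to the diagonal -/

lemma IsKer.comp {F : G → AfH → ℂ} (hF : IsKer F) {φ : ℂ → ℂ} (hφ : Continuous φ)
    (h0 : φ 0 = 0) : IsKer fun g y => φ (F g y) where
  inv a ha b hb g y := congrArg φ (hF.inv a ha b hb g y)
  supp g y h := hF.supp g y fun h' => h (by rw [h', h0])
  cont g := hφ.comp (hF.cont g)
  fin := hF.fin.imp fun s hs => ⟨hs.1, fun g y h => hs.2 g y fun h' => h (by rw [h', h0])⟩
  ht := hF.ht.imp fun T hT g y h => hT g y fun h' => h (by rw [h', h0])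

lemma IsKer.ht_left {F : G → AfH → ℂ} (hF : IsKer F) : ∃ T, ∀ g y, F g y ≠ 0 → Ht T (g • y) := by
  obtain ⟨T, hT⟩ := hF.star.ht
  refine ⟨T, fun g y h => hT g⁻¹ (g • y) ?_⟩
  unfold starK
  rw [inv_inv, inv_smul_smul]
  exact (map_ne_zero _).2 h

lemma IsKer.exists_bump {F : G → AfH → ℂ} (hF : IsKer F) :
    ∃ n : ℕ, ∀ g y, F g y ≠ 0 → bump n y = 1 ∧ bump n (g • y) = 1 := by
  obtain ⟨T, hT⟩ := hF.ht
  obtain ⟨T', hT'⟩ := hF.ht_left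
  obtain ⟨n, hn⟩ := GL2System.exists_bump T
  obtain ⟨n', hn'⟩ := GL2System.exists_bump T'
  exact ⟨max n n', fun g y h => ⟨hn _ (le_max_left _ _) _ (hF.supp g y h).1 (hT g y h),
    hn' _ (le_max_right _ _) _ (hF.supp g y h).2 (hT' g y h)⟩⟩

/-- Multiplication by a diagonal element from the left. -/
lemma dg_mul_kA {k : AfH → ℂ} (hk : IsInv k) {F F' : G → AfH → ℂ} (hF : IsKer F) (hF' : IsKer F')
    (h : ∀ g y, F' g y = k (g • y) * F g y) : kA (dg k) hk.isKer * kA F hF = kA F' hF' := by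
  rw [kA_mul]
  refine kA_congr ?_
  rw [conv_dg_left hk hF]
  funext g y
  exact (h g y).symm

lemma kA_mul_dg {k : AfH → ℂ} (hk : IsInv k) {F F' : G → AfH → ℂ} (hF : IsKer F) (hF' : IsKer F')
    (h : ∀ g y, F' g y = F g y * k y) : kA F hF * kA (dg k) hk.isKer = kA F' hF' := by
  rw [kA_mul]
  refine kA_congr ?_
  rw [conv_dg_right hk hF]
  funext g y
  exact (h g y).symm

lemma Twisted.dg_comm {β : ℝ} {φ : A →L[ℂ] ℂ} (h : Twisted β φ) {k : AfH → ℂ} (hk : IsInv k)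
    (a : A) : φ (kA (dg k) hk.isKer * a) = φ (a * kA (dg k) hk.isKer) := by
  rw [h _ hk.isKer 1 one_pos (fun g y hg => detR_Gam (dg_ne hg).1), Real.one_rpow]
  simp

/-- A bump is a local unit on both sides of the kernel; the twisted identity with it reads φ(F) =
d^{-β} φ(F), and d^{-β} ≠ 1. -/
lemma Twisted.eq_zero_of_det_ne {β : ℝ} (hβ : 0 < β) {φ : A →L[ℂ] ℂ} (h : Twisted β φ)
    {F : G → AfH → ℂ} (hF : IsKer F) {d : ℝ} (hd : 0 < d) (hd1 : d ≠ 1)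
    (hdet : ∀ g y, F g y ≠ 0 → detR g = d) : φ (kA F hF) = 0 := by
  obtain ⟨n, hn⟩ := hF.exists_bump
  have hk := (isInv_bump n).ofReal
  have h1 : kA (dg fun y => (bump n y : ℂ)) hk.isKer * kA F hF = kA F hF := by
    refine dg_mul_kA hk hF hF fun g y => ?_
    by_cases h0 : F g y = 0
    · rw [h0, mul_zero]
    · rw [(hn g y h0).2, Complex.ofReal_one, one_mul]
  have h2 : kA F hF * kA (dg fun y => (bump n y : ℂ)) hk.isKer = kA F hF := by
    refine kA_mul_dg hk hF hF fun g y => ?_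
    by_cases h0 : F g y = 0
    · rw [h0, zero_mul]
    · rw [(hn g y h0).1, Complex.ofReal_one, mul_one]
  have h3 := h F hF d hd hdet (kA (dg fun y => (bump n y : ℂ)) hk.isKer)
  rw [h1, h2] at h3
  by_contra h0
  have h4 : ((d ^ (-β) : ℝ) : ℂ) = 1 := by
    refine mul_right_cancel₀ h0 ?_
    rw [one_mul]
    exact h3.symm
  have h5 : d ^ (-β) = 1 := by exact_mod_cast h4
  have h6 := congrArg Real.log h5
  rw [Real.log_rpow hd, Real.log_one] at h6
  rcases mul_eq_zero.1 h6 with h7 | h7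
  · linarith
  · exact hd1 (Real.eq_one_of_pos_of_log_eq_zero hd h7)

/-! ### The weight of the points divisible by powers of two. -/

/-- The scalar matrix `2 ^ n`. -/
def twoPow (n : ℕ) : G := scal (2 ^ n) (by positivity)

lemma twoPow_mem (n : ℕ) : twoPow n ∈ M2Zplus := by
  refine ⟨2 ^ n • 1, fun i j => ?_⟩
  unfold twoPow
  rw [scal_apply, Matrix.smul_apply]
  fin_cases i <;> fin_cases j <;> simp

lemma twoPow_comm (n : ℕ) (g : G) : twoPow n * g = g * twoPow n := scal_comm _ _ _

lemma twoPow_inv_comm (n : ℕ) (g : G) : (twoPow n)⁻¹ * g = g * (twoPow n)⁻¹ := by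
  rw [inv_mul_eq_iff_eq_mul, ← mul_assoc, twoPow_comm, mul_inv_cancel_right]

lemma detR_twoPow (n : ℕ) : detR (twoPow n) = 4 ^ n := by
  unfold twoPow
  rw [detR_scal]
  push_cast
  rw [← pow_mul, mul_comm, pow_mul]
  norm_num

lemma twoPow_inv_smul_snd (n : ℕ) (y : AfH) : ((twoPow n)⁻¹ • y).2 = y.2 := by
  have := scal_smul_snd (2 ^ n) (by positivity) ((twoPow n)⁻¹ • y)
  rw [← this]
  change (twoPow n • (twoPow n)⁻¹ • y).2 = _
  rw [smul_inv_smul]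

/-- The characteristic function of `2 ^ n Y`, cut off by a bump. -/
def twoBump (m n : ℕ) (y : AfH) : ℝ := bump m ((twoPow n)⁻¹ • y)

lemma mem_Y_of_twoPow {n : ℕ} {y : AfH} (h : (twoPow n)⁻¹ • y ∈ Y) : y ∈ Y := by
  have := M2Zplus_smul_mem (twoPow_mem n) h
  rwa [smul_inv_smul] at this

lemma isInv_twoBump (m n : ℕ) : IsInv (twoBump m n) where
  inv a ha y := by
    unfold twoBump
    rw [smul_smul, twoPow_inv_comm, mul_smul, (isInv_bump m).inv a ha]
  supp y h := mem_Y_of_twoPow ((isInv_bump m).supp _ h)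
  cont := (isInv_bump m).cont.comp (continuous_const_smul _)
  ht := (isInv_bump m).ht.imp fun T hT y h => Ht_congr (twoPow_inv_smul_snd n y) (hT _ h)

/-- The kernel supported on the coset of `2 ^ n`. -/
def twoK (m n : ℕ) (g : G) (y : AfH) : ℂ := dg (fun y => (bump m y : ℂ)) ((twoPow n)⁻¹ * g) y

lemma twoK_ne {m n : ℕ} {g : G} {y : AfH} (h : twoK m n g y ≠ 0) :
    (twoPow n)⁻¹ * g ∈ Gam ∧ (bump m y : ℂ) ≠ 0 := dg_ne h

lemma isKer_twoK (m n : ℕ) : IsKer (twoK m n) where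
  inv a ha b hb g y := by
    unfold twoK
    rw [← mul_assoc, ← mul_assoc, twoPow_inv_comm, mul_assoc a]
    exact (isInv_bump m).ofReal.isKer.inv a ha b hb _ y
  supp g y h := by
    obtain ⟨h1, h2⟩ := (isInv_bump m).ofReal.isKer.supp _ _ h
    refine ⟨h1, ?_⟩
    have := M2Zplus_smul_mem (twoPow_mem n) h2
    rwa [mul_smul, smul_inv_smul] at this
  cont g := (isInv_bump m).ofReal.isKer.cont _
  fin := by
    refine ⟨{rc (twoPow n)}, Set.finite_singleton _, fun g y h => ?_⟩
    refine rc_eq_rc_iff.2 ?_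
    have := inv_mem (twoK_ne h).1
    rwa [mul_inv_rev, inv_inv, ← twoPow_comm] at this
  ht := (isInv_bump m).ofReal.isKer.ht.imp fun T hT g y h => hT _ y h

/-- With v the kernel `twoK`, a cut-off partial isometry implementing the scalar 2^n, the range side
v v* is the square of `twoBump`, a function living on 2^n Y. -/
lemma twoK_mul_star (m n : ℕ) :
    kA (twoK m n) (isKer_twoK m n) * star (kA (twoK m n) (isKer_twoK m n)) =
      kA (dg fun y => (twoBump m n y : ℂ)) (isInv_twoBump m n).ofReal.isKer *
      star (kA (dg fun y => (twoBump m n y : ℂ)) (isInv_twoBump m n).ofReal.isKer) := by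
  have hI := (isInv_twoBump m n).ofReal
  rw [kA_star, kA_star, kA_mul, kA_mul]
  refine kA_congr ?_
  rw [conv_dg_left hI hI.isKer.star, starK_dg hI]
  funext g y
  unfold conv
  rw [lsum_eq_single (conv_leftInv (isKer_twoK m n) (isKer_twoK m n).star g y) (twoPow n)⁻¹]
  · unfold starK twoK twoBump
    rw [inv_inv, ← twoPow_comm, inv_mul_cancel_left, inv_mul_cancel, dg_of_mem (one_mem _),
      smul_smul]
    by_cases hg : g ∈ Gam
    · rw [dg_of_mem hg, dg_of_mem hg, twoPow_inv_comm, mul_smul, (isInv_bump m).inv g hg]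
    · rw [dg_of_notMem hg, dg_of_notMem hg, zero_mul, mul_zero]
  · intro x hx
    have h1 := (twoK_ne ((map_ne_zero _).1 (right_ne_zero_of_mul hx))).1
    rw [twoPow_inv_comm] at h1
    refine rc_eq_rc_iff.2 ?_
    rwa [twoPow_inv_comm]

/-- The source side v* v is the square of a bump, of norm at most 1 for every n. Together with
`twoK_mul_star` it is used to bound the weight of 2^n Y. -/
lemma star_mul_twoK (m n : ℕ) :
    star (kA (twoK m n) (isKer_twoK m n)) * kA (twoK m n) (isKer_twoK m n) =
      kA (dg fun y => (bump m y : ℂ) * (bump m y : ℂ))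
        ((isInv_bump m).ofReal.mul (isInv_bump m).ofReal).isKer := by
  rw [kA_star, kA_mul]
  refine kA_congr ?_
  funext g y
  unfold conv
  rw [lsum_eq_single (conv_leftInv (isKer_twoK m n).star (isKer_twoK m n) g y) (twoPow n)]
  · unfold starK twoK
    rw [smul_smul, inv_mul_cancel_right, mul_inv_rev, inv_inv, inv_mul_cancel_left, inv_mul_cancel,
      dg_of_mem (one_mem _)]
    by_cases hg : g ∈ Gam
    · rw [dg_of_mem hg, dg_of_mem (inv_mem hg), (isInv_bump m).inv g hg, Complex.conj_ofReal]
    · rw [dg_of_notMem hg, dg_of_notMem (fun h => hg (by simpa using inv_mem h)), map_zero,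
        zero_mul]
  · intro x hx
    have h1 := inv_mem (twoK_ne (right_ne_zero_of_mul hx)).1
    rw [mul_inv_rev, inv_inv, ← twoPow_comm] at h1
    exact rc_eq_rc_iff.2 h1

lemma detR_twoK {m n : ℕ} {g : G} {y : AfH} (h : twoK m n g y ≠ 0) : detR g = 4 ^ n := by
  have h1 := detR_Gam (twoK_ne h).1
  rw [detR_mul, detR_inv, detR_twoPow, inv_mul_eq_one₀ (by positivity)] at h1
  exact h1.symm

/-- The kernel v has determinant 4^n, so φ(v v*) = 4^{-nβ} φ(v* v). -/
lemma tendsto_twoBump {β : ℝ} (hβ : 0 < β) {φ : A →L[ℂ] ℂ} (h : Twisted β φ) (m : ℕ) :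
    Filter.Tendsto (fun n : ℕ =>
      (φ (kA (dg fun y => (twoBump m n y : ℂ)) (isInv_twoBump m n).ofReal.isKer *
      star (kA (dg fun y => (twoBump m n y : ℂ)) (isInv_twoBump m n).ofReal.isKer))).re)
      Filter.atTop (nhds 0) := by
  have key : ∀ n : ℕ, ‖φ (kA (dg fun y => (twoBump m n y : ℂ)) (isInv_twoBump m n).ofReal.isKer *
      star (kA (dg fun y => (twoBump m n y : ℂ)) (isInv_twoBump m n).ofReal.isKer))‖ ≤
      ((4 : ℝ) ^ (-β)) ^ n * ‖φ‖ := by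
    intro n
    rw [← twoK_mul_star, h _ _ (4 ^ n) (by positivity) (fun g y => detR_twoK), star_mul_twoK,
      norm_mul, Complex.norm_real, Real.norm_of_nonneg (by positivity)]
    have e : ((4 : ℝ) ^ n) ^ (-β) = ((4 : ℝ) ^ (-β)) ^ n := by
      rw [← Real.rpow_natCast, ← Real.rpow_natCast, ← Real.rpow_mul (by norm_num),
        ← Real.rpow_mul (by norm_num), mul_comm]
    rw [e]
    gcongr
    refine (φ.le_opNorm _).trans ?_
    refine mul_le_of_le_one_right (norm_nonneg _) (norm_kA_dg_le
      ((isInv_bump m).ofReal.mul (isInv_bump m).ofReal) (fun y => ?_) zero_le_one)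
    rw [norm_mul, Complex.norm_real, Real.norm_of_nonneg (bump_nonneg _ _)]
    exact mul_le_one₀ (bump_le_one _ _) (bump_nonneg _ _) (bump_le_one _ _)
  refine squeeze_zero_norm (fun n => (Complex.abs_re_le_norm _).trans (key n)) ?_
  have h4 : (4 : ℝ) ^ (-β) < 1 := Real.rpow_lt_one_of_one_lt_of_neg (by norm_num) (by linarith)
  have := (tendsto_pow_atTop_nhds_zero_of_lt_one (by positivity) h4).mul_const ‖φ‖
  rwa [zero_mul] at this

lemma detR_conj {a b g : G} (ha : a ∈ Gam) (hb : b ∈ Gam) : detR (a * g * b⁻¹) = detR g := by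
  rw [detR_mul, detR_mul, detR_inv, detR_Gam ha, detR_Gam hb]
  norm_num

/-! ### Kernels of determinant one outside Γ are sums of commutators. -/

/-- A sum of squares measuring how much `g` moves the orbit of `y`. -/
def moveSq (t : Finset {k : AfH → ℝ // IsInv k}) (g : G) (y : AfH) : ℝ :=
  ∑ k ∈ t, (k.1 (g • y) - k.1 y) ^ 2

lemma moveSq_inv (t : Finset {k : AfH → ℝ // IsInv k}) {a b : G} (ha : a ∈ Gam) (hb : b ∈ Gam)
    (g : G) (y : AfH) : moveSq t (a * g * b⁻¹) (b • y) = moveSq t g y := by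
  refine Finset.sum_congr rfl fun k _ => ?_
  rw [smul_smul, inv_mul_cancel_right, mul_smul, k.2.inv a ha, k.2.inv b hb]

lemma continuous_moveSq (t : Finset {k : AfH → ℝ // IsInv k}) (g : G) :
    Continuous (moveSq t g) := by
  refine continuous_finsetSum _ fun k _ => ?_
  exact ((k.2.cont.comp (continuous_const_smul g)).sub k.2.cont).pow 2

/-- Points of a fundamental domain not divisible by `2 ^ n`. -/
def freeSet (T : ℝ) (n : ℕ) (g : G) : Set AfH :=
  KT T ∩ ({y | y ∈ Y ∧ g • y ∈ Y} ∩ {y | (twoPow n)⁻¹ • y ∈ Y}ᶜ)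

lemma isClopen_twoPow (n : ℕ) : IsClopen {y : AfH | (twoPow n)⁻¹ • y ∈ Y} :=
  isClopen_Y.preimage (continuous_const_smul (twoPow n)⁻¹)

lemma isCompact_freeSet (T : ℝ) (n : ℕ) (g : G) : IsCompact (freeSet T n g) :=
  (isCompact_KT T).inter_right ((isClopen_dom g).isClosed.inter
    (isClopen_twoPow n).isOpen.isClosed_compl)

/-- Not being divisible by 2^n gives ρ ≠ 0, so by freeness g y is not in the Γ-orbit of y and the
two orbits can be separated. -/
lemma exists_move {T : ℝ} {n : ℕ} {g : G} (hx : detR g = 1) (hx' : g ∉ Gam) {y : AfH}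
    (hy : y ∈ freeSet T n g) : ∃ k : AfH → ℝ, IsInv k ∧ k (g • y) ≠ k y := by
  have hfree : ∀ γ ∈ Gam, γ • g • y ≠ y := by
    intro γ hγ e
    rw [smul_smul] at e
    have hy0 : y.1 ≠ 0 := by
      intro h0
      refine hy.2.2 fun i j => ?_
      rw [smul_fst, h0, Matrix.mul_zero]
      exact RSub.zero_mem
    have := eq_one_of_smul_eq (by rw [detR_mul, detR_Gam hγ, hx, one_mul]) hy0 e
    exact hx' ((Subgroup.mul_mem_cancel_left _ hγ).1 (this ▸ one_mem _))
  obtain ⟨k, hk, -, h1, h2⟩ := exists_sep hy.2.1.1 hfree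
  exact ⟨k, hk, by rw [h2]; exact h1.ne⟩

/-- Compactness of `freeSet`. The conditions on g stand inside the existential so that a choice can
be made for all cosets at once. -/
lemma exists_move_finset (T : ℝ) (n : ℕ) (g : G) : ∃ t : Finset {k : AfH → ℝ // IsInv k},
    detR g = 1 → g ∉ Gam → ∀ y ∈ freeSet T n g, ∃ k ∈ t, k.1 (g • y) ≠ k.1 y := by
  by_cases hx : detR g = 1 ∧ g ∉ Gam
  · obtain ⟨t, ht⟩ := (isCompact_freeSet T n g).elim_finite_subcover
      (fun k : {k : AfH → ℝ // IsInv k} => {y | k.1 (g • y) ≠ k.1 y})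
      (fun k => isOpen_ne_fun (k.2.cont.comp (continuous_const_smul g)) k.2.cont)
      (fun y hy => by
        obtain ⟨k, hk, hk'⟩ := exists_move hx.1 hx.2 hy
        exact Set.mem_iUnion.2 ⟨⟨k, hk⟩, hk'⟩)
    refine ⟨t, fun _ _ y hy => ?_⟩
    obtain ⟨k, hk, hk'⟩ := Set.mem_iUnion₂.1 (ht hy)
    exact ⟨k, hk, hk'⟩
  · exact ⟨∅, fun h1 h2 => absurd ⟨h1, h2⟩ hx⟩

lemma exists_moveSq_ge {T : ℝ} {n : ℕ} {g : G} {t : Finset {k : AfH → ℝ // IsInv k}}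
    (ht : ∀ y ∈ freeSet T n g, ∃ k ∈ t, k.1 (g • y) ≠ k.1 y) :
    ∃ δ : ℝ, 0 < δ ∧ ∀ y ∈ freeSet T n g, δ ≤ moveSq t g y := by
  by_cases hne : (freeSet T n g).Nonempty
  · obtain ⟨y, hy, hmin⟩ := (isCompact_freeSet T n g).exists_isMinOn hne
      (continuous_moveSq t g).continuousOn
    refine ⟨moveSq t g y, ?_, fun z hz => hmin hz⟩
    obtain ⟨k, hk, hk'⟩ := ht y hy
    refine Finset.sum_pos' (fun _ _ => sq_nonneg _) ⟨k, hk, ?_⟩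
    have := sub_ne_zero.2 hk'
    positivity
  · exact ⟨1, one_pos, fun y hy => absurd ⟨y, hy⟩ hne⟩

lemma exists_pos_le {ι : Type*} (S : Finset ι) {δ : ι → ℝ} (h : ∀ i, 0 < δ i) :
    ∃ ε : ℝ, 0 < ε ∧ ∀ i ∈ S, ε ≤ δ i := by
  by_cases hne : S.Nonempty
  · refine ⟨S.inf' hne δ, ?_, fun x hx => Finset.inf'_le _ hx⟩
    rw [Finset.lt_inf'_iff]
    exact fun x _ => h x
  · rw [Finset.not_nonempty_iff_eq_empty] at hne
    exact ⟨1, one_pos, fun x hx => absurd hx (by rw [hne]; exact Finset.notMem_empty x)⟩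

lemma twoPow_inv_smul_smul (n : ℕ) (b : G) (y : AfH) :
    (twoPow n)⁻¹ • b • y = b • (twoPow n)⁻¹ • y := by
  rw [smul_smul, twoPow_inv_comm, mul_smul]

lemma twoPow_inv_smul_mem_iff (n : ℕ) {b : G} (hb : b ∈ Gam) (y : AfH) :
    (twoPow n)⁻¹ • b • y ∈ Y ↔ (twoPow n)⁻¹ • y ∈ Y := by
  rw [twoPow_inv_smul_smul, Gam_smul_mem_iff hb]

lemma mem_freeSet {T : ℝ} {n : ℕ} {g : G} {y : AfH} (hK : y ∈ KT T) (hy : y ∈ Y)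
    (hgy : g • y ∈ Y) (h : (twoPow n)⁻¹ • y ∉ Y) : y ∈ freeSet T n g :=
  ⟨hK, ⟨hy, hgy⟩, h⟩

lemma smul_mem_freeSet {T : ℝ} {n : ℕ} {a b g : G} (ha : a ∈ Gam) (hb : b ∈ Gam) {y : AfH}
    (hK : b • y ∈ KT T) (hy : y ∈ Y) (hgy : g • y ∈ Y) (h : (twoPow n)⁻¹ • y ∉ Y) :
    b • y ∈ freeSet T n (a * g * b⁻¹) := by
  refine mem_freeSet hK (Gam_smul_mem hb hy) ?_ fun h' =>
    h ((twoPow_inv_smul_mem_iff n hb y).1 h')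
  rw [smul_smul, inv_mul_cancel_right, mul_smul]
  exact Gam_smul_mem ha hgy

lemma exists_moveSq_of_finite (T : ℝ) (n : ℕ) {s : Set RC} (hs : s.Finite) :
    ∃ t, ∃ ε : ℝ, 0 < ε ∧ ∀ x ∈ s, detR x.out = 1 → x.out ∉ Gam →
      ∀ y ∈ freeSet T n x.out, ε ≤ moveSq t x.out y := by
  classical
  choose t ht using fun x : RC => exists_move_finset T n x.out
  have hδ : ∀ x : RC, ∃ δ : ℝ, 0 < δ ∧ (x ∈ s → detR x.out = 1 → x.out ∉ Gam →
      ∀ y ∈ freeSet T n x.out, δ ≤ moveSq (hs.toFinset.biUnion t) x.out y) := by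
    intro x
    by_cases hx : x ∈ s ∧ detR x.out = 1 ∧ x.out ∉ Gam
    · obtain ⟨δ, hδ, h⟩ := exists_moveSq_ge (T := T) (n := n) (g := x.out)
          (t := hs.toFinset.biUnion t) fun y hy => by
        obtain ⟨k, hk, hk'⟩ := ht x hx.2.1 hx.2.2 y hy
        exact ⟨k, Finset.mem_biUnion.2 ⟨x, hs.mem_toFinset.2 hx.1, hk⟩, hk'⟩
      exact ⟨δ, hδ, fun _ _ _ => h⟩
    · exact ⟨1, one_pos, fun h1 h2 h3 => absurd ⟨h1, h2, h3⟩ hx⟩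
  choose δ hδ0 hδ using hδ
  obtain ⟨ε, hε, hεδ⟩ := exists_pos_le hs.toFinset hδ0
  exact ⟨_, ε, hε, fun x hx h1 h2 y hy =>
    (hεδ x (hs.mem_toFinset.2 hx)).trans (hδ x hx h1 h2 y hy)⟩

/-- Modulo Γ × Γ the support lies over finitely many group elements and over compact sets `freeSet`,
where `moveSq` has a positive lower bound; bi-invariance of `moveSq` carries the bound to the whole
support. -/
lemma IsKer.exists_moveSq {F : G → AfH → ℂ} (hF : IsKer F) (n : ℕ) (hdet : ∀ g y, F g y ≠ 0 →
    detR g = 1 ∧ g ∉ Gam ∧ (twoPow n)⁻¹ • y ∉ Y) :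
    ∃ t, ∃ ε : ℝ, 0 < ε ∧ ∀ g y, F g y ≠ 0 → ε ≤ moveSq t g y := by
  obtain ⟨s, hs, hsF⟩ := hF.fin
  obtain ⟨T, hT⟩ := hF.ht
  obtain ⟨t, ε, hε, h⟩ := exists_moveSq_of_finite T n (finite_rc_mul hs)
  refine ⟨t, ε, hε, fun g y hgy => ?_⟩
  obtain ⟨h1, h2, h3⟩ := hdet g y hgy
  obtain ⟨hy, hgy'⟩ := hF.supp g y hgy
  obtain ⟨b, hb, hbK⟩ := exists_smul_mem_KT hy (hT g y hgy)
  obtain ⟨a, ha, e⟩ := exists_out (g * b⁻¹)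
  obtain ⟨c, hc, ec⟩ := exists_out g
  have e' : (rc (g * b⁻¹)).out = a * g * b⁻¹ := by rw [e, mul_assoc]
  have hx : ∃ y ∈ s, ∃ γ ∈ Gam, rc (g * b⁻¹) = rc (y.out * γ) := by
    refine ⟨rc g, hsF g y hgy, b⁻¹, inv_mem hb, ?_⟩
    rw [ec, mul_assoc, rc_gam_mul hc]
  have h4 := h (rc (g * b⁻¹)) hx
  rw [e'] at h4
  rw [← moveSq_inv t ha hb]
  refine h4 ?_ ?_ _ (smul_mem_freeSet ha hb hbK hy hgy' h3)
  · rw [detR_conj ha hb, h1]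
  · rwa [mul_mul_inv_mem_iff ha hb]

/-- A KMS functional vanishes on kernels whose support consists of elements of determinant `1`
outside `Γ`, acting on points `y` that are not divisible by `2 ^ n`. -/
lemma Twisted.eq_zero_of_free {β : ℝ} {φ : A →L[ℂ] ℂ} (h : Twisted β φ)
    {F : G → AfH → ℂ} (hF : IsKer F) (n : ℕ) (hdet : ∀ g y, F g y ≠ 0 →
      detR g = 1 ∧ g ∉ Gam ∧ (twoPow n)⁻¹ • y ∉ Y) : φ (kA F hF) = 0 := by
  obtain ⟨t', ε, hε, hD⟩ := hF.exists_moveSq n hdet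
  -- On the support of F the sum over k of (k(g y) - k(y)) w_k is 1, so F is the sum of the
  -- commutators of k with w_k F. The maximum with ε keeps the denominator away from zero off the
  -- support.
  let w : {k : AfH → ℝ // IsInv k} → G → AfH → ℂ := fun k g y =>
    (((k.1 (g • y) - k.1 y) / max (moveSq t' g y) ε : ℝ) : ℂ)
  have hu : ∀ k, IsKer fun g y => w k g y * F g y := fun k => by
    refine hF.mul_fun (fun a ha b hb g y => ?_) fun g => ?_
    · dsimp only [w]
      rw [moveSq_inv t' ha hb, smul_smul, inv_mul_cancel_right, mul_smul, k.2.inv a ha, k.2.inv b hb]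
    · refine Complex.continuous_ofReal.comp (Continuous.div ?_ ((continuous_moveSq t' g).max continuous_const) ?_)
      · exact (k.2.cont.comp (continuous_const_smul g)).sub k.2.cont
      · exact fun y => (lt_max_of_lt_right hε).ne'
  have hkl : ∀ k : {k : AfH → ℝ // IsInv k},
      IsKer fun g y => (k.1 (g • y) : ℂ) * (w k g y * F g y) := fun k => by
    have := k.2.ofReal.isKer.conv (hu k)
    rwa [conv_dg_left k.2.ofReal (hu k)] at this
  have hkr : ∀ k : {k : AfH → ℝ // IsInv k},
      IsKer fun g y => w k g y * F g y * (k.1 y : ℂ) := fun k => by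
    have := (hu k).conv k.2.ofReal.isKer
    rwa [conv_dg_right k.2.ofReal (hu k)] at this
  have hcomm : ∀ k, φ (kA _ (hkl k)) = φ (kA _ (hkr k)) := fun k => by
    rw [← dg_mul_kA k.2.ofReal (hu k) (hkl k) (fun g y => rfl),
      ← kA_mul_dg k.2.ofReal (hu k) (hkr k) (fun g y => rfl)]
    exact h.dg_comm k.2.ofReal _
  have hsum : kA F hF + ∑ k ∈ t', kA _ (hkr k) = ∑ k ∈ t', kA _ (hkl k) := by
    rw [← kA_sum hkr (IsKer.sum fun k _ => hkr k), ← kA_sum hkl (IsKer.sum fun k _ => hkl k),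
      ← kA_add]
    refine kA_congr ?_
    funext g y
    rw [← eq_sub_iff_add_eq, ← Finset.sum_sub_distrib]
    by_cases h0 : F g y = 0
    · simp [h0]
    · have h1 : max (moveSq t' g y) ε = moveSq t' g y := max_eq_left (hD g y h0)
      have h2 : moveSq t' g y ≠ 0 := (hε.trans_le (hD g y h0)).ne'
      have h3 : ∀ k : {k : AfH → ℝ // IsInv k},
          (k.1 (g • y) : ℂ) * (w k g y * F g y) - w k g y * F g y * (k.1 y : ℂ) =
          ((k.1 (g • y) - k.1 y) ^ 2 : ℝ) * (F g y / (moveSq t' g y : ℂ)) := fun k => by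
        dsimp only [w]
        rw [h1]
        push_cast
        ring
      rw [Finset.sum_congr rfl fun k _ => h3 k, ← Finset.sum_mul, ← Complex.ofReal_sum]
      change _ = (moveSq t' g y : ℂ) * _
      rw [mul_div_cancel₀]
      exact_mod_cast h2
  have h4 := congrArg φ hsum
  rw [map_add, map_sum, map_sum, Finset.sum_congr rfl fun k _ => hcomm k] at h4
  exact add_eq_right.1 h4

open Classical in
lemma IsKer.offTwo {F : G → AfH → ℂ} (hF : IsKer F) (n : ℕ) :
    IsKer fun g y => (if (twoPow n)⁻¹ • y ∈ Y then 0 else 1 : ℂ) * F g y := by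
  refine hF.mul_fun (w := fun g y => (if (twoPow n)⁻¹ • y ∈ Y then 0 else 1 : ℂ))
    (fun a ha b hb g y => ?_) fun g => ?_
  · by_cases h : (twoPow n)⁻¹ • y ∈ Y
    · rw [if_pos h, if_pos ((twoPow_inv_smul_mem_iff n hb y).2 h)]
    · rw [if_neg h, if_neg fun h' => h ((twoPow_inv_smul_mem_iff n hb y).1 h')]
  · refine continuous_if (fun y hy => ?_) continuousOn_const continuousOn_const
    rw [(isClopen_twoPow n).frontier_eq] at hy
    exact absurd hy (Set.notMem_empty _)

/-- For each n only the part of F over 2^n Y can contribute, and by Cauchy–Schwarz it is bounded by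
the weight of 2^n Y, which tends to 0. -/
lemma Twisted.eq_zero_of_notMem {β : ℝ} (hβ : 0 < β) {φ : A →L[ℂ] ℂ} (h : Twisted β φ)
    (hpos : IsPos φ) {F : G → AfH → ℂ} (hF : IsKer F)
    (hdet : ∀ g y, F g y ≠ 0 → detR g = 1 ∧ g ∉ Gam) : φ (kA F hF) = 0 := by
  obtain ⟨m, hm⟩ := hF.exists_bump
  have hsplit : ∀ n : ℕ, φ (kA F hF) = φ (kA F hF *
      kA (dg fun y => (twoBump m n y : ℂ)) (isInv_twoBump m n).ofReal.isKer) := by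
    intro n
    have hI := (isInv_twoBump m n).ofReal
    have h1 := hF.offTwo n
    have h2 := hF.conv hI.isKer
    rw [conv_dg_right hI hF] at h2
    rw [kA_mul_dg hI hF h2 fun g y => rfl]
    have h3 : kA F hF = kA _ h1 + kA _ h2 := by
      rw [← kA_add]
      refine kA_congr ?_
      funext g y
      by_cases h0 : F g y = 0
      · simp [h0]
      · by_cases hy : (twoPow n)⁻¹ • y ∈ Y
        -- Scalars do not move τ, so on 2^n Y the function `twoBump` has the same value as the bump
        -- that equals 1 on the support of F.
        · have : twoBump m n y = 1 := by
            unfold twoBump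
            rw [bump_congr m hy (hF.supp g y h0).1 (twoPow_inv_smul_snd n y), (hm g y h0).1]
          rw [if_pos hy, this, zero_mul, zero_add, Complex.ofReal_one, mul_one]
        · have : twoBump m n y = 0 := by
            by_contra hne
            exact hy ((isInv_bump m).supp _ hne)
          rw [if_neg hy, this, one_mul, Complex.ofReal_zero, mul_zero, add_zero]
    rw [h3, map_add, h.eq_zero_of_free h1 n, zero_add]
    intro g y hne
    refine ⟨(hdet g y (right_ne_zero_of_mul hne)).1, (hdet g y (right_ne_zero_of_mul hne)).2, ?_⟩
    intro hy
    exact left_ne_zero_of_mul hne (if_pos hy)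
  have hb : ∀ n : ℕ, ‖φ (kA F hF)‖ ^ 2 ≤ (φ (kA F hF * star (kA F hF))).re *
      (φ (kA (dg fun y => (twoBump m n y : ℂ)) (isInv_twoBump m n).ofReal.isKer *
      star (kA (dg fun y => (twoBump m n y : ℂ)) (isInv_twoBump m n).ofReal.isKer))).re := by
    intro n
    have hI := (isInv_twoBump m n).ofReal
    have h1 := hpos.cauchy_schwarz (star (kA F hF)) (kA (dg fun y => (twoBump m n y : ℂ)) hI.isKer)
    rw [star_star, ← hsplit] at h1
    have h2 : star (kA (dg fun y => (twoBump m n y : ℂ)) hI.isKer) =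
        kA (dg fun y => (twoBump m n y : ℂ)) hI.isKer := by
      rw [kA_star]
      refine kA_congr ?_
      rw [starK_dg hI]
      simp only [Complex.conj_ofReal]
    rw [h2] at h1 ⊢
    exact h1
  have h5 := ge_of_tendsto' ((tendsto_twoBump hβ h m).const_mul _) hb
  rw [mul_zero] at h5
  have : ‖φ (kA F hF)‖ = 0 := pow_eq_zero_iff two_ne_zero |>.1 (le_antisymm h5 (sq_nonneg _))
  exact norm_eq_zero.1 this

/-- The part of a kernel supported on a bi-invariant set. -/
lemma IsKer.ite {F : G → AfH → ℂ} (hF : IsKer F) {P : G → Prop}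
    [DecidablePred P]     (hP : ∀ a ∈ Gam, ∀ b ∈ Gam, ∀ g, P (a * g * b⁻¹) ↔ P g) :
    IsKer fun g y => if P g then F g y else 0 := by
  have := hF.mul_fun (w := fun g _ => if P g then 1 else 0) (fun a ha b hb g y => by
    by_cases h : P g
    · rw [if_pos h, if_pos ((hP a ha b hb g).2 h)]
    · rw [if_neg h, if_neg fun h' => h ((hP a ha b hb g).1 h')]) (fun g => continuous_const)
  convert this using 3
  split_ifs
  · rw [one_mul]
  · rw [zero_mul]

lemma IsKer.exists_dets {F : G → AfH → ℂ} (hF : IsKer F) :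
    ∃ S : Finset ℝ, ∀ g y, F g y ≠ 0 → detR g ∈ S := by
  obtain ⟨s, hs, h⟩ := hF.fin
  refine ⟨(hs.image fun x => detR x.out).toFinset, fun g y hg => ?_⟩
  rw [Set.Finite.mem_toFinset]
  refine ⟨rc g, h g y hg, ?_⟩
  obtain ⟨a, ha, e⟩ := exists_out g
  dsimp only
  rw [e, detR_mul, detR_Gam ha, one_mul]

open Classical in
/-- The homogeneous component of a kernel. -/
def detPart (d : ℝ) (F : G → AfH → ℂ) (g : G) (y : AfH) : ℂ := if detR g = d then F g y else 0

lemma IsKer.detPart {F : G → AfH → ℂ} (hF : IsKer F) (d : ℝ) : IsKer (detPart d F) := by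
  classical
  exact hF.ite (P := fun g => detR g = d) fun a ha b hb g => by rw [detR_conj ha hb]

lemma detPart_ne {d : ℝ} {F : G → AfH → ℂ} {g : G} {y : AfH} (h : detPart d F g y ≠ 0) :
    detR g = d := by
  by_contra h0
  exact h (if_neg h0)

lemma sum_detPart {F : G → AfH → ℂ} {S : Finset ℝ} (h : ∀ g y, F g y ≠ 0 → detR g ∈ S) (g : G)
    (y : AfH) : ∑ d ∈ S, detPart d F g y = F g y := by
  unfold detPart
  rw [Finset.sum_ite_eq]
  split_ifs with h0
  · rfl
  · by_contra hne
    exact h0 (h g y fun h1 => hne h1.symm)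

/-- A KMS functional is determined by its restriction to the diagonal. -/
lemma Twisted.eq_diag {β : ℝ} (hβ : 0 < β) {φ : A →L[ℂ] ℂ} (h : Twisted β φ)
    (hpos : IsPos φ) {F : G → AfH → ℂ} (hF : IsKer F) :
    φ (kA F hF) = φ (kA (dg (F 1)) hF.diag.isKer) := by
  classical
  obtain ⟨S, hS⟩ := hF.exists_dets
  have h1 : IsKer fun g y => if detR g = 1 ∧ g ∉ Gam then F g y else 0 :=
    hF.ite (P := fun g => detR g = 1 ∧ g ∉ Gam) fun a ha b hb g => by
      rw [detR_conj ha hb, mul_mul_inv_mem_iff ha hb]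
  have h2 : IsKer fun g y => if detR g ≠ 1 then F g y else 0 :=
    hF.ite (P := fun g => detR g ≠ 1) fun a ha b hb g => by rw [detR_conj ha hb]
  have e : kA F hF = kA (dg (F 1)) hF.diag.isKer + kA _ h1 + kA _ h2 := by
    rw [← kA_add, ← kA_add]
    refine kA_congr ?_
    funext g y
    by_cases hg : g ∈ Gam
    · have h3 : F g y = F 1 y := by
        have := hF.left hg 1 y
        rwa [mul_one] at this
      rw [dg_of_mem hg, if_neg (fun h => h.2 hg), if_neg (not_not.2 (detR_Gam hg)), h3]
      simp
    · rw [dg_of_notMem hg]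
      by_cases hd : detR g = 1
      · rw [if_pos ⟨hd, hg⟩, if_neg (not_not.2 hd)]; simp
      · rw [if_neg (fun h => hd h.1), if_pos hd]; simp
  have e2 : φ (kA _ h2) = 0 := by
    have hS2 : ∀ g y, (if detR g ≠ 1 then F g y else 0) ≠ 0 → detR g ∈ S := fun g y hne => by
      split_ifs at hne
      · exact hS g y hne
      · exact absurd rfl hne
    have : kA _ h2 = ∑ d ∈ S, kA _ (h2.detPart d) := by
      rw [← kA_sum (fun d => h2.detPart d) (IsKer.sum fun d _ => h2.detPart d)]
      refine kA_congr ?_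
      funext g y
      exact (sum_detPart hS2 g y).symm
    rw [this, map_sum]
    refine Finset.sum_eq_zero fun d _ => ?_
    by_cases hd : 0 < d ∧ d ≠ 1
    · exact h.eq_zero_of_det_ne hβ _ hd.1 hd.2 fun g y => detPart_ne
    · have : kA _ (h2.detPart d) = 0 := by
        rw [← kA_zero IsKer.zero]
        refine kA_congr ?_
        funext g y
        by_contra hne
        have h3 := detPart_ne hne
        refine hd ⟨h3 ▸ detR_pos g, fun h4 => hne ?_⟩
        unfold detPart
        rw [if_pos h3]
        exact if_neg (not_not.2 (h3.trans h4))
      rw [this, map_zero]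
  rw [e, map_add, map_add, e2, h.eq_zero_of_notMem hβ hpos h1, add_zero, add_zero]
  intro g y hne
  by_contra h0
  exact hne (if_neg h0)

/-! ### Hecke functionals -/

/-- The sum of a kernel over `h ∈ Γ \ GL₂⁺(ℚ)`. -/
def SK {E : Type*} [AddCommMonoid E] [TopologicalSpace E] (u : G → AfH → E) (y : AfH) : E :=
  lsum fun h => u h y

/-- A real kernel. -/
def IsKerR (u : G → AfH → ℝ) : Prop := IsKer fun g y => (u g y : ℂ)

/-- The kernel `(h, y) ↦ Det(h)^{-β} u(h⁻¹, h y)`. -/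
def sharp (β : ℝ) (u : G → AfH → ℝ) (h : G) (y : AfH) : ℝ := detR h ^ (-β) * u h⁻¹ (h • y)

lemma IsKer.leftInv {F : G → AfH → ℂ} (hF : IsKer F) (y : AfH) : LeftInv fun h => F h y :=
  fun _ ha g => hF.left ha g y

lemma IsKer.SK_eq_sum {F : G → AfH → ℂ} (hF : IsKer F) :
    ∃ S : Finset RC, (∀ g y, F g y ≠ 0 → rc g ∈ S) ∧
      ∀ y, SK F y = ∑ x ∈ S, F x.out y := by
  obtain ⟨s, hs, h⟩ := hF.fin
  exact ⟨hs.toFinset, fun g y hg => hs.mem_toFinset.2 (h g y hg), fun y =>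
    lsum_eq_sum hs fun g hg => h g y hg⟩

lemma IsKer.isInv_SK {F : G → AfH → ℂ} (hF : IsKer F) : IsInv (SK F) where
  inv a ha y := by
    have h1 : SK F (a • y) = lsum fun h => F (h * a) y := by
      unfold SK
      congr 1
      funext h
      exact hF.right ha h y
    rw [h1]
    exact lsum_mul_right (hF.leftInv y) a
  supp y h := by
    obtain ⟨g, hg⟩ := exists_ne_of_lsum_ne h
    exact (hF.supp _ _ hg).1
  cont := by
    obtain ⟨S, -, hS⟩ := hF.SK_eq_sum
    rw [funext hS]
    exact continuous_finsetSum _ fun x _ => hF.cont _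
  ht := hF.ht.imp fun T hT y h => by
    obtain ⟨g, hg⟩ := exists_ne_of_lsum_ne h
    exact hT _ _ hg

lemma ofReal_SK (u : G → AfH → ℝ) (y : AfH) : ((SK u y : ℝ) : ℂ) = SK (fun g y => (u g y : ℂ)) y :=
  Complex.ofReal_tsum _

lemma IsKerR.isInv_SK {u : G → AfH → ℝ} (hu : IsKerR u) : IsInv (SK u) := by
  have h : SK u = fun y => (SK (fun g y => (u g y : ℂ)) y).re := by
    funext y
    rw [← ofReal_SK, Complex.ofReal_re]
  rw [h]
  exact (IsKer.isInv_SK hu).re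

lemma SK_congr {E : Type*} [AddCommMonoid E] [TopologicalSpace E] {u u' : G → AfH → E} {y : AfH}
    (h : ∀ g, u g y = u' g y) : SK u y = SK u' y := by
  unfold SK
  rw [funext h]

lemma SK_mul_left {E : Type*} [DivisionRing E] [TopologicalSpace E] [IsTopologicalRing E]
    [T2Space E] (c : E) (u : G → AfH → E) (y : AfH) :
    SK (fun g y => c * u g y) y = c * SK u y := tsum_mul_left

lemma SK_nonneg {u : G → AfH → ℝ} (hu : ∀ g y, 0 ≤ u g y) (y : AfH) : 0 ≤ SK u y :=
  tsum_nonneg fun _ => hu _ _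

lemma conv_one (F F' : G → AfH → ℂ) :
    conv F F' 1 = SK fun h y => F h⁻¹ (h • y) * F' h y := by
  funext y
  unfold conv SK
  simp only [one_mul]

lemma IsKerR.sharp {β : ℝ} {u : G → AfH → ℝ} (hu : IsKerR u) : IsKerR (sharp β u) := by
  have h1 := hu.star.mul_fun (w := fun g _ => ((detR g ^ (-β) : ℝ) : ℂ))
    (fun a ha b hb g y => by rw [detR_conj ha hb]) (fun g => continuous_const)
  have : (fun g y => ((GL2System.sharp β u g y : ℝ) : ℂ)) = fun g y => ((detR g ^ (-β) : ℝ) : ℂ) *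
      starK (fun g y => (u g y : ℂ)) g y := by
    funext g y
    unfold starK GL2System.sharp
    rw [Complex.conj_ofReal, Complex.ofReal_mul]
  unfold IsKerR
  rw [this]
  exact h1

/-- A positive linear functional on the real invariant functions with the Hecke property that
characterizes the restrictions of KMS functionals to the diagonal. -/
structure IsHecke (β : ℝ) (μ : (AfH → ℝ) → ℝ) : Prop where
  add : ∀ k k', IsInv k → IsInv k' → μ (fun y => k y + k' y) = μ k + μ k'
  smul : ∀ (c : ℝ) k, IsInv k → μ (fun y => c * k y) = c * μ k
  nonneg : ∀ k, IsInv k → (∀ y, 0 ≤ k y) → 0 ≤ μ k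
  bdd : ∃ C, ∀ k, IsInv k → (∀ y, k y ≤ 1) → μ k ≤ C
  hecke : ∀ u, IsKerR u → μ (SK u) = μ (SK (sharp β u))

/-! ### Restriction of a state to the diagonal. -/

/-- The diagonal element of `A` given by an invariant function. -/
def dgA (k : AfH → ℂ) (hk : IsInv k) : A := kA (dg k) hk.isKer

lemma dgA_congr {k k' : AfH → ℂ} {hk : IsInv k} {hk' : IsInv k'}
    (h : ∀ y, k y = k' y) : dgA k hk = dgA k' hk' := kA_congr (by rw [funext h])

lemma dgA_add {k k' : AfH → ℂ} (hk : IsInv k) (hk' : IsInv k') :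
    dgA k hk + dgA k' hk' = dgA (fun y => k y + k' y) (hk.add hk') := by
  unfold dgA
  rw [← kA_add]
  refine kA_congr ?_
  funext g y
  unfold dg
  split_ifs <;> simp

lemma dgA_mul {k k' : AfH → ℂ} (hk : IsInv k) (hk' : IsInv k') :
    dgA k hk * dgA k' hk' = dgA (fun y => k y * k' y) (hk.mul hk') := by
  refine kA_mul_dg hk' hk.isKer _ fun g y => ?_
  unfold dg
  split_ifs <;> simp

lemma dgA_smul (c : ℂ) {k : AfH → ℂ} (hk : IsInv k) :
    c • dgA k hk = dgA (fun y => c * k y) (hk.const_mul c) := by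
  have h : (dg fun y => c * k y) = fun g y => c * dg k g y := by
    funext g y
    unfold dg
    split_ifs <;> simp
  have h2 : IsKer fun g y => c * dg k g y := h ▸ (hk.const_mul c).isKer
  unfold dgA
  rw [← kA_smul c hk.isKer h2]
  exact kA_congr h.symm

lemma IsInv.conj {k : AfH → ℂ} (hk : IsInv k) : IsInv fun y => (starRingEnd ℂ) (k y) :=
  hk.comp Complex.continuous_conj (map_zero _)

lemma star_dgA {k : AfH → ℂ} (hk : IsInv k) :
    star (dgA k hk) = dgA (fun y => (starRingEnd ℂ) (k y)) hk.conj := by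
  unfold dgA
  rw [kA_star]
  exact kA_congr (starK_dg hk)

lemma norm_dgA_le {k : AfH → ℂ} (hk : IsInv k) {M : ℝ} (hM : ∀ y, ‖k y‖ ≤ M) (h0 : 0 ≤ M) :
    ‖dgA k hk‖ ≤ M := norm_kA_dg_le hk hM h0

lemma dgA_def {k : AfH → ℂ} (hk : IsInv k) : kA (dg k) hk.isKer = dgA k hk := rfl

open Classical in
/-- The restriction of a functional on `A` to the real invariant functions. -/
def diagFun (φ : A →L[ℂ] ℂ) (k : AfH → ℝ) : ℝ :=
  if h : IsInv k then (φ (dgA (fun y => (k y : ℂ)) h.ofReal)).re else 0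

lemma diagFun_eq (φ : A →L[ℂ] ℂ) {k : AfH → ℝ} (hk : IsInv k) :
    diagFun φ k = (φ (dgA (fun y => (k y : ℂ)) hk.ofReal)).re := dif_pos hk

lemma diagFun_add (φ : A →L[ℂ] ℂ) {k k' : AfH → ℝ} (hk : IsInv k) (hk' : IsInv k') :
    diagFun φ (fun y => k y + k' y) = diagFun φ k + diagFun φ k' := by
  have e : dgA (fun y => ((k y + k' y : ℝ) : ℂ)) (hk.add hk').ofReal =
      dgA (fun y => (k y : ℂ)) hk.ofReal + dgA (fun y => (k' y : ℂ)) hk'.ofReal := by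
    rw [dgA_add]
    exact dgA_congr fun y => Complex.ofReal_add _ _
  rw [diagFun_eq φ hk, diagFun_eq φ hk', diagFun_eq φ (hk.add hk'), e, map_add, Complex.add_re]

lemma diagFun_smul (φ : A →L[ℂ] ℂ) (c : ℝ) {k : AfH → ℝ} (hk : IsInv k) :
    diagFun φ (fun y => c * k y) = c * diagFun φ k := by
  have e : dgA (fun y => ((c * k y : ℝ) : ℂ)) (hk.const_mul c).ofReal =
      (c : ℂ) • dgA (fun y => (k y : ℂ)) hk.ofReal := by
    rw [dgA_smul]
    exact dgA_congr fun y => Complex.ofReal_mul _ _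
  rw [diagFun_eq φ hk, diagFun_eq φ (hk.const_mul c), e, map_smul, smul_eq_mul,
    Complex.re_ofReal_mul]

/-- The square root of k is again an invariant function, so the diagonal element is of the form b* b
inside `A`. -/
lemma IsPos.dg_nonneg {φ : A →L[ℂ] ℂ} (h : IsPos φ) {k : AfH → ℝ} (hk : IsInv k)
    (h0 : ∀ y, 0 ≤ k y) : 0 ≤ (φ (dgA (fun y => (k y : ℂ)) hk.ofReal)).re ∧
      (φ (dgA (fun y => (k y : ℂ)) hk.ofReal)).im = 0 := by
  have hs : IsInv fun y => √(k y) := hk.comp Real.continuous_sqrt Real.sqrt_zero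
  have e : dgA (fun y => (k y : ℂ)) hk.ofReal =
      star (dgA (fun y => ((√(k y) : ℝ) : ℂ)) hs.ofReal) *
        dgA (fun y => ((√(k y) : ℝ) : ℂ)) hs.ofReal := by
    rw [star_dgA, dgA_mul]
    refine dgA_congr fun y => ?_
    rw [Complex.conj_ofReal, ← Complex.ofReal_mul, Real.mul_self_sqrt (h0 y)]
  rw [e]
  exact h _

lemma IsInv.max_zero {k : AfH → ℝ} (hk : IsInv k) : IsInv fun y => max (k y) 0 :=
  hk.comp (φ := fun x => max x 0) (by fun_prop) (max_self 0)

/-- Positive and negative parts have real values, hence so does k; no information is lost in taking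
the real part in `diagFun`. -/
lemma IsPos.dg_eq {φ : A →L[ℂ] ℂ} (h : IsPos φ) {k : AfH → ℝ} (hk : IsInv k) :
    φ (dgA (fun y => (k y : ℂ)) hk.ofReal) = (diagFun φ k : ℂ) := by
  refine Complex.ext (by rw [diagFun_eq φ hk, Complex.ofReal_re]) ?_
  rw [Complex.ofReal_im]
  have h1 := hk.max_zero
  have h2 := (hk.const_mul (-1)).max_zero
  have e : dgA (fun y => (k y : ℂ)) hk.ofReal +
      dgA (fun y => ((max (-1 * k y) 0 : ℝ) : ℂ)) h2.ofReal =
      dgA (fun y => ((max (k y) 0 : ℝ) : ℂ)) h1.ofReal := by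
    rw [dgA_add]
    refine dgA_congr fun y => ?_
    rw [← Complex.ofReal_add]
    congr 1
    rcases le_total (k y) 0 with h | h
    · rw [max_eq_right h, max_eq_left (by linarith)]; ring
    · rw [max_eq_left h, max_eq_right (by linarith)]; ring
  have := congrArg (fun a => (φ a).im) e
  simp only [map_add, Complex.add_im] at this
  rw [(h.dg_nonneg h1 fun y => le_max_right _ _).2,
    (h.dg_nonneg h2 fun y => le_max_right _ _).2, add_zero] at this
  exact this

/-- The complexification of a real functional. -/
def cplx (μ : (AfH → ℝ) → ℝ) (k : AfH → ℂ) : ℂ :=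
  (μ fun y => (k y).re : ℝ) + (μ fun y => (k y).im : ℝ) * Complex.I

lemma IsPos.dg_eq_cplx {φ : A →L[ℂ] ℂ} (h : IsPos φ) {k : AfH → ℂ} (hk : IsInv k) :
    φ (dgA k hk) = cplx (diagFun φ) k := by
  have e : dgA k hk = dgA (fun y => ((k y).re : ℂ)) hk.re.ofReal +
      Complex.I • dgA (fun y => ((k y).im : ℂ)) hk.im.ofReal := by
    rw [dgA_smul, dgA_add]
    refine dgA_congr fun y => ?_
    rw [mul_comm, Complex.re_add_im]
  unfold cplx
  rw [← h.dg_eq hk.re, ← h.dg_eq hk.im, e, map_add, map_smul, smul_eq_mul, mul_comm Complex.I]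

lemma Twisted.eq_cplx {β : ℝ} (hβ : 0 < β) {φ : A →L[ℂ] ℂ} (h : Twisted β φ) (hpos : IsPos φ)
    {F : G → AfH → ℂ} (hF : IsKer F) : φ (kA F hF) = cplx (diagFun φ) (F 1) := by
  rw [h.eq_diag hβ hpos hF, dgA_def hF.diag, hpos.dg_eq_cplx]

lemma diagFun_le (φ : A →L[ℂ] ℂ) (h : IsPos φ) {k : AfH → ℝ} (hk : IsInv k)
    (h1 : ∀ y, k y ≤ 1) : diagFun φ k ≤ ‖φ‖ := by
  have h2 : diagFun φ k ≤ diagFun φ fun y => max (k y) 0 := by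
    have h3 := h.dg_nonneg (hk.max_zero.sub hk) fun y => sub_nonneg.2 (le_max_left _ _)
    rw [← diagFun_eq φ (hk.max_zero.sub hk)] at h3
    have h4 := diagFun_add φ hk (hk.max_zero.sub hk)
    simp only [add_sub_cancel] at h4
    linarith [h3.1]
  refine h2.trans ?_
  rw [diagFun_eq φ hk.max_zero]
  refine (Complex.re_le_norm _).trans ((φ.le_opNorm _).trans ?_)
  refine mul_le_of_le_one_right (norm_nonneg _) (norm_dgA_le hk.max_zero.ofReal (fun y => ?_)
    zero_le_one)
  rw [Complex.norm_real, Real.norm_of_nonneg (le_max_right _ _)]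
  exact max_le (h1 y) zero_le_one

/-- The square root with the sign of the argument. -/
def sqrtD (x : ℝ) : ℝ := √(max x 0) - √(max (-x) 0)

/-- The square root of the absolute value. -/
def sqrtS (x : ℝ) : ℝ := √(max x 0) + √(max (-x) 0)

lemma sqrtD_mul_sqrtS (x : ℝ) : sqrtD x * sqrtS x = x := by
  unfold sqrtD sqrtS
  have h1 := Real.mul_self_sqrt (le_max_right x 0)
  have h2 := Real.mul_self_sqrt (le_max_right (-x) 0)
  have h3 : max x 0 - max (-x) 0 = x := by
    rcases le_total x 0 with h | h
    · rw [max_eq_right h, max_eq_left (by linarith)]; ring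
    · rw [max_eq_left h, max_eq_right (by linarith)]; ring
  linear_combination h1 - h2 + h3

/-- A homogeneous real kernel satisfies the Hecke relation. -/
lemma Twisted.hecke_hom {β : ℝ} (hβ : 0 < β) {φ : A →L[ℂ] ℂ} (h : Twisted β φ) (hpos : IsPos φ)
    {u : G → AfH → ℝ} (hu : IsKerR u) {d : ℝ} (hd : 0 < d)
    (hdet : ∀ g y, u g y ≠ 0 → detR g = d) :
    diagFun φ (SK u) = diagFun φ (SK (sharp β u)) := by
  -- The kernel u is written as a product of two kernels a and b. Then the diagonal of a* b is `SK
  -- u`, while that of b a* is d^{-β} times `SK (sharp β u)`, and the twisted identity compares the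
  -- two.
  have ha : IsKer fun g y => ((sqrtD (u g y) : ℝ) : ℂ) :=
    IsKer.comp hu (φ := fun z => ((sqrtD z.re : ℝ) : ℂ))
      (by unfold sqrtD; fun_prop) (by simp [sqrtD])
  have hb : IsKer fun g y => ((sqrtS (u g y) : ℝ) : ℂ) :=
    IsKer.comp hu (φ := fun z => ((sqrtS z.re : ℝ) : ℂ))
      (by unfold sqrtS; fun_prop) (by simp [sqrtS])
  have hdet' : ∀ g y, ((sqrtS (u g y) : ℝ) : ℂ) ≠ 0 → detR g = d := by
    intro g y hne
    refine hdet g y fun h0 => hne ?_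
    rw [h0]
    simp [sqrtS]
  have key := h _ hb d hd hdet' (star (kA _ ha))
  rw [kA_star, kA_mul, kA_mul, h.eq_cplx hβ hpos, h.eq_cplx hβ hpos] at key
  have e1 : conv (starK fun g y => ((sqrtD (u g y) : ℝ) : ℂ))
      (fun g y => ((sqrtS (u g y) : ℝ) : ℂ)) 1 = fun y => ((SK u y : ℝ) : ℂ) := by
    rw [conv_one]
    funext y
    rw [ofReal_SK]
    refine SK_congr fun g => ?_
    unfold starK
    rw [inv_inv, inv_smul_smul, Complex.conj_ofReal, ← Complex.ofReal_mul, sqrtD_mul_sqrtS]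
  have e2 : conv (fun g y => ((sqrtS (u g y) : ℝ) : ℂ))
      (starK fun g y => ((sqrtD (u g y) : ℝ) : ℂ)) 1 =
      fun y => ((d ^ (-β) * SK (sharp β u) y : ℝ) : ℂ) := by
    rw [conv_one]
    funext y
    rw [Complex.ofReal_mul, ofReal_SK, ← SK_mul_left]
    refine SK_congr fun g => ?_
    unfold starK sharp
    rw [Complex.conj_ofReal, ← Complex.ofReal_mul, mul_comm (sqrtS _), sqrtD_mul_sqrtS]
    by_cases h0 : u g⁻¹ (g • y) = 0
    · rw [h0]; simp
    · have h1 := hdet _ _ h0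
      rw [detR_inv, inv_eq_iff_eq_inv] at h1
      rw [h1, Real.inv_rpow hd.le, ← Complex.ofReal_mul, mul_inv_cancel_left₀]
      exact (Real.rpow_pos_of_pos hd _).ne'
  rw [e1, e2] at key
  unfold cplx at key
  simp only [Complex.ofReal_re, Complex.ofReal_im] at key
  have hS := hu.sharp (β := β) |>.isInv_SK
  have h0 : diagFun φ (fun _ => 0) = 0 := by
    have := diagFun_smul φ 0 (IsInv.zero (E := ℝ))
    simpa using this
  rw [h0, diagFun_smul φ _ hS, Complex.ofReal_zero, zero_mul, add_zero, add_zero,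
    Complex.ofReal_mul] at key
  have h2 : ((d ^ (-β) : ℝ) : ℂ) ≠ 0 := by exact_mod_cast (Real.rpow_pos_of_pos hd _).ne'
  exact_mod_cast (mul_left_cancel₀ h2 key).symm

lemma SK_sum {ι : Type*} {s : Finset ι} {u : ι → G → AfH → ℝ} (hu : ∀ i, IsKerR (u i)) :
    SK (fun g y => ∑ i ∈ s, u i g y) = fun y => ∑ i ∈ s, SK (u i) y := by
  classical
  funext y
  have h := fun i => IsKer.SK_eq_sum (hu i)
  choose S hS _ using h
  unfold SK lsum
  refine Summable.tsum_finsetSum fun i _ => ?_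
  refine summable_of_ne_finset_zero (s := S i) fun x hx => ?_
  by_contra h0
  have := hS i x.out y (by exact_mod_cast h0)
  rw [show rc x.out = x from Quotient.out_eq x] at this
  exact hx this

lemma diagFun_sum (φ : A →L[ℂ] ℂ) {ι : Type*} (s : Finset ι) {k : ι → AfH → ℝ}
    (hk : ∀ i, IsInv (k i)) : diagFun φ (fun y => ∑ i ∈ s, k i y) = ∑ i ∈ s, diagFun φ (k i) := by
  classical
  induction s using Finset.induction_on with
  | empty =>
    have := diagFun_smul φ 0 (IsInv.zero (E := ℝ))
    simpa using this
  | insert i s hi ih =>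
    simp only [Finset.sum_insert hi]
    rw [diagFun_add φ (hk i) (IsInv.sum fun j _ => hk j), ih]

open Classical in
/-- The diagonal part of a positive KMS functional is a Hecke functional. -/
lemma Twisted.isHecke {β : ℝ} (hβ : 0 < β) {φ : A →L[ℂ] ℂ} (h : Twisted β φ) (hpos : IsPos φ) :
    IsHecke β (diagFun φ) where
  add k k' hk hk' := diagFun_add φ hk hk'
  smul c k hk := diagFun_smul φ c hk
  nonneg k hk h0 := by rw [diagFun_eq φ hk]; exact (hpos.dg_nonneg hk h0).1
  bdd := ⟨‖φ‖, fun k hk h1 => diagFun_le φ hpos hk h1⟩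
  hecke u hu := by
    obtain ⟨S, hS⟩ := IsKer.exists_dets hu
    -- Finitely many determinants occur in u, and both sides of the relation are additive, so the
    -- homogeneous case suffices.
    let v : ℝ → G → AfH → ℝ := fun d g y => if detR g = d then u g y else 0
    have hv : ∀ d, IsKerR (v d) := fun d => by
      have := IsKer.detPart hu d
      unfold IsKerR
      convert this using 3
      unfold v detPart
      split_ifs <;> simp
    have e : ∀ g y, u g y = ∑ d ∈ S, v d g y := fun g y => by
      unfold v
      rw [Finset.sum_ite_eq]
      split_ifs with h0
      · rfl
      · by_contra hne
        exact h0 (hS g y (by exact_mod_cast hne))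
    have e1 : SK u = fun y => ∑ d ∈ S, SK (v d) y := by
      rw [← SK_sum hv]
      congr 1
      funext g y
      exact e g y
    have e2 : SK (sharp β u) = fun y => ∑ d ∈ S, SK (sharp β (v d)) y := by
      rw [← SK_sum fun d => (hv d).sharp]
      congr 1
      funext g y
      unfold sharp
      rw [e, Finset.mul_sum]
    rw [e1, e2, diagFun_sum φ S fun d => (hv d).isInv_SK,
      diagFun_sum φ S fun d => (hv d).sharp.isInv_SK]
    refine Finset.sum_congr rfl fun d _ => ?_
    have hvd : ∀ g y, v d g y ≠ 0 → detR g = d := fun g y hne => by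
      by_contra h0
      exact hne (if_neg h0)
    by_cases hd : 0 < d
    · exact h.hecke_hom hβ hpos (hv d) hd hvd
    · have h0 : ∀ g y, v d g y = 0 := fun g y => by
        by_contra hne
        exact hd (hvd g y hne ▸ detR_pos g)
      have h1 : SK (v d) = SK (sharp β (v d)) := by
        funext y
        refine SK_congr fun g => ?_
        unfold sharp
        rw [h0, h0, mul_zero]
      rw [h1]

lemma isClosed_pos {B : Type*} [NonUnitalCStarAlgebra B] (φ : B →L[ℂ] ℂ) :
    IsClosed {a : B | 0 ≤ (φ (star a * a)).re ∧ (φ (star a * a)).im = 0} := by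
  have hc : Continuous fun a : B => φ (star a * a) :=
    φ.continuous.comp (continuous_star.mul continuous_id)
  exact (isClosed_le continuous_const (Complex.continuous_re.comp hc)).inter
    (isClosed_eq (Complex.continuous_im.comp hc) continuous_const)

lemma isClosed_twist {B : Type*} [NonUnitalCStarAlgebra B] (φ : B →L[ℂ] ℂ) (b : B) (c : ℂ) :
    IsClosed {a : B | φ (b * a) = c * φ (a * b)} :=
  isClosed_eq (φ.continuous.comp (continuous_const.mul continuous_id))
    (continuous_const.mul (φ.continuous.comp (continuous_id.mul continuous_const)))

/-! ### The mass of a Hecke functional -/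

namespace IsHecke

variable {β : ℝ} {μ : (AfH → ℝ) → ℝ} (hμ : IsHecke β μ)
include hμ

lemma zero : μ (fun _ => 0) = 0 := by
  have := hμ.smul 0 _ (IsInv.zero (E := ℝ))
  simpa using this

lemma sub {k k' : AfH → ℝ} (hk : IsInv k) (hk' : IsInv k') :
    μ (fun y => k y - k' y) = μ k - μ k' := by
  have := hμ.add _ _ (hk.sub hk') hk'
  simp only [sub_add_cancel] at this
  linarith

lemma mono {k k' : AfH → ℝ} (hk : IsInv k) (hk' : IsInv k') (h : ∀ y, k y ≤ k' y) :
    μ k ≤ μ k' := by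
  have h1 := hμ.nonneg _ (hk'.sub hk) fun y => sub_nonneg.2 (h y)
  rw [hμ.sub hk' hk] at h1
  linarith

end IsHecke

/-- The total mass of a functional. -/
def mass (μ : (AfH → ℝ) → ℝ) : ℝ := ⨆ n, μ (bump n)

namespace IsHecke

variable {β : ℝ} {μ : (AfH → ℝ) → ℝ} (hμ : IsHecke β μ)
include hμ

lemma bddAbove_bump : BddAbove (Set.range fun n => μ (bump n)) := by
  obtain ⟨C, hC⟩ := hμ.bdd
  refine ⟨C, ?_⟩
  rintro _ ⟨n, rfl⟩
  exact hC _ (isInv_bump n) (bump_le_one n)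

lemma bump_le_mass (n : ℕ) : μ (bump n) ≤ mass μ := le_ciSup hμ.bddAbove_bump n

lemma mass_nonneg : 0 ≤ mass μ :=
  (hμ.nonneg _ (isInv_bump 0) (bump_nonneg 0)).trans (hμ.bump_le_mass 0)

lemma tendsto_bump : Filter.Tendsto (fun n => μ (bump n)) Filter.atTop (nhds (mass μ)) :=
  tendsto_atTop_ciSup (fun m n h => hμ.mono (isInv_bump m) (isInv_bump n) (bump_mono h))
    hμ.bddAbove_bump

/-- A bump equal to 1 on the support of k gives k ≤ M · `bump n`. -/
lemma le_mul_mass {k : AfH → ℝ} (hk : IsInv k) {M : ℝ} (h0 : 0 ≤ M) (h : ∀ y, k y ≤ M) :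
    μ k ≤ M * mass μ := by
  obtain ⟨T, hT⟩ := hk.ht
  obtain ⟨n, hn⟩ := exists_bump T
  have h1 : μ k ≤ μ fun y => M * bump n y := by
    refine hμ.mono hk ((isInv_bump n).const_mul M) fun y => ?_
    by_cases h2 : k y = 0
    · rw [h2]
      exact mul_nonneg h0 (bump_nonneg n y)
    · rw [hn n le_rfl y (hk.supp y h2) (hT y h2), mul_one]
      exact h y
  rw [hμ.smul M _ (isInv_bump n)] at h1
  exact h1.trans (mul_le_mul_of_nonneg_left (hμ.bump_le_mass n) h0)

lemma abs_le_mul_mass {k : AfH → ℝ} (hk : IsInv k) {M : ℝ} (h0 : 0 ≤ M) (h : ∀ y, |k y| ≤ M) :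
    |μ k| ≤ M * mass μ := by
  refine abs_le.2 ⟨?_, hμ.le_mul_mass hk h0 fun y => (le_abs_self _).trans (h y)⟩
  have := hμ.le_mul_mass (hk.const_mul (-1)) h0 fun y => by
    have := neg_le_of_abs_le (h y)
    linarith
  rw [hμ.smul _ _ hk] at this
  linarith

lemma cplx_add {k k' : AfH → ℂ} (hk : IsInv k) (hk' : IsInv k') :
    cplx μ (fun y => k y + k' y) = cplx μ k + cplx μ k' := by
  unfold cplx
  simp only [Complex.add_re, Complex.add_im]
  rw [hμ.add _ _ hk.re hk'.re, hμ.add _ _ hk.im hk'.im]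
  push_cast
  ring

lemma cplx_smul (c : ℂ) {k : AfH → ℂ} (hk : IsInv k) :
    cplx μ (fun y => c * k y) = c * cplx μ k := by
  unfold cplx
  simp only [Complex.mul_re, Complex.mul_im]
  rw [hμ.sub (hk.re.const_mul _) (hk.im.const_mul _), hμ.add _ _ (hk.im.const_mul _)
    (hk.re.const_mul _), hμ.smul _ _ hk.re, hμ.smul _ _ hk.re, hμ.smul _ _ hk.im, hμ.smul _ _ hk.im]
  refine Complex.ext ?_ ?_
  · simp
  · simp

lemma cplx_ofReal (k : AfH → ℝ) : cplx μ (fun y => (k y : ℂ)) = μ k := by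
  unfold cplx
  simp only [Complex.ofReal_re, Complex.ofReal_im]
  rw [hμ.zero]
  simp

/-- Multiplying by a phase makes the value real and non-negative; it is then the value of μ on the
real part, which is at most M. -/
lemma norm_cplx_le {k : AfH → ℂ} (hk : IsInv k) {M : ℝ} (h0 : 0 ≤ M) (h : ∀ y, ‖k y‖ ≤ M) :
    ‖cplx μ k‖ ≤ M * mass μ := by
  obtain ⟨c, hc, e⟩ : ∃ c : ℂ, ‖c‖ = 1 ∧ c * cplx μ k = ‖cplx μ k‖ := by
    by_cases hz : cplx μ k = 0
    · exact ⟨1, by simp, by simp [hz]⟩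
    · have hz' : (‖cplx μ k‖ : ℂ) ≠ 0 := by exact_mod_cast norm_ne_zero_iff.2 hz
      refine ⟨(starRingEnd ℂ) (cplx μ k) / ‖cplx μ k‖, ?_, ?_⟩
      · rw [norm_div, RCLike.norm_conj, Complex.norm_real, norm_norm,
          div_self (norm_ne_zero_iff.2 hz)]
      · rw [div_mul_eq_mul_div, mul_comm, Complex.mul_conj, Complex.normSq_eq_norm_sq,
          div_eq_iff hz']
        push_cast
        ring
  have h1 := hμ.cplx_smul c hk
  rw [e] at h1
  have h2 := congrArg Complex.re h1
  rw [Complex.ofReal_re] at h2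
  rw [← h2]
  have h3 : (cplx μ fun y => c * k y).re = μ fun y => (c * k y).re := by
    unfold cplx
    simp
  rw [h3]
  refine hμ.le_mul_mass (hk.const_mul c).re h0 fun y => ?_
  refine (Complex.re_le_norm _).trans ?_
  rw [norm_mul, hc, one_mul]
  exact h y

lemma cplx_hecke {F : G → AfH → ℂ} (hF : IsKer F) :
    cplx μ (SK F) = cplx μ (SK fun h y => ((detR h ^ (-β) : ℝ) : ℂ) * F h⁻¹ (h • y)) := by
  have hre : IsKerR fun g y => (F g y).re :=
    hF.comp (φ := fun z => (z.re : ℂ)) (by fun_prop) (by simp)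
  have him : IsKerR fun g y => (F g y).im :=
    hF.comp (φ := fun z => (z.im : ℂ)) (by fun_prop) (by simp)
  have h1 : IsKer fun g y => ((detR g ^ (-β) : ℝ) : ℂ) * F g⁻¹ (g • y) := by
    have h2 := (hF.comp (φ := starRingEnd ℂ) Complex.continuous_conj (map_zero _)).star.mul_fun
      (w := fun g _ => ((detR g ^ (-β) : ℝ) : ℂ))
      (fun a ha b hb g y => by rw [detR_conj ha hb]) (fun g => continuous_const)
    have : (fun g y => ((detR g ^ (-β) : ℝ) : ℂ) * F g⁻¹ (g • y)) = fun g y =>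
        ((detR g ^ (-β) : ℝ) : ℂ) * starK (fun g y => (starRingEnd ℂ) (F g y)) g y := by
      funext g y
      unfold starK
      rw [Complex.conj_conj]
    rw [this]
    exact h2
  have hs : ∀ {F : G → AfH → ℂ}, IsKer F → (fun y => (SK F y).re) = SK fun g y => (F g y).re := by
    intro F hF
    funext y
    obtain ⟨S, hS, -⟩ := hF.SK_eq_sum
    refine Complex.re_tsum ?_
    refine summable_of_ne_finset_zero (s := S) fun x hx => ?_
    by_contra h0
    have := hS x.out y h0
    rw [show rc x.out = x from Quotient.out_eq x] at this
    exact hx this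
  have hs' : ∀ {F : G → AfH → ℂ}, IsKer F → (fun y => (SK F y).im) = SK fun g y => (F g y).im := by
    intro F hF
    funext y
    obtain ⟨S, hS, -⟩ := hF.SK_eq_sum
    refine Complex.im_tsum ?_
    refine summable_of_ne_finset_zero (s := S) fun x hx => ?_
    by_contra h0
    have := hS x.out y h0
    rw [show rc x.out = x from Quotient.out_eq x] at this
    exact hx this
  unfold cplx
  rw [hs hF, hs' hF, hs h1, hs' h1, hμ.hecke _ hre, hμ.hecke _ him]
  unfold sharp
  simp only [Complex.re_ofReal_mul, Complex.im_ofReal_mul]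

/-! ### The functional on A attached to a Hecke functional. -/

/-- The functional on `C_c(Z)` given by a Hecke functional. -/
def toLinear : CcZ →ₗ[ℂ] ℂ where
  toFun f := cplx μ (val f 1)
  map_add' f f' := by
    rw [← hμ.cplx_add (isKer_val f).diag (isKer_val f').diag]
    congr 1
    funext y
    exact val_add f f' 1 y
  map_smul' c f := by
    rw [RingHom.id_apply, smul_eq_mul, ← hμ.cplx_smul c (isKer_val f).diag]
    congr 1
    funext y
    exact val_smul c f 1 y

lemma norm_toLinear_le (f : CcZ) : ‖hμ.toLinear f‖ ≤ mass μ * ‖toAL f‖ := by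
  rw [mul_comm]
  refine hμ.norm_cplx_le (isKer_val f).diag (norm_nonneg _) fun y => ?_
  by_cases hy : y ∈ Y
  · exact norm_val_le f hy
  · have : val f 1 y = 0 := by
      by_contra h0
      exact hy ((isKer_val f).diag.supp y h0)
    rw [this, norm_zero]
    exact norm_nonneg _

/-- The functional on `A` given by a Hecke functional. -/
def toA : A →L[ℂ] ℂ := hμ.toLinear.extendOfNorm toAL

lemma toA_kA {F : G → AfH → ℂ} (hF : IsKer F) : hμ.toA (kA F hF) = cplx μ (F 1) := by
  have h := LinearMap.extendOfNorm_eq (f := hμ.toLinear) (e := toAL) denseRange_toA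
    ⟨_, hμ.norm_toLinear_le⟩ (ofKer F hF)
  refine h.trans ?_
  change cplx μ (val (ofKer F hF) 1) = _
  rw [val_ofKer]

lemma norm_toA_le : ‖hμ.toA‖ ≤ mass μ := by
  refine ContinuousLinearMap.opNorm_le_bound _ hμ.mass_nonneg fun a => ?_
  exact LinearMap.norm_extendOfNorm_apply_le (f := hμ.toLinear) (e := toAL) denseRange_toA _
    hμ.norm_toLinear_le a

/-- The bumps give elements of norm at most 1 whose values approach the mass. -/
lemma mass_le_norm {φ : A →L[ℂ] ℂ}
    (h : ∀ {F : G → AfH → ℂ} (hF : IsKer F), φ (kA F hF) = cplx μ (F 1)) : mass μ ≤ ‖φ‖ := by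
  refine ciSup_le fun n => ?_
  have h1 := h (isInv_bump n).ofReal.isKer
  have h2 : dg (fun y => (bump n y : ℂ)) 1 = fun y => (bump n y : ℂ) :=
    funext fun y => dg_of_mem (one_mem _) _ _
  rw [h2, hμ.cplx_ofReal, dgA_def (isInv_bump n).ofReal] at h1
  have h3 := φ.le_opNorm (dgA (fun y => (bump n y : ℂ)) (isInv_bump n).ofReal)
  rw [h1, Complex.norm_real] at h3
  refine (le_abs_self _).trans (h3.trans ?_)
  refine mul_le_of_le_one_right (norm_nonneg _) (norm_dgA_le _ (fun y => ?_) zero_le_one)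
  rw [Complex.norm_real, Real.norm_of_nonneg (bump_nonneg n y)]
  exact bump_le_one n y

lemma norm_toA : ‖hμ.toA‖ = mass μ :=
  le_antisymm hμ.norm_toA_le (hμ.mass_le_norm hμ.toA_kA)

/-- On the diagonal, f* f is the function of y given by the sum of |f(h, y)|² over cosets h, which
is non-negative; density does the rest. -/
lemma isPos_toA : IsPos hμ.toA := by
  intro a
  refine denseRange_toA.induction_on (p := fun a => 0 ≤ (hμ.toA (star a * a)).re ∧
    (hμ.toA (star a * a)).im = 0) a (isClosed_pos hμ.toA) fun f => ?_
  rw [toA_eq_kA, kA_star, kA_mul, hμ.toA_kA]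
  have hk : IsKerR fun g y => ‖val f g y‖ ^ 2 :=
    (isKer_val f).comp (φ := fun z => ((‖z‖ ^ 2 : ℝ) : ℂ)) (by fun_prop) (by simp)
  have e : conv (starK (val f)) (val f) 1 =
      fun y => ((SK (fun g y => ‖val f g y‖ ^ 2) y : ℝ) : ℂ) := by
    rw [conv_one]
    funext y
    rw [ofReal_SK]
    refine SK_congr fun g => ?_
    unfold starK
    rw [inv_inv, inv_smul_smul, mul_comm, Complex.mul_conj, Complex.normSq_eq_norm_sq]
  rw [e, hμ.cplx_ofReal]
  exact ⟨hμ.nonneg _ hk.isInv_SK (SK_nonneg fun _ _ => sq_nonneg _), Complex.ofReal_im _⟩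

/-- The Hecke relation is applied to the kernel u(h, y) = f(h⁻¹, h y) F(h, y), whose coset sum is
the diagonal of f * F and whose transform is d^β times the diagonal of F * f. -/
lemma twisted_toA : Twisted β hμ.toA := by
  intro F hF d hd hdet a
  refine denseRange_toA.induction_on (p := fun a => hμ.toA (kA F hF * a) =
    ((d ^ (-β) : ℝ) : ℂ) * hμ.toA (a * kA F hF)) a ?_ fun f => ?_
  · exact isClosed_twist hμ.toA _ _
  · have hf := isKer_val f
    rw [toA_eq_kA, kA_mul, kA_mul, hμ.toA_kA, hμ.toA_kA]
    have hu : IsKer fun h y => val f h⁻¹ (h • y) * F h y := by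
      have h1 := hF.mul_fun (w := fun h y => val f h⁻¹ (h • y)) (fun a ha b hb g y => ?_)
        fun g => ?_
      · exact h1
      · have : (a * g * b⁻¹)⁻¹ = b * g⁻¹ * a⁻¹ := by group
        rw [smul_smul, inv_mul_cancel_right, this, mul_smul, hf.inv b hb a ha]
      · exact (hf.cont _).comp (continuous_const_smul g)
    have h1 := hμ.cplx_hecke hu
    have h2 : (SK fun h y => ((detR h ^ (-β) : ℝ) : ℂ) *
        (val f h⁻¹⁻¹ (h⁻¹ • h • y) * F h⁻¹ (h • y))) =
        fun y => ((d ^ (-β) : ℝ) : ℂ)⁻¹ * conv F (val f) 1 y := by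
      rw [conv_one]
      funext y
      rw [← SK_mul_left]
      refine SK_congr fun h => ?_
      rw [inv_inv, inv_smul_smul]
      by_cases h0 : F h⁻¹ (h • y) = 0
      · rw [h0]; simp
      · have h2 := hdet _ _ h0
        rw [detR_inv, inv_eq_iff_eq_inv] at h2
        rw [h2, Real.inv_rpow hd.le, Complex.ofReal_inv, mul_comm (val f h y)]
    rw [h2, hμ.cplx_smul _ (hF.conv hf).diag] at h1
    rw [conv_one (val f), h1, mul_inv_cancel_left₀]
    exact_mod_cast (Real.rpow_pos_of_pos hd _).ne'

end IsHecke

/-! ### The KMS condition from its algebraic form -/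

/-- The functions `u` and `v` are the boundary values of a bounded continuous function on the
strip `0 ≤ Im z ≤ β` that is holomorphic in the interior. -/
def IsStripBoundary (β : ℝ) (u v : ℝ → ℂ) : Prop :=
  ∃ F : ℂ → ℂ, (∃ C : ℝ, ∀ z : ℂ, 0 ≤ z.im → z.im ≤ β → ‖F z‖ ≤ C) ∧
    ContinuousOn F {z : ℂ | 0 ≤ z.im ∧ z.im ≤ β} ∧
    DifferentiableOn ℂ F {z : ℂ | 0 < z.im ∧ z.im < β} ∧
    ∀ t : ℝ, F t = u t ∧ F (t + β * Complex.I) = v t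

lemma IsStripBoundary.zero (β : ℝ) : IsStripBoundary β (fun _ => 0) (fun _ => 0) :=
  ⟨fun _ => 0, ⟨0, by simp⟩, continuousOn_const, differentiableOn_const 0, by simp⟩

lemma IsStripBoundary.add {β : ℝ} {u v u' v' : ℝ → ℂ} (h : IsStripBoundary β u v)
    (h' : IsStripBoundary β u' v') :
    IsStripBoundary β (fun t => u t + u' t) (fun t => v t + v' t) := by
  obtain ⟨F, ⟨C, hC⟩, hc, hd, hF⟩ := h
  obtain ⟨F', ⟨C', hC'⟩, hc', hd', hF'⟩ := h'
  refine ⟨fun z => F z + F' z, ⟨C + C', fun z hz hz' =>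
    (norm_add_le _ _).trans (add_le_add (hC z hz hz') (hC' z hz hz'))⟩, hc.add hc', hd.add hd',
    fun t => ⟨?_, ?_⟩⟩
  · dsimp only
    rw [(hF t).1, (hF' t).1]
  · dsimp only
    rw [(hF t).2, (hF' t).2]

lemma IsStripBoundary.sum {β : ℝ} {ι : Type*} {s : Finset ι} {u v : ι → ℝ → ℂ}
    (h : ∀ i ∈ s, IsStripBoundary β (u i) (v i)) :
    IsStripBoundary β (fun t => ∑ i ∈ s, u i t) (fun t => ∑ i ∈ s, v i t) := by
  classical
  induction s using Finset.induction_on with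
  | empty => simpa using IsStripBoundary.zero β
  | insert i s hi ih =>
    simp only [Finset.sum_insert hi]
    exact (h i (Finset.mem_insert_self _ _)).add
      (ih fun j hj => h j (Finset.mem_insert_of_mem hj))

lemma isStripBoundary_phase {β d : ℝ} (hd : 0 < d) (c : ℂ) :
    IsStripBoundary β (fun t => phase d t * c)
      (fun t => phase d t * ((d ^ (-β) : ℝ) : ℂ) * c) := by
  refine ⟨fun z => (d : ℂ) ^ (z * Complex.I) * c, ⟨max 1 (d ^ (-β)) * ‖c‖, fun z hz hz' => ?_⟩,
    ((differentiable_cpow_I hd).continuous.mul continuous_const).continuousOn,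
    ((differentiable_cpow_I hd).mul_const _).differentiableOn, fun t => ⟨rfl, ?_⟩⟩
  · rw [norm_mul]
    gcongr
    exact norm_cpow_I_le hd hz hz'
  · dsimp only
    rw [cpow_add_beta hd]

/-- By Phragmén–Lindelöf a uniform estimate on the two edges holds on the whole strip. The
approximating functions are therefore uniformly Cauchy, and their limit is continuous, bounded, and
holomorphic inside. -/
lemma IsStripBoundary.limit {β : ℝ} (hβ : 0 < β) {u v : ℝ → ℂ} {un vn : ℕ → ℝ → ℂ} {δ : ℕ → ℝ}
    (hδ : Filter.Tendsto δ Filter.atTop (nhds 0)) (h : ∀ n, IsStripBoundary β (un n) (vn n))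
    (hu : ∀ n t, ‖un n t - u t‖ ≤ δ n) (hv : ∀ n t, ‖vn n t - v t‖ ≤ δ n) :
    IsStripBoundary β u v := by
  choose F hb hc hd hF using h
  have hdiff : ∀ n m, ∀ z ∈ {z : ℂ | 0 ≤ z.im ∧ z.im ≤ β}, dist (F n z) (F m z) ≤ δ n + δ m := by
    intro n m z hz
    obtain ⟨C, hC⟩ := hb n
    obtain ⟨C', hC'⟩ := hb m
    rw [dist_eq_norm]
    have tri : ∀ {a b c : ℂ} {x y : ℝ}, ‖a - c‖ ≤ x → ‖b - c‖ ≤ y → ‖a - b‖ ≤ x + y := by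
      intro a b c x y hx hy
      rw [← norm_sub_rev c] at hy
      exact (norm_sub_le_norm_sub_add_norm_sub a c b).trans (add_le_add hx hy)
    refine norm_le_of_strip hβ (F := fun z => F n z - F m z) (C := C + C') ?_ ((hc n).sub (hc m))
      ((hd n).sub (hd m)) ?_ ?_ hz.1 hz.2
    · exact fun w hw hw' => (norm_sub_le _ _).trans (add_le_add (hC w hw hw') (hC' w hw hw'))
    · intro t
      rw [(hF n t).1, (hF m t).1]
      exact tri (hu n t) (hu m t)
    · intro t
      rw [(hF n t).2, (hF m t).2]
      exact tri (hv n t) (hv m t)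
  have hcau : UniformCauchySeqOn F Filter.atTop {z : ℂ | 0 ≤ z.im ∧ z.im ≤ β} := by
    rw [Metric.uniformCauchySeqOn_iff]
    intro ε hε
    obtain ⟨N, hN⟩ := Filter.eventually_atTop.1 (hδ.eventually_lt_const (half_pos hε))
    refine ⟨N, fun m hm n hn z hz => (hdiff m n z hz).trans_lt ?_⟩
    linarith [hN m hm, hN n hn]
  have hlim : ∀ z : ℂ, ∃ w, z ∈ {z : ℂ | 0 ≤ z.im ∧ z.im ≤ β} →
      Filter.Tendsto (fun n => F n z) Filter.atTop (nhds w) := by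
    intro z
    by_cases hz : z ∈ {z : ℂ | 0 ≤ z.im ∧ z.im ≤ β}
    · obtain ⟨w, hw⟩ := cauchySeq_tendsto_of_complete (hcau.cauchySeq hz)
      exact ⟨w, fun _ => hw⟩
    · exact ⟨0, fun h => absurd h hz⟩
  choose H hH using hlim
  have hunif := hcau.tendstoUniformlyOn_of_tendsto fun z hz => hH z hz
  refine ⟨H, ?_, hunif.continuousOn (Filter.Frequently.of_forall hc), ?_, fun t => ⟨?_, ?_⟩⟩
  · obtain ⟨N, hN⟩ := Filter.eventually_atTop.1 (Metric.tendstoUniformlyOn_iff.1 hunif 1 one_pos)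
    obtain ⟨C, hC⟩ := hb N
    refine ⟨1 + C, fun z hz hz' => ?_⟩
    have h1 := (hN N le_rfl z ⟨hz, hz'⟩).le
    rw [dist_eq_norm] at h1
    calc ‖H z‖ = ‖(H z - F N z) + F N z‖ := by rw [sub_add_cancel]
      _ ≤ _ := (norm_add_le _ _).trans (add_le_add h1 (hC z hz hz'))
  · have ho : IsOpen {z : ℂ | 0 < z.im ∧ z.im < β} :=
      (isOpen_lt continuous_const Complex.continuous_im).inter
        (isOpen_lt Complex.continuous_im continuous_const)
    exact (hunif.mono fun z hz => ⟨hz.1.le, hz.2.le⟩).tendstoLocallyUniformlyOn.differentiableOn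
      (.of_forall hd) ho
  · refine tendsto_nhds_unique (hH t ⟨by simp, by simpa using hβ.le⟩) ?_
    simp only [(hF _ t).1]
    exact tendsto_iff_norm_sub_tendsto_zero.2
      (squeeze_zero (fun _ => norm_nonneg _) (fun n => hu n t) hδ)
  · refine tendsto_nhds_unique (hH _ ⟨by simpa using hβ.le, by simp⟩) ?_
    simp only [(hF _ t).2]
    exact tendsto_iff_norm_sub_tendsto_zero.2
      (squeeze_zero (fun _ => norm_nonneg _) (fun n => hv n t) hδ)

lemma norm_sigma_le (t : ℝ) (a : A) : ‖sigma t a‖ ≤ ‖a‖ := by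
  change ‖ambientEvolution t a.1‖ ≤ ‖a.1‖
  exact lp.norm_le_of_forall_le (norm_nonneg _) fun y =>
    (norm_conj_le _ _ _).trans (a.1.norm_apply_le y)

lemma norm_map_mul_sub_le {B : Type*} [NonUnitalCStarAlgebra B] (φ : B →L[ℂ] ℂ) (a b c : B) :
    ‖φ (a * b) - φ (a * c)‖ ≤ ‖φ‖ * ‖a‖ * ‖b - c‖ ∧
      ‖φ (b * a) - φ (c * a)‖ ≤ ‖φ‖ * ‖a‖ * ‖b - c‖ := by
  constructor
  · rw [← map_sub, ← mul_sub, mul_assoc]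
    exact (φ.le_opNorm _).trans (by gcongr; exact norm_mul_le _ _)
  · rw [← map_sub, ← sub_mul, mul_assoc, mul_comm ‖a‖]
    exact (φ.le_opNorm _).trans (by gcongr; exact norm_mul_le _ _)

/-- The kernel is a finite sum of homogeneous ones, for each of which d^{iz} φ(a F) is the required
function. -/
lemma Twisted.isStripBoundary_kA {β : ℝ} {φ : A →L[ℂ] ℂ} (h : Twisted β φ) (a : A)
    {F : G → AfH → ℂ} (hF : IsKer F) :
    IsStripBoundary β (fun t => φ (a * sigma t (kA F hF))) (fun t => φ (sigma t (kA F hF) * a)) := by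
  classical
  obtain ⟨S, hS⟩ := hF.exists_dets
  have hsum : kA F hF = ∑ d ∈ S, kA _ (hF.detPart d) := by
    rw [← kA_sum (fun d => hF.detPart d) (IsKer.sum fun d _ => hF.detPart d)]
    refine kA_congr ?_
    funext g y
    exact (sum_detPart hS g y).symm
  have hσ : ∀ t, sigma t (kA F hF) = ∑ d ∈ S, phase d t • kA _ (hF.detPart d) := by
    intro t
    rw [hsum, map_sum]
    exact Finset.sum_congr rfl fun d _ => sigma_kA _ (fun g y => detPart_ne) t
  have key : IsStripBoundary β (fun t => ∑ d ∈ S, phase d t * φ (a * kA _ (hF.detPart d)))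
      (fun t => ∑ d ∈ S, phase d t * φ (kA _ (hF.detPart d) * a)) := by
    refine IsStripBoundary.sum fun d _ => ?_
    by_cases hd : 0 < d
    · have := isStripBoundary_phase (β := β) hd (φ (a * kA _ (hF.detPart d)))
      simp only [mul_assoc] at this
      rw [← h _ (hF.detPart d) d hd (fun g y => detPart_ne) a] at this
      exact this
    · have h0 : kA _ (hF.detPart d) = 0 := by
        rw [← kA_zero IsKer.zero]
        refine kA_congr ?_
        funext g y
        by_contra hne
        exact hd (detPart_ne hne ▸ detR_pos g)
      simp only [h0, mul_zero, zero_mul, map_zero]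
      exact IsStripBoundary.zero β
  convert key using 2 with t t
  · rw [hσ, Finset.mul_sum, map_sum]
    simp only [mul_smul_comm, map_smul, smul_eq_mul]
  · rw [hσ, Finset.sum_mul, map_sum]
    simp only [smul_mul_assoc, map_smul, smul_eq_mul]

/-- Approximate b by kernels; since σ_t does not increase norms, the boundary values converge
uniformly in t. -/
lemma Twisted.isKMS {β : ℝ} (hβ : 0 < β) {φ : A →L[ℂ] ℂ} (h : Twisted β φ) :
    IsKMS (fun t (a : A) => sigma t a) β φ := by
  intro a b
  change IsStripBoundary β (fun t => φ (a * sigma t b)) (fun t => φ (sigma t b * a))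
  obtain ⟨f, hf⟩ := exists_seq_strictAnti_tendsto (0 : ℝ)
  have hex : ∀ n, ∃ g : CcZ, dist b (toA g) < f n := fun n =>
    denseRange_toA.exists_dist_lt b (hf.2.1 n)
  choose g hg using hex
  refine IsStripBoundary.limit hβ (un := fun n t => φ (a * sigma t (toA (g n))))
    (vn := fun n t => φ (sigma t (toA (g n)) * a)) (δ := fun n => ‖φ‖ * ‖a‖ * f n) ?_ (fun n => ?_)
    (fun n t => ?_) fun n t => ?_
  · simpa using hf.2.2.const_mul (‖φ‖ * ‖a‖)
  · simp only [toA_eq_kA]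
    exact h.isStripBoundary_kA a _
  all_goals
    have h1 : ‖sigma t (toA (g n)) - sigma t b‖ ≤ f n := by
      rw [← map_sub]
      refine (norm_sigma_le _ _).trans ?_
      rw [← dist_eq_norm, dist_comm]
      exact (hg n).le
  · exact (norm_map_mul_sub_le φ a _ _).1.trans (by gcongr)
  · exact (norm_map_mul_sub_le φ a _ _).2.trans (by gcongr)

/-! ### Hermite normal forms and the partition function -/

/-- The indices of the Hermite normal forms `(a + 1, b; 0, d + 1)`, `b ≤ d`. -/
abbrev HNF : Type := Σ p : ℕ × ℕ, Fin (p.2 + 1)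

/-- The Hermite normal form with a given index. -/
def hnfMat (x : HNF) : Matrix (Fin 2) (Fin 2) ℤ := !![x.1.1 + 1, (x.2 : ℕ); 0, x.1.2 + 1]

lemma hnfMat_det (x : HNF) : (hnfMat x).det = (x.1.1 + 1) * (x.1.2 + 1) := by
  rw [hnfMat, Matrix.det_fin_two_of, mul_zero, sub_zero]

lemma hnfMat_det_pos (x : HNF) : 0 < (hnfMat x).det := by
  rw [hnfMat_det]
  positivity

/-- The class of a Hermite normal form. -/
def hnf (x : HNF) : Cosets M2Zplus :=
  Quotient.mk _ ⟨ofInt (hnfMat x) (hnfMat_det_pos x), ofInt_mem _ _⟩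

lemma cosetDet_hnf (x : HNF) : cosetDet (hnf x) = ((x.1.1 : ℝ) + 1) * ((x.1.2 : ℝ) + 1) := by
  change detR (ofInt (hnfMat x) (hnfMat_det_pos x)) = _
  rw [detR_ofInt, hnfMat_det]
  push_cast
  rfl

lemma iota_mul_ofInt (s : SL(2, ℤ)) (m : Matrix (Fin 2) (Fin 2) ℤ) (h : 0 < m.det)
    (h' : 0 < (s.1 * m).det) : iota s * ofInt m h = ofInt (s.1 * m) h' := by
  refine G_ext fun i j => ?_
  rw [ofInt_apply, Matrix.mul_apply]
  push_cast
  change ((iota s).1.1 * (ofInt m h).1.1) i j = _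
  rw [Matrix.mul_apply]
  rfl

/-- An element of SL₂(ℤ) relating two such matrices is upper triangular with diagonal entries 1, and
the bound on the upper right entry excludes a nontrivial shift. -/
lemma hnf_injective : Function.Injective hnf := by
  intro x x' h
  obtain ⟨γ, hγ, e⟩ := Quotient.exact h
  obtain ⟨s, rfl⟩ := mem_Gam.1 hγ
  dsimp only at e
  have h' : 0 < (s.1 * hnfMat x).det := by
    rw [Matrix.det_mul, s.2, one_mul]
    exact hnfMat_det_pos x
  rw [iota_mul_ofInt s _ _ h'] at e
  have e' : ∀ i j, hnfMat x' i j = (s.1 * hnfMat x) i j := fun i j => by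
    have := congrArg (fun g : G => g.1.1 i j) e
    simpa only [ofInt_apply, Int.cast_inj] using this
  have hd := s.2
  rw [Matrix.det_fin_two] at hd
  obtain ⟨⟨a, d⟩, b, hb⟩ := x
  obtain ⟨⟨a', d'⟩, b', hb'⟩ := x'
  have e00 := e' 0 0
  have e01 := e' 0 1
  have e10 := e' 1 0
  have e11 := e' 1 1
  simp only [hnfMat, Matrix.mul_apply, Fin.sum_univ_two, Matrix.of_apply, Matrix.cons_val',
    Matrix.cons_val_zero, Matrix.cons_val_one, Matrix.cons_val_fin_one, mul_zero, add_zero]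
    at e00 e01 e10 e11
  have hc : s.1 1 0 = 0 := by
    rcases mul_eq_zero.1 e10.symm with h | h
    · exact h
    · omega
  rw [hc, mul_zero, sub_zero] at hd
  have hs : s.1 0 0 = 1 := by
    rcases Int.eq_one_or_neg_one_of_mul_eq_one hd with h | h
    · exact h
    · rw [h] at e00; omega
  rw [hs, one_mul] at hd e00 e01
  rw [hc, zero_mul, zero_add, hd, one_mul] at e11
  have ha : a = a' := by omega
  have hdd : d = d' := by omega
  subst ha hdd
  have hbb : b = b' := by
    dsimp only at hb hb'
    have h0 : s.1 0 1 = 0 := by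
      by_contra h0
      rcases lt_or_gt_of_ne h0 with h1 | h1
      · nlinarith [mul_le_mul_of_nonneg_right (show s.1 0 1 ≤ -1 by omega)
          (show (0 : ℤ) ≤ (d : ℤ) + 1 by positivity)]
      · nlinarith [mul_le_mul_of_nonneg_right (show 1 ≤ s.1 0 1 by omega)
          (show (0 : ℤ) ≤ (d : ℤ) + 1 by positivity)]
    rw [h0, zero_mul, add_zero] at e01
    exact_mod_cast e01.symm
  subst hbb
  rfl

lemma hnf_surjective : Function.Surjective hnf := by
  intro x
  refine Quotient.inductionOn x ?_
  rintro ⟨g, hg⟩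
  obtain ⟨m, hm, rfl⟩ := exists_ofInt hg
  have hdet : 0 < m 0 0 * m 1 1 - m 0 1 * m 1 0 := by rwa [← Matrix.det_fin_two]
  have hne : m 0 0 ≠ 0 ∨ m 1 0 ≠ 0 := by
    by_contra! h
    rw [h.1, h.2] at hdet
    simp at hdet
  set n : ℤ := (Int.gcd (m 0 0) (m 1 0) : ℤ) with hn
  have hn0 : 0 < n := Int.natCast_pos.2 (Int.gcd_pos_iff.2 hne)
  obtain ⟨c, hc⟩ : n ∣ m 0 0 := Int.gcd_dvd_left ..
  obtain ⟨c', hc'⟩ : n ∣ m 1 0 := Int.gcd_dvd_right ..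
  set u := Int.gcdA (m 0 0) (m 1 0)
  set v := Int.gcdB (m 0 0) (m 1 0)
  have hbez : c * u + c' * v = 1 := by
    have h := Int.gcd_eq_gcd_ab (m 0 0) (m 1 0)
    rw [← hn] at h
    have : n * (c * u + c' * v) = n * 1 := by
      rw [mul_one]; conv_rhs => rw [h]
      change _ = m 0 0 * u + m 1 0 * v
      rw [hc, hc']; ring
    exact mul_left_cancel₀ hn0.ne' this
  set d := c * m 1 1 - c' * m 0 1
  have hd : 0 < d := by
    have : n * d = m 0 0 * m 1 1 - m 0 1 * m 1 0 := by rw [hc, hc']; ring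
    rw [← this] at hdet
    exact pos_of_mul_pos_right hdet hn0.le
  set b0 := u * m 0 1 + v * m 1 1
  set q := b0 / d
  have hb0 : 0 ≤ b0 % d := Int.emod_nonneg _ hd.ne'
  have hb1 : b0 % d < d := Int.emod_lt_of_pos _ hd
  have hb2 : b0 % d = b0 - d * q := Int.emod_def _ _
  -- Bézout coefficients of the first column put its gcd in the corner and 0 below; subtracting q
  -- times the second row reduces the upper right entry modulo d.
  let s : SL(2, ℤ) := ⟨!![u + q * c', v - q * c; -c', c], by
    rw [Matrix.det_fin_two_of]; linear_combination hbez⟩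
  have e : s.1 * m = !![n, b0 % d; 0, d] := by
    ext i j
    fin_cases i <;> fin_cases j <;>
      simp only [s, Matrix.mul_apply, Fin.sum_univ_two, Matrix.of_apply, Matrix.cons_val',
        Matrix.cons_val_zero, Matrix.cons_val_one, Matrix.cons_val_fin_one, Fin.zero_eta,
        Fin.mk_one, Fin.isValue]
    · rw [hc, hc']; linear_combination n * hbez
    · rw [hb2]; ring
    · rw [hc, hc']; ring
    · ring
  refine ⟨⟨((n - 1).toNat, (d - 1).toNat), ⟨(b0 % d).toNat, by dsimp only; omega⟩⟩, ?_⟩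
  symm
  refine Quotient.sound ⟨iota s, iota_mem s, ?_⟩
  have h' : 0 < (s.1 * m).det := by
    rw [Matrix.det_mul, s.2, one_mul]
    exact hm
  rw [iota_mul_ofInt s _ _ h']
  refine G_ext fun i j => ?_
  rw [ofInt_apply, ofInt_apply, e, Int.cast_inj]
  have h1 : ((n - 1).toNat : ℤ) + 1 = n := by omega
  have h2 : ((d - 1).toNat : ℤ) + 1 = d := by omega
  have h3 : ((b0 % d).toNat : ℤ) = b0 % d := by omega
  unfold hnfMat
  dsimp only
  rw [h1, h2, h3]

/-- The bijection between Hermite normal forms and `Γ \ M₂(ℤ)⁺`. -/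
def hnfEquiv : HNF ≃ Cosets M2Zplus := Equiv.ofBijective hnf ⟨hnf_injective, hnf_surjective⟩

lemma hasSum_zeta {s : ℝ} (hs : 1 < s) :
    HasSum (fun n : ℕ => (((n : ℝ) + 1) ^ (-s) : ℝ)) (riemannZeta s).re ∧
      ((riemannZeta s).re : ℂ) = riemannZeta s := by
  have h1 : Summable fun n : ℕ => (((n : ℝ) + 1) ^ (-s) : ℝ) := by
    have := (summable_nat_add_iff (f := fun n : ℕ => ((n : ℝ) ^ (-s) : ℝ)) 1).2
      (Real.summable_nat_rpow.2 (by linarith))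
    simpa using this
  have h2 : ((∑' n : ℕ, (((n : ℝ) + 1) ^ (-s) : ℝ) : ℝ) : ℂ) = riemannZeta s := by
    rw [zeta_eq_tsum_one_div_nat_add_one_cpow (by simpa using hs), Complex.ofReal_tsum]
    refine tsum_congr fun n => ?_
    rw [Complex.ofReal_cpow (by positivity), Complex.ofReal_neg, Complex.cpow_neg, one_div]
    push_cast
    rfl
  rw [← h2, Complex.ofReal_re]
  exact ⟨h1.hasSum, rfl⟩

/-- The partition function `ζ(β) ζ(β - 1)` as a real number. -/
def partZ (β : ℝ) : ℝ := (riemannZeta β).re * (riemannZeta (β - 1)).re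

lemma ofReal_partZ {β : ℝ} (hβ : 2 < β) :
    (partZ β : ℂ) = riemannZeta β * riemannZeta (β - 1) := by
  have h1 := (hasSum_zeta (s := β) (by linarith)).2
  have h2 := (hasSum_zeta (s := β - 1) (by linarith)).2
  push_cast at h2
  rw [partZ, Complex.ofReal_mul, h1, h2]

/-- For diagonal entries a and d there are d Hermite normal forms, so the sum of (ad)^{-β} d factors
into ζ(β) and ζ(β - 1). -/
lemma hasSum_partZ {β : ℝ} (hβ : 2 < β) :
    HasSum (fun x : Cosets M2Zplus => cosetDet x ^ (-β)) (partZ β) := by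
  rw [← hnfEquiv.hasSum_iff]
  have e : (fun x : Cosets M2Zplus => cosetDet x ^ (-β)) ∘ hnfEquiv =
      fun x : HNF => ((x.1.1 : ℝ) + 1) ^ (-β) * ((x.1.2 : ℝ) + 1) ^ (-β) := by
    funext x
    change cosetDet (hnf x) ^ (-β) = _
    rw [cosetDet_hnf, Real.mul_rpow (by positivity) (by positivity)]
  rw [e]
  have h1 := (hasSum_zeta (s := β) (by linarith)).1
  have h2 := (hasSum_zeta (s := β - 1) (by linarith)).1
  have h3 := h1.mul h2
    (h1.summable.mul_of_nonneg h2.summable (fun _ => by positivity) fun _ => by positivity)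
  push_cast at h3
  have inner : ∀ p : ℕ × ℕ, HasSum
      (fun _ : Fin (p.2 + 1) => ((p.1 : ℝ) + 1) ^ (-β) * ((p.2 : ℝ) + 1) ^ (-β))
      (((p.1 : ℝ) + 1) ^ (-β) * ((p.2 : ℝ) + 1) ^ (-(β - 1))) := by
    intro p
    have h := hasSum_fintype
      (fun _ : Fin (p.2 + 1) => ((p.1 : ℝ) + 1) ^ (-β) * ((p.2 : ℝ) + 1) ^ (-β))
    convert h using 1
    rw [Finset.sum_const, Finset.card_univ, Fintype.card_fin, nsmul_eq_mul, neg_sub, sub_eq_add_neg,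
      Real.rpow_add (by positivity), Real.rpow_one]
    push_cast
    ring
  refine HasSum.sigma_of_hasSum h3 inner ?_
  refine (summable_sigma_of_nonneg fun _ => by positivity).2 ⟨fun p => (inner p).summable, ?_⟩
  simp only [(inner _).tsum_eq]
  exact h3.summable

lemma partZ_pos {β : ℝ} (hβ : 2 < β) : 0 < partZ β := by
  have h := hasSum_partZ hβ
  have h1 := le_hasSum h (Quotient.mk _ ⟨1, (mem_Gam_iff.1 (one_mem _)).1⟩) fun x _ =>
    (Real.rpow_pos_of_pos (cosetDet_pos x) _).le
  refine lt_of_lt_of_le ?_ h1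
  exact Real.rpow_pos_of_pos (cosetDet_pos _) _

/-- The convergent sum of Det⁻³ has only finitely many terms that are at least J⁻³. -/
lemma finite_cosetDet_le (J : ℝ) : {x : Cosets M2Zplus | cosetDet x ≤ J}.Finite := by
  have h := (hasSum_partZ (β := 3) (by norm_num)).summable.tendsto_cofinite_zero
  rcases lt_or_ge J 1 with hJ | hJ
  · refine Set.Finite.subset Set.finite_empty fun x hx => ?_
    refine Quotient.inductionOn x (fun g hg => ?_) hx
    exact absurd (one_le_detR g.2) (not_le.2 (lt_of_le_of_lt hg hJ))
  · have h1 := h.eventually_lt_const (Real.rpow_pos_of_pos (zero_lt_one.trans_le hJ) (-3))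
    rw [Filter.eventually_cofinite] at h1
    refine h1.subset fun x (hx : cosetDet x ≤ J) => not_lt.2 ?_
    exact Real.rpow_le_rpow_of_nonpos (cosetDet_pos x) hx (by norm_num)

lemma finite_rc_M2Zplus (J : ℝ) : {x : RC | ∃ g ∈ M2Zplus, detR g ≤ J ∧ x = rc g}.Finite := by
  refine ((finite_cosetDet_le J).image toRC).subset ?_
  rintro x ⟨g, hg, hJ, rfl⟩
  exact ⟨Quotient.mk _ ⟨g, hg⟩, hJ, rfl⟩

/-! ### Points whose determinant is a unit at small primes -/

/-- The points `(ρ, τ)` of `Y` such that no prime `p ≤ J` divides `Det ρ`. -/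
def YJ (J : ℕ) : Set AfH := {y | y ∈ Y ∧ ∀ p : ℕ, p.Prime → p ≤ J → ¬ Dvd p y.1.det}

/-- The points `(ρ, τ)` of `Y` such that `ρ` is invertible. -/
def Y0 : Set AfH := {y | y ∈ Y ∧ ∀ p : ℕ, p.Prime → ¬ Dvd p y.1.det}

lemma det_smul (g : G) (y : AfH) : (g • y).1.det = qA g.1.1.det * y.1.det := by
  rw [smul_fst, Matrix.det_mul]
  congr 1
  exact (RingHom.map_det _ _).symm

lemma det_smul_of_mem {γ : G} (hγ : γ ∈ Gam) (y : AfH) : (γ • y).1.det = y.1.det := by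
  obtain ⟨s, rfl⟩ := hγ
  rw [det_smul]
  have : ((Matrix.SpecialLinearGroup.toGLPos.comp
    (Matrix.SpecialLinearGroup.map (n := Fin 2) (Int.castRingHom ℚ))) s).1.1.det = 1 :=
    (Matrix.SpecialLinearGroup.map (n := Fin 2) (Int.castRingHom ℚ) s).2
  rw [this, map_one, one_mul]

lemma mem_YJ {J : ℕ} {y : AfH} :
    y ∈ YJ J ↔ y ∈ Y ∧ ∀ p : ℕ, p.Prime → p ≤ J → ¬ Dvd p y.1.det := Iff.rfl

lemma YJ_anti {J K : ℕ} (h : J ≤ K) {y : AfH} (hy : y ∈ YJ K) : y ∈ YJ J :=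
  ⟨hy.1, fun p hp hpJ => hy.2 p hp (hpJ.trans h)⟩

lemma mem_Y0_iff {y : AfH} : y ∈ Y0 ↔ ∀ J, y ∈ YJ J :=
  ⟨fun h _ => ⟨h.1, fun p hp _ => h.2 p hp⟩, fun h => ⟨(h 0).1, fun p hp => (h p).2 p hp le_rfl⟩⟩

lemma smul_mem_YJ_iff {γ : G} (hγ : γ ∈ Gam) (J : ℕ) (y : AfH) : γ • y ∈ YJ J ↔ y ∈ YJ J := by
  change γ • y ∈ Y ∧ _ ↔ y ∈ Y ∧ _
  rw [Gam_smul_mem_iff hγ, det_smul_of_mem hγ]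

lemma isClopen_YJ (J : ℕ) : IsClopen (YJ J) := by
  have hc : Continuous fun y : AfH => y.1.det := continuous_fst.matrix_det
  have h : YJ J = Y ∩ ⋂ p ∈ (Finset.range (J + 1)).filter Nat.Prime,
      ((fun y : AfH => y.1.det) ⁻¹' {a | Dvd p a})ᶜ := by
    ext y
    rw [Set.mem_inter_iff, Set.mem_iInter₂, mem_YJ]
    refine and_congr_right fun _ => ⟨fun h p hp => ?_, fun h p h1 h2 => ?_⟩
    · rw [Finset.mem_filter, Finset.mem_range, Nat.lt_succ_iff] at hp
      exact h p hp.2 hp.1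
    · refine h p ?_
      rw [Finset.mem_filter, Finset.mem_range, Nat.lt_succ_iff]
      exact ⟨h2, h1⟩
  rw [h]
  exact isClopen_Y.inter (isClopen_biInter_finset fun p _ => ((isClopen_Dvd p).preimage hc).compl)

lemma det_mem {y : AfH} (hy : y ∈ Y) : y.1.det ∈ R := by
  rw [Matrix.det_fin_two, sub_eq_add_neg]
  exact R_add (R_mul (hy _ _) (hy _ _)) (RSub.neg_mem (R_mul (hy _ _) (hy _ _)))

/-- Multiply gρ by the adjugate of ρ: the denominators of g are bounded by det ρ. -/
lemma det_mul_entry_mem {y : AfH} (hy : y ∈ Y) {g : G} (hg : g • y ∈ Y) (i j : Fin 2) :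
    y.1.det * qA (g.1.1 i j) ∈ R := by
  have h : (g • y).1 * y.1.adjugate = y.1.det • (g.1.1.map qA) := by
    rw [smul_fst, Matrix.mul_assoc, Matrix.mul_adjugate, Matrix.mul_smul, Matrix.mul_one]
  have h2 : ((g • y).1 * y.1.adjugate) i j = y.1.det * qA (g.1.1 i j) := by
    rw [h]; rfl
  rw [← h2, Matrix.mul_apply, Fin.sum_univ_two]
  have hadj : ∀ k, y.1.adjugate k j ∈ R := by
    intro k
    rw [Matrix.adjugate_fin_two]
    fin_cases k <;> fin_cases j
    · exact hy _ _
    · exact RSub.neg_mem (hy _ _)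
    · exact RSub.neg_mem (hy _ _)
    · exact hy _ _
  exact R_add (R_mul (hg _ _) (hadj _)) (R_mul (hg _ _) (hadj _))

/-- Elements of `GL₂⁺(ℚ)` that map a point to `Y` are integral when their denominators are prime
to the determinant. -/
lemma mem_M2Zplus_of_YJ {J : ℕ} {y : AfH} (hy : y ∈ YJ J) {g : G} (hg : g • y ∈ Y) {N : ℕ}
    (hN : (0 : ℚ) < N) (hN' : scal N hN * g ∈ M2Zplus) (hp : ∀ p : ℕ, p.Prime → p ∣ N → p ≤ J) :
    g ∈ M2Zplus := by
  obtain ⟨m, hm⟩ := hN'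
  have key : ∀ i j, qA (g.1.1 i j) ∈ R := by
    intro i j v
    obtain ⟨p, hpp, rfl⟩ := exists_eq_pv v
    rw [HeightOneSpectrum.mem_adicCompletionIntegers]
    -- At primes dividing N the determinant of ρ is a unit and bounds the denominators of g; at the
    -- others N is a unit and N g is integral.
    by_cases hpN : p ∣ N
    · have h1 := hy.2 p hpp (hp p hpp hpN)
      rw [dvd_prime_iff hpp (det_mem hy.1)] at h1
      have h2 := det_mul_entry_mem hy.1 hg i j (pv p hpp)
      rw [HeightOneSpectrum.mem_adicCompletionIntegers, Af_mul_apply, map_mul] at h2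
      have h3 := det_mem hy.1 (pv p hpp)
      rw [HeightOneSpectrum.mem_adicCompletionIntegers] at h3
      rwa [le_antisymm h3 (not_lt.1 h1), one_mul] at h2
    · have h1 := R_int (m i j) (pv p hpp)
      rw [← hm, scal_mul_apply, map_mul, HeightOneSpectrum.mem_adicCompletionIntegers,
        Af_mul_apply, map_mul] at h1
      have h2 : Valued.v ((qA (N : ℚ)) (pv p hpp)) = 1 := by
        rw [valued_qA]
        have h := (pv p hpp).valuation_of_algebraMap (K := ℚ) (N : ℤ)
        simp only [eq_intCast, Int.cast_natCast] at h
        rw [h]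
        refine HeightOneSpectrum.intValuation_eq_one_iff.2 ?_
        change (N : ℤ) ∉ Ideal.span {(p : ℤ)}
        rw [Ideal.mem_span_singleton]
        exact_mod_cast hpN
      rwa [h2, one_mul] at h1
  have key2 : ∀ i j, ∃ n : ℤ, g.1.1 i j = n := fun i j => qA_mem_iff.1 (key i j)
  choose n hn using key2
  exact ⟨Matrix.of n, fun i j => hn i j⟩

lemma mem_M2Zplus_of_Y0 {y : AfH} (hy : y ∈ Y0) {g : G} : g • y ∈ Y ↔ g ∈ M2Zplus := by
  refine ⟨fun h => ?_, fun h => M2Zplus_smul_mem h hy.1⟩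
  obtain ⟨N, hN, hN'⟩ := exists_scal_mul_mem g
  exact mem_M2Zplus_of_YJ (mem_Y0_iff.1 hy N) h hN hN' fun p _ hp =>
    Nat.le_of_dvd (by exact_mod_cast hN) hp

/-- The matrix k · h g⁻¹ is integral, k h being the adjugate of h⁻¹, and h g⁻¹ maps a point of `YJ
J` into `Y` with k ≤ J, so h g⁻¹ is integral. By symmetry so is its inverse, and both have
determinant 1. -/
lemma mem_Gam_of_YJ {J j k : ℕ} {y : AfH} {g h : G} (hg : g⁻¹ ∈ Mset j) (hh : h⁻¹ ∈ Mset k)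
    (hj : j ≤ J) (hk : k ≤ J) (h1 : g • y ∈ YJ J) (h2 : h • y ∈ YJ J) : h * g⁻¹ ∈ Gam := by
  have aux : ∀ {j k : ℕ} {g h : G}, g⁻¹ ∈ Mset j → h⁻¹ ∈ Mset k → k ≤ J → g • y ∈ YJ J →
      h • y ∈ YJ J → h * g⁻¹ ∈ M2Zplus := by
    intro j k g h hg hh hk h1 h2
    have hk0 : 0 < k := by
      have := detR_pos h⁻¹
      rw [hh.2] at this
      exact_mod_cast this
    have hk' : (0 : ℚ) < k := by exact_mod_cast hk0
    refine mem_M2Zplus_of_YJ h1 (N := k) ?_ hk' ?_ fun p _ hp => (Nat.le_of_dvd hk0 hp).trans hk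
    · rw [smul_smul, inv_mul_cancel_right]
      exact h2.1
    · rw [← mul_assoc]
      have := scal_mul_inv_mem hk' hh
      rw [inv_inv] at this
      exact M2Zplus_mul this.1 hg.1
  have ha := aux hg hh hk h1 h2
  have hb := aux hh hg hj h2 h1
  refine mem_Gam_iff.2 ⟨ha, le_antisymm ?_ (one_le_detR ha)⟩
  have e : detR (h * g⁻¹) * detR (g * h⁻¹) = 1 := by
    rw [← detR_mul, ← detR_one]
    congr 1
    group
  nlinarith [one_le_detR hb, detR_pos (h * g⁻¹)]

lemma int_dvd_of_Dvd {p : ℕ} (hp : p ≠ 0) {n : ℤ} (h : Dvd p (qA n)) : (p : ℤ) ∣ n := by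
  unfold Dvd at h
  rw [← map_mul, qA_mem_iff] at h
  obtain ⟨k, hk⟩ := h
  refine ⟨k, ?_⟩
  have hp' : (p : ℚ) ≠ 0 := by exact_mod_cast hp
  have : (n : ℚ) = p * k := by rw [← hk, mul_inv_cancel_left₀ hp']
  exact_mod_cast this

lemma Dvd_of_int_dvd {p : ℕ} {n : ℤ} (h : (p : ℤ) ∣ n) : Dvd p (qA n) := by
  rcases Nat.eq_zero_or_pos p with rfl | hp
  · unfold Dvd
    simp only [Nat.cast_zero, inv_zero, map_zero, zero_mul]
    exact RSub.zero_mem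
  obtain ⟨k, rfl⟩ := h
  have hp' : (p : ℚ) ≠ 0 := by exact_mod_cast hp.ne'
  unfold Dvd
  rw [Int.cast_mul, Int.cast_natCast, map_mul, qA_inv_mul_cancel hp']
  exact R_int k

/-- A singular matrix over 𝔽_p has a nonzero left kernel vector. A coprime lift comes from a column
that is nonzero modulo p, turned by a right angle and divided by its gcd. -/
lemma exists_coprime_row {p : ℕ} (hp : p.Prime) (n : Matrix (Fin 2) (Fin 2) ℤ)
    (h : (p : ℤ) ∣ n.det) : ∃ c d : ℤ, IsCoprime c d ∧ ∀ j, (p : ℤ) ∣ c * n 0 j + d * n 1 j := by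
  have hpi := Nat.prime_iff_prime_int.1 hp
  rw [Matrix.det_fin_two] at h
  by_cases hn : ∀ i j, (p : ℤ) ∣ n i j
  · exact ⟨1, 0, isCoprime_one_left, fun j => by simpa using hn 0 j⟩
  push Not at hn
  have hj : ∃ j, ¬ ((p : ℤ) ∣ n 0 j ∧ (p : ℤ) ∣ n 1 j) := by
    obtain ⟨i, j, hij⟩ := hn
    refine ⟨j, fun h => hij ?_⟩
    fin_cases i
    · exact h.1
    · exact h.2
  obtain ⟨j, hj⟩ := hj
  have hne : ¬ (n 0 j = 0 ∧ n 1 j = 0) := fun h0 => hj (by rw [h0.1, h0.2]; simp)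
  have hg0 : 0 < Int.gcd (n 0 j) (n 1 j) := Int.gcd_pos_iff.2 (by tauto)
  obtain ⟨g, c, d, hg, hco, h0, h1⟩ := Int.exists_gcd_one' hg0
  have hpg : ¬ (p : ℤ) ∣ g := fun h => hj ⟨h0 ▸ h.mul_left _, h1 ▸ h.mul_left _⟩
  refine ⟨d, -c, ?_, fun k => ?_⟩
  · exact ((Int.isCoprime_iff_gcd_eq_one.2 hco).symm).neg_right
  · have h2 : (p : ℤ) ∣ g * (d * n 0 k + -c * n 1 k) := by
      have e : (g : ℤ) * (d * n 0 k + -c * n 1 k) = n 1 j * n 0 k - n 0 j * n 1 k := by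
        rw [h0, h1]; ring
      rw [e]
      fin_cases j <;> fin_cases k <;> dsimp only [Fin.zero_eta, Fin.mk_one, Fin.isValue]
      · rw [mul_comm, sub_self]; exact dvd_zero _
      · rw [show n 1 0 * n 0 1 - n 0 0 * n 1 1 = -(n 0 0 * n 1 1 - n 0 1 * n 1 0) by ring]
        exact h.neg_right
      · rw [show n 1 1 * n 0 0 - n 0 1 * n 1 0 = n 0 0 * n 1 1 - n 0 1 * n 1 0 by ring]
        exact h
      · rw [mul_comm, sub_self]; exact dvd_zero _
    exact (hpi.dvd_or_dvd h2).resolve_left hpg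

/-- Since R/pR = ℤ/p, the matrix may be replaced by an integral one congruent to it modulo p. -/
lemma exists_row_of_Dvd {p : ℕ} (hp : p.Prime) {B : Matrix (Fin 2) (Fin 2) Af}
    (hB : ∀ i j, B i j ∈ R) (h : Dvd p B.det) :
    ∃ c d : ℤ, IsCoprime c d ∧ ∀ j, Dvd p (qA c * B 0 j + qA d * B 1 j) := by
  have hp0 := hp.ne_zero
  have hex : ∀ i j, ∃ n : ℤ, Dvd p (B i j - qA n) := fun i j => exists_int_dvd hp0 (hB i j)
  choose n hn using hex
  have hsub : ∀ {a b : Af} {k l : ℤ}, a ∈ R → Dvd p (a - qA k) → Dvd p (b - qA l) →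
      Dvd p (a * b - qA (k * l : ℤ)) := by
    intro a b k l ha h1 h2
    have e : a * b - qA (k * l : ℤ) = a * (b - qA l) + qA l * (a - qA k) := by
      rw [Int.cast_mul, map_mul]; ring
    rw [e]
    exact (Dvd.mul ha h2).add (Dvd.mul (R_int l) h1)
  have hdet : (p : ℤ) ∣ (Matrix.of n).det := by
    refine int_dvd_of_Dvd hp0 ?_
    have h1 := hsub (hB 0 0) (hn 0 0) (hn 1 1)
    have h2 := hsub (hB 0 1) (hn 0 1) (hn 1 0)
    have h3 := (h.add h2).add h1.neg
    rw [Matrix.det_fin_two] at h3 ⊢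
    convert h3 using 1
    simp only [Matrix.of_apply, Int.cast_sub, map_sub]
    ring
  obtain ⟨c, d, hco, hcd⟩ := exists_coprime_row hp _ hdet
  refine ⟨c, d, hco, fun j => ?_⟩
  have e : qA c * B 0 j + qA d * B 1 j = (qA c * (B 0 j - qA (n 0 j)) +
      qA d * (B 1 j - qA (n 1 j))) + qA ((c * n 0 j + d * n 1 j : ℤ) : ℚ) := by
    rw [Int.cast_add, Int.cast_mul, Int.cast_mul, map_add, map_mul, map_mul]
    ring
  rw [e]
  exact ((Dvd.mul (R_int c) (hn 0 j)).add (Dvd.mul (R_int d) (hn 1 j))).add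
    (Dvd_of_int_dvd (hcd j))

/-- A point of `Y` whose determinant is divisible by `p` is the image of a point of `Y` under an
integral matrix of determinant `p`. -/
lemma exists_Mset_of_Dvd {p : ℕ} (hp : p.Prime) {y : AfH} (hy : y ∈ Y) (h : Dvd p y.1.det) :
    ∃ m ∈ Mset p, m⁻¹ • y ∈ Y := by
  have hpQ : (p : ℚ) ≠ 0 := by exact_mod_cast hp.ne_zero
  obtain ⟨c, d, ⟨u, v, huv⟩, hcd⟩ := exists_row_of_Dvd hp hy h
  -- The inverse of m has rows (c/p, d/p) and (-v, u). The first row sends ρ to an integral row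
  -- because c ρ₁ + d ρ₂ is divisible by p.
  let m : Matrix (Fin 2) (Fin 2) ℤ := !![u * p, -d; v * p, c]
  have hm : m.det = p := by
    rw [Matrix.det_fin_two_of]; linear_combination (p : ℤ) * huv
  have hm0 : 0 < m.det := by rw [hm]; exact_mod_cast hp.pos
  let w : Matrix (Fin 2) (Fin 2) ℚ := !![c / p, d / p; -v, u]
  have hwd : w.det = (p : ℚ)⁻¹ := by
    rw [Matrix.det_fin_two_of]
    have : (u * c + v * d : ℚ) = 1 := by exact_mod_cast huv
    field_simp
    linear_combination this
  have hw0 : 0 < w.det := by rw [hwd]; have := hp.pos; positivity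
  have hinv : (ofInt m hm0)⁻¹ = ofRat w hw0 := by
    have huv' : (u * c + v * d : ℚ) = 1 := by exact_mod_cast huv
    refine (eq_inv_of_mul_eq_one_left (G_ext fun i j => ?_)).symm
    change ((ofRat w hw0).1.1 * (ofInt m hm0).1.1) i j = (1 : Matrix (Fin 2) (Fin 2) ℚ) i j
    rw [Matrix.mul_apply, Fin.sum_univ_two, ofInt_apply, ofInt_apply]
    fin_cases i <;> fin_cases j <;> simp [ofRat, m, w] <;> field_simp <;>
      first | linear_combination huv' | ring
  refine ⟨ofInt m hm0, ⟨ofInt_mem _ _, ?_⟩, ?_⟩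
  · rw [detR_ofInt, hm, Int.cast_natCast]
  rw [hinv]
  intro i j
  rw [smul_fst, Matrix.mul_apply, Fin.sum_univ_two]
  fin_cases i
  · change qA (c / p) * y.1 0 j + qA (d / p) * y.1 1 j ∈ R
    have h1 := hcd j
    unfold Dvd at h1
    convert h1 using 1
    rw [div_eq_inv_mul, div_eq_inv_mul, map_mul, map_mul]
    ring
  · change qA (-v) * y.1 0 j + qA u * y.1 1 j ∈ R
    have := R_add (R_mul (R_int (-v)) (hy 0 j)) (R_mul (R_int u) (hy 1 j))
    push_cast at this ⊢
    exact this

/-- Every point of `Y` is covered by integral matrices of small determinant. -/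
lemma exists_cover {J : ℕ} (hJ : 1 ≤ J) {y : AfH} (hy : y ∈ Y) :
    (∃ j ≤ J, ∃ m ∈ Mset j, m⁻¹ • y ∈ YJ J) ∨
      ∃ j, J < j ∧ j ≤ J ^ 2 ∧ ∃ m ∈ Mset j, m⁻¹ • y ∈ Y := by
  classical
  let P : ℕ → Prop := fun j => ∃ m ∈ Mset j, m⁻¹ • y ∈ Y
  have hP1 : P 1 := by
    refine ⟨1, ?_, by simpa using hy⟩
    have := mem_Gam_iff.1 (one_mem Gam)
    exact ⟨this.1, by rw [this.2, Nat.cast_one]⟩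
  -- If the quotient of y by a matrix of the largest admissible determinant j ≤ J still has det ρ
  -- divisible by a prime p ≤ J, then splitting off p gives determinant j p, which exceeds J by
  -- maximality and is at most J².
  set j := Nat.findGreatest P J
  have hj : P j := Nat.findGreatest_spec hJ hP1
  have hjJ : j ≤ J := Nat.findGreatest_le J
  obtain ⟨m, hm, hmy⟩ := hj
  by_cases h : m⁻¹ • y ∈ YJ J
  · exact Or.inl ⟨j, hjJ, m, hm, h⟩
  have h' : ∃ p : ℕ, p.Prime ∧ p ≤ J ∧ Dvd p (m⁻¹ • y).1.det := by
    by_contra! h0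
    exact h ⟨hmy, fun p hp hpJ => h0 p hp hpJ⟩
  obtain ⟨p, hp, hpJ, hdvd⟩ := h'
  obtain ⟨m', hm', hmy'⟩ := exists_Mset_of_Dvd hp hmy hdvd
  have hmm : m * m' ∈ Mset (j * p) := by
    refine ⟨M2Zplus_mul hm.1 hm'.1, ?_⟩
    rw [detR_mul, hm.2, hm'.2, Nat.cast_mul]
  have hmmy : (m * m')⁻¹ • y ∈ Y := by rwa [mul_inv_rev, mul_smul]
  refine Or.inr ⟨j * p, ?_, ?_, m * m', hmm, hmmy⟩
  · by_contra! hle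
    have h1 : j * p ≤ j := Nat.le_findGreatest hle ⟨_, hmm, hmmy⟩
    have hj0 : 0 < j := by
      have := detR_pos m
      rw [hm.2] at this
      exact_mod_cast this
    have := (Nat.mul_le_mul_left_iff hj0).1 (h1.trans (by rw [mul_one]))
    exact absurd hp.two_le (by omega)
  · rw [sq]
    exact Nat.mul_le_mul hjJ hpJ

/-! ### Weighted sums over integral matrices -/

lemma hasSum_cosets {E : Type*} [AddCommMonoid E] [TopologicalSpace E] {S : Set G} {u : G → E}
    (hu : LeftInv u) (h0 : ∀ g, g ∉ S → u g = 0) {v : Cosets S → E}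
    (hv : ∀ g : S, v (Quotient.mk _ g) = u g) {a : E} :
    HasSum (fun x : RC => u x.out) a ↔ HasSum v a := by
  rw [← toRC_injective.hasSum_iff (f := fun x : RC => u x.out)]
  · refine iff_of_eq (congrArg (HasSum · a) (funext fun x => ?_))
    refine Quotient.inductionOn x fun g => ?_
    rw [hv]
    exact hu.out g.1
  · intro x hx
    refine h0 _ fun h => hx ⟨Quotient.mk _ ⟨x.out, h⟩, ?_⟩
    exact Quotient.out_eq x

open Classical in
/-- The weight `Det(h)^{-β}` on the integral matrices with determinant in `D`. -/
def wt (β : ℝ) (D : Set ℝ) (h : G) : ℝ :=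
  if h ∈ M2Zplus ∧ detR h ∈ D then detR h ^ (-β) else 0

lemma wt_of_mem {β : ℝ} {D : Set ℝ} {h : G} (hh : h ∈ M2Zplus) (hD : detR h ∈ D) :
    wt β D h = detR h ^ (-β) := if_pos ⟨hh, hD⟩

lemma wt_of_not {β : ℝ} {D : Set ℝ} {h : G} (hh : ¬ (h ∈ M2Zplus ∧ detR h ∈ D)) :
    wt β D h = 0 := if_neg hh

lemma wt_ne {β : ℝ} {D : Set ℝ} {h : G} (hh : wt β D h ≠ 0) : h ∈ M2Zplus ∧ detR h ∈ D := by
  by_contra h0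
  exact hh (wt_of_not h0)

lemma wt_nonneg (β : ℝ) (D : Set ℝ) (h : G) : 0 ≤ wt β D h := by
  by_cases hh : h ∈ M2Zplus ∧ detR h ∈ D
  · rw [wt_of_mem hh.1 hh.2]
    exact Real.rpow_nonneg (detR_pos h).le _
  · rw [wt_of_not hh]

lemma wt_mono (β : ℝ) {D D' : Set ℝ} (hD : D ⊆ D') (h : G) : wt β D h ≤ wt β D' h := by
  by_cases hh : h ∈ M2Zplus ∧ detR h ∈ D
  · rw [wt_of_mem hh.1 hh.2, wt_of_mem hh.1 (hD hh.2)]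
  · rw [wt_of_not hh]
    exact wt_nonneg _ _ _

lemma wt_add (β : ℝ) {D D' D'' : Set ℝ} (hD : ∀ x, x ∈ D'' ↔ x ∈ D ∨ x ∈ D')
    (hD' : ∀ x, x ∈ D → x ∉ D') (h : G) : wt β D'' h = wt β D h + wt β D' h := by
  by_cases h0 : h ∈ M2Zplus
  · by_cases h1 : detR h ∈ D
    · rw [wt_of_mem h0 h1, wt_of_mem h0 ((hD _).2 (Or.inl h1)),
        wt_of_not (D := D') fun h2 => hD' _ h1 h2.2, add_zero]
    · rw [wt_of_not (D := D) fun h2 => h1 h2.2, zero_add]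
      by_cases h2 : detR h ∈ D'
      · rw [wt_of_mem h0 h2, wt_of_mem h0 ((hD _).2 (Or.inr h2))]
      · rw [wt_of_not fun h3 => h2 h3.2, wt_of_not fun h3 => ((hD _).1 h3.2).elim h1 h2]
  · rw [wt_of_not fun h1 => h0 h1.1, wt_of_not fun h1 => h0 h1.1, wt_of_not fun h1 => h0 h1.1,
      add_zero]

lemma gam_mul_mem_M2Zplus_iff {γ : G} (hγ : γ ∈ Gam) {h : G} :
    γ * h ∈ M2Zplus ↔ h ∈ M2Zplus := by
  refine ⟨fun hh => ?_, fun hh => M2Zplus_mul (Gam_le_M2Zplus hγ) hh⟩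
  simpa using M2Zplus_mul (Gam_le_M2Zplus (inv_mem hγ)) hh

lemma mul_gam_mem_M2Zplus_iff {γ : G} (hγ : γ ∈ Gam) {h : G} :
    h * γ ∈ M2Zplus ↔ h ∈ M2Zplus := by
  refine ⟨fun hh => ?_, fun hh => M2Zplus_mul hh (Gam_le_M2Zplus hγ)⟩
  simpa using M2Zplus_mul hh (Gam_le_M2Zplus (inv_mem hγ))

lemma wt_gam_mul (β : ℝ) (D : Set ℝ) {γ : G} (hγ : γ ∈ Gam) (h : G) :
    wt β D (γ * h) = wt β D h := by
  unfold wt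
  rw [gam_mul_mem_M2Zplus_iff hγ, detR_mul, detR_Gam hγ, one_mul]

lemma wt_mul_gam (β : ℝ) (D : Set ℝ) {γ : G} (hγ : γ ∈ Gam) (h : G) :
    wt β D (h * γ) = wt β D h := by
  unfold wt
  rw [mul_gam_mem_M2Zplus_iff hγ, detR_mul, detR_Gam hγ, mul_one]

lemma hasSum_wt {β : ℝ} (hβ : 2 < β) :
    HasSum (fun x : RC => wt β Set.univ x.out) (partZ β) := by
  refine (hasSum_cosets (S := M2Zplus) (v := fun x => cosetDet x ^ (-β))
    (fun _ hγ g => wt_gam_mul β _ hγ g) (fun g hg => wt_of_not fun h => hg h.1)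
    fun g => ?_).2 (hasSum_partZ hβ)
  rw [wt_of_mem g.2 (Set.mem_univ _)]
  rfl

lemma summable_wt {β : ℝ} (hβ : 2 < β) (D : Set ℝ) : Summable fun x : RC => wt β D x.out :=
  (hasSum_wt hβ).summable.of_nonneg_of_le (fun _ => wt_nonneg _ _ _)
    fun _ => wt_mono β (Set.subset_univ D) _

/-- The total weight of the integral matrices with determinant in `D`. -/
def wsum (β : ℝ) (D : Set ℝ) : ℝ := lsum (wt β D)

lemma wsum_univ {β : ℝ} (hβ : 2 < β) : wsum β Set.univ = partZ β := (hasSum_wt hβ).tsum_eq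

lemma wsum_nonneg (β : ℝ) (D : Set ℝ) : 0 ≤ wsum β D := tsum_nonneg fun _ => wt_nonneg _ _ _

lemma wsum_mono {β : ℝ} (hβ : 2 < β) {D D' : Set ℝ} (hD : D ⊆ D') : wsum β D ≤ wsum β D' :=
  (summable_wt hβ D).tsum_le_tsum (fun _ => wt_mono β hD _) (summable_wt hβ D')

lemma tendsto_wsum {β : ℝ} (hβ : 2 < β) :
    Filter.Tendsto (fun J : ℕ => wsum β (Set.Ioi (J : ℝ))) Filter.atTop (nhds 0) := by
  have h := tendsto_tsum_of_dominated_convergence (𝓕 := Filter.atTop)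
    (f := fun (J : ℕ) (x : RC) => wt β (Set.Ioi (J : ℝ)) x.out) (g := fun _ => 0)
    (hasSum_wt hβ).summable (fun x => ?_) (.of_forall fun J x => ?_)
  · rwa [tsum_zero] at h
  · refine tendsto_const_nhds.congr' ?_
    obtain ⟨N, hN⟩ := exists_nat_ge (detR x.out)
    filter_upwards [Filter.eventually_ge_atTop N] with J hJ
    refine (wt_of_not fun h => ?_).symm
    have h1 : (N : ℝ) ≤ J := by exact_mod_cast hJ
    exact absurd h.2 (not_lt.2 (hN.trans h1))
  · rw [Real.norm_of_nonneg (wt_nonneg _ _ _)]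
    exact wt_mono β (Set.subset_univ _) _

/-- The sum of `Det(m)^{-β} k(m y)` over the classes of the integral matrices `m` with determinant
in `D`. -/
def psi (β : ℝ) (D : Set ℝ) (k : AfH → ℝ) (y : AfH) : ℝ := lsum fun h => wt β D h * k (h • y)

section Psi

variable {β : ℝ} (hβ : 2 < β) {k : AfH → ℝ} {M : ℝ} (hk : ∀ y, |k y| ≤ M)
include hβ hk

lemma summable_psi (D : Set ℝ) (y : AfH) :
    Summable fun x : RC => wt β D x.out * k (x.out • y) := by
  refine Summable.of_norm_bounded ((summable_wt hβ D).mul_right M) fun x => ?_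
  rw [norm_mul, Real.norm_of_nonneg (wt_nonneg _ _ _)]
  exact mul_le_mul_of_nonneg_left (hk _) (wt_nonneg _ _ _)

lemma abs_psi_le (D : Set ℝ) (y : AfH) : |psi β D k y| ≤ M * wsum β D := by
  have h := tsum_of_norm_bounded (f := fun x : RC => wt β D x.out * k (x.out • y))
    ((summable_wt hβ D).hasSum.mul_left M) fun x => ?_
  · exact h
  · rw [norm_mul, Real.norm_of_nonneg (wt_nonneg _ _ _), mul_comm]
    exact mul_le_mul_of_nonneg_right (hk _) (wt_nonneg _ _ _)

lemma psi_split {D D' D'' : Set ℝ} (hD : ∀ x, x ∈ D'' ↔ x ∈ D ∨ x ∈ D')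
    (hD' : ∀ x, x ∈ D → x ∉ D') (y : AfH) : psi β D'' k y = psi β D k y + psi β D' k y := by
  unfold psi lsum
  rw [← (summable_psi hβ hk D y).tsum_add (summable_psi hβ hk D' y)]
  refine tsum_congr fun x => ?_
  dsimp only
  rw [wt_add β hD hD', add_mul]

lemma psi_univ_eq (J : ℝ) (y : AfH) :
    psi β Set.univ k y = psi β (Set.Iic J) k y + psi β (Set.Ioi J) k y :=
  psi_split hβ hk (D := Set.Iic J) (D' := Set.Ioi J)
    (fun x => ⟨fun _ => le_or_gt x J, fun _ => Set.mem_univ x⟩) (fun _ h h' => not_lt.2 (Set.mem_Iic.1 h) (Set.mem_Ioi.1 h')) y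

lemma psi_add {k' : AfH → ℝ} {M' : ℝ} (hk' : ∀ y, |k' y| ≤ M') (D : Set ℝ) (y : AfH) :
    psi β D (fun y => k y + k' y) y = psi β D k y + psi β D k' y := by
  unfold psi lsum
  rw [← (summable_psi hβ hk D y).tsum_add (summable_psi hβ hk' D y)]
  exact tsum_congr fun x => mul_add _ _ _

lemma psi_mono {k' : AfH → ℝ} {M' : ℝ} (hk' : ∀ y, |k' y| ≤ M') (h : ∀ y, k y ≤ k' y)
    (D : Set ℝ) (y : AfH) : psi β D k y ≤ psi β D k' y :=
  (summable_psi hβ hk D y).tsum_le_tsum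
    (fun _ => mul_le_mul_of_nonneg_left (h _) (wt_nonneg _ _ _)) (summable_psi hβ hk' D y)

end Psi

lemma psi_smul (β : ℝ) (D : Set ℝ) (c : ℝ) (k : AfH → ℝ) (y : AfH) :
    psi β D (fun y => c * k y) y = c * psi β D k y := by
  unfold psi lsum
  rw [← tsum_mul_left]
  exact tsum_congr fun x => mul_left_comm _ _ _

lemma psi_nonneg (β : ℝ) (D : Set ℝ) {k : AfH → ℝ} (hk : ∀ y, 0 ≤ k y) (y : AfH) :
    0 ≤ psi β D k y := tsum_nonneg fun _ => mul_nonneg (wt_nonneg _ _ _) (hk _)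

lemma psi_gam (β : ℝ) (D : Set ℝ) {k : AfH → ℝ} (hk : IsInv k) {γ : G} (hγ : γ ∈ Gam) (y : AfH) :
    psi β D k (γ • y) = psi β D k y := by
  have h := lsum_mul_right (u := fun h => wt β D h * k (h • y)) (fun a ha g => by
    dsimp only
    rw [wt_gam_mul β D ha, mul_smul, hk.inv a ha]) γ
  rw [psi, psi, ← h]
  congr 1
  funext g
  rw [wt_mul_gam β D hγ, mul_smul]

/-! ### The Hecke kernels -/

open Classical in
/-- The kernel with value `k y` at `(h, y)` if `h⁻¹` is integral with determinant in `D` and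
`h y ∈ P`. -/
def heckeK (k : AfH → ℝ) (D : Set ℝ) (P : Set AfH) (h : G) (y : AfH) : ℝ :=
  if h⁻¹ ∈ M2Zplus ∧ detR h⁻¹ ∈ D ∧ h • y ∈ P then k y else 0

lemma heckeK_pos {k : AfH → ℝ} {D : Set ℝ} {P : Set AfH} {h : G} {y : AfH}
    (hh : h⁻¹ ∈ M2Zplus ∧ detR h⁻¹ ∈ D ∧ h • y ∈ P) : heckeK k D P h y = k y := if_pos hh

lemma heckeK_neg {k : AfH → ℝ} {D : Set ℝ} {P : Set AfH} {h : G} {y : AfH}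
    (hh : ¬ (h⁻¹ ∈ M2Zplus ∧ detR h⁻¹ ∈ D ∧ h • y ∈ P)) : heckeK k D P h y = 0 := if_neg hh

lemma heckeK_ne {k : AfH → ℝ} {D : Set ℝ} {P : Set AfH} {h : G} {y : AfH}
    (hh : heckeK k D P h y ≠ 0) : (h⁻¹ ∈ M2Zplus ∧ detR h⁻¹ ∈ D ∧ h • y ∈ P) ∧ k y ≠ 0 := by
  by_cases h0 : h⁻¹ ∈ M2Zplus ∧ detR h⁻¹ ∈ D ∧ h • y ∈ P
  · rw [heckeK_pos h0] at hh
    exact ⟨h0, hh⟩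
  · exact absurd (heckeK_neg h0) hh

lemma heckeK_nonneg {k : AfH → ℝ} (hk : ∀ y, 0 ≤ k y) (D : Set ℝ) (P : Set AfH) (h : G) (y : AfH) :
    0 ≤ heckeK k D P h y := by
  by_cases h0 : h⁻¹ ∈ M2Zplus ∧ detR h⁻¹ ∈ D ∧ h • y ∈ P
  · rw [heckeK_pos h0]
    exact hk y
  · rw [heckeK_neg h0]

lemma isKerR_heckeK {k : AfH → ℝ} (hk : IsInv k) {D : Set ℝ} {J : ℝ} (hD : ∀ x ∈ D, x ≤ J)
    {P : Set AfH} (hP : IsClopen P) (hPY : ∀ y ∈ P, y ∈ Y)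
    (hPinv : ∀ γ ∈ Gam, ∀ y, γ • y ∈ P ↔ y ∈ P) : IsKerR (heckeK k D P) where
  inv a ha b hb g y := by
    have e : (a * g * b⁻¹)⁻¹ = b * g⁻¹ * a⁻¹ := by group
    have e2 : (a * g * b⁻¹) • b • y = a • g • y := by simp [mul_smul]
    unfold heckeK
    rw [e, e2, mul_gam_mem_M2Zplus_iff (inv_mem ha), gam_mul_mem_M2Zplus_iff hb, hPinv a ha,
      hk.inv b hb, detR_conj hb ha]
  supp g y h := by
    have h1 := heckeK_ne (Complex.ofReal_ne_zero.1 h)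
    exact ⟨hk.supp y h1.2, hPY _ h1.1.2.2⟩
  cont g := by
    classical
    refine Complex.continuous_ofReal.comp ?_
    by_cases h0 : g⁻¹ ∈ M2Zplus ∧ detR g⁻¹ ∈ D
    · have e : heckeK k D P g = fun y => if g • y ∈ P then k y else 0 := by
        funext y
        by_cases h1 : g • y ∈ P
        · rw [heckeK_pos ⟨h0.1, h0.2, h1⟩, if_pos h1]
        · rw [heckeK_neg fun h => h1 h.2.2, if_neg h1]
      rw [e]
      exact continuous_ite_Y (hP.preimage (continuous_const_smul g)) hk.cont
    · have e : heckeK k D P g = fun y => 0 := by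
        funext y
        exact heckeK_neg fun h => h0 ⟨h.1, h.2.1⟩
      rw [e]
      exact continuous_const
  fin := by
    refine ⟨_, finite_rc_inv (finite_rc_M2Zplus J), fun g y h => ?_⟩
    have h1 := (heckeK_ne (Complex.ofReal_ne_zero.1 h)).1
    exact ⟨g⁻¹, ⟨g⁻¹, h1.1, hD _ h1.2.1, rfl⟩, by rw [inv_inv]⟩
  ht := by
    obtain ⟨T, hT⟩ := hk.ht
    exact ⟨T, fun g y h => hT y (heckeK_ne (Complex.ofReal_ne_zero.1 h)).2⟩

/-- The transform evaluates the kernel at (h⁻¹, h y), where its condition says that h is integral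
with determinant in D and that y, which no longer depends on h, lies in P. -/
lemma SK_sharp_heckeK (β : ℝ) (k : AfH → ℝ) (D : Set ℝ) (P : Set AfH) :
    SK (sharp β (heckeK k D P)) = P.indicator (psi β D k) := by
  funext y
  by_cases hy : y ∈ P
  · rw [Set.indicator_of_mem hy, psi, SK]
    congr 1
    funext h
    unfold sharp
    by_cases hh : h ∈ M2Zplus ∧ detR h ∈ D
    · rw [wt_of_mem hh.1 hh.2, heckeK_pos]
      rw [inv_inv, inv_smul_smul]
      exact ⟨hh.1, hh.2, hy⟩
    · rw [wt_of_not hh, zero_mul, heckeK_neg, mul_zero]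
      rw [inv_inv]
      exact fun h1 => hh ⟨h1.1, h1.2.1⟩
  · rw [Set.indicator_of_notMem hy]
    have : ∀ h, sharp β (heckeK k D P) h y = 0 := fun h => by
      unfold sharp
      rw [heckeK_neg, mul_zero]
      rw [inv_smul_smul]
      exact fun h1 => hy h1.2.2
    unfold SK lsum
    simp only [this, tsum_zero]

lemma isInv_indicator_psi (β : ℝ) {k : AfH → ℝ} (hk : IsInv k) {D : Set ℝ} {J : ℝ} (hD : ∀ x ∈ D, x ≤ J)
    {P : Set AfH} (hP : IsClopen P) (hPY : ∀ y ∈ P, y ∈ Y)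
    (hPinv : ∀ γ ∈ Gam, ∀ y, γ • y ∈ P ↔ y ∈ P) : IsInv (P.indicator (psi β D k)) := by
  rw [← SK_sharp_heckeK]
  exact (isKerR_heckeK hk hD hP hPY hPinv).sharp.isInv_SK

lemma IsKerR.SK_eq_sum {u : G → AfH → ℝ} (hu : IsKerR u) :
    ∃ S : Finset RC, (∀ g y, u g y ≠ 0 → rc g ∈ S) ∧ ∀ y, SK u y = ∑ x ∈ S, u x.out y := by
  obtain ⟨S, hS, hS'⟩ := IsKer.SK_eq_sum hu
  refine ⟨S, fun g y h => hS g y (Complex.ofReal_ne_zero.2 h), fun y => ?_⟩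
  have h := hS' y
  rw [← ofReal_SK, ← Complex.ofReal_sum] at h
  exact Complex.ofReal_injective h

lemma IsKerR.leftInv {u : G → AfH → ℝ} (hu : IsKerR u) (y : AfH) : LeftInv fun h => u h y :=
  fun _ hγ g => Complex.ofReal_injective (IsKer.left hu hγ g y)

lemma IsKerR.le_SK {u : G → AfH → ℝ} (hu : IsKerR u) (h0 : ∀ g y, 0 ≤ u g y) (g : G) (y : AfH) :
    u g y ≤ SK u y := by
  obtain ⟨S, hS, hS'⟩ := hu.SK_eq_sum
  by_cases h : u g y = 0
  · rw [h]; exact SK_nonneg h0 y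
  · rw [hS', ← (hu.leftInv y).out g]
    exact Finset.single_le_sum (f := fun x : RC => u x.out y) (fun x _ => h0 _ _) (hS g y h)

/-- At most one coset contributes to the sum, by `mem_Gam_of_YJ`. So `SK` multiplies k by the
indicator of the points covered from `YJ J` by determinants at most J. -/
lemma SK_heckeK_YJ {k : AfH → ℝ} (hk : IsInv k) (J : ℕ) (y : AfH) :
    (SK (heckeK k (Set.Iic (J : ℝ)) (YJ J)) y = k y ∨
      SK (heckeK k (Set.Iic (J : ℝ)) (YJ J)) y = 0) ∧
    ((∃ j ≤ J, ∃ m ∈ Mset j, m⁻¹ • y ∈ YJ J) →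
      SK (heckeK k (Set.Iic (J : ℝ)) (YJ J)) y = k y) := by
  have hker := isKerR_heckeK hk (D := Set.Iic (J : ℝ)) (fun x h => h) (isClopen_YJ J)
    (fun y h => h.1) fun _ hγ y => smul_mem_YJ_iff hγ J y
  have hM : ∀ {g : G}, g ∈ M2Zplus → detR g ≤ J → ∃ j ≤ J, g ∈ Mset j := by
    intro g hg hJ
    obtain ⟨j, -, hj⟩ := exists_detR_eq hg
    rw [hj] at hJ
    exact ⟨j, by exact_mod_cast hJ, hg, hj⟩
  have key : ∀ g, g⁻¹ ∈ M2Zplus ∧ detR g⁻¹ ∈ Set.Iic (J : ℝ) ∧ g • y ∈ YJ J →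
      SK (heckeK k (Set.Iic (J : ℝ)) (YJ J)) y = k y := by
    intro g hg
    rw [← heckeK_pos (k := k) hg]
    refine lsum_eq_single (hker.leftInv y) g fun x hx => ?_
    have hx' := (heckeK_ne hx).1
    obtain ⟨j, hj, hgj⟩ := hM hg.1 hg.2.1
    obtain ⟨i, hi, hxi⟩ := hM hx'.1 hx'.2.1
    exact rc_eq_rc_iff.2 (mem_Gam_of_YJ hxi hgj hi hj hx'.2.2 hg.2.2)
  constructor
  · by_cases h : ∃ g, g⁻¹ ∈ M2Zplus ∧ detR g⁻¹ ∈ Set.Iic (J : ℝ) ∧ g • y ∈ YJ J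
    · obtain ⟨g, hg⟩ := h
      exact Or.inl (key g hg)
    · right
      have : ∀ g, heckeK k (Set.Iic (J : ℝ)) (YJ J) g y = 0 := fun g =>
        heckeK_neg fun hg => h ⟨g, hg⟩
      unfold SK lsum
      simp only [this, tsum_zero]
  · rintro ⟨j, hj, m, hm, hmy⟩
    refine key m⁻¹ ⟨?_, ?_, hmy⟩
    · rw [inv_inv]; exact hm.1
    · rw [inv_inv, hm.2]
      exact Set.mem_Iic.2 (Nat.cast_le.2 hj)

/-! ### Hecke functionals are determined on the points with unit determinant -/

lemma isInv_indicator_YJ {k : AfH → ℝ} (hk : IsInv k) (J : ℕ) : IsInv ((YJ J).indicator k) := by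
  classical
  have h := hk.mul_left (b := fun y => if y ∈ YJ J then 1 else 0)
    (continuous_ite_Y (P := fun y => y ∈ YJ J) (isClopen_YJ J) continuous_const) fun a ha y => by
      simp only [smul_mem_YJ_iff ha]
  have e : (YJ J).indicator k = fun y => (if y ∈ YJ J then 1 else 0) * k y := by
    funext y
    by_cases hy : y ∈ YJ J
    · rw [Set.indicator_of_mem hy, if_pos hy, one_mul]
    · rw [Set.indicator_of_notMem hy, if_neg hy, zero_mul]
  rw [e]
  exact h

lemma isInv_psi_YJ (β : ℝ) {k : AfH → ℝ} (hk : IsInv k) {D : Set ℝ} {c : ℝ} (hD : ∀ x ∈ D, x ≤ c)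
    (J : ℕ) : IsInv ((YJ J).indicator (psi β D k)) :=
  isInv_indicator_psi β hk hD (isClopen_YJ J) (fun _ h => h.1) fun _ hγ y => smul_mem_YJ_iff hγ J y

lemma isInv_psi_Y (β : ℝ) {k : AfH → ℝ} (hk : IsInv k) {D : Set ℝ} {c : ℝ} (hD : ∀ x ∈ D, x ≤ c) :
    IsInv (Y.indicator (psi β D k)) :=
  isInv_indicator_psi β hk hD isClopen_Y (fun _ h => h) fun _ hγ _ => Gam_smul_mem_iff hγ

namespace IsHecke

variable {β : ℝ} {μ : (AfH → ℝ) → ℝ} (hμ : IsHecke β μ)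
include hμ

lemma heckeK {k : AfH → ℝ} (hk : IsInv k) {D : Set ℝ} {c : ℝ} (hD : ∀ x ∈ D, x ≤ c)
    {P : Set AfH} (hP : IsClopen P) (hPY : ∀ y ∈ P, y ∈ Y)
    (hPinv : ∀ γ ∈ Gam, ∀ y, γ • y ∈ P ↔ y ∈ P) :
    μ (SK (GL2System.heckeK k D P)) = μ (P.indicator (psi β D k)) := by
  rw [hμ.hecke _ (isKerR_heckeK hk hD hP hPY hPinv), SK_sharp_heckeK]

lemma psi_indicator_le (hβ : 2 < β) {k : AfH → ℝ} {M : ℝ} (hM : ∀ y, |k y| ≤ M) (D : Set ℝ)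
    {P : Set AfH} (h : IsInv (P.indicator (psi β D k))) :
    μ (P.indicator (psi β D k)) ≤ M * wsum β D * mass μ := by
  have hM0 : 0 ≤ M := (abs_nonneg _).trans (hM (0, UpperHalfPlane.I))
  have h0 : 0 ≤ M * wsum β D := mul_nonneg hM0 (wsum_nonneg _ _)
  refine hμ.le_mul_mass h h0 fun y => ?_
  exact Set.indicator_apply_le' (fun _ => (le_abs_self _).trans (abs_psi_le hβ hM D y)) fun _ => h0

/-- A Hecke functional is approximately determined by its restriction to the functions supported
on `YJ J`. -/
lemma approx (hβ : 2 < β) {k : AfH → ℝ} (hk : IsInv k) (h0 : ∀ y, 0 ≤ k y) {M : ℝ}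
    (hM : ∀ y, |k y| ≤ M) {J₀ J : ℕ} (hJ : J₀ ≤ J) (h1 : 1 ≤ J) :
    μ ((YJ J).indicator (psi β (Set.Iic (J₀ : ℝ)) k)) ≤ μ k ∧
      μ k ≤ μ ((YJ J).indicator (psi β (Set.Iic (J₀ : ℝ)) k)) +
        2 * (M * wsum β (Set.Ioi (J₀ : ℝ)) * mass μ) := by
  have hM0 : 0 ≤ M := (abs_nonneg _).trans (hM (0, UpperHalfPlane.I))
  have hJ' : (J₀ : ℝ) ≤ J := Nat.cast_le.2 hJ
  have hIoc : ∀ {c d : ℝ}, ∀ x ∈ Set.Ioc c d, x ≤ d := fun x hx => hx.2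
  have hIic : ∀ {d : ℝ}, ∀ x ∈ Set.Iic d, x ≤ d := fun x hx => hx
  have hEK := isKerR_heckeK hk (hIic (d := J)) (isClopen_YJ J) (fun y h => h.1)
    fun _ hγ y => smul_mem_YJ_iff hγ J y
  have hNK := isKerR_heckeK hk (hIoc (c := J) (d := (J : ℝ) ^ 2)) isClopen_Y (fun y h => h)
    fun _ hγ _ => Gam_smul_mem_iff hγ
  have hE := hμ.heckeK hk (hIic (d := J)) (isClopen_YJ J) (fun y h => h.1)
    fun _ hγ y => smul_mem_YJ_iff hγ J y
  have hN := hμ.heckeK hk (hIoc (c := J) (d := (J : ℝ) ^ 2)) isClopen_Y (fun y h => h)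
    fun _ hγ _ => Gam_smul_mem_iff hγ
  -- By `exists_cover`, kE ≤ k ≤ kE + kN. The Hecke relation turns μ(kE) into the value of μ on the
  -- main sum cut off to `YJ J`, and μ(kN) into a sum over determinants above J.
  set kE := SK (GL2System.heckeK k (Set.Iic (J : ℝ)) (YJ J))
  set kN := SK (GL2System.heckeK k (Set.Ioc (J : ℝ) ((J : ℝ) ^ 2)) Y)
  have hN0 : ∀ y, 0 ≤ kN y := fun y => SK_nonneg (heckeK_nonneg h0 _ _) y
  have hEle : ∀ y, kE y ≤ k y := fun y => by
    rcases (SK_heckeK_YJ hk J y).1 with h | h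
    · exact h.le
    · exact h.le.trans (h0 y)
  have hE0 : ∀ y, 0 ≤ kE y := fun y => SK_nonneg (heckeK_nonneg h0 _ _) y
  have hle : ∀ y, k y ≤ kE y + kN y := by
    intro y
    by_cases hy : k y = 0
    · rw [hy]; exact add_nonneg (hE0 y) (hN0 y)
    rcases exists_cover h1 (hk.supp y hy) with h | ⟨j, hj, hj2, m, hm, hmy⟩
    · rw [show kE y = k y from (SK_heckeK_YJ hk J y).2 h]
      linarith [hN0 y]
    · have h2 := hNK.le_SK (heckeK_nonneg h0 _ _) m⁻¹ y
      rw [heckeK_pos] at h2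
      · linarith [hE0 y]
      · rw [inv_inv, hm.2]
        exact ⟨hm.1, ⟨Nat.cast_lt.2 hj, by exact_mod_cast hj2⟩, hmy⟩
  have hwm : wsum β (Set.Ioc (J : ℝ) ((J : ℝ) ^ 2)) ≤ wsum β (Set.Ioi (J₀ : ℝ)) :=
    wsum_mono hβ fun x hx => hJ'.trans_lt hx.1
  have hwm' : wsum β (Set.Ioc (J₀ : ℝ) J) ≤ wsum β (Set.Ioi (J₀ : ℝ)) :=
    wsum_mono hβ fun x hx => hx.1
  have hmass := hμ.mass_nonneg
  have i1 := isInv_psi_YJ β hk (hIic (d := J₀)) J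
  have i2 := isInv_psi_YJ β hk (hIic (d := J)) J
  have i3 := isInv_psi_YJ β hk (hIoc (c := J₀) (d := J)) J
  have i4 := isInv_psi_Y β hk (hIoc (c := J) (d := (J : ℝ) ^ 2))
  have b1 : μ kN ≤ M * wsum β (Set.Ioi (J₀ : ℝ)) * mass μ := by
    rw [hN]
    exact (hμ.psi_indicator_le hβ hM _ i4).trans (by gcongr)
  have b2 : μ ((YJ J).indicator (psi β (Set.Ioc (J₀ : ℝ) J) k)) ≤
      M * wsum β (Set.Ioi (J₀ : ℝ)) * mass μ :=
    (hμ.psi_indicator_le hβ hM _ i3).trans (by gcongr)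
  -- The determinants in (J₀, J] give the second of the two tails in the error.
  have hsplit : (YJ J).indicator (psi β (Set.Iic (J : ℝ)) k) = fun y =>
      (YJ J).indicator (psi β (Set.Iic (J₀ : ℝ)) k) y +
        (YJ J).indicator (psi β (Set.Ioc (J₀ : ℝ) J) k) y := by
    funext y
    by_cases hy : y ∈ YJ J
    · simp only [Set.indicator_of_mem hy]
      refine psi_split hβ hM (fun x => ?_) (fun x h h' => not_lt.2 (Set.mem_Iic.1 h) h'.1) y
      rw [Set.mem_Iic, Set.mem_Iic, Set.mem_Ioc]
      exact ⟨fun h => (le_or_gt x J₀).imp id fun h' => ⟨h', h⟩,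
        fun h => h.elim (fun h => h.trans hJ') fun h => h.2⟩
    · simp only [Set.indicator_of_notMem hy, add_zero]
  have e1 := hμ.add _ _ i1 i3
  rw [← hsplit] at e1
  have e2 := hμ.add _ _ hEK.isInv_SK hNK.isInv_SK
  have c1 := hμ.mono hEK.isInv_SK hk hEle
  have c2 := hμ.mono hk (hEK.isInv_SK.add hNK.isInv_SK) hle
  have c3 := hμ.nonneg _ i3 fun y => Set.indicator_nonneg (fun y _ => psi_nonneg β _ h0 y) y
  have c4 : μ (SK (GL2System.heckeK k (Set.Iic (J : ℝ)) (YJ J))) = μ kE := rfl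
  have c5 : μ (SK (GL2System.heckeK k (Set.Ioc (J : ℝ) ((J : ℝ) ^ 2)) Y)) = μ kN := rfl
  rw [c4, c5] at e2
  constructor
  · linarith
  · linarith

end IsHecke

/-! ### The Hecke property of `psi` -/

lemma exists_nat_scal_of_finite {s : Set RC} (hs : s.Finite) :
    ∃ N : ℕ, ∀ g : G, rc g ∈ s → ∃ n ≤ N, ∃ hn : (0 : ℚ) < n, scal n hn * g ∈ M2Zplus := by
  choose n hn hn' using fun x : RC => exists_scal_mul_mem x.out
  refine ⟨∑ x ∈ hs.toFinset, n x, fun g hg => ⟨n (rc g),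
    Finset.single_le_sum (f := n) (fun _ _ => Nat.zero_le _) (hs.mem_toFinset.2 hg), hn _, ?_⟩⟩
  obtain ⟨γ, hγ, e⟩ := exists_out g
  have h := hn' (rc g)
  rw [e, ← mul_assoc, scal_comm, mul_assoc, gam_mul_mem_M2Zplus_iff hγ] at h
  exact h

/-- A kernel and its inverse involve bounded denominators only. Once J exceeds them, at points of
`YJ J` an integral m forces the other variable g to be integral as well, so in the double sum below
both variables may be taken integral. -/
lemma IsKerR.exists_mem {u : G → AfH → ℝ} (hu : IsKerR u) :
    ∃ J₀ : ℕ, ∀ J, J₀ ≤ J → ∀ y ∈ YJ J, ∀ g m : G, m ∈ M2Zplus →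
      (u (g * m⁻¹) (m • y) ≠ 0 → g ∈ M2Zplus) ∧ (u (m * g⁻¹) (g • y) ≠ 0 → g ∈ M2Zplus) := by
  obtain ⟨s, hs, hs'⟩ := hu.fin
  obtain ⟨N, hN⟩ := exists_nat_scal_of_finite hs
  obtain ⟨N', hN'⟩ := exists_nat_scal_of_finite (finite_rc_inv hs)
  have hne : ∀ {g y}, u g y ≠ 0 → rc g ∈ s ∧ y ∈ Y ∧ g • y ∈ Y := fun {g y} h =>
    ⟨hs' g y (Complex.ofReal_ne_zero.2 h), hu.supp g y (Complex.ofReal_ne_zero.2 h)⟩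
  have key : ∀ {J n : ℕ} {y : AfH} {g h m : G}, y ∈ YJ J → g • y ∈ Y → n ≤ J →
      ∀ hn : (0 : ℚ) < n, scal n hn * h ∈ M2Zplus → m ∈ M2Zplus → h * m = g → g ∈ M2Zplus := by
    intro J n y g h m hy hg hnJ hn hh hm e
    refine mem_M2Zplus_of_YJ hy hg hn ?_ fun p _ hp =>
      (Nat.le_of_dvd (by exact_mod_cast hn) hp).trans hnJ
    rw [← e, ← mul_assoc]
    exact M2Zplus_mul hh hm
  refine ⟨max N N', fun J hJ y hy g m hm => ⟨fun h => ?_, fun h => ?_⟩⟩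
  · obtain ⟨h1, -, h3⟩ := hne h
    rw [smul_smul, inv_mul_cancel_right] at h3
    obtain ⟨n, hn, hn0, hn'⟩ := hN _ h1
    exact key hy h3 (hn.trans ((le_max_left _ _).trans hJ)) hn0 hn' hm (inv_mul_cancel_right _ _)
  · obtain ⟨h1, h2, -⟩ := hne h
    obtain ⟨n, hn, hn0, hn'⟩ := hN' (g * m⁻¹) ⟨m * g⁻¹, h1, by rw [mul_inv_rev, inv_inv]⟩
    exact key hy h2 (hn.trans ((le_max_right _ _).trans hJ)) hn0 hn' hm (inv_mul_cancel_right _ _)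

lemma IsKerR.abs {u : G → AfH → ℝ} (hu : IsKerR u) : IsKerR fun g y => |u g y| := by
  have := IsKer.comp hu (φ := fun z => ((‖z‖ : ℝ) : ℂ)) (by fun_prop) (by simp)
  simpa [IsKerR] using this

/-- The kernel `W(g, m) = Det(m)^{-β} u(g m⁻¹, m y)` on pairs of integral matrices. -/
def pairK (β : ℝ) (u : G → AfH → ℝ) (y : AfH) (g m : G) : ℝ :=
  wt β Set.univ m * u (g * m⁻¹) (m • y)

lemma SK_smul_eq {u : G → AfH → ℝ} (hu : IsKerR u) (m : G) (y : AfH) :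
    SK u (m • y) = lsum fun g => u (g * m⁻¹) (m • y) := by
  have h := lsum_mul_right (hu.leftInv (m • y)) m⁻¹
  exact h.symm

/-- For fixed m the sum over g of absolute values is `SK |u|` at m y, which is bounded, and the
weights Det(m)^{-β} are summable. -/
lemma summable_pairK {β : ℝ} (hβ : 2 < β) {u : G → AfH → ℝ} (hu : IsKerR u) (y : AfH) :
    Summable fun p : RC × RC => pairK β u y p.2.out p.1.out := by
  obtain ⟨M, hM0, hM⟩ := hu.abs.isInv_SK.exists_bound
  have hfin : ∀ m : G, Summable fun x : RC => |u (x.out * m⁻¹) (m • y)| := by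
    intro m
    obtain ⟨S, hS, -⟩ := hu.SK_eq_sum
    have h1 : {x : RC | rcRight m⁻¹ x ∈ S}.Finite :=
      S.finite_toSet.preimage (rcRight m⁻¹).injective.injOn
    refine summable_of_ne_finset_zero (s := h1.toFinset) fun x hx => ?_
    by_contra hne
    refine hx (h1.mem_toFinset.2 ?_)
    have h2 := hS _ _ (abs_ne_zero.1 hne)
    have h3 : rcRight m⁻¹ x = rc (x.out * m⁻¹) := by
      rw [← rcRight_rc]
      congr 1
      exact (Quotient.out_eq x).symm
    change rcRight m⁻¹ x ∈ S
    rwa [h3]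
  have hsum : ∀ m : G, ∑' x : RC, |u (x.out * m⁻¹) (m • y)| ≤ M := by
    intro m
    have h := SK_smul_eq hu.abs m y
    rw [lsum] at h
    rw [← h]
    exact (le_abs_self _).trans (hM _)
  refine Summable.of_norm ?_
  refine (summable_prod_of_nonneg fun _ => norm_nonneg _).2 ⟨fun x => ?_, ?_⟩
  · simp only [pairK, norm_mul, Real.norm_eq_abs]
    exact (hfin _).mul_left _
  · simp only [pairK, norm_mul, Real.norm_eq_abs, tsum_mul_left]
    refine ((summable_wt hβ Set.univ).mul_right M).of_nonneg_of_le (fun x => ?_) fun x => ?_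
    · exact mul_nonneg (abs_nonneg _) (tsum_nonneg fun _ => abs_nonneg _)
    · rw [abs_of_nonneg (wt_nonneg _ _ _)]
      exact mul_le_mul_of_nonneg_left (hsum _) (wt_nonneg _ _ _)

/-- Both sides are double sums of Det(m)^{-β} u(g m⁻¹, m y) over integral g and m, differing only in
which variable is summed first: in the transformed sum Det(m)^{-β} Det(g m⁻¹)^{-β} = Det(g)^{-β}. -/
lemma exists_psi_hecke {β : ℝ} (hβ : 2 < β) {u : G → AfH → ℝ} (hu : IsKerR u) :
    ∃ J₀ : ℕ, ∀ J, J₀ ≤ J → ∀ y ∈ YJ J,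
      psi β Set.univ (SK u) y = psi β Set.univ (SK (sharp β u)) y := by
  obtain ⟨J₀, hJ₀⟩ := hu.exists_mem
  refine ⟨J₀, fun J hJ y hy => ?_⟩
  have e1 : psi β Set.univ (SK u) y =
      ∑' x : RC, ∑' x' : RC, pairK β u y x'.out x.out := by
    refine tsum_congr fun x => ?_
    dsimp only
    rw [SK_smul_eq hu, lsum, ← tsum_mul_left]
    rfl
  have e2 : psi β Set.univ (SK (sharp β u)) y =
      ∑' x : RC, ∑' x' : RC, pairK β u y x.out x'.out := by
    refine tsum_congr fun x => ?_
    dsimp only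
    rw [SK_smul_eq hu.sharp, lsum, ← tsum_mul_left]
    refine tsum_congr fun x' => ?_
    unfold pairK sharp
    set m := x.out
    set g := x'.out
    rw [smul_smul, inv_mul_cancel_right, mul_inv_rev, inv_inv]
    by_cases hm : m ∈ M2Zplus
    · rw [wt_of_mem hm (Set.mem_univ _)]
      by_cases h0 : u (m * g⁻¹) (g • y) = 0
      · rw [h0, mul_zero, mul_zero, mul_zero]
      · have hg := (hJ₀ J hJ y hy g m hm).2 h0
        rw [wt_of_mem hg (Set.mem_univ _), ← mul_assoc, ← Real.mul_rpow (detR_pos _).le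
          (detR_pos _).le, ← detR_mul, ← mul_assoc, detR_mul, detR_mul,
          detR_inv, mul_comm (detR m), mul_inv_cancel_right₀ (detR_pos m).ne']
    · rw [wt_of_not fun h => hm h.1, zero_mul]
      by_cases hg : g ∈ M2Zplus
      · by_cases h0 : u (m * g⁻¹) (g • y) = 0
        · rw [h0, mul_zero]
        · exact absurd ((hJ₀ J hJ y hy m g hg).1 h0) hm
      · rw [wt_of_not fun h => hg h.1, zero_mul]
  rw [e1, e2]
  exact (Summable.tsum_comm (f := fun x x' : RC => pairK β u y x'.out x.out)
    (summable_pairK hβ hu y)).symm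

/-! ### The part of a Hecke functional on the invertible points -/

lemma IsInv.neg {k : AfH → ℝ} (hk : IsInv k) : IsInv fun y => -k y := by
  simpa using hk.const_mul (-1)

lemma IsInv.exists_sub {k : AfH → ℝ} (hk : IsInv k) : ∃ a b : AfH → ℝ, IsInv a ∧ IsInv b ∧
    (∀ y, 0 ≤ a y) ∧ (∀ y, 0 ≤ b y) ∧ (k = fun y => a y - b y) ∧
    ∀ y, k y = 0 → a y = 0 ∧ b y = 0 := by
  refine ⟨fun y => max (k y) 0, fun y => max (-k y) 0, hk.max_zero, hk.neg.max_zero,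
    fun _ => le_max_right _ _, fun _ => le_max_right _ _, funext fun y => ?_, fun y h => ?_⟩
  · dsimp only
    rcases le_total 0 (k y) with h | h
    · rw [max_eq_left h, max_eq_right (by linarith), sub_zero]
    · rw [max_eq_right h, max_eq_left (by linarith), zero_sub, neg_neg]
  · simp [h]

/-- The limit of `μ(1_{YJ} k)`, that is, the part of `μ` on the points `(ρ, τ)` with `ρ`
invertible. -/
def unitPart (μ : (AfH → ℝ) → ℝ) (k : AfH → ℝ) : ℝ :=
  Filter.limUnder Filter.atTop fun J : ℕ => μ ((YJ J).indicator k)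

/-- The function `psi`, cut off outside `Y`. -/
def psiY (β : ℝ) (k : AfH → ℝ) : AfH → ℝ := Y.indicator (psi β Set.univ k)

lemma indicator_YJ_Y (J : ℕ) (f : AfH → ℝ) : (YJ J).indicator (Y.indicator f) =
    (YJ J).indicator f := by
  rw [Set.indicator_indicator, Set.inter_eq_left.2 fun y hy => hy.1]

lemma abs_psiY_sub_le {β : ℝ} (hβ : 2 < β) {k : AfH → ℝ} {M : ℝ} (hM : ∀ y, |k y| ≤ M) (J : ℝ)
    (y : AfH) :
    |psiY β k y - Y.indicator (psi β (Set.Iic J) k) y| ≤ M * wsum β (Set.Ioi J) := by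
  unfold psiY
  by_cases hy : y ∈ Y
  · rw [Set.indicator_of_mem hy, Set.indicator_of_mem hy, psi_univ_eq hβ hM J, add_sub_cancel_left]
    exact abs_psi_le hβ hM _ y
  · rw [Set.indicator_of_notMem hy, Set.indicator_of_notMem hy, sub_zero, abs_zero]
    exact (abs_nonneg _).trans (abs_psi_le hβ hM (Set.Ioi J) y)

lemma continuous_psiY {β : ℝ} (hβ : 2 < β) {k : AfH → ℝ} (hk : IsInv k) :
    Continuous (psiY β k) := by
  obtain ⟨M, hM0, hM⟩ := hk.exists_bound
  have h1 : Filter.Tendsto (fun J : ℕ => M * wsum β (Set.Ioi (J : ℝ))) Filter.atTop (nhds 0) := by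
    simpa using (tendsto_wsum hβ).const_mul M
  have h : TendstoUniformly (fun (J : ℕ) => Y.indicator (psi β (Set.Iic (J : ℝ)) k)) (psiY β k)
      Filter.atTop := by
    rw [Metric.tendstoUniformly_iff]
    intro ε hε
    filter_upwards [h1.eventually_lt_const hε] with J hJ y
    rw [Real.dist_eq]
    exact (abs_psiY_sub_le hβ hM J y).trans_lt hJ
  exact h.continuous (.of_forall fun J => (isInv_psi_Y β hk (fun x h => h)).cont)

lemma psiY_gam (β : ℝ) {k : AfH → ℝ} (hk : IsInv k) {γ : G} (hγ : γ ∈ Gam) (y : AfH) :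
    psiY β k (γ • y) = psiY β k y := by
  unfold psiY
  by_cases hy : y ∈ Y
  · rw [Set.indicator_of_mem hy, Set.indicator_of_mem (Gam_smul_mem hγ hy), psi_gam β _ hk hγ]
  · rw [Set.indicator_of_notMem hy, Set.indicator_of_notMem fun h => hy ((Gam_smul_mem_iff hγ).1 h)]

lemma isInv_psiY_mul {β : ℝ} (hβ : 2 < β) {k k₀ : AfH → ℝ} (hk : IsInv k) (hk₀ : IsInv k₀) :
    IsInv fun y => psiY β k y * k₀ y :=
  hk₀.mul_left (continuous_psiY hβ hk) fun _ ha y => psiY_gam β hk ha y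

/-- A prime factor of Det h would be at most J and divide the determinant of h y. -/
lemma detR_eq_one_of_YJ {J : ℕ} {y : AfH} {h : G} (hh : h ∈ M2Zplus)
    (hJ : detR h ≤ J) (hy : h • y ∈ YJ J) (hy' : y ∈ Y) : detR h = 1 := by
  obtain ⟨j, hj0, hj⟩ := exists_detR_eq hh
  rw [hj] at hJ ⊢
  have hjJ : j ≤ J := by exact_mod_cast hJ
  by_contra hne
  have hj1 : j ≠ 1 := fun h => hne (by rw [h, Nat.cast_one])
  obtain ⟨p, hp, q, hq⟩ := Nat.exists_prime_and_dvd hj1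
  refine hy.2 p hp ((Nat.le_of_dvd hj0 ⟨q, hq⟩).trans hjJ) ?_
  have hdet : h.1.1.det = (p : ℚ) * q := by
    have : h.1.1.det = (j : ℚ) := by
      unfold detR at hj
      exact_mod_cast hj
    rw [this, hq, Nat.cast_mul]
  unfold Dvd
  rw [det_smul, hdet, map_mul, mul_assoc, qA_inv_mul_cancel (by exact_mod_cast hp.ne_zero)]
  exact R_mul (by simpa using R_int q) (det_mem hy')

/-- On `YJ J`, the function `psi` of a function supported in `YJ J` is close to that function. -/
lemma abs_psi_indicator_sub_le {β : ℝ} (hβ : 2 < β) {k : AfH → ℝ} (hk : IsInv k) {M : ℝ}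
    (hM : ∀ y, |k y| ≤ M) {J : ℕ} (hJ : 1 ≤ J) {y : AfH} (hy : y ∈ YJ J) :
    |psi β Set.univ ((YJ J).indicator k) y - k y| ≤ M * wsum β (Set.Ioi (J : ℝ)) := by
  have hM' : ∀ y, |(YJ J).indicator k y| ≤ M := fun y => by
    by_cases h : y ∈ YJ J
    · rw [Set.indicator_of_mem h]; exact hM y
    · rw [Set.indicator_of_notMem h, abs_zero]; exact (abs_nonneg _).trans (hM y)
  have hi := isInv_indicator_YJ hk J
  -- Among determinants at most J only the coset of 1 sends y into `YJ J`.
  have e : psi β (Set.Iic (J : ℝ)) ((YJ J).indicator k) y = k y := by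
    have h := lsum_eq_single (u := fun h => wt β (Set.Iic (J : ℝ)) h * (YJ J).indicator k (h • y))
      (fun γ hγ g => by
        dsimp only
        rw [wt_gam_mul β _ hγ, mul_smul, hi.inv γ hγ]) 1 fun h hh => by
        have h1 := wt_ne (left_ne_zero_of_mul hh)
        have h2 := Set.mem_of_indicator_ne_zero (right_ne_zero_of_mul hh)
        exact rc_of_mem (mem_Gam_iff.2 ⟨h1.1, detR_eq_one_of_YJ h1.1 h1.2 h2 hy.1⟩)
    rw [psi, h, one_smul, Set.indicator_of_mem hy, wt_of_mem (mem_Gam_iff.1 (one_mem _)).1,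
      detR_one, Real.one_rpow, one_mul]
    rw [detR_one, Set.mem_Iic]
    exact_mod_cast hJ
  rw [psi_univ_eq hβ hM' J, e, add_sub_cancel_left]
  exact abs_psi_le hβ hM' _ y

namespace IsHecke

variable {β : ℝ} {μ : (AfH → ℝ) → ℝ} (hμ : IsHecke β μ)
include hμ

/-- For non-negative k the values decrease with J and are bounded below; a general k is a difference
of two such functions. -/
lemma tendsto_unitPart {k : AfH → ℝ} (hk : IsInv k) :
    Filter.Tendsto (fun J : ℕ => μ ((YJ J).indicator k)) Filter.atTop (nhds (unitPart μ k)) := by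
  have aux : ∀ a : AfH → ℝ, IsInv a → (∀ y, 0 ≤ a y) →
      ∃ c, Filter.Tendsto (fun J : ℕ => μ ((YJ J).indicator a)) Filter.atTop (nhds c) := by
    intro a ha h0
    refine ⟨_, tendsto_atTop_ciInf (fun J K hJK => ?_) ⟨0, ?_⟩⟩
    · refine hμ.mono (isInv_indicator_YJ ha K) (isInv_indicator_YJ ha J) fun y => ?_
      exact Set.indicator_le_indicator_of_subset (fun y hy => YJ_anti hJK hy) h0 y
    · rintro _ ⟨J, rfl⟩
      exact hμ.nonneg _ (isInv_indicator_YJ ha J) fun y => Set.indicator_nonneg (fun y _ => h0 y) y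
  obtain ⟨a, b, ha, hb, ha0, hb0, rfl, -⟩ := hk.exists_sub
  obtain ⟨c, hc⟩ := aux a ha ha0
  obtain ⟨d, hd⟩ := aux b hb hb0
  refine tendsto_nhds_limUnder ⟨c - d, (hc.sub hd).congr fun J => ?_⟩
  rw [← hμ.sub (isInv_indicator_YJ ha J) (isInv_indicator_YJ hb J)]
  congr 1
  exact (Set.indicator_sub (YJ J) a b).symm

lemma unitPart_eq {k : AfH → ℝ} (hk : IsInv k) {c : ℝ}
    (h : Filter.Tendsto (fun J : ℕ => μ ((YJ J).indicator k)) Filter.atTop (nhds c)) :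
    unitPart μ k = c := tendsto_nhds_unique (hμ.tendsto_unitPart hk) h

lemma unitPart_add {k k' : AfH → ℝ} (hk : IsInv k) (hk' : IsInv k') :
    unitPart μ (fun y => k y + k' y) = unitPart μ k + unitPart μ k' := by
  refine hμ.unitPart_eq (hk.add hk')
    (((hμ.tendsto_unitPart hk).add (hμ.tendsto_unitPart hk')).congr fun J => ?_)
  rw [← hμ.add _ _ (isInv_indicator_YJ hk J) (isInv_indicator_YJ hk' J)]
  congr 1
  exact (Set.indicator_add (YJ J) k k').symm

lemma unitPart_smul (c : ℝ) {k : AfH → ℝ} (hk : IsInv k) :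
    unitPart μ (fun y => c * k y) = c * unitPart μ k := by
  refine hμ.unitPart_eq (hk.const_mul c) (((hμ.tendsto_unitPart hk).const_mul c).congr fun J => ?_)
  rw [← hμ.smul _ _ (isInv_indicator_YJ hk J)]
  congr 1
  exact (funext fun y => Set.indicator_const_mul (YJ J) k c y).symm

/-- The comparison is needed only on `YJ J` for large J, which is why statements valid only for
large J, such as `exists_psi_hecke`, can be used. -/
lemma unitPart_mono {k k' : AfH → ℝ} (hk : IsInv k) (hk' : IsInv k') {J₀ : ℕ}
    (h : ∀ J, J₀ ≤ J → ∀ y ∈ YJ J, k y ≤ k' y) : unitPart μ k ≤ unitPart μ k' := by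
  refine le_of_tendsto_of_tendsto (hμ.tendsto_unitPart hk) (hμ.tendsto_unitPart hk') ?_
  filter_upwards [Filter.eventually_ge_atTop J₀] with J hJ
  refine hμ.mono (isInv_indicator_YJ hk J) (isInv_indicator_YJ hk' J) fun y => ?_
  by_cases hy : y ∈ YJ J
  · rw [Set.indicator_of_mem hy, Set.indicator_of_mem hy]
    exact h J hJ y hy
  · rw [Set.indicator_of_notMem hy, Set.indicator_of_notMem hy]

lemma unitPart_congr {k k' : AfH → ℝ} (hk : IsInv k) (hk' : IsInv k') {J₀ : ℕ}
    (h : ∀ J, J₀ ≤ J → ∀ y ∈ YJ J, k y = k' y) : unitPart μ k = unitPart μ k' :=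
  le_antisymm (hμ.unitPart_mono hk hk' fun J hJ y hy => (h J hJ y hy).le)
    (hμ.unitPart_mono hk' hk fun J hJ y hy => (h J hJ y hy).ge)

lemma unitPart_nonneg {k : AfH → ℝ} (hk : IsInv k) (h0 : ∀ y, 0 ≤ k y) : 0 ≤ unitPart μ k :=
  ge_of_tendsto' (hμ.tendsto_unitPart hk) fun J =>
    hμ.nonneg _ (isInv_indicator_YJ hk J) fun y => Set.indicator_nonneg (fun y _ => h0 y) y

lemma unitPart_sub {k k' : AfH → ℝ} (hk : IsInv k) (hk' : IsInv k') :
    unitPart μ (fun y => k y - k' y) = unitPart μ k - unitPart μ k' := by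
  rw [eq_sub_iff_add_eq, ← hμ.unitPart_add (hk.sub hk') hk']
  simp

lemma unitPart_le {k : AfH → ℝ} (hk : IsInv k) (h0 : ∀ y, 0 ≤ k y) : unitPart μ k ≤ μ k :=
  le_of_tendsto' (hμ.tendsto_unitPart hk) fun J =>
    hμ.mono (isInv_indicator_YJ hk J) hk fun y => Set.indicator_le_self' (fun y _ => h0 y) y

lemma unitPart_psi_le (hβ : 2 < β) {k : AfH → ℝ} (hk : IsInv k) (h0 : ∀ y, 0 ≤ k y) {M : ℝ}
    (hM : ∀ y, |k y| ≤ M) (J₀ : ℕ) :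
    unitPart μ (Y.indicator (psi β (Set.Iic (J₀ : ℝ)) k)) ≤ μ k ∧
      μ k ≤ unitPart μ (Y.indicator (psi β (Set.Iic (J₀ : ℝ)) k)) +
        2 * (M * wsum β (Set.Ioi (J₀ : ℝ)) * mass μ) := by
  have h := hμ.tendsto_unitPart (isInv_psi_Y β hk (D := Set.Iic (J₀ : ℝ)) (fun x h => h))
  simp only [indicator_YJ_Y] at h
  constructor
  · refine le_of_tendsto h ?_
    filter_upwards [Filter.eventually_ge_atTop (max J₀ 1)] with J hJ
    exact (hμ.approx hβ hk h0 hM ((le_max_left _ _).trans hJ) ((le_max_right _ _).trans hJ)).1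
  · refine ge_of_tendsto (h.add_const _) ?_
    filter_upwards [Filter.eventually_ge_atTop (max J₀ 1)] with J hJ
    exact (hμ.approx hβ hk h0 hM ((le_max_left _ _).trans hJ) ((le_max_right _ _).trans hJ)).2

/-- A Hecke functional that is a point mass on the invertible points is a sum over the Hecke
orbit of the point. -/
lemma eq_psi_of_unitPart (hβ : 2 < β) {C : ℝ} {y₀ : AfH} (hy₀ : y₀ ∈ Y)
    (h : ∀ k, IsInv k → unitPart μ k = C * k y₀) {k : AfH → ℝ} (hk : IsInv k) :
    μ k = C * psi β Set.univ k y₀ := by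
  have aux : ∀ a : AfH → ℝ, IsInv a → (∀ y, 0 ≤ a y) → μ a = C * psi β Set.univ a y₀ := by
    intro a ha h0
    obtain ⟨M, hM0, hM⟩ := ha.exists_bound
    have h1 : ∀ J : ℕ, unitPart μ (Y.indicator (psi β (Set.Iic (J : ℝ)) a)) =
        C * psi β Set.univ a y₀ - C * psi β (Set.Ioi (J : ℝ)) a y₀ := fun J => by
      rw [h _ (isInv_psi_Y β ha (D := Set.Iic (J : ℝ)) (fun x h => h)), Set.indicator_of_mem hy₀,
        psi_univ_eq hβ hM J]
      ring
    have h2 : Filter.Tendsto (fun J : ℕ => psi β (Set.Ioi (J : ℝ)) a y₀) Filter.atTop (nhds 0) := by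
      refine squeeze_zero_norm (fun J => abs_psi_le hβ hM _ y₀) ?_
      simpa using (tendsto_wsum hβ).const_mul M
    have h3 : Filter.Tendsto (fun J : ℕ => unitPart μ (Y.indicator (psi β (Set.Iic (J : ℝ)) a)))
        Filter.atTop (nhds (C * psi β Set.univ a y₀)) := by
      simp only [h1]
      simpa using (h2.const_mul C).const_sub (C * psi β Set.univ a y₀)
    have h4 : Filter.Tendsto (fun J : ℕ => unitPart μ (Y.indicator (psi β (Set.Iic (J : ℝ)) a)) +
        2 * (M * wsum β (Set.Ioi (J : ℝ)) * mass μ)) Filter.atTop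
        (nhds (C * psi β Set.univ a y₀)) := by
      have := h3.add ((((tendsto_wsum hβ).const_mul M).mul_const (mass μ)).const_mul 2)
      simpa using this
    exact le_antisymm (ge_of_tendsto' h4 fun J => (hμ.unitPart_psi_le hβ ha h0 hM J).2)
      (le_of_tendsto' h3 fun J => (hμ.unitPart_psi_le hβ ha h0 hM J).1)
  obtain ⟨a, b, ha, hb, ha0, hb0, rfl, -⟩ := hk.exists_sub
  obtain ⟨M, -, hM⟩ := ha.exists_bound
  obtain ⟨M', -, hM'⟩ := hk.exists_bound
  have e : psi β Set.univ a y₀ = psi β Set.univ (fun y => a y - b y) y₀ + psi β Set.univ b y₀ := by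
    obtain ⟨M'', -, hM''⟩ := hb.exists_bound
    rw [← psi_add hβ hM' hM'']
    simp
  rw [hμ.sub ha hb, aux a ha ha0, aux b hb hb0, e]
  ring

/-- A positive functional that vanishes on the non-negative functions that vanish at `y₀` is a
multiple of the evaluation. -/
lemma unitPart_eq_mul {y₀ : AfH} (hy₀ : y₀ ∈ Y)
    (h : ∀ k, IsInv k → (∀ y, 0 ≤ k y) → k y₀ = 0 → unitPart μ k = 0) :
    ∃ b : AfH → ℝ, IsInv b ∧ (∀ y, 0 ≤ b y) ∧ b y₀ = 1 ∧
      ∀ k, IsInv k → unitPart μ k = unitPart μ b * k y₀ := by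
  obtain ⟨n, hn⟩ := exists_bump (max y₀.2.im y₀.2.im⁻¹)
  have hb1 := hn n le_rfl y₀ hy₀ (exists_Ht y₀)
  refine ⟨bump n, isInv_bump n, bump_nonneg n, hb1, fun k hk => ?_⟩
  -- This function vanishes at y₀, and so do its positive and negative parts, to which the
  -- hypothesis applies.
  have hd : IsInv fun y => k y - k y₀ * bump n y := hk.sub ((isInv_bump n).const_mul _)
  obtain ⟨a, b, ha, hb, ha0, hb0, e, h0⟩ := hd.exists_sub
  have h1 := h0 y₀ (by rw [hb1, mul_one, sub_self])
  have h2 : unitPart μ (fun y => k y - k y₀ * bump n y) = 0 := by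
    rw [e, hμ.unitPart_sub ha hb, h a ha ha0 h1.1, h b hb hb0 h1.2, sub_zero]
  rw [hμ.unitPart_sub hk ((isInv_bump n).const_mul _), hμ.unitPart_smul _ (isInv_bump n)] at h2
  linarith

end IsHecke

/-! ### Extremal Hecke functionals -/

/-- A normalized Hecke functional all of whose Hecke minorants are proportional to it. -/
structure IsExtHecke (β : ℝ) (μ : (AfH → ℝ) → ℝ) : Prop extends IsHecke β μ where
  mass_eq : mass μ = 1
  prop : ∀ ν, IsHecke β ν → (∀ k, IsInv k → (∀ y, 0 ≤ k y) → ν k ≤ μ k) →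
    ∃ c, ∀ k, IsInv k → ν k = c * μ k

/-- The Gibbs functional of a point. -/
def gibbs (β : ℝ) (y : AfH) (k : AfH → ℝ) : ℝ := (partZ β)⁻¹ * psi β Set.univ k y

lemma psi_one {β : ℝ} (hβ : 2 < β) (y : AfH) : psi β Set.univ (fun _ => 1) y = partZ β := by
  unfold psi
  simp only [mul_one]
  exact wsum_univ hβ

lemma psi_le_partZ {β : ℝ} (hβ : 2 < β) {k : AfH → ℝ} (hk : IsInv k) (h : ∀ y, k y ≤ 1) (y : AfH) :
    psi β Set.univ k y ≤ partZ β := by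
  obtain ⟨M, -, hM⟩ := hk.exists_bound
  rw [← psi_one hβ y]
  exact psi_mono hβ hM (k' := fun _ => 1) (M' := 1) (fun _ => by simp) h _ y

section Weighted

variable {β : ℝ} (hβ : 2 < β) {μ : (AfH → ℝ) → ℝ} (hμ : IsHecke β μ) {k₀ : AfH → ℝ}
  (hk₀ : IsInv k₀) (h0 : ∀ y, 0 ≤ k₀ y)
include hβ hμ hk₀ h0

/-- The Hecke relation holds for `psi` pointwise on `YJ J` with J large, so it survives
multiplication by any weight k₀. -/
lemma IsHecke.weighted : IsHecke β fun k => unitPart μ fun y => psiY β k y * k₀ y where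
  add k k' hk hk' := by
    rw [← hμ.unitPart_add (isInv_psiY_mul hβ hk hk₀) (isInv_psiY_mul hβ hk' hk₀)]
    congr 1
    funext y
    obtain ⟨M, -, hM⟩ := hk.exists_bound
    obtain ⟨M', -, hM'⟩ := hk'.exists_bound
    rw [← add_mul]
    congr 1
    unfold psiY
    by_cases hy : y ∈ Y
    · simp only [Set.indicator_of_mem hy]
      exact psi_add hβ hM hM' _ y
    · simp only [Set.indicator_of_notMem hy, add_zero]
  smul c k hk := by
    rw [← hμ.unitPart_smul c (isInv_psiY_mul hβ hk hk₀)]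
    congr 1
    funext y
    rw [← mul_assoc]
    congr 1
    unfold psiY
    rw [← Set.indicator_const_mul]
    exact congrFun (congrArg _ (funext fun y => psi_smul β _ c k y)) y
  nonneg k hk hk0 := hμ.unitPart_nonneg (isInv_psiY_mul hβ hk hk₀) fun y =>
    mul_nonneg (Set.indicator_nonneg (fun y _ => psi_nonneg β _ hk0 y) y) (h0 y)
  bdd := by
    refine ⟨partZ β * unitPart μ k₀, fun k hk h1 => ?_⟩
    rw [← hμ.unitPart_smul _ hk₀]
    refine hμ.unitPart_mono (J₀ := 0) (isInv_psiY_mul hβ hk hk₀) (hk₀.const_mul _)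
      fun J _ y hy => mul_le_mul_of_nonneg_right ?_ (h0 y)
    rw [psiY, Set.indicator_of_mem hy.1]
    exact psi_le_partZ hβ hk h1 y
  hecke u hu := by
    obtain ⟨J₀, hJ₀⟩ := exists_psi_hecke hβ hu
    refine hμ.unitPart_congr (isInv_psiY_mul hβ hu.isInv_SK hk₀)
      (isInv_psiY_mul hβ hu.sharp.isInv_SK hk₀) (J₀ := J₀) fun J hJ y hy => ?_
    unfold psiY
    rw [Set.indicator_of_mem hy.1, Set.indicator_of_mem hy.1, hJ₀ J hJ y hy]

/-- With `psi` truncated at determinant J this is the lower estimate in `unitPart_psi_le`; the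
truncation costs a tail that tends to 0. -/
lemma IsHecke.weighted_le (h1 : ∀ y, k₀ y ≤ 1) {k : AfH → ℝ} (hk : IsInv k)
    (hk0 : ∀ y, 0 ≤ k y) : unitPart μ (fun y => psiY β k y * k₀ y) ≤ μ k := by
  obtain ⟨M, hM0, hM⟩ := hk.exists_bound
  have hlim : Filter.Tendsto (fun J : ℕ => μ k + M * wsum β (Set.Ioi (J : ℝ)) * unitPart μ k₀)
      Filter.atTop (nhds (μ k)) := by
    simpa using (((tendsto_wsum hβ).const_mul M).mul_const (unitPart μ k₀)).const_add (μ k)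
  refine ge_of_tendsto' hlim fun J => ?_
  have i1 := isInv_psi_Y β hk (D := Set.Iic (J : ℝ)) (fun x h => h)
  refine le_trans ?_ (add_le_add_left (hμ.unitPart_psi_le hβ hk hk0 hM J).1 _)
  rw [← hμ.unitPart_smul _ hk₀, ← hμ.unitPart_add i1 (hk₀.const_mul _)]
  refine hμ.unitPart_mono (J₀ := 0) (isInv_psiY_mul hβ hk hk₀) (i1.add (hk₀.const_mul _))
    fun J' _ y hy => ?_
  have h2 := (abs_le.1 (abs_psiY_sub_le hβ hM J y)).2
  have h3 : 0 ≤ Y.indicator (psi β (Set.Iic (J : ℝ)) k) y :=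
    Set.indicator_nonneg (fun y _ => psi_nonneg β _ hk0 y) y
  calc psiY β k y * k₀ y
      ≤ (Y.indicator (psi β (Set.Iic (J : ℝ)) k) y + M * wsum β (Set.Ioi (J : ℝ))) * k₀ y :=
        mul_le_mul_of_nonneg_right (by linarith) (h0 y)
    _ ≤ _ := by
        rw [add_mul]
        exact add_le_add_left (mul_le_of_le_one_right h3 (h1 y)) _

/-- On `YJ J` the operator `psi` changes 1_{YJ} k only by a tail, so feeding these functions to the
weighted functional recovers the integral of k against the weight k₀. -/
lemma IsHecke.tendsto_weighted {k : AfH → ℝ} (hk : IsInv k) :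
    Filter.Tendsto (fun J : ℕ => unitPart μ fun y => psiY β ((YJ J).indicator k) y * k₀ y)
      Filter.atTop (nhds (unitPart μ fun y => k y * k₀ y)) := by
  obtain ⟨M, hM0, hM⟩ := hk.exists_bound
  have hlim : Filter.Tendsto (fun J : ℕ => M * wsum β (Set.Ioi (J : ℝ)) * unitPart μ k₀)
      Filter.atTop (nhds 0) := by
    simpa using ((tendsto_wsum hβ).const_mul M).mul_const (unitPart μ k₀)
  rw [tendsto_iff_norm_sub_tendsto_zero]
  refine squeeze_zero' (.of_forall fun _ => norm_nonneg _) ?_ hlim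
  filter_upwards [Filter.eventually_ge_atTop 1] with J hJ
  have i1 := isInv_psiY_mul hβ (isInv_indicator_YJ hk J) hk₀
  have i2 := hk.mul hk₀
  have hb : ∀ J', J ≤ J' → ∀ y ∈ YJ J',
      |psiY β ((YJ J).indicator k) y - k y| ≤ M * wsum β (Set.Ioi (J : ℝ)) := by
    intro J' hJ' y hy
    have hy' := YJ_anti hJ' hy
    rw [psiY, Set.indicator_of_mem hy.1]
    exact abs_psi_indicator_sub_le hβ hk hM hJ hy'
  have key : ∀ s : ℝ, |s| = 1 → s * (unitPart μ (fun y => psiY β ((YJ J).indicator k) y * k₀ y) -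
      unitPart μ (fun y => k y * k₀ y)) ≤ M * wsum β (Set.Ioi (J : ℝ)) * unitPart μ k₀ := by
    intro s hs
    rw [← hμ.unitPart_sub i1 i2, ← hμ.unitPart_smul _ (i1.sub i2), ← hμ.unitPart_smul _ hk₀]
    refine hμ.unitPart_mono (J₀ := J) ((i1.sub i2).const_mul _) (hk₀.const_mul _)
      fun J' hJ' y hy => ?_
    rw [← sub_mul, ← mul_assoc]
    refine mul_le_mul_of_nonneg_right ?_ (h0 y)
    refine (le_abs_self _).trans ?_
    rw [abs_mul, hs, one_mul]
    exact hb J' hJ' y hy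
  rw [Real.norm_eq_abs, abs_le]
  constructor
  · linarith [key (-1) (by simp)]
  · linarith [key 1 (by simp)]

end Weighted

/-- A nonzero functional charges every neighbourhood of some point. -/
lemma IsHecke.exists_point {β : ℝ} {μ : (AfH → ℝ) → ℝ} (hμ : IsHecke β μ) {b : AfH → ℝ}
    (hb : IsInv b) (hb' : unitPart μ b ≠ 0) : ∃ y₀ ∈ Y, ∀ k, IsInv k → (∀ y, 0 ≤ k y) →
      0 < k y₀ → 0 < unitPart μ k := by
  by_contra! h
  choose! κ hκ hκ0 hκpos hκle using h
  obtain ⟨T, hT⟩ := hb.ht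
  -- Otherwise finitely many non-negative functions with non-positive integral cover `KT T`. Their
  -- sum K is positive there, so a multiple of K dominates |b| and forces the integral of b to
  -- vanish.
  obtain ⟨t, ht, hcov⟩ := (isCompact_KT T).elim_nhds_subcover (fun y => {z | 0 < κ y z})
    fun y hy => (isOpen_lt continuous_const (hκ y hy.1).cont).mem_nhds (hκpos y hy.1)
  have htY : ∀ x ∈ t, x ∈ Y := fun x hx => (ht x hx).1
  set K : AfH → ℝ := fun z => ∑ x ∈ t, κ x z with hKdef
  have hK : IsInv K := IsInv.sum fun x hx => hκ x (htY x hx)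
  have hK0 : ∀ z, 0 ≤ K z := fun z => Finset.sum_nonneg fun x hx => hκ0 x (htY x hx) z
  have hKle : ∀ s ⊆ t, unitPart μ (fun z => ∑ x ∈ s, κ x z) ≤ 0 := by
    classical
    intro s
    induction s using Finset.induction_on with
    | empty =>
      intro _
      simp only [Finset.sum_empty]
      have := hμ.unitPart_smul 0 (IsInv.zero (E := ℝ))
      simp only [mul_zero, zero_mul] at this
      exact this.le
    | insert x s hx ih =>
      intro hs
      have hs' := (Finset.subset_insert x s).trans hs
      have hxt := htY x (hs (Finset.mem_insert_self x s))
      simp only [Finset.sum_insert hx]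
      rw [hμ.unitPart_add (hκ x hxt) (IsInv.sum fun i hi => hκ i (htY i (hs' hi)))]
      linarith [hκle x hxt, ih hs']
  have hKle' : unitPart μ K ≤ 0 := hKle t subset_rfl
  obtain ⟨M, hM0, hM⟩ := hb.exists_bound
  have hc : ∃ c : ℝ, 0 ≤ c ∧ ∀ z, |b z| ≤ c * K z := by
    rcases (KT T).eq_empty_or_nonempty with he | hne
    · refine ⟨0, le_rfl, fun z => ?_⟩
      by_cases hz : b z = 0
      · rw [hz, abs_zero, zero_mul]
      · obtain ⟨γ, -, h⟩ := exists_smul_mem_KT (hb.supp z hz) (hT z hz)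
        rw [he] at h
        exact absurd h (Set.notMem_empty _)
    · obtain ⟨w, hw, hmin⟩ := (isCompact_KT T).exists_isMinOn hne hK.cont.continuousOn
      have hKw : 0 < K w := by
        obtain ⟨x, hx, hxw⟩ := Set.mem_iUnion₂.1 (hcov hw)
        exact lt_of_lt_of_le hxw
          (Finset.single_le_sum (f := fun x => κ x w) (fun i hi => hκ0 i (htY i hi) w) hx)
      refine ⟨M / K w, by positivity, fun z => ?_⟩
      by_cases hz : b z = 0
      · rw [hz, abs_zero]
        exact mul_nonneg (by positivity) (hK0 z)
      · obtain ⟨γ, hγ, h⟩ := exists_smul_mem_KT (hb.supp z hz) (hT z hz)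
        have h1 : K w ≤ K z := by
          rw [← hK.inv γ hγ z]
          exact isMinOn_iff.1 hmin _ h
        refine (hM z).trans ?_
        rw [div_mul_eq_mul_div, le_div_iff₀ hKw]
        exact mul_le_mul_of_nonneg_left h1 hM0
  obtain ⟨c, hc0, hc⟩ := hc
  have e1 : unitPart μ b ≤ 0 := by
    refine (hμ.unitPart_mono (J₀ := 0) hb (hK.const_mul c) fun _ _ y _ =>
      (le_abs_self _).trans (hc y)).trans ?_
    rw [hμ.unitPart_smul _ hK]
    exact mul_nonpos_of_nonneg_of_nonpos hc0 hKle'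
  have e2 : -unitPart μ b ≤ 0 := by
    have h1 : -unitPart μ b = unitPart μ (fun y => -1 * b y) := by
      rw [hμ.unitPart_smul _ hb]; ring
    rw [h1]
    refine (hμ.unitPart_mono (J₀ := 0) (hb.const_mul _) (hK.const_mul c) fun J _ y _ => ?_).trans ?_
    · rw [neg_one_mul]
      exact (neg_le_abs _).trans (hc y)
    · rw [hμ.unitPart_smul _ hK]
      exact mul_nonpos_of_nonneg_of_nonpos hc0 hKle'
  exact hb' (by linarith)

lemma IsHecke.unitPart_indicator {β : ℝ} {μ : (AfH → ℝ) → ℝ} (hμ : IsHecke β μ) {k : AfH → ℝ}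
    (hk : IsInv k) (J : ℕ) : unitPart μ ((YJ J).indicator k) = unitPart μ k :=
  hμ.unitPart_congr (isInv_indicator_YJ hk J) hk (J₀ := J) fun _ hJ _ hy =>
    Set.indicator_of_mem (YJ_anti hJ hy) k

lemma tendsto_psi_bump {β : ℝ} (hβ : 2 < β) {y : AfH} (hy : y ∈ Y) :
    Filter.Tendsto (fun n : ℕ => psi β Set.univ (bump n) y) Filter.atTop (nhds (partZ β)) := by
  rw [← wsum_univ hβ]
  refine tendsto_tsum_of_dominated_convergence
    (f := fun (n : ℕ) (x : RC) => wt β Set.univ x.out * bump n (x.out • y))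
    (g := fun x : RC => wt β Set.univ x.out) (hasSum_wt hβ).summable (fun x => ?_)
    (.of_forall fun n x => ?_)
  · by_cases hx : x.out ∈ M2Zplus
    · obtain ⟨N, hN⟩ := exists_nat_ge (logH (x.out • y))
      refine tendsto_const_nhds.congr' ?_
      filter_upwards [Filter.eventually_ge_atTop N] with n hn
      rw [bump_eq_one (M2Zplus_smul_mem hx hy) (hN.trans (Nat.cast_le.2 hn)), mul_one]
    · rw [wt_of_not fun h => hx h.1]
      simp only [zero_mul]
      exact tendsto_const_nhds
  · rw [norm_mul, Real.norm_of_nonneg (wt_nonneg _ _ _), Real.norm_of_nonneg (bump_nonneg _ _)]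
    exact mul_le_of_le_one_right (wt_nonneg _ _ _) (bump_le_one _ _)

/-- An extremal Hecke functional is the Gibbs functional of an invertible point. -/
lemma IsExtHecke.exists_eq_gibbs {β : ℝ} (hβ : 2 < β) {μ : (AfH → ℝ) → ℝ} (h : IsExtHecke β μ) :
    ∃ y₀ ∈ Y0, ∀ k, IsInv k → μ k = gibbs β y₀ k := by
  have hμ := h.toIsHecke
  -- Extremality makes the weighted functional a multiple c of μ; evaluating both on 1_{YJ} k and
  -- letting J grow transfers the proportionality to the invertible points.
  have hprop : ∀ k₀, IsInv k₀ → (∀ y, 0 ≤ k₀ y) → (∀ y, k₀ y ≤ 1) →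
      ∃ c, ∀ k, IsInv k → unitPart μ (fun y => k y * k₀ y) = c * unitPart μ k := by
    intro k₀ hk₀ h0 h1
    obtain ⟨c, hc⟩ := h.prop _ (hμ.weighted hβ hk₀ h0) fun k hk hk0 =>
      hμ.weighted_le hβ hk₀ h0 h1 hk hk0
    refine ⟨c, fun k hk => ?_⟩
    refine tendsto_nhds_unique (hμ.tendsto_weighted hβ hk₀ h0 hk) ?_
    refine ((hμ.tendsto_unitPart hk).const_mul c).congr fun J => ?_
    rw [← hc _ (isInv_indicator_YJ hk J)]
  have hne : ∃ b, IsInv b ∧ unitPart μ b ≠ 0 := by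
    by_contra! h0
    have h1 : ∀ k, IsInv k → μ k = 0 := fun k hk => by
      -- With constant 0 the point is irrelevant, and any element of `Y` serves.
      rw [hμ.eq_psi_of_unitPart hβ (C := 0) (y₀ := (0, UpperHalfPlane.I))
        (fun i j => RSub.zero_mem) (fun k hk => by rw [h0 k hk, zero_mul]) hk, zero_mul]
    have h2 := h.mass_eq
    unfold mass at h2
    simp only [h1 _ (isInv_bump _), ciSup_const] at h2
    exact zero_ne_one h2
  obtain ⟨b, hb, hb'⟩ := hne
  obtain ⟨y₀, hy₀, hpos⟩ := hμ.exists_point hb hb'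
  have hvan : ∀ k, IsInv k → (∀ y, 0 ≤ k y) → k y₀ = 0 → unitPart μ k = 0 := by
    intro k hk hk0 hky
    refine le_antisymm (le_of_forall_pos_le_add fun ε hε => ?_) (hμ.unitPart_nonneg hk hk0)
    obtain ⟨n, hn⟩ := exists_bump (max y₀.2.im y₀.2.im⁻¹)
    have hn1 := hn n le_rfl y₀ hy₀ (exists_Ht y₀)
    -- The weight lives where k ≤ ε and is positive at y₀, so its constant c is positive. Then c ∫k
    -- = ∫k k₀ ≤ ε ∫k₀ ≤ ε c, where ∫ denotes `unitPart μ`.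
    set k₀ : AfH → ℝ := fun y => max (1 - k y / ε) 0 * bump n y with hk₀def
    have hk₀ : IsInv k₀ := (isInv_bump n).mul_left (by have := hk.cont; fun_prop)
      fun a ha y => by rw [hk.inv a ha]
    have h0 : ∀ y, 0 ≤ k₀ y := fun y => mul_nonneg (le_max_right _ _) (bump_nonneg n y)
    have hle1 : ∀ y, max (1 - k y / ε) 0 ≤ 1 := fun y =>
      max_le (by linarith [div_nonneg (hk0 y) hε.le]) zero_le_one
    have h1 : ∀ y, k₀ y ≤ 1 := fun y =>
      mul_le_one₀ (hle1 y) (bump_nonneg n y) (bump_le_one n y)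
    have hk₀pos : 0 < unitPart μ k₀ := by
      refine hpos k₀ hk₀ h0 ?_
      simp only [hk₀def, hky, hn1]
      simp
    obtain ⟨c, hc⟩ := hprop k₀ hk₀ h0 h1
    obtain ⟨T, hT⟩ := (isInv_bump n).ht
    obtain ⟨m, hm⟩ := exists_bump T
    have e1 : unitPart μ k₀ = c * unitPart μ (bump m) := by
      rw [← hc _ (isInv_bump m)]
      congr 1
      funext y
      by_cases hy : bump n y = 0
      · simp only [hk₀def, hy, mul_zero]
      · rw [hm m le_rfl y ((isInv_bump n).supp y hy) (hT y hy), one_mul]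
    have hm1 : unitPart μ (bump m) ≤ 1 :=
      (hμ.unitPart_le (isInv_bump m) (bump_nonneg m)).trans
        ((hμ.bump_le_mass m).trans h.mass_eq.le)
    have hm0 : 0 ≤ unitPart μ (bump m) := hμ.unitPart_nonneg (isInv_bump m) (bump_nonneg m)
    have hc0 : 0 < c := by
      rw [e1] at hk₀pos
      exact pos_of_mul_pos_left hk₀pos hm0
    have e2 : c * unitPart μ k ≤ ε * unitPart μ k₀ := by
      rw [← hc k hk, ← hμ.unitPart_smul _ hk₀]
      refine hμ.unitPart_mono (J₀ := 0) (hk.mul hk₀) (hk₀.const_mul ε) fun J _ y _ => ?_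
      by_cases hy : k y ≤ ε
      · exact mul_le_mul_of_nonneg_right hy (h0 y)
      · have : k₀ y = 0 := by
          have h2 : 1 - k y / ε ≤ 0 := by
            rw [sub_nonpos, le_div_iff₀ hε]
            linarith
          simp only [hk₀def]
          rw [max_eq_right h2, zero_mul]
        rw [this, mul_zero, mul_zero]
    rw [e1, mul_left_comm] at e2
    have e3 := le_of_mul_le_mul_left e2 hc0
    rw [zero_add]
    exact e3.trans (mul_le_of_le_one_right hε.le hm1)
  obtain ⟨b, hb, hb0, hb1, hlin⟩ := hμ.unitPart_eq_mul hy₀ hvan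
  have hbpos := hpos b hb hb0 (by rw [hb1]; exact one_pos)
  -- Restricting b to `YJ J` does not change its integral, which is positive; a point mass located
  -- outside `YJ J` would give 0.
  have hy₀' : y₀ ∈ Y0 := mem_Y0_iff.2 fun J => by
    have h1 := hlin _ (isInv_indicator_YJ hb J)
    rw [hμ.unitPart_indicator hb] at h1
    by_contra hJ
    rw [Set.indicator_of_notMem hJ, mul_zero] at h1
    exact hbpos.ne' h1
  have heq := fun k (hk : IsInv k) => hμ.eq_psi_of_unitPart hβ hy₀ hlin hk
  have hmass : unitPart μ b * partZ β = 1 := by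
    rw [← h.mass_eq]
    refine tendsto_nhds_unique ((tendsto_psi_bump hβ hy₀).const_mul _) ?_
    exact hμ.tendsto_bump.congr fun n => heq _ (isInv_bump n)
  refine ⟨y₀, hy₀', fun k hk => ?_⟩
  rw [heq k hk, gibbs, eq_inv_of_mul_eq_one_left hmass]

/-! ### Gibbs functionals -/

section Gibbs

variable {β : ℝ} (hβ : 2 < β) {y₀ : AfH} (hy₀ : y₀ ∈ Y0)
include hβ hy₀

lemma isHecke_gibbs : IsHecke β (gibbs β y₀) where
  add k k' hk hk' := by
    obtain ⟨M, -, hM⟩ := hk.exists_bound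
    obtain ⟨M', -, hM'⟩ := hk'.exists_bound
    unfold gibbs
    rw [psi_add hβ hM hM', mul_add]
  smul c k _ := by
    unfold gibbs
    rw [psi_smul, mul_left_comm]
  nonneg k _ h0 := mul_nonneg (inv_nonneg.2 (partZ_pos hβ).le) (psi_nonneg β _ h0 _)
  bdd := ⟨(partZ β)⁻¹ * partZ β, fun k hk h1 =>
    mul_le_mul_of_nonneg_left (psi_le_partZ hβ hk h1 _) (inv_nonneg.2 (partZ_pos hβ).le)⟩
  hecke u hu := by
    obtain ⟨J, hJ⟩ := exists_psi_hecke hβ hu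
    unfold gibbs
    rw [hJ J le_rfl _ (mem_Y0_iff.1 hy₀ J)]

lemma mass_gibbs : mass (gibbs β y₀) = 1 := by
  rw [← inv_mul_cancel₀ (partZ_pos hβ).ne']
  exact tendsto_nhds_unique (isHecke_gibbs hβ hy₀).tendsto_bump
    ((tendsto_psi_bump hβ hy₀.1).const_mul _)

/-- At an invertible point `psi` of 1_{YJ} k tends to k(y₀), since only the coset of 1 keeps the
point in `YJ J` up to determinant J. So the point can be read off from its Gibbs functional. -/
lemma unitPart_gibbs {k : AfH → ℝ} (hk : IsInv k) :
    unitPart (gibbs β y₀) k = (partZ β)⁻¹ * k y₀ := by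
  refine (isHecke_gibbs hβ hy₀).unitPart_eq hk (Filter.Tendsto.const_mul _ ?_)
  obtain ⟨M, -, hM⟩ := hk.exists_bound
  rw [tendsto_iff_norm_sub_tendsto_zero]
  refine squeeze_zero' (.of_forall fun _ => norm_nonneg _) ?_
    (by simpa using (tendsto_wsum hβ).const_mul M)
  filter_upwards [Filter.eventually_ge_atTop 1] with J hJ
  exact abs_psi_indicator_sub_le hβ hk hM hJ (mem_Y0_iff.1 hy₀ J)

/-- The invertible part of a minorant is dominated by a point mass, hence is a multiple of it, and a
Hecke functional is determined by its invertible part. -/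
lemma isExtHecke_gibbs : IsExtHecke β (gibbs β y₀) where
  toIsHecke := isHecke_gibbs hβ hy₀
  mass_eq := mass_gibbs hβ hy₀
  prop ν hν hle := by
    have hμ := isHecke_gibbs hβ hy₀
    obtain ⟨b, hb, -, -, hlin⟩ := hν.unitPart_eq_mul hy₀.1 fun k hk hk0 hky => by
      refine le_antisymm ?_ (hν.unitPart_nonneg hk hk0)
      have h1 : unitPart (gibbs β y₀) k = 0 := by rw [unitPart_gibbs hβ hy₀ hk, hky, mul_zero]
      rw [← h1]
      refine le_of_tendsto_of_tendsto' (hν.tendsto_unitPart hk) (hμ.tendsto_unitPart hk) fun J => ?_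
      exact hle _ (isInv_indicator_YJ hk J) fun y => Set.indicator_nonneg (fun y _ => hk0 y) y
    refine ⟨unitPart ν b * partZ β, fun k hk => ?_⟩
    rw [hν.eq_psi_of_unitPart hβ hy₀.1 hlin hk, gibbs, mul_assoc,
      mul_inv_cancel_left₀ (partZ_pos hβ).ne']

/-- A function separating the two orbits would have different invertible parts by `unitPart_gibbs`.
-/
lemma exists_smul_eq_of_gibbs {y₁ : AfH} (hy₁ : y₁ ∈ Y0)
    (h : ∀ k, IsInv k → gibbs β y₀ k = gibbs β y₁ k) : ∃ γ ∈ Gam, γ • y₁ = y₀ := by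
  by_contra! hne
  obtain ⟨k, hk, -, hpos, hk1⟩ := exists_sep hy₀.1 hne
  have h1 : unitPart (gibbs β y₀) k = unitPart (gibbs β y₁) k :=
    (isHecke_gibbs hβ hy₀).unitPart_eq hk (((isHecke_gibbs hβ hy₁).tendsto_unitPart hk).congr
      fun J => (h _ (isInv_indicator_YJ hk J)).symm)
  rw [unitPart_gibbs hβ hy₀ hk, unitPart_gibbs hβ hy₁ hk, hk1, mul_zero] at h1
  exact (mul_pos (inv_pos.2 (partZ_pos hβ)) hpos).ne' h1

end Gibbs

lemma gibbs_smul (β : ℝ) {γ : G} (hγ : γ ∈ Gam) (y : AfH) {k : AfH → ℝ} (hk : IsInv k) :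
    gibbs β (γ • y) k = gibbs β y k := by
  unfold gibbs
  rw [psi_gam β _ hk hγ]

/-! ### Extremal KMS states and extremal Hecke functionals -/

lemma eq_of_kA {φ ψ : A →L[ℂ] ℂ}
    (h : ∀ {F : G → AfH → ℂ} (hF : IsKer F), φ (kA F hF) = ψ (kA F hF)) : φ = ψ := by
  refine ContinuousLinearMap.ext fun a => ?_
  refine denseRange_toA.induction_on (p := fun a => φ a = ψ a) a
    (isClosed_eq φ.continuous ψ.continuous) fun f => ?_
  rw [toA_eq_kA]
  exact h _

lemma cplx_congr {μ ν : (AfH → ℝ) → ℝ} (h : ∀ k, IsInv k → μ k = ν k) {k : AfH → ℂ}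
    (hk : IsInv k) : cplx μ k = cplx ν k := by
  unfold cplx
  rw [h _ hk.re, h _ hk.im]

lemma kms_isHecke {β : ℝ} (hβ : 0 < β) {φ : A →L[ℂ] ℂ}
    (h : φ ∈ kmsStates (fun t (a : A) => sigma t a) β) : IsHecke β (diagFun φ) :=
  (h.2.twisted hβ).isHecke hβ h.1.2

lemma kms_eq_toA {β : ℝ} (hβ : 0 < β) {φ : A →L[ℂ] ℂ}
    (h : φ ∈ kmsStates (fun t (a : A) => sigma t a) β) {μ : (AfH → ℝ) → ℝ} (hμ : IsHecke β μ)
    (he : ∀ k, IsInv k → diagFun φ k = μ k) : φ = hμ.toA := by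
  refine eq_of_kA fun hF => ?_
  rw [hμ.toA_kA, (h.2.twisted hβ).eq_cplx hβ h.1.2]
  exact cplx_congr he hF.diag

lemma kms_mass {β : ℝ} (hβ : 0 < β) {φ : A →L[ℂ] ℂ}
    (h : φ ∈ kmsStates (fun t (a : A) => sigma t a) β) : mass (diagFun φ) = 1 := by
  rw [← h.1.1]
  conv_rhs => rw [kms_eq_toA hβ h (kms_isHecke hβ h) fun _ _ => rfl]
  exact (kms_isHecke hβ h).norm_toA.symm

namespace IsHecke

variable {β : ℝ} {μ : (AfH → ℝ) → ℝ} (hμ : IsHecke β μ)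
include hμ

lemma toA_mem (hβ : 0 < β) (h1 : mass μ = 1) :
    hμ.toA ∈ kmsStates (fun t (a : A) => sigma t a) β :=
  ⟨⟨hμ.norm_toA.trans h1, hμ.isPos_toA⟩, hμ.twisted_toA.isKMS hβ⟩

lemma diagFun_toA {k : AfH → ℝ} (hk : IsInv k) : diagFun hμ.toA k = μ k := by
  have h2 : dg (fun y => (k y : ℂ)) 1 = fun y => (k y : ℂ) :=
    funext fun y => dg_of_mem (one_mem _) _ _
  rw [diagFun_eq _ hk, dgA, hμ.toA_kA, h2, hμ.cplx_ofReal, Complex.ofReal_re]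

lemma nonneg_smul {c : ℝ} (hc : 0 ≤ c) : IsHecke β fun k => c * μ k where
  add k k' hk hk' := by rw [hμ.add k k' hk hk', mul_add]
  smul a k hk := by rw [hμ.smul a k hk, mul_left_comm]
  nonneg k hk h0 := mul_nonneg hc (hμ.nonneg k hk h0)
  bdd := by
    obtain ⟨C, hC⟩ := hμ.bdd
    exact ⟨c * C, fun k hk h1 => mul_le_mul_of_nonneg_left (hC k hk h1) hc⟩
  hecke u hu := by rw [hμ.hecke u hu]

lemma mass_smul (c : ℝ) (h : IsHecke β fun k => c * μ k) :
    mass (fun k => c * μ k) = c * mass μ :=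
  tendsto_nhds_unique h.tendsto_bump (hμ.tendsto_bump.const_mul c)

lemma sub_isHecke {ν : (AfH → ℝ) → ℝ} (hν : IsHecke β ν)
    (h : ∀ k, IsInv k → (∀ y, 0 ≤ k y) → ν k ≤ μ k) : IsHecke β fun k => μ k - ν k where
  add k k' hk hk' := by rw [hμ.add k k' hk hk', hν.add k k' hk hk']; ring
  smul a k hk := by rw [hμ.smul a k hk, hν.smul a k hk]; ring
  nonneg k hk h0 := sub_nonneg.2 (h k hk h0)
  bdd := by
    refine ⟨mass μ, fun k hk h1 => ?_⟩
    have hmax : IsInv fun y => max (k y) 0 := hk.max_zero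
    have h2 := hμ.le_mul_mass hmax zero_le_one fun y => max_le (h1 y) zero_le_one
    have h3 := h _ (hmax.sub hk) fun y => sub_nonneg.2 (le_max_left _ _)
    rw [hμ.sub hmax hk, hν.sub hmax hk] at h3
    have h4 := hν.nonneg _ hmax fun y => le_max_right _ _
    linarith
  hecke u hu := by rw [hμ.hecke u hu, hν.hecke u hu]

lemma mass_sub {ν : (AfH → ℝ) → ℝ} (hν : IsHecke β ν) (h : IsHecke β fun k => μ k - ν k) :
    mass (fun k => μ k - ν k) = mass μ - mass ν :=
  tendsto_nhds_unique h.tendsto_bump (hμ.tendsto_bump.sub hν.tendsto_bump)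

lemma eq_zero_of_mass (h : mass μ = 0) {k : AfH → ℝ} (hk : IsInv k) : μ k = 0 := by
  obtain ⟨M, hM0, hM⟩ := hk.exists_bound
  have := hμ.abs_le_mul_mass hk hM0 hM
  rw [h, mul_zero] at this
  exact abs_nonpos_iff.1 this

end IsHecke

lemma diagFun_comb (φ ψ : A →L[ℂ] ℂ) (a b : ℝ) {k : AfH → ℝ} (hk : IsInv k) :
    diagFun (a • φ + b • ψ) k = a * diagFun φ k + b * diagFun ψ k := by
  rw [diagFun_eq _ hk, diagFun_eq _ hk, diagFun_eq _ hk]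
  simp

/-- A minorant ν of mass c strictly between 0 and 1 and its complement, both normalized, give KMS
states with φ as a proper convex combination, so extremality yields ν = c μ. For c = 0 or 1 one of
the two parts vanishes. -/
lemma extremal_isExtHecke {β : ℝ} (hβ : 0 < β) {φ : A →L[ℂ] ℂ}
    (h : φ ∈ extremalKMS (fun t (a : A) => sigma t a) β) : IsExtHecke β (diagFun φ) where
  toIsHecke := kms_isHecke hβ h.1
  mass_eq := kms_mass hβ h.1
  prop ν hν hle := by
    have hμ := kms_isHecke hβ h.1
    have hm := kms_mass hβ h.1
    have hρ := hμ.sub_isHecke hν hle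
    have hρm := hμ.mass_sub hν hρ
    rw [hm] at hρm
    set c := mass ν with hc
    have hc0 : 0 ≤ c := hν.mass_nonneg
    have hc1 : 0 ≤ 1 - c := hρm ▸ hρ.mass_nonneg
    rcases hc0.eq_or_lt with h0 | h0
    · exact ⟨0, fun k hk => by rw [hν.eq_zero_of_mass h0.symm hk, zero_mul]⟩
    rcases hc1.eq_or_lt with h1 | h1
    · refine ⟨1, fun k hk => ?_⟩
      have := hρ.eq_zero_of_mass (hρm.trans h1.symm) hk
      linarith
    have hν' := hν.nonneg_smul (inv_nonneg.2 hc0)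
    have hρ' := hρ.nonneg_smul (inv_nonneg.2 hc1)
    have m1 := hν'.toA_mem hβ (by rw [hν.mass_smul _ hν', ← hc, inv_mul_cancel₀ h0.ne'])
    have m2 := hρ'.toA_mem hβ (by rw [hρ.mass_smul _ hρ', hρm, inv_mul_cancel₀ h1.ne'])
    have hcomb : c • hν'.toA + (1 - c) • hρ'.toA = φ := by
      symm
      refine eq_of_kA fun {F} hF => ?_
      rw [(h.1.2.twisted hβ).eq_cplx hβ h.1.1.2, _root_.add_apply,
        _root_.smul_apply, _root_.smul_apply, hν'.toA_kA, hρ'.toA_kA]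
      unfold cplx
      rw [Complex.real_smul, Complex.real_smul]
      have : ((1 : ℂ) - c) ≠ 0 := by exact_mod_cast h1.ne'
      have : (c : ℂ) ≠ 0 := by exact_mod_cast h0.ne'
      push_cast
      field_simp
      ring
    have := ((mem_extremePoints.1 h).2 _ m1 _ m2 ⟨c, 1 - c, h0, h1, by ring, hcomb⟩).1
    refine ⟨c, fun k hk => ?_⟩
    rw [← this, hν'.diagFun_toA hk, mul_inv_cancel_left₀ h0.ne']

/-- In a convex combination each weighted component is a minorant of μ, hence proportional to it,
and comparison of masses shows that the component is μ itself. -/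
lemma IsExtHecke.toA_mem {β : ℝ} (hβ : 0 < β) {μ : (AfH → ℝ) → ℝ} (h : IsExtHecke β μ) :
    h.toIsHecke.toA ∈ extremalKMS (fun t (a : A) => sigma t a) β := by
  have hμ := h.toIsHecke
  have aux : ∀ φ ψ : A →L[ℂ] ℂ, φ ∈ kmsStates (fun t (a : A) => sigma t a) β →
      ψ ∈ kmsStates (fun t (a : A) => sigma t a) β → ∀ a b : ℝ, 0 < a → 0 < b → a + b = 1 →
      a • φ + b • ψ = hμ.toA → φ = hμ.toA := by
    intro φ ψ hφ hψ a b ha hb hab e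
    have hφ' := kms_isHecke hβ hφ
    have hψ' := kms_isHecke hβ hψ
    have hsum : ∀ k, IsInv k → μ k = a * diagFun φ k + b * diagFun ψ k := fun k hk => by
      rw [← diagFun_comb _ _ _ _ hk, e, hμ.diagFun_toA hk]
    have hν := hφ'.nonneg_smul ha.le
    obtain ⟨c, hc⟩ := h.prop _ hν fun k hk hk0 => by
      rw [hsum k hk]
      exact le_add_of_nonneg_right (mul_nonneg hb.le (hψ'.nonneg k hk hk0))
    have hca : c = a := by
      have h1 : Filter.Tendsto (fun n => a * diagFun φ (bump n)) Filter.atTop (nhds (c * 1)) := by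
        simp only [hc _ (isInv_bump _)]
        rw [← h.mass_eq]
        exact hμ.tendsto_bump.const_mul c
      have h2 := hφ'.tendsto_bump.const_mul a
      rw [kms_mass hβ hφ] at h2
      simpa using tendsto_nhds_unique h1 h2
    refine kms_eq_toA hβ hφ hμ fun k hk => ?_
    have := hc k hk
    rw [hca] at this
    exact mul_left_cancel₀ ha.ne' this
  refine mem_extremePoints.2 ⟨hμ.toA_mem hβ h.mass_eq, ?_⟩
  rintro φ hφ ψ hψ ⟨a, b, ha, hb, hab, e⟩
  refine ⟨aux φ ψ hφ hψ a b ha hb hab e, aux ψ φ hψ hφ b a hb ha ((add_comm _ _).trans hab) ?_⟩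
  rw [add_comm]
  exact e

/-- The Gibbs state of an invertible point. -/
def gibbsState {β : ℝ} (hβ : 2 < β) (y : AfH) (hy : y ∈ Y0) :
    extremalKMS (fun t (a : A) => sigma t a) β :=
  ⟨(isExtHecke_gibbs hβ hy).toIsHecke.toA, (isExtHecke_gibbs hβ hy).toA_mem (by linarith)⟩

lemma gibbsState_smul {β : ℝ} (hβ : 2 < β) {y y' : AfH} (hy : y ∈ Y0) (hy' : y' ∈ Y0) {γ : G}
    (hγ : γ ∈ Gam) (h : γ • y = y') : gibbsState hβ y hy = gibbsState hβ y' hy' := by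
  subst h
  refine Subtype.ext (eq_of_kA fun hF => ?_)
  dsimp only [gibbsState]
  rw [IsHecke.toA_kA, IsHecke.toA_kA]
  exact cplx_congr (fun k hk => (gibbs_smul β hγ y hk).symm) hF.diag

lemma exists_smul_eq_of_gibbsState {β : ℝ} (hβ : 2 < β) {y y' : AfH} (hy : y ∈ Y0) (hy' : y' ∈ Y0)
    (h : gibbsState hβ y hy = gibbsState hβ y' hy') : ∃ γ ∈ Gam, γ • y = y' := by
  refine exists_smul_eq_of_gibbs hβ hy' hy fun k hk => ?_
  rw [← (isHecke_gibbs hβ hy').diagFun_toA hk, ← (isHecke_gibbs hβ hy).diagFun_toA hk]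
  exact congrArg (fun φ => diagFun φ k) (congrArg Subtype.val h).symm

lemma exists_gibbsState_eq {β : ℝ} (hβ : 2 < β)
    (φ : extremalKMS (fun t (a : A) => sigma t a) β) :
    ∃ y, ∃ hy : y ∈ Y0, gibbsState hβ y hy = φ := by
  have hβ0 : 0 < β := by linarith
  obtain ⟨y, hy, h⟩ := (extremal_isExtHecke hβ0 φ.2).exists_eq_gibbs hβ
  exact ⟨y, hy, Subtype.ext (kms_eq_toA hβ0 φ.2.1 (isHecke_gibbs hβ hy) h).symm⟩

lemma hasSum_gibbsState {β : ℝ} (hβ : 2 < β) {y : AfH} (hy : y ∈ Y0) (f : CcZ) :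
    HasSum (fun m : Cosets M2Zplus =>
      (riemannZeta β * riemannZeta (β - 1))⁻¹ * gibbsTerm β f y m)
      ((gibbsState hβ y hy : A →L[ℂ] ℂ) (toA f)) := by
  have hf := isKer_val f
  have hd := hf.diag
  have e : (gibbsState hβ y hy : A →L[ℂ] ℂ) (toA f) = cplx (gibbs β y) (val f 1) := by
    rw [toA_eq_kA]
    exact IsHecke.toA_kA _ _
  have e2 : cplx (gibbs β y) (val f 1) =
      (riemannZeta β * riemannZeta (β - 1))⁻¹ * cplx (fun k => psi β Set.univ k y) (val f 1) := by
    rw [← ofReal_partZ hβ]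
    unfold cplx gibbs
    push_cast
    ring
  rw [e, e2]
  refine HasSum.mul_left _ ?_
  refine (hasSum_cosets (S := M2Zplus)
    (u := fun h => (wt β Set.univ h : ℂ) * val f 1 (h • y)) (fun γ hγ g => ?_) (fun g hg => ?_)
    fun g => ?_).1 ?_
  · dsimp only
    rw [wt_gam_mul β _ hγ, mul_smul, hd.inv γ hγ]
  · rw [wt_of_not fun h => hg h.1, Complex.ofReal_zero, zero_mul]
  · rw [wt_of_mem g.2 (Set.mem_univ _), mul_comm]
    rfl
  · obtain ⟨M, -, hM⟩ := hd.re.exists_bound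
    obtain ⟨M', -, hM'⟩ := hd.im.exists_bound
    rw [Complex.hasSum_iff]
    unfold cplx
    constructor
    · have := (summable_psi hβ hM Set.univ y).hasSum
      simpa [psi, lsum] using this
    · have := (summable_psi hβ hM' Set.univ y).hasSum
      simpa [psi, lsum] using this

/-! ### Positive energy and the partition function -/

lemma energy_nonneg {y : AfH} (hy : y ∈ Y0) (x : Cosets (Gy y)) : 0 ≤ energy x := by
  refine Quotient.inductionOn x fun g => ?_
  exact Real.log_nonneg (one_le_detR ((mem_M2Zplus_of_Y0 hy).1 g.2))

/-- For invertible ρ the set `Gy y` equals M₂(ℤ)⁺, so the trace is the Dirichlet series of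
`hasSum_partZ`. -/
lemma hasSum_partition {β : ℝ} (hβ : 2 < β) {y : AfH} (hy : y ∈ Y0) :
    HasSum (fun x : Cosets (Gy y) => ((Real.exp (-β * energy x) : ℝ) : ℂ))
      (riemannZeta β * riemannZeta (β - 1)) := by
  rw [← ofReal_partZ hβ, Complex.hasSum_ofReal]
  refine (hasSum_cosets (S := Gy y) (fun γ hγ g => wt_gam_mul β Set.univ hγ g) (fun g hg => ?_)
    fun g => ?_).1 (hasSum_wt hβ)
  · exact wt_of_not fun h => hg ((mem_M2Zplus_of_Y0 hy).2 h.1)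
  · rw [wt_of_mem ((mem_M2Zplus_of_Y0 hy).1 g.2) (Set.mem_univ _),
      Real.rpow_def_of_pos (detR_pos _), mul_comm]
    rfl

lemma continuous_phase {d : ℝ} (hd : 0 < d) : Continuous (phase d) :=
  (differentiable_cpow_I hd).continuous.comp Complex.continuous_ofReal

lemma hasDerivAt_phase {d : ℝ} (hd : 0 < d) :
    HasDerivAt (phase d) (Complex.I * Real.log d) 0 := by
  have h1 : HasDerivAt (fun z : ℂ => z * Complex.I) Complex.I ((0 : ℝ) : ℂ) := by
    simpa using (hasDerivAt_id ((0 : ℝ) : ℂ)).mul_const Complex.I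
  have h2 := (h1.const_cpow (c := (d : ℂ)) (Or.inl (by exact_mod_cast hd.ne'))).comp_ofReal
  simp only [Complex.ofReal_zero, zero_mul, Complex.cpow_zero, one_mul] at h2
  rw [← Complex.ofReal_log hd.le, mul_comm] at h2
  exact h2

/-- Dominated convergence for the squared norm: each phase is continuous and two phases differ by at
most 2, whence the factor 4. -/
lemma continuous_timeU (y : AfH) (ξ : Hy y) : Continuous fun t => timeU y t ξ := by
  rw [continuous_iff_continuousAt]
  intro s
  have hs : Summable fun x => ‖ξ x‖ ^ 2 := by
    simpa using (lp.memℓp ξ).summable (by norm_num)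
  have key : Filter.Tendsto (fun t => ∑' x, ‖(timeU y t ξ - timeU y s ξ) x‖ ^ 2) (nhds s)
      (nhds (∑' _ : Cosets (Gy y), (0 : ℝ))) := by
    refine tendsto_tsum_of_dominated_convergence (bound := fun x => 4 * ‖ξ x‖ ^ 2)
      (hs.mul_left 4) (fun x => ?_) (.of_forall fun t x => ?_)
    · have hc : Continuous fun t => ‖phase (cosetDet x) t * ξ x - phase (cosetDet x) s * ξ x‖ ^ 2 :=
        ((((continuous_phase (cosetDet_pos x)).mul continuous_const).sub continuous_const).norm).pow 2
      have := hc.tendsto s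
      simpa [timeU_apply] using this
    · have e : (timeU y t ξ - timeU y s ξ) x =
          (phase (cosetDet x) t - phase (cosetDet x) s) * ξ x := by
        rw [sub_mul]; rfl
      rw [e, Real.norm_of_nonneg (sq_nonneg _), norm_mul, mul_pow]
      have h2 : ‖phase (cosetDet x) t - phase (cosetDet x) s‖ ≤ 2 := by
        refine (norm_sub_le _ _).trans ?_
        rw [norm_phase (cosetDet_pos x), norm_phase (cosetDet_pos x)]
        norm_num
      have h3 : ‖phase (cosetDet x) t - phase (cosetDet x) s‖ ^ 2 ≤ 4 := by
        nlinarith [norm_nonneg (phase (cosetDet x) t - phase (cosetDet x) s)]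
      exact mul_le_mul_of_nonneg_right h3 (sq_nonneg _)
  rw [tsum_zero] at key
  rw [ContinuousAt, tendsto_iff_norm_sub_tendsto_zero]
  have h4 := key.sqrt
  rw [Real.sqrt_zero] at h4
  refine h4.congr fun t => ?_
  have := lp.norm_rpow_eq_tsum (p := 2) (by norm_num) (timeU y t ξ - timeU y s ξ)
  simp only [ENNReal.toReal_ofNat, Real.rpow_ofNat] at this
  rw [← this, Real.sqrt_sq (norm_nonneg _)]

/-- The unitary `e^{itH_y}`. -/
def unitaryU (y : AfH) (t : ℝ) : unitary (Hy y →L[ℂ] Hy y) :=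
  ⟨timeU y t, by
    rw [Unitary.mem_iff, star_timeU]
    exact ⟨timeU_neg_mul y t, by simpa using timeU_neg_mul y (-t)⟩⟩

lemma isPositiveEnergy_rep (y : Y) (hy : (y : AfH) ∈ Y0) :
    IsPositiveEnergy (fun t a => sigma t a) (rep y) := by
  refine ⟨unitaryU y, fun s t => Subtype.ext (timeU_add y s t), continuous_timeU y,
    fun t a => ?_, fun ξ η h => ?_⟩
  · have : (star (unitaryU y t) : Hy y.1 →L[ℂ] Hy y.1) = timeU y (-t) := star_timeU y t
    rw [this]
    rfl
  -- Evaluation at a coset is continuous, so the derivative may be computed coordinate by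
  -- coordinate.
  · have hη : ∀ x, η x = Real.log (cosetDet x) * ξ x := by
      intro x
      have h1 := ((evalL x).restrictScalars ℝ).hasFDerivAt.comp_hasDerivAt (0 : ℝ) h
      have h2 := (hasDerivAt_phase (cosetDet_pos x)).mul_const (ξ x)
      have h3 := h1.unique h2
      have h4 : Complex.I * η x = Complex.I * (Real.log (cosetDet x) * ξ x) := by
        rw [← mul_assoc]
        exact h3
      exact mul_left_cancel₀ Complex.I_ne_zero h4
    have h5 := Complex.hasSum_re (lp.hasSum_inner (𝕜 := ℂ) ξ η)
    refine h5.nonneg fun x => ?_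
    rw [hη x, RCLike.inner_apply, mul_assoc, Complex.mul_conj, ← Complex.ofReal_mul,
      Complex.ofReal_re]
    exact mul_nonneg (energy_nonneg hy x) (Complex.normSq_nonneg _)

/-! ### Lifts of torsion points and the points (ρ, τ) of a ℚ-lattice. -/

namespace QLattice

variable {l : QLattice}

lemma Lifts.add {x x' : Fin 2 → ℚ} {z z' : ℂ} (h : l.Lifts x z) (h' : l.Lifts x' z') :
    l.Lifts (x + x') (z + z') := by
  obtain ⟨hz, e⟩ := h
  obtain ⟨hz', e'⟩ := h'
  exact ⟨add_mem hz hz', by rw [QuotientAddGroup.mk_add, map_add, e, e']; rfl⟩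

lemma Lifts.neg {x : Fin 2 → ℚ} {z : ℂ} (h : l.Lifts x z) : l.Lifts (-x) (-z) := by
  obtain ⟨hz, e⟩ := h
  exact ⟨neg_mem hz, by rw [QuotientAddGroup.mk_neg, map_neg, e]; rfl⟩

lemma Lifts.sub {x x' : Fin 2 → ℚ} {z z' : ℂ} (h : l.Lifts x z) (h' : l.Lifts x' z') :
    l.Lifts (x - x') (z - z') := by
  rw [sub_eq_add_neg, sub_eq_add_neg]
  exact h.add h'.neg

lemma mem_QSpan {L : Submodule ℤ ℂ} {z : ℂ} (h : z ∈ L) : z ∈ QSpan L :=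
  Submodule.subset_span h

lemma lifts_zero_iff {z : ℂ} : l.Lifts 0 z ↔ z ∈ l.lat := by
  have key : ∀ hz : z ∈ QSpan l.lat, l.φ (QuotientAddGroup.mk 0) = QuotientAddGroup.mk ⟨z, hz⟩ ↔
      z ∈ l.lat := by
    intro hz
    rw [QuotientAddGroup.mk_zero, map_zero, eq_comm, QuotientAddGroup.eq_zero_iff]
    rfl
  exact ⟨fun ⟨hz, e⟩ => (key hz).1 e, fun h => ⟨mem_QSpan h, (key _).2 h⟩⟩

lemma Lifts.congr {x x' : Fin 2 → ℚ} {z : ℂ} (h : l.Lifts x z) (hx : x' - x ∈ Z2) :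
    l.Lifts x' z := by
  obtain ⟨hz, e⟩ := h
  refine ⟨hz, e ▸ congrArg _ (QuotientAddGroup.eq.2 ?_)⟩
  rw [neg_add_eq_sub, ← neg_sub]
  exact neg_mem hx

lemma Lifts.mem_lat {x : Fin 2 → ℚ} {z : ℂ} (h : l.Lifts x z) (hx : x ∈ Z2) : z ∈ l.lat :=
  lifts_zero_iff.1 (h.congr (by rw [zero_sub]; exact neg_mem hx))

lemma Lifts.zsmul {x : Fin 2 → ℚ} {z : ℂ} (h : l.Lifts x z) (n : ℤ) : l.Lifts (n • x) (n * z) := by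
  obtain ⟨hz, e⟩ := h
  refine ⟨by simpa using zsmul_mem hz n, ?_⟩
  rw [QuotientAddGroup.mk_zsmul, map_zsmul, e, ← QuotientAddGroup.mk_zsmul]
  congr 1
  exact Subtype.ext (by simp)

lemma exists_lift (l : QLattice) (x : Fin 2 → ℚ) : ∃ z, l.Lifts x z := by
  obtain ⟨⟨z, hz⟩, e⟩ := QuotientAddGroup.mk_surjective (l.φ (QuotientAddGroup.mk x))
  exact ⟨z, hz, e.symm⟩

/-- The lattice of `l` is `c (ℤ + ℤτ)`. -/
def HasBasis (l : QLattice) (c : ℂ) (τ : ℍ) : Prop :=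
  ∀ z : ℂ, z ∈ l.lat ↔ ∃ m n : ℤ, z = c * (m + n * (τ : ℂ))

/-- `l = c θ(ρ, τ)` for `y = (ρ, τ)`. -/
structure ThetaAt (l : QLattice) (c : ℂ) (y : AfH) : Prop where
  ne_zero : c ≠ 0
  basis : l.HasBasis c y.2
  lifts : ∀ x q : Fin 2 → ℚ,
    (∀ i, y.1 i 0 * qA (x 0) + y.1 i 1 * qA (x 1) - qA (q i) ∈ R) →
    l.Lifts x (c * (q 0 - (y.2 : ℂ) * q 1))

lemma isTheta_iff {y : AfH} : l.IsTheta y ↔ ∃ c, l.ThetaAt c y := by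
  have e : ∀ (x : Fin 2 → ℚ) i, y.1.mulVec (fun j => algebraMap ℚ Af (x j)) i =
      y.1 i 0 * qA (x 0) + y.1 i 1 * qA (x 1) := fun x i => by
    rw [Matrix.mulVec, dotProduct, Fin.sum_univ_two]
  constructor
  · rintro ⟨c, hc, h1, h2⟩
    exact ⟨c, hc, h1, fun x q h => h2 x q fun i => by rw [e]; exact h i⟩
  · rintro ⟨c, hc, h1, h2⟩
    exact ⟨c, hc, h1, fun x q h => h2 x q fun i => by rw [← e]; exact h i⟩

lemma add_mul_coe_inj {τ : ℍ} {a b a' b' : ℝ} (h : (a + b * (τ : ℂ) : ℂ) = a' + b' * τ) :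
    a = a' ∧ b = b' := by
  have him := congrArg Complex.im h
  have hre := congrArg Complex.re h
  have hτ := τ.im_ne_zero
  simp only [Complex.add_im, Complex.ofReal_im, Complex.mul_im, Complex.ofReal_re, zero_mul,
    add_zero, zero_add, UpperHalfPlane.coe_im, Complex.add_re, Complex.mul_re, sub_zero] at him hre
  have hb := mul_right_cancel₀ hτ him
  rw [hb] at hre
  exact ⟨add_right_cancel hre, hb⟩

lemma rat_add_mul_coe_inj {τ : ℍ} {a b a' b' : ℚ} (h : (a + b * (τ : ℂ) : ℂ) = a' + b' * τ) :
    a = a' ∧ b = b' := by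
  have := add_mul_coe_inj (τ := τ) (a := a) (b := b) (a' := a') (b' := b') (by exact_mod_cast h)
  exact ⟨by exact_mod_cast this.1, by exact_mod_cast this.2⟩

lemma HasBasis.mem_iff {c : ℂ} {τ : ℍ} (hc : c ≠ 0) (h : l.HasBasis c τ) {q : Fin 2 → ℚ} :
    c * (q 0 - (τ : ℂ) * q 1) ∈ l.lat ↔ q ∈ Z2 := by
  rw [h]
  constructor
  · rintro ⟨m, n, e⟩
    have e' := mul_left_cancel₀ hc e
    have := rat_add_mul_coe_inj (τ := τ) (a := q 0) (b := -q 1) (a' := m) (b' := n)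
      (by push_cast; linear_combination e')
    rintro i
    fin_cases i
    · exact ⟨m, this.1⟩
    · exact ⟨-n, by push_cast; rw [← this.2]; exact (neg_neg _).symm⟩
  · intro hq
    obtain ⟨m, hm⟩ := hq 0
    obtain ⟨n, hn⟩ := hq 1
    exact ⟨m, -n, by rw [hm, hn]; push_cast; ring⟩

lemma HasBasis.exists_eq {c : ℂ} {τ : ℍ} (h : l.HasBasis c τ) {z : ℂ} (hz : z ∈ QSpan l.lat) :
    ∃ q : Fin 2 → ℚ, z = c * (q 0 - (τ : ℂ) * q 1) := by
  refine Submodule.span_induction (p := fun z _ => ∃ q : Fin 2 → ℚ, z = c * (q 0 - (τ : ℂ) * q 1))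
    ?_ ?_ ?_ ?_ hz
  · intro z hz
    obtain ⟨m, n, e⟩ := (h z).1 hz
    exact ⟨![m, -n], by rw [e]; simp; left; ring⟩
  · exact ⟨0, by simp⟩
  · rintro _ _ _ _ ⟨q, rfl⟩ ⟨r, rfl⟩
    exact ⟨q + r, by simp; ring⟩
  · rintro a _ _ ⟨q, rfl⟩
    exact ⟨a • q, by simp [Rat.smul_def]; ring⟩

lemma exists_rat_approx (y : AfH) (x : Fin 2 → ℚ) :
    ∃ q : Fin 2 → ℚ, ∀ i, y.1 i 0 * qA (x 0) + y.1 i 1 * qA (x 1) - qA (q i) ∈ R := by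
  choose q hq using fun i => exists_rat_sub_mem (y.1 i 0 * qA (x 0) + y.1 i 1 * qA (x 1))
  exact ⟨q, hq⟩

/-- Two lifts of the same x differ by an element of the lattice, which can be absorbed into q as an
integral vector. -/
lemma ThetaAt.lifts_iff {c : ℂ} {y : AfH} (h : l.ThetaAt c y) {x : Fin 2 → ℚ} {z : ℂ} :
    l.Lifts x z ↔ ∃ q : Fin 2 → ℚ, (∀ i, y.1 i 0 * qA (x 0) + y.1 i 1 * qA (x 1) - qA (q i) ∈ R) ∧
      z = c * (q 0 - (y.2 : ℂ) * q 1) := by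
  refine ⟨fun hz => ?_, fun ⟨q, hq, e⟩ => e ▸ h.lifts x q hq⟩
  obtain ⟨q, hq⟩ := exists_rat_approx y x
  have h1 := (hz.sub (h.lifts x q hq))
  rw [sub_self, lifts_zero_iff, h.basis] at h1
  obtain ⟨m, n, e⟩ := h1
  refine ⟨![q 0 + m, q 1 - n], fun i => ?_, ?_⟩
  · fin_cases i
    · have := RSub.sub_mem (hq 0) (R_int m)
      change _ - qA (q 0 + m) ∈ R
      rw [map_add, ← sub_sub]
      exact this
    · have := R_add (hq 1) (R_int n)
      change _ - qA (q 1 - n) ∈ R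
      rw [map_sub, ← sub_add]
      exact this
  · rw [sub_eq_iff_eq_add.1 e]
    simp
    ring

/-- The basis vector e_j is 0 in ℚ²/ℤ², so its lift lies in the lattice; thus any rational
approximation of the j-th column of ρ modulo R is integral. -/
lemma ThetaAt.mem_Y {c : ℂ} {y : AfH} (h : l.ThetaAt c y) : y ∈ Y := by
  intro i j
  obtain ⟨q, hq⟩ := exists_rat_approx y (Pi.single j 1)
  have h1 := (h.lifts _ q hq).mem_lat fun k => by
    by_cases hk : k = j
    · subst hk; exact ⟨1, by simp⟩
    · exact ⟨0, by simp [hk]⟩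
  obtain ⟨n, hn⟩ := (h.basis.mem_iff h.ne_zero).1 h1 i
  have h2 := R_add (hq i) (R_int n)
  rw [hn, sub_add_cancel] at h2
  fin_cases j <;> simpa using h2

/-- If p divides det ρ, there is a coprime pair (a, b) with ρ(a, b) divisible by p; then (a/p, b/p)
is sent to 0, and injectivity makes p divide both a and b. -/
lemma ThetaAt.mem_Y0 {c : ℂ} {y : AfH} (h : l.ThetaAt c y) (hl : l.IsInvertible) : y ∈ Y0 := by
  refine ⟨h.mem_Y, fun p hp hd => ?_⟩
  have hp0 : (p : ℚ) ≠ 0 := by exact_mod_cast hp.ne_zero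
  rw [← Matrix.det_transpose] at hd
  obtain ⟨a, b, hab, hd⟩ := exists_row_of_Dvd hp (B := y.1.transpose) (fun i j => h.mem_Y j i) hd
  have h1 := h.lifts ![(p : ℚ)⁻¹ * a, (p : ℚ)⁻¹ * b] 0 fun i => by
    have := hd i
    unfold Dvd at this
    simp only [Matrix.transpose_apply] at this
    convert this using 1
    simp
    ring
  simp only [Pi.zero_apply, Rat.cast_zero, mul_zero, sub_zero] at h1
  obtain ⟨hz, e⟩ := h1
  have h2 : (QuotientAddGroup.mk ![(p : ℚ)⁻¹ * a, (p : ℚ)⁻¹ * b] : (Fin 2 → ℚ) ⧸ Z2) = 0 :=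
    hl.1 (by rw [e, map_zero]; rfl)
  rw [QuotientAddGroup.eq_zero_iff] at h2
  have h3 : ∀ {a : ℤ}, (∃ n : ℤ, (p : ℚ)⁻¹ * a = n) → (p : ℤ) ∣ a := by
    rintro a ⟨n, hn⟩
    rw [inv_mul_eq_iff_eq_mul₀ hp0] at hn
    exact ⟨n, by exact_mod_cast hn⟩
  exact (Nat.prime_iff_prime_int.1 hp).not_isUnit
    (hab.isUnit_of_dvd' (h3 (h2 0)) (h3 (h2 1)))

lemma ThetaAt.isScaling {l' : QLattice} {c c' : ℂ} {y : AfH} (h : l.ThetaAt c y)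
    (h' : l'.ThetaAt c' y) : IsScaling (c' / c) l l' := by
  have hc := h.ne_zero
  have e : ∀ z w : ℂ, z = c * w ↔ c' / c * z = c' * w := fun z w => by
    rw [div_mul_eq_mul_div, div_eq_iff hc, mul_assoc, mul_right_inj' h'.ne_zero, mul_comm w]
  refine ⟨fun z => ?_, fun x z => ?_⟩
  · simp only [h.basis z, h'.basis (c' / c * z), e]
  · simp only [h.lifts_iff, h'.lifts_iff, e]

lemma ThetaAt.of_isScaling {l' : QLattice} {c d : ℂ} {y : AfH} (h : l.ThetaAt c y) (hd : d ≠ 0)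
    (hs : IsScaling d l l') : l'.ThetaAt (d * c) y := by
  refine ⟨mul_ne_zero hd h.ne_zero, fun z => ?_, fun x q hq => ?_⟩
  · obtain ⟨w, rfl⟩ : ∃ w, z = d * w := ⟨d⁻¹ * z, (mul_inv_cancel_left₀ hd z).symm⟩
    rw [← hs.1, h.basis]
    simp only [mul_assoc, mul_right_inj' hd]
  · rw [mul_assoc, ← hs.2]
    exact h.lifts x q hq

end QLattice

/-! ### Uniqueness of (ρ, τ) up to Γ. -/

namespace QLattice

variable {l : QLattice}

lemma iota_coe_smul_mul (s : SL(2, ℤ)) (y : AfH) :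
    ((iota s • y).2 : ℂ) * (s.1 1 0 * (y.2 : ℂ) + s.1 1 1) = s.1 0 0 * (y.2 : ℂ) + s.1 0 1 := by
  have h := coe_smul_mul (iota s) y
  have e : ∀ i j, ((((iota s).1.1 i j : ℚ) : ℝ) : ℂ) = s.1 i j := fun i j => by
    change ((((s.1 i j : ℤ) : ℚ) : ℝ) : ℂ) = _
    norm_cast
  simpa only [e] using h

lemma iota_smul_fst_apply (s : SL(2, ℤ)) (y : AfH) (i j : Fin 2) : (iota s • y).1 i j =
    qA (s.1 i 0 : ℤ) * y.1 0 j + qA (s.1 i 1 : ℤ) * y.1 1 j := by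
  rw [smul_fst, Matrix.mul_apply, Fin.sum_univ_two]
  rfl

/-- Changing the basis of the lattice by s multiplies c by the denominator of s at τ; the identity
(sτ)(s₁₀τ + s₁₁) = s₀₀τ + s₀₁ then shows that the vector sq represents the same complex number as q
before. -/
lemma ThetaAt.smul {c : ℂ} {y : AfH} (h : l.ThetaAt c y) (s : SL(2, ℤ)) :
    l.ThetaAt (c * (s.1 1 0 * (y.2 : ℂ) + s.1 1 1)) (iota s • y) := by
  have hdet : s.1 0 0 * s.1 1 1 - s.1 0 1 * s.1 1 0 = 1 := by
    rw [← Matrix.det_fin_two]; exact s.2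
  have hdetC : (s.1 0 0 * s.1 1 1 - s.1 0 1 * s.1 1 0 : ℂ) = 1 := by exact_mod_cast hdet
  have hdetQ : ((s.1 0 0 : ℤ) * (s.1 1 1 : ℤ) - (s.1 0 1 : ℤ) * (s.1 1 0 : ℤ) : ℚ) = 1 := by
    exact_mod_cast hdet
  have hdetA : qA (s.1 0 0 : ℤ) * qA (s.1 1 1 : ℤ) - qA (s.1 0 1 : ℤ) * qA (s.1 1 0 : ℤ) = 1 := by
    rw [← map_mul, ← map_mul, ← map_sub, hdetQ, map_one]
  have hw := iota_coe_smul_mul s y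
  refine ⟨mul_ne_zero h.ne_zero fun h0 => ?_, fun z => ?_, fun x q hq => ?_⟩
  · rw [h0, mul_zero] at hw
    have h1 := rat_add_mul_coe_inj (τ := y.2) (a := s.1 1 1) (b := s.1 1 0) (a' := 0) (b' := 0)
      (by push_cast; linear_combination h0)
    rw [h1.1, h1.2] at hdetQ
    simp at hdetQ
  · rw [h.basis]
    constructor
    · rintro ⟨m, n, rfl⟩
      refine ⟨s.1 0 0 * m - s.1 0 1 * n, s.1 1 1 * n - s.1 1 0 * m, ?_⟩
      push_cast
      linear_combination -(c * (m + n * (y.2 : ℂ))) * hdetC -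
        c * (s.1 1 1 * n - s.1 1 0 * m) * hw
    · rintro ⟨m, n, rfl⟩
      refine ⟨m * s.1 1 1 + n * s.1 0 1, m * s.1 1 0 + n * s.1 0 0, ?_⟩
      push_cast
      linear_combination c * n * hw
  · have h1 := h.lifts x ![(s.1 1 1 : ℤ) * q 0 - (s.1 0 1 : ℤ) * q 1,
      (s.1 0 0 : ℤ) * q 1 - (s.1 1 0 : ℤ) * q 0] fun i => by
        have h0 := hq 0
        have h1 := hq 1
        simp only [iota_smul_fst_apply] at h0 h1
        fin_cases i
        · have := RSub.sub_mem (R_mul (R_int (s.1 1 1)) h0) (R_mul (R_int (s.1 0 1)) h1)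
          rw [mem_RSub] at this
          convert this using 1
          simp only [Fin.zero_eta, Matrix.cons_val_zero, map_sub, map_mul]
          linear_combination -(y.1 0 0 * qA (x 0) + y.1 0 1 * qA (x 1)) * hdetA
        · have := RSub.sub_mem (R_mul (R_int (s.1 0 0)) h1) (R_mul (R_int (s.1 1 0)) h0)
          rw [mem_RSub] at this
          convert this using 1
          simp only [Fin.mk_one, Matrix.cons_val_one, Matrix.cons_val_fin_one, map_sub, map_mul]
          linear_combination -(y.1 1 0 * qA (x 0) + y.1 1 1 * qA (x 1)) * hdetA
    convert h1 using 1
    simp only [Matrix.cons_val_zero, Matrix.cons_val_one, Matrix.cons_val_fin_one]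
    push_cast
    linear_combination -c * q 1 * hw

/-- Evaluating φ at e_j/N shows that the j-th columns of the two matrices agree modulo N, for every
N. -/
lemma ThetaAt.eq_of_snd_eq {c : ℂ} {y y' : AfH} (h : l.ThetaAt c y) (h' : l.ThetaAt c y')
    (e : y.2 = y'.2) : y = y' := by
  refine Prod.ext (Matrix.ext fun i j => sub_eq_zero.1 (eq_zero_of_Dvd fun N hN => ?_)) e
  obtain ⟨q, hq⟩ := exists_rat_approx y (Pi.single j (N : ℚ)⁻¹)
  obtain ⟨r, hr⟩ := exists_rat_approx y' (Pi.single j (N : ℚ)⁻¹)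
  have h1 := (h.lifts _ q hq).sub (h'.lifts _ r hr)
  rw [sub_self, lifts_zero_iff, ← e] at h1
  have h2 : q - r ∈ Z2 := (h.basis.mem_iff h.ne_zero).1 (by
    convert h1 using 1
    simp
    ring)
  obtain ⟨n, hn⟩ := h2 i
  have h3 := R_add (RSub.sub_mem (hq i) (hr i)) (R_int n)
  rw [← hn, Pi.sub_apply, map_sub] at h3
  unfold Dvd
  convert h3 using 1
  fin_cases j <;> simp <;> ring

/-- Each basis is an integral combination of the other, so the determinants of the two transition
matrices have product 1; since τ and τ' both lie in ℍ, the sign is positive. -/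
lemma HasBasis.exists_smul_eq {c c' : ℂ} {y : AfH} {τ' : ℍ} (hc : c ≠ 0) (hc' : c' ≠ 0)
    (h : l.HasBasis c y.2) (h' : l.HasBasis c' τ') :
    ∃ s : SL(2, ℤ), c' = c * (s.1 1 0 * (y.2 : ℂ) + s.1 1 1) ∧ (iota s • y).2 = τ' := by
  have key : ∀ {c c' : ℂ} {τ τ' : ℍ}, l.HasBasis c τ → l.HasBasis c' τ' → ∃ m n k j : ℤ,
      c' = c * (m + n * (τ : ℂ)) ∧ c' * τ' = c * (k + j * (τ : ℂ)) := by
    intro c c' τ τ' h h'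
    obtain ⟨m, n, e⟩ := (h c').1 ((h' _).2 ⟨1, 0, by simp⟩)
    obtain ⟨k, j, e'⟩ := (h (c' * τ')).1 ((h' _).2 ⟨0, 1, by simp⟩)
    exact ⟨m, n, k, j, e, e'⟩
  obtain ⟨d, e, b, a, h1, h2⟩ := key h h'
  obtain ⟨d', e', b', a', h3, h4⟩ := key h' h
  have h5 := rat_add_mul_coe_inj (τ := y.2) (a := d' * d + e' * b) (b := d' * e + e' * a) (a' := 1)
    (b' := 0) (mul_left_cancel₀ hc (by
      push_cast; linear_combination -h3 - (d' : ℂ) * h1 - (e' : ℂ) * h2))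
  have h6 := rat_add_mul_coe_inj (τ := y.2) (a := b' * d + a' * b) (b := b' * e + a' * a) (a' := 0)
    (b' := 1) (mul_left_cancel₀ hc (by
      push_cast; linear_combination -h4 - (b' : ℂ) * h1 - (a' : ℂ) * h2))
  have h7 : (a * d - b * e) * (a' * d' - b' * e') = 1 := by
    have : ((a * d - b * e : ℤ) : ℚ) * (a' * d' - b' * e' : ℤ) = 1 := by
      push_cast
      linear_combination (b' * e + a' * a : ℚ) * h5.1 + h6.2 - (b' * d + a' * b : ℚ) * h5.2
    exact_mod_cast this
  have h8 : (τ' : ℂ) * (d + e * (y.2 : ℂ)) = b + a * y.2 := by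
    refine mul_left_cancel₀ hc ?_
    linear_combination h2 - (τ' : ℂ) * h1
  have hpos : 0 < a * d - b * e := by
    have him := congrArg Complex.im h8
    have hre := congrArg Complex.re h8
    simp only [Complex.add_im, Complex.mul_im, Complex.intCast_im, Complex.intCast_re,
      UpperHalfPlane.coe_im, UpperHalfPlane.coe_re, Complex.add_re, Complex.mul_re, zero_mul,
      add_zero, zero_add, sub_zero] at him hre
    have h9 : ((a * d - b * e : ℤ) : ℝ) * y.2.im =
        τ'.im * ((d + e * y.2.re) ^ 2 + (e * y.2.im) ^ 2) := by
      push_cast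
      linear_combination (-(d + e * y.2.re)) * him + e * y.2.im * hre
    have h10 : (0 : ℝ) ≤ ((a * d - b * e : ℤ) : ℝ) := by
      refine nonneg_of_mul_nonneg_left (h9 ▸ ?_) y.2.im_pos
      exact mul_nonneg τ'.im_pos.le (by positivity)
    refine lt_of_le_of_ne (by exact_mod_cast h10) fun h0 => ?_
    rw [← h0, zero_mul] at h7
    exact zero_ne_one h7
  have hdet : a * d - b * e = 1 := by
    rcases Int.isUnit_iff.1 (IsUnit.of_mul_eq_one _ h7) with h | h <;> omega
  let s : SL(2, ℤ) := ⟨!![a, b; e, d], by rw [Matrix.det_fin_two_of]; exact hdet⟩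
  refine ⟨s, by rw [h1, add_comm]; rfl, UpperHalfPlane.ext ?_⟩
  have h9 := iota_coe_smul_mul s y
  have hne : (d + e * (y.2 : ℂ) : ℂ) ≠ 0 := right_ne_zero_of_mul (h1 ▸ hc')
  refine mul_right_cancel₀ hne ?_
  rw [h8, add_comm, add_comm (b : ℂ)]
  exact h9

lemma ThetaAt.exists_smul_eq {c c' : ℂ} {y y' : AfH} (h : l.ThetaAt c y) (h' : l.ThetaAt c' y') :
    ∃ γ ∈ Gam, γ • y = y' := by
  obtain ⟨s, rfl, hs⟩ := h.basis.exists_smul_eq h.ne_zero h'.ne_zero h'.basis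
  exact ⟨iota s, iota_mem s, (h.smul s).eq_of_snd_eq h' hs⟩

end QLattice

lemma mem_Z2_iff {x : Fin 2 → ℚ} : x ∈ Z2 ↔ ∀ i, qA (x i) ∈ R :=
  forall_congr' fun _ => qA_mem_iff.symm

lemma Dvd.of_dvd {N M : ℕ} (hM : M ≠ 0) (h : N ∣ M) {a : Af} (ha : Dvd M a) : Dvd N a := by
  obtain ⟨k, rfl⟩ := h
  have hk : (k : ℚ) ≠ 0 := by exact_mod_cast right_ne_zero_of_mul hM
  have := R_mul (R_int k) ha
  unfold Dvd
  rw [← mul_assoc, ← map_mul] at this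
  convert this using 3
  push_cast
  rw [mul_inv, mul_comm (N : ℚ)⁻¹, mul_inv_cancel_left₀ hk]

/-- A compatible system of residues comes from an element of `R`. -/
lemma exists_forall_Dvd_sub {n : ℕ → ℤ}
    (hn : ∀ N M : ℕ, M ≠ 0 → N ∣ M → (N : ℤ) ∣ n M - n N) :
    ∃ a ∈ R, ∀ N : ℕ, N ≠ 0 → Dvd N (a - qA (n N)) := by
  have htrans : ∀ {N M : ℕ} {a : Af}, M ≠ 0 → N ∣ M → Dvd M (a - qA (n M)) →
      Dvd N (a - qA (n N)) := by
    intro N M a hM h ha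
    have := (ha.of_dvd hM h).add (Dvd_of_int_dvd (hn N M hM h))
    rwa [Int.cast_sub, map_sub, sub_add_sub_cancel] at this
  -- The conditions modulo k! form a decreasing sequence of non-empty compact sets, and every N
  -- divides N!.
  let t : ℕ → Set Af := fun k =>
    R ∩ (fun a : Af => a - qA (n k.factorial)) ⁻¹' {a | Dvd k.factorial a}
  have hcl : ∀ k, IsClosed (t k) := fun k =>
    isClosed_R.inter ((isClopen_Dvd _).1.preimage (continuous_id.sub continuous_const))
  obtain ⟨a, ha⟩ := IsCompact.nonempty_iInter_of_sequence_nonempty_isCompact_isClosed t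
    (fun k a ha => ⟨ha.1, htrans (Nat.factorial_ne_zero _)
      (Nat.factorial_dvd_factorial k.le_succ) ha.2⟩)
    (fun k => ⟨qA (n k.factorial), R_int _, by
      change qA (n k.factorial) - qA (n k.factorial) ∈ {a | Dvd k.factorial a}
      rw [sub_self]
      exact (by unfold Dvd; rw [mul_zero]; exact RSub.zero_mem : Dvd k.factorial 0)⟩)
    (isCompact_R.of_isClosed_subset (hcl 0) Set.inter_subset_left) hcl
  rw [Set.mem_iInter] at ha
  exact ⟨a, (ha 0).1, fun N hN => htrans (Nat.factorial_ne_zero _)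
    (Nat.dvd_factorial (Nat.pos_of_ne_zero hN) le_rfl) (ha N).2⟩

/-! ### Existence of (ρ, τ), and of an invertible lattice for each point of Y0. -/

namespace QLattice

variable {l : QLattice}

/-- The ratio of two basis vectors is not real by independence over ℝ; changing its sign if
necessary puts it in ℍ. -/
lemma exists_hasBasis (l : QLattice) : ∃ c τ, c ≠ 0 ∧ l.HasBasis c τ := by
  have := l.discrete
  have : IsZLattice ℝ l.lat := ⟨l.span_top⟩
  let b : Module.Basis (Fin 2) ℤ l.lat := Module.finBasisOfFinrankEq ℤ l.lat
    (by rw [ZLattice.rank ℝ, Complex.finrank_real_complex])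
  let B := b.ofZLatticeBasis ℝ
  have hB : ∀ z : ℂ, z ∈ l.lat ↔ ∃ m n : ℤ, z = m * B 0 + n * B 1 := by
    intro z
    conv_lhs => rw [← b.ofZLatticeBasis_span ℝ]
    rw [Submodule.mem_span_range_iff_exists_fun]
    constructor
    · rintro ⟨c, rfl⟩
      exact ⟨c 0, c 1, by simp [Fin.sum_univ_two, B]⟩
    · rintro ⟨m, n, rfl⟩
      exact ⟨![m, n], by simp [Fin.sum_univ_two, B]⟩
  have h0 : B 0 ≠ 0 := B.ne_zero 0
  have him : (B 1 / B 0).im ≠ 0 := by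
    intro him
    have hli := Fintype.linearIndependent_iff.1 B.linearIndependent ![-(B 1 / B 0).re, 1] (by
      have e : B 1 / B 0 = ((B 1 / B 0).re : ℂ) := Complex.ext rfl (by simpa using him)
      rw [div_eq_iff h0] at e
      rw [Fin.sum_univ_two, Complex.real_smul, Complex.real_smul]
      simp only [Matrix.cons_val_zero, Matrix.cons_val_one, Matrix.cons_val_fin_one]
      push_cast
      linear_combination e) 1
    exact one_ne_zero hli
  have e1 : B 0 * (B 1 / B 0) = B 1 := mul_div_cancel₀ _ h0
  rcases him.lt_or_gt with h | h
  · refine ⟨B 0, ⟨-(B 1 / B 0), by simpa using h⟩, h0, fun z => (hB z).trans ⟨?_, ?_⟩⟩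
    · rintro ⟨m, n, rfl⟩
      exact ⟨m, -n, by push_cast; linear_combination -(n : ℂ) * e1⟩
    · rintro ⟨m, n, rfl⟩
      exact ⟨m, -n, by push_cast; linear_combination -(n : ℂ) * e1⟩
  · refine ⟨B 0, ⟨B 1 / B 0, h⟩, h0, fun z => (hB z).trans ⟨?_, ?_⟩⟩
    · rintro ⟨m, n, rfl⟩
      exact ⟨m, n, by push_cast; linear_combination -(n : ℂ) * e1⟩
    · rintro ⟨m, n, rfl⟩
      exact ⟨m, n, by push_cast; linear_combination (n : ℂ) * e1⟩

/-- Every `ℚ`-lattice is a multiple of some `θ(ρ, τ)`. -/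
lemma exists_thetaAt (l : QLattice) : ∃ c y, l.ThetaAt c y := by
  obtain ⟨c, τ, hc, hb⟩ := l.exists_hasBasis
  -- N times a lift of e_j/N lies in the lattice, so the lift has coordinates n/N. These integers
  -- are the j-th column of ρ modulo N.
  have key : ∀ (j : Fin 2) (N : ℕ), ∃ n : Fin 2 → ℤ, N ≠ 0 → l.Lifts (Pi.single j (N : ℚ)⁻¹)
      (c * (((N : ℚ)⁻¹ * n 0 : ℚ) - (τ : ℂ) * ((N : ℚ)⁻¹ * n 1 : ℚ))) := by
    intro j N
    rcases eq_or_ne N 0 with rfl | hN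
    · exact ⟨0, fun h => absurd rfl h⟩
    have hN' : (N : ℚ) ≠ 0 := by exact_mod_cast hN
    obtain ⟨z, hz⟩ := l.exists_lift (Pi.single j (N : ℚ)⁻¹)
    obtain ⟨q, rfl⟩ := hb.exists_eq hz.1
    have h1 := (hz.zsmul N).mem_lat fun i => by
      by_cases hi : i = j
      · subst hi; exact ⟨1, by simp [hN']⟩
      · exact ⟨0, by simp [hi]⟩
    have h2 : (N : ℚ) • q ∈ Z2 := (hb.mem_iff hc).1 (by
      convert h1 using 1
      simp
      ring)
    choose n hn using h2
    refine ⟨n, fun _ => ?_⟩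
    rw [← hn, ← hn, Pi.smul_apply, Pi.smul_apply, smul_eq_mul, smul_eq_mul,
      inv_mul_cancel_left₀ hN', inv_mul_cancel_left₀ hN']
    exact hz
  choose n hn using key
  -- Because k · e_j/(Nk) = e_j/N, the two lifts differ by a lattice element.
  have hcompat : ∀ i j (N M : ℕ), M ≠ 0 → N ∣ M → (N : ℤ) ∣ n j M i - n j N i := by
    rintro i j N M hM ⟨k, rfl⟩
    have hN := left_ne_zero_of_mul hM
    have hN' : (N : ℚ) ≠ 0 := by exact_mod_cast hN
    have hk' : (k : ℚ) ≠ 0 := by exact_mod_cast right_ne_zero_of_mul hM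
    have h1 := (((hn j _ hM).zsmul k).sub (hn j N hN)).mem_lat (fun i => ⟨0, by
      by_cases hi : i = j
      · subst hi
        simp only [Pi.sub_apply, Pi.smul_apply, Pi.single_eq_same]
        push_cast
        rw [zsmul_eq_mul]
        field_simp
        simp
      · simp [hi]⟩)
    have h2 : (fun i => (N : ℚ)⁻¹ * (n j (N * k) i - n j N i)) ∈ Z2 := (hb.mem_iff hc).1 (by
      convert h1 using 1
      have : (k : ℂ) ≠ 0 := by exact_mod_cast hk'
      push_cast
      field_simp
      ring)
    obtain ⟨m, hm⟩ := h2 i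
    rw [inv_mul_eq_iff_eq_mul₀ hN'] at hm
    exact ⟨m, by exact_mod_cast hm⟩
  choose ρ hρ hρn using fun i j => exists_forall_Dvd_sub (hcompat i j)
  refine ⟨c, (Matrix.of ρ, τ), hc, hb, fun x q hq => ?_⟩
  simp only [Matrix.of_apply] at hq
  set N := (x 0).den * (x 1).den with hN
  have hN0 : N ≠ 0 := mul_ne_zero (x 0).den_ne_zero (x 1).den_ne_zero
  have hN' : (N : ℚ) ≠ 0 := by exact_mod_cast hN0
  obtain ⟨a, ha⟩ : ∃ a : Fin 2 → ℤ, ∀ i, x i = a i * (N : ℚ)⁻¹ := by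
    refine ⟨![(x 0).num * (x 1).den, (x 1).num * (x 0).den], fun i => ?_⟩
    rw [eq_mul_inv_iff_mul_eq₀ hN', hN]
    fin_cases i
    · simp [← mul_assoc, Rat.mul_den_eq_num]
    · simp [mul_comm ((x 0).den : ℚ), ← mul_assoc, Rat.mul_den_eq_num]
  have h1 := ((hn 0 N hN0).zsmul (a 0)).add ((hn 1 N hN0).zsmul (a 1))
  have hx : x = a 0 • Pi.single 0 (N : ℚ)⁻¹ + a 1 • Pi.single 1 (N : ℚ)⁻¹ := by
    ext i
    fin_cases i <;> simp [ha]
  rw [← hx] at h1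
  have h2 : (fun i => q i - (a 0 * ((N : ℚ)⁻¹ * n 0 N i) + a 1 * ((N : ℚ)⁻¹ * n 1 N i))) ∈ Z2 := by
    rw [mem_Z2_iff]
    intro i
    have h3 := RSub.sub_mem (R_add (R_mul (R_int (a 0)) (hρn i 0 N hN0))
      (R_mul (R_int (a 1)) (hρn i 1 N hN0))) (hq i)
    rw [mem_RSub] at h3
    convert h3 using 1
    simp only [ha, map_sub, map_add, map_mul]
    ring
  have h3 := h1.add (lifts_zero_iff.2 ((hb.mem_iff hc).2 h2))
  rw [add_zero] at h3
  convert h3 using 1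
  push_cast
  ring

/-- Every point of `Y0` comes from an invertible `ℚ`-lattice. -/
lemma exists_thetaAt_of_mem_Y0 {y : AfH} (hy : y ∈ Y0) :
    ∃ l : QLattice, l.IsInvertible ∧ l.ThetaAt 1 y := by
  let L : PeriodPair := ⟨1, y.2, LinearIndependent.pair_iff.2 fun s t h => by
    have := add_mul_coe_inj (τ := y.2) (a := s) (b := t) (a' := 0) (b' := 0) (by
      rw [Complex.real_smul, Complex.real_smul, mul_one] at h
      simpa using h)
    exact this⟩
  have hspan : Submodule.span ℝ (L.lattice : Set ℂ) = ⊤ := IsZLattice.span_top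
  let l₀ : QLattice := ⟨L.lattice, inferInstance, hspan, 0⟩
  have hb : l₀.HasBasis 1 y.2 := fun z => by
    refine PeriodPair.mem_lattice.trans (exists₂_congr fun m n => ?_)
    rw [one_mul, eq_comm]
    change z = m * 1 + n * (y.2 : ℂ) ↔ _
    rw [mul_one]
  have hQ : ∀ q : Fin 2 → ℚ, ((q 0 : ℂ) - (y.2 : ℂ) * q 1) ∈ QSpan L.lattice := by
    intro q
    refine AddSubgroup.sub_mem _ ?_ ?_
    · have := Submodule.smul_mem (Submodule.span ℚ (L.lattice : Set ℂ)) (q 0)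
        (Submodule.subset_span L.ω₁_mem_lattice)
      rw [Rat.smul_def] at this
      change (q 0 : ℂ) * 1 ∈ _ at this
      rwa [mul_one] at this
    · have := Submodule.smul_mem (Submodule.span ℚ (L.lattice : Set ℂ)) (q 1)
        (Submodule.subset_span L.ω₂_mem_lattice)
      rw [Rat.smul_def, mul_comm] at this
      exact this
  let P : (Fin 2 → ℚ) →+ QQuot L.lattice := AddMonoidHom.mk'
    (fun q => QuotientAddGroup.mk ⟨_, hQ q⟩) (fun q r => by
      rw [← QuotientAddGroup.mk_add]
      refine congrArg _ (Subtype.ext ?_)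
      change _ = (_ : ℂ) + _
      push_cast [Pi.add_apply]
      ring)
  have hP : ∀ q, P q = 0 ↔ q ∈ Z2 := fun q => by
    rw [← hb.mem_iff one_ne_zero, one_mul]
    exact QuotientAddGroup.eq_zero_iff _
  choose q hq using exists_rat_approx y
  have huniq : ∀ x r, (∀ i, y.1 i 0 * qA (x 0) + y.1 i 1 * qA (x 1) - qA (r i) ∈ R) →
      P (q x) = P r := by
    intro x r hr
    rw [← sub_eq_zero, ← map_sub, hP, mem_Z2_iff]
    intro i
    have := RSub.sub_mem (hr i) (hq x i)
    rwa [sub_sub_sub_cancel_left, ← map_sub] at this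
  let f : (Fin 2 → ℚ) →+ QQuot L.lattice := AddMonoidHom.mk' (fun x => P (q x)) (fun x x' => by
    rw [← map_add]
    refine huniq _ _ fun i => ?_
    have := R_add (hq x i) (hq x' i)
    convert this using 1
    simp only [Pi.add_apply, map_add]
    ring)
  have hf : ∀ x ∈ Z2, f x = 0 := fun x hx => by
    rw [mem_Z2_iff] at hx
    refine (huniq x 0 fun i => ?_).trans (map_zero P)
    have := R_add (R_mul (hy.1 i 0) (hx 0)) (R_mul (hy.1 i 1) (hx 1))
    simpa using this
  -- The inverse of det ρ in R gives Cramer's rule: injectivity of φ by recovering x from ρx, and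
  -- surjectivity by approximating ρ⁻¹r with rationals.
  obtain ⟨b, hbR, hb1⟩ := exists_mul_eq_one (det_mem hy.1) hy.2
  rw [Matrix.det_fin_two] at hb1
  refine ⟨⟨L.lattice, inferInstance, hspan, QuotientAddGroup.lift Z2 f hf⟩, ⟨?_, ?_⟩,
    one_ne_zero, hb, fun x r hr => ?_⟩
  · rw [injective_iff_map_eq_zero]
    intro x hx
    induction x using QuotientAddGroup.induction_on with
    | H x =>
      have h1 : q x ∈ Z2 := (hP _).1 hx
      rw [mem_Z2_iff] at h1
      have h2 : ∀ i, y.1 i 0 * qA (x 0) + y.1 i 1 * qA (x 1) ∈ R := fun i => by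
        simpa using R_add (hq x i) (h1 i)
      rw [QuotientAddGroup.eq_zero_iff, mem_Z2_iff]
      intro i
      fin_cases i
      · have := R_mul hbR (RSub.sub_mem (R_mul (hy.1 1 1) (h2 0)) (R_mul (hy.1 0 1) (h2 1)))
        convert this using 1
        simp only [Fin.zero_eta]
        linear_combination -qA (x 0) * hb1
      · have := R_mul hbR (RSub.sub_mem (R_mul (hy.1 0 0) (h2 1)) (R_mul (hy.1 1 0) (h2 0)))
        convert this using 1
        simp only [Fin.mk_one]
        linear_combination -qA (x 1) * hb1
  · intro w
    obtain ⟨⟨z, hz⟩, rfl⟩ := QuotientAddGroup.mk_surjective w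
    obtain ⟨r, hr⟩ := hb.exists_eq hz
    obtain ⟨x₀, hx₀⟩ := exists_rat_sub_mem (b * (y.1 1 1 * qA (r 0) - y.1 0 1 * qA (r 1)))
    obtain ⟨x₁, hx₁⟩ := exists_rat_sub_mem (b * (y.1 0 0 * qA (r 1) - y.1 1 0 * qA (r 0)))
    refine ⟨QuotientAddGroup.mk ![x₀, x₁], (huniq ![x₀, x₁] r fun i => ?_).trans
      (congrArg _ (Subtype.ext ((one_mul _).symm.trans hr.symm)))⟩
    have := RSub.neg_mem (R_add (R_mul (hy.1 i 0) hx₀) (R_mul (hy.1 i 1) hx₁))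
    rw [mem_RSub] at this
    convert this using 1
    fin_cases i
    · simp
      linear_combination qA (r 0) * hb1
    · simp
      linear_combination qA (r 1) * hb1
  · refine ⟨by rw [one_mul]; exact hQ r, (huniq x r hr).trans ?_⟩
    exact congrArg _ (Subtype.ext (one_mul _).symm)

end QLattice

/-! ### The adelic description -/

/-- The integer K bounds the primes that can divide det ρ. If p does divide it, splitting off an
integral matrix of determinant p replaces K by K/p. -/
lemma exists_smul_mem_Y0_of_det_mul (K : ℕ) : ∀ (y : AfH) (b : Af), K ≠ 0 → y ∈ Y → b ∈ R →
    y.1.det * b = qA K → ∃ r : G, r • y ∈ Y0 := by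
  induction K using Nat.strong_induction_on with
  | _ K ih =>
    intro y b hK hy hb e
    by_cases h : y ∈ Y0
    · exact ⟨1, by rwa [one_smul]⟩
    obtain ⟨p, hp, hd⟩ : ∃ p : ℕ, p.Prime ∧ Dvd p y.1.det := by
      by_contra hc
      push Not at hc
      exact h ⟨hy, hc⟩
    have hp0 : (p : ℚ) ≠ 0 := by exact_mod_cast hp.ne_zero
    obtain ⟨m, hm, hmy⟩ := exists_Mset_of_Dvd hp hy hd
    have h1 := Dvd.mul hb hd
    rw [mul_comm, e] at h1
    obtain ⟨k, rfl⟩ : p ∣ K := by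
      exact_mod_cast int_dvd_of_Dvd hp.ne_zero (n := K) (by simpa using h1)
    have hk : k ≠ 0 := right_ne_zero_of_mul hK
    have hdet : m⁻¹.1.1.det = (p : ℚ)⁻¹ := by
      have h2 := detR_inv m
      rw [hm.2] at h2
      exact Rat.cast_injective (α := ℝ) (h2.trans (by push_cast; rfl))
    obtain ⟨r, hr⟩ := ih k (lt_mul_of_one_lt_left (Nat.pos_of_ne_zero hk) hp.one_lt)
      (m⁻¹ • y) b hk hmy hb (by
        rw [det_smul, hdet, mul_assoc, e, ← map_mul]
        rw [Nat.cast_mul, inv_mul_cancel_left₀ hp0])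
    exact ⟨r * m⁻¹, by rwa [mul_smul]⟩

/-- This is GL₂(𝔸_f) = GL₂⁺(ℚ) GL₂(R). Clear the denominators n of ρ and M of b; the product of the
new determinant and the new b is then the integer n²M. -/
lemma exists_smul_mem_Y0 {y : AfH} {b : Af} (e : y.1.det * b = 1) : ∃ r : G, r • y ∈ Y0 := by
  choose N hN0 hN using fun i j => exists_nat_mul_mem (y.1 i j)
  obtain ⟨M, hM0, hM⟩ := exists_nat_mul_mem b
  let n : ℕ := ∏ i, ∏ j, N i j
  have hn0 : n ≠ 0 := Finset.prod_ne_zero_iff.2 fun i _ => Finset.prod_ne_zero_iff.2 fun j _ =>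
    hN0 i j
  have hn : (0 : ℚ) < n := by exact_mod_cast Nat.pos_of_ne_zero hn0
  obtain ⟨r, hr⟩ := exists_smul_mem_Y0_of_det_mul (n ^ 2 * M) (scal n hn • y) (qA M * b)
    (mul_ne_zero (pow_ne_zero _ hn0) hM0) (fun i j => by
      rw [scal_smul_fst]
      obtain ⟨k, hk⟩ : N i j ∣ n :=
        (Finset.dvd_prod_of_mem (fun j => N i j) (Finset.mem_univ j)).trans
          (Finset.dvd_prod_of_mem (fun i => ∏ j, N i j) (Finset.mem_univ i))
      have := R_mul (R_int k) (hN i j)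
      rw [← mul_assoc, ← map_mul] at this
      convert this using 3
      rw [hk]
      push_cast
      ring) hM (by
      rw [Matrix.det_fin_two] at e ⊢
      simp only [scal_smul_fst]
      rw [Nat.cast_mul, Nat.cast_pow, map_mul, map_pow]
      linear_combination qA n ^ 2 * qA M * e)
  exact ⟨r * scal n hn, by rwa [mul_smul]⟩

lemma archPart_mul (g h : GL (Fin 2) Adele) : archPart (g * h) = archPart g * archPart h :=
  map_mul _ g h

lemma finPart_mul (g h : GL (Fin 2) Adele) : finPart (g * h) = finPart g * finPart h :=
  map_mul _ g h

/-- The point of `M₂(𝔸_f) × ℍ` given by an element of `GL₂(𝔸)`. -/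
def adelePoint (g : GL (Fin 2) Adele) : AfH := ((finPart g).1, archPart g • UpperHalfPlane.I)

/-- The diagonal embedding of `GL₂(ℚ)`. -/
def ratEmb (q : GL (Fin 2) ℚ) : GL (Fin 2) Adele :=
  Matrix.GeneralLinearGroup.map (algebraMap ℚ Adele) q

lemma ratEmb_mem (q : GL (Fin 2) ℚ) : ratEmb q ∈ ratGL := ⟨q, rfl⟩

lemma det_archPart_ratEmb_mul (q : GL (Fin 2) ℚ) (g : GL (Fin 2) Adele) :
    (archPart (ratEmb q * g)).1.det = ((q.1.det : ℚ) : ℝ) * (archPart g).1.det := by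
  rw [archPart_mul, Units.val_mul, Matrix.det_mul]
  congr 1
  exact (RingHom.map_det (algebraMap ℚ ℝ) q.1).symm

lemma adelePoint_ratEmb_mul (r : G) (g : GL (Fin 2) Adele) :
    adelePoint (ratEmb r.1 * g) = r • adelePoint g := by
  refine Prod.ext ?_ ?_
  · change (finPart (ratEmb r.1 * g)).1 = _
    rw [finPart_mul]
    rfl
  · change archPart (ratEmb r.1 * g) • UpperHalfPlane.I = _
    rw [archPart_mul, mul_smul]
    rfl

/-- The matrices (a, b; -b, a) are exactly the stabilizer of i in GL₂⁺(ℝ). -/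
lemma mem_complexGL {k : GL (Fin 2) Adele} : k ∈ complexGL ↔
    finPart k = 1 ∧ 0 < (archPart k).1.det ∧ archPart k • UpperHalfPlane.I = UpperHalfPlane.I := by
  constructor
  · rintro ⟨a, b, h1, h2⟩
    have hdet : (archPart k).1.det = a ^ 2 + b ^ 2 := by
      rw [Matrix.det_fin_two]
      change (k 0 0).1 * (k 1 1).1 - (k 0 1).1 * (k 1 0).1 = _
      simp only [h1]
      simp
      ring
    have hpos : 0 < (archPart k).1.det := by
      refine lt_of_le_of_ne (hdet ▸ by positivity) (Ne.symm ?_)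
      exact ((Matrix.isUnit_iff_isUnit_det _).1 (archPart k).isUnit).ne_zero
    refine ⟨Units.ext (Matrix.ext h2), hpos,
      (UpperHalfPlane.gl_smul_I_eq_I_iff_of_pos hpos).2 ⟨?_, ?_⟩⟩
    · exact (h1 0 0).trans (h1 1 1).symm
    · change (k 0 1).1 = -(k 1 0).1
      rw [h1, h1]
      simp
  · rintro ⟨h1, h2, h3⟩
    obtain ⟨h4, h5⟩ := (UpperHalfPlane.gl_smul_I_eq_I_iff_of_pos h2).1 h3
    refine ⟨(k 0 0).1, (k 0 1).1, fun i j => ?_, fun i j => ?_⟩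
    · have h4 : (k 0 0).1 = (k 1 1).1 := h4
      have h5 : (k 0 1).1 = -(k 1 0).1 := h5
      fin_cases i <;> fin_cases j <;> simp [h4, h5]
    · exact congrArg (fun m : GL (Fin 2) Af => m.1 i j) h1

/-- `ℂ^*` as a subgroup of `GL₂(𝔸)`. -/
def complexSubgroup : Subgroup (GL (Fin 2) Adele) where
  carrier := complexGL
  one_mem' := mem_complexGL.2 ⟨map_one _, by
    rw [show archPart 1 = 1 from map_one _]
    simp, by rw [show archPart 1 = 1 from map_one _, one_smul]⟩
  mul_mem' := fun {a b} ha hb => by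
    rw [mem_complexGL] at *
    refine ⟨by rw [finPart_mul, ha.1, hb.1, one_mul], ?_, ?_⟩
    · rw [archPart_mul, Units.val_mul, Matrix.det_mul]
      exact mul_pos ha.2.1 hb.2.1
    · rw [archPart_mul, mul_smul, hb.2.2, ha.2.2]
  inv_mem' := fun {a} ha => by
    rw [mem_complexGL] at *
    have e : archPart a⁻¹ = (archPart a)⁻¹ := map_inv _ a
    refine ⟨?_, ?_, ?_⟩
    · rw [show finPart a⁻¹ = (finPart a)⁻¹ from map_inv _ a, ha.1, inv_one]
    · refine pos_of_mul_pos_left (b := (archPart a).1.det) ?_ ha.2.1.le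
      rw [← Matrix.det_mul, ← Units.val_mul, e, inv_mul_cancel]
      simp
    · rw [e, inv_smul_eq_iff, ha.2.2]

/-- The double coset of an element of `GL₂(𝔸)`. -/
def adelicClass (g : GL (Fin 2) Adele) : AdelicQuotient := Quotient.mk _ g

lemma adelicClass_eq_iff {g g' : GL (Fin 2) Adele} : adelicClass g = adelicClass g' ↔
    ∃ q, ∃ k ∈ complexGL, g' = ratEmb q * g * k := by
  refine (DoubleCoset.eq ratGL complexSubgroup g g').trans ⟨?_, ?_⟩
  · rintro ⟨_, ⟨q, rfl⟩, k, hk, e⟩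
    exact ⟨q, k, hk, e⟩
  · rintro ⟨q, k, hk, e⟩
    exact ⟨_, ratEmb_mem q, k, hk, e⟩

lemma adelePoint_mul {k : GL (Fin 2) Adele} (hk : k ∈ complexGL) (g : GL (Fin 2) Adele) :
    adelePoint (g * k) = adelePoint g ∧
      (0 < (archPart (g * k)).1.det ↔ 0 < (archPart g).1.det) := by
  obtain ⟨h1, h2, h3⟩ := mem_complexGL.1 hk
  refine ⟨?_, ?_⟩
  · rw [adelePoint, finPart_mul, archPart_mul, mul_smul, h1, h3, mul_one]
    rfl
  · rw [archPart_mul, Units.val_mul, Matrix.det_mul]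
    exact mul_pos_iff_of_pos_right h2

/-- Every double coset has a representative in `GL₂⁺(ℝ) × GL₂(R)`. -/
lemma exists_adelicClass_eq (x : AdelicQuotient) :
    ∃ g, adelicClass g = x ∧ 0 < (archPart g).1.det ∧ adelePoint g ∈ Y0 := by
  obtain ⟨g, rfl⟩ : ∃ g, adelicClass g = x := Quotient.exists_rep x
  have hone : (1 : GL (Fin 2) Adele) ∈ complexGL := complexSubgroup.one_mem
  -- The rational matrix diag(-1, 1) corrects the sign of the archimedean determinant before the
  -- finite part is treated with elements of GL₂⁺(ℚ).
  obtain ⟨q, hq⟩ : ∃ q : GL (Fin 2) ℚ, 0 < (archPart (ratEmb q * g)).1.det := by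
    have h0 : (archPart g).1.det ≠ 0 :=
      ((Matrix.isUnit_iff_isUnit_det _).1 (archPart g).isUnit).ne_zero
    rcases h0.lt_or_gt with h | h
    · refine ⟨Matrix.GeneralLinearGroup.mkOfDetNeZero !![-1, 0; 0, 1] (by simp), ?_⟩
      rw [det_archPart_ratEmb_mul]
      change 0 < (((!![-1, 0; 0, 1] : Matrix (Fin 2) (Fin 2) ℚ).det : ℚ) : ℝ) * _
      rw [Matrix.det_fin_two_of]
      push_cast
      linarith
    · exact ⟨1, by rw [det_archPart_ratEmb_mul]; simpa using h⟩
  have hu : (adelePoint (ratEmb q * g)).1.det * (finPart (ratEmb q * g))⁻¹.1.det = 1 := by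
    change (finPart (ratEmb q * g)).1.det * _ = 1
    rw [← Matrix.det_mul, ← Units.val_mul, mul_inv_cancel]
    simp
  obtain ⟨r, hr⟩ := exists_smul_mem_Y0 hu
  refine ⟨ratEmb r.1 * (ratEmb q * g), ?_, ?_, ?_⟩
  · exact (adelicClass_eq_iff.2 ⟨r.1 * q, 1, hone, by
      rw [show ratEmb (r.1 * q) = ratEmb r.1 * ratEmb q from map_mul _ _ _, mul_one, mul_assoc]⟩).symm
  · rw [det_archPart_ratEmb_mul]
    exact mul_pos (detR_pos r) hq
  · rwa [adelePoint_ratEmb_mul]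

/-- Representatives of a double coset in `GL₂⁺(ℝ) × GL₂(R)` give points in the same orbit
of `Γ`, and conversely. -/
lemma adelicClass_eq_iff_exists_smul {g g' : GL (Fin 2) Adele} (hg : 0 < (archPart g).1.det)
    (hg' : 0 < (archPart g').1.det) (h : adelePoint g ∈ Y0) (h' : adelePoint g' ∈ Y0) :
    adelicClass g = adelicClass g' ↔ ∃ γ ∈ Gam, γ • adelePoint g = adelePoint g' := by
  rw [adelicClass_eq_iff]
  constructor
  · rintro ⟨q, k, hk, rfl⟩
    rw [(adelePoint_mul hk _).2, det_archPart_ratEmb_mul, mul_pos_iff_of_pos_right hg] at hg'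
    let r : G := ⟨q, by exact_mod_cast hg'⟩
    have e : adelePoint (ratEmb q * g * k) = r • adelePoint g :=
      (adelePoint_mul hk _).1.trans (adelePoint_ratEmb_mul r g)
    refine ⟨r, ?_, e.symm⟩
    rw [e] at h'
    -- Since r carries one invertible point to another, both r and its inverse are integral, which
    -- puts r in Γ.
    have h1 : r ∈ M2Zplus := (mem_M2Zplus_of_Y0 h).1 h'.1
    have h2 : r⁻¹ ∈ M2Zplus := (mem_M2Zplus_of_Y0 h').1 (by rw [inv_smul_smul]; exact h.1)
    have h3 := one_le_detR h2
    rw [detR_inv, one_le_inv₀ (detR_pos r)] at h3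
    exact mem_Gam_iff.2 ⟨h1, le_antisymm h3 (one_le_detR h1)⟩
  · rintro ⟨γ, -, e⟩
    rw [← adelePoint_ratEmb_mul] at e
    refine ⟨γ.1, (ratEmb γ.1 * g)⁻¹ * g', mem_complexGL.2 ⟨?_, ?_, ?_⟩, by
      rw [mul_inv_cancel_left]⟩
    · rw [finPart_mul, show finPart (ratEmb γ.1 * g)⁻¹ = (finPart (ratEmb γ.1 * g))⁻¹ from
        map_inv _ _, inv_mul_eq_one]
      exact Units.ext (congrArg Prod.fst e)
    · have h1 : 0 < (archPart (ratEmb γ.1 * g)).1.det := by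
        rw [det_archPart_ratEmb_mul]
        exact mul_pos (detR_pos γ) hg
      refine pos_of_mul_pos_right (a := (archPart (ratEmb γ.1 * g)).1.det) ?_ h1.le
      rwa [← Matrix.det_mul, ← Units.val_mul, ← archPart_mul, mul_inv_cancel_left]
    · rw [archPart_mul, mul_smul, show archPart (ratEmb γ.1 * g)⁻¹ =
        (archPart (ratEmb γ.1 * g))⁻¹ from map_inv _ _, inv_smul_eq_iff]
      exact (congrArg Prod.snd e).symm

lemma exists_adelePoint_eq {y : AfH} (hy : y ∈ Y0) :
    ∃ g, 0 < (archPart g).1.det ∧ adelePoint g = y := by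
  obtain ⟨b, -, hb⟩ := exists_mul_eq_one (det_mem hy.1) hy.2
  -- This matrix sends i to τ and has determinant Im τ > 0.
  let α : Matrix (Fin 2) (Fin 2) ℝ := !![y.2.im, y.2.re; 0, 1]
  have hα : α.det = y.2.im := by rw [Matrix.det_fin_two_of]; ring
  let m : Matrix (Fin 2) (Fin 2) Adele := Matrix.of fun i j => (α i j, y.1 i j)
  have hm : IsUnit m.det := by
    have e : m.det = (α.det, y.1.det) := by
      rw [Matrix.det_fin_two, Matrix.det_fin_two, Matrix.det_fin_two]
      rfl
    rw [e, Prod.isUnit_iff]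
    exact ⟨(hα ▸ y.2.im_ne_zero).isUnit, IsUnit.of_mul_eq_one _ hb⟩
  have ha : (archPart (Matrix.GeneralLinearGroup.mk'' m hm)).1 = α := rfl
  have hpos : 0 < (archPart (Matrix.GeneralLinearGroup.mk'' m hm)).1.det := by
    rw [ha, hα]
    exact y.2.im_pos
  refine ⟨Matrix.GeneralLinearGroup.mk'' m hm, hpos, Prod.ext rfl (UpperHalfPlane.ext ?_)⟩
  change ((archPart (Matrix.GeneralLinearGroup.mk'' m hm) • UpperHalfPlane.I : ℍ) : ℂ) = y.2
  rw [UpperHalfPlane.coe_smul_of_det_pos hpos, UpperHalfPlane.num, UpperHalfPlane.denom]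
  change ((y.2.im : ℂ) * Complex.I + (y.2.re : ℂ)) / (((0 : ℝ) : ℂ) * Complex.I + (1 : ℝ)) = y.2
  rw [Complex.ofReal_zero, zero_mul, zero_add, Complex.ofReal_one, div_one, add_comm]
  exact Complex.re_add_im _

/-! ### Invertible lattices up to scaling -/

lemma mem_Y0_of_isTheta {l : InvQLattice} {y : AfH} (h : l.1.IsTheta y) : y ∈ Y0 := by
  obtain ⟨c, hc⟩ := QLattice.isTheta_iff.1 h
  exact hc.mem_Y0 l.2

lemma exists_isTheta (l : InvQLattice) : ∃ y, l.1.IsTheta y := by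
  obtain ⟨c, y, h⟩ := l.1.exists_thetaAt
  exact ⟨y, QLattice.isTheta_iff.2 ⟨c, h⟩⟩

lemma exists_isTheta_of_mem_Y0 {y : AfH} (hy : y ∈ Y0) : ∃ l : InvQLattice, l.1.IsTheta y := by
  obtain ⟨l, hl, h⟩ := QLattice.exists_thetaAt_of_mem_Y0 hy
  exact ⟨⟨l, hl⟩, QLattice.isTheta_iff.2 ⟨1, h⟩⟩

lemma latticeClass_eq_iff {l l' : InvQLattice} {y y' : AfH} (h : l.1.IsTheta y)
    (h' : l'.1.IsTheta y') : Quotient.mk scalingSetoid l = Quotient.mk scalingSetoid l' ↔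
      ∃ γ ∈ Gam, γ • y = y' := by
  obtain ⟨c, hc⟩ := QLattice.isTheta_iff.1 h
  obtain ⟨c', hc'⟩ := QLattice.isTheta_iff.1 h'
  rw [Quotient.eq]
  constructor
  · rintro ⟨d, hd, hs⟩
    exact (hc.of_isScaling hd hs).exists_smul_eq hc'
  · rintro ⟨_, ⟨s, rfl⟩, rfl⟩
    have h1 := hc.smul s
    exact ⟨_, div_ne_zero hc'.ne_zero h1.ne_zero, h1.isScaling hc'⟩

/-- The extremal KMS state attached to an invertible lattice. -/
def latticeState {β : ℝ} (hβ : 2 < β) (x : InvQLatticeClass) :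
    extremalKMS (fun t (a : A) => sigma t a) β :=
  gibbsState hβ (exists_isTheta x.out).choose (mem_Y0_of_isTheta (exists_isTheta x.out).choose_spec)

/-- The point chosen in `latticeState` and y differ by an element of Γ, under which Gibbs states are
invariant. -/
lemma latticeState_mk {β : ℝ} (hβ : 2 < β) {l : InvQLattice} {y : AfH} (h : l.1.IsTheta y) :
    latticeState hβ (Quotient.mk scalingSetoid l) = gibbsState hβ y (mem_Y0_of_isTheta h) := by
  obtain ⟨γ, hγ, e⟩ := (latticeClass_eq_iff
    (exists_isTheta (Quotient.mk scalingSetoid l).out).choose_spec h).1 (Quotient.out_eq _)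
  exact gibbsState_smul hβ _ _ hγ e

lemma bijective_latticeState {β : ℝ} (hβ : 2 < β) : Function.Bijective (latticeState hβ) := by
  constructor
  · intro x x'
    refine Quotient.inductionOn₂ x x' fun l l' e => ?_
    obtain ⟨y, hy⟩ := exists_isTheta l
    obtain ⟨y', hy'⟩ := exists_isTheta l'
    rw [latticeState_mk hβ hy, latticeState_mk hβ hy'] at e
    exact (latticeClass_eq_iff hy hy').2 (exists_smul_eq_of_gibbsState hβ _ _ e)
  · intro φ
    obtain ⟨y, hy, rfl⟩ := exists_gibbsState_eq hβ φ
    obtain ⟨l, hl⟩ := exists_isTheta_of_mem_Y0 hy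
    exact ⟨Quotient.mk _ l, latticeState_mk hβ hl⟩

lemma exists_adelic_isTheta (x : AdelicQuotient) : ∃ l : InvQLattice, ∃ g, adelicClass g = x ∧
    0 < (archPart g).1.det ∧ l.1.IsTheta (adelePoint g) := by
  obtain ⟨g, hgx, hg, hy⟩ := exists_adelicClass_eq x
  obtain ⟨l, hl⟩ := exists_isTheta_of_mem_Y0 hy
  exact ⟨l, g, hgx, hg, hl⟩

/-- The lattice attached to a double coset. -/
def adelicLattice (x : AdelicQuotient) : InvQLatticeClass :=
  Quotient.mk _ (exists_adelic_isTheta x).choose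

lemma adelicLattice_mk {g : GL (Fin 2) Adele} {l : InvQLattice} (hg : 0 < (archPart g).1.det)
    (h : l.1.IsTheta (adelePoint g)) :
    adelicLattice (adelicClass g) = Quotient.mk scalingSetoid l := by
  obtain ⟨g', e, hg', h'⟩ := (exists_adelic_isTheta (adelicClass g)).choose_spec
  exact (latticeClass_eq_iff h' h).2 ((adelicClass_eq_iff_exists_smul hg' hg
    (mem_Y0_of_isTheta h') (mem_Y0_of_isTheta h)).1 e)

/-- Both sides are the set of Γ-orbits in `Y0`, by `latticeClass_eq_iff` and
`adelicClass_eq_iff_exists_smul`. -/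
lemma bijective_adelicLattice : Function.Bijective adelicLattice := by
  constructor
  · intro x x' e
    obtain ⟨l, g, rfl, hg, h⟩ := exists_adelic_isTheta x
    obtain ⟨l', g', rfl, hg', h'⟩ := exists_adelic_isTheta x'
    rw [adelicLattice_mk hg h, adelicLattice_mk hg' h', latticeClass_eq_iff h h'] at e
    exact (adelicClass_eq_iff_exists_smul hg hg' (mem_Y0_of_isTheta h)
      (mem_Y0_of_isTheta h')).2 e
  · intro x
    refine Quotient.inductionOn x fun l => ?_
    obtain ⟨y, hy⟩ := exists_isTheta l
    obtain ⟨g, hg, rfl⟩ := exists_adelePoint_eq (mem_Y0_of_isTheta hy)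
    exact ⟨adelicClass g, adelicLattice_mk hg hy⟩

end
end GL2System

theorem mainTheorem1 :
    -- every invertible `ℚ`-lattice is, up to scaling, of the form `θ(ρ, τ)` with `(ρ, τ) ∈ Y`
    (∀ l : InvQLattice, ∃ y : Y, l.1.IsTheta y) ∧
    -- 1) the representation given by an invertible `ℚ`-lattice has positive energy; in particular
    -- the eigenvalues of the Hamiltonian `H_y` are non-negative
    (∀ (l : InvQLattice) (y : Y), l.1.IsTheta y →
      IsPositiveEnergy (fun t a => sigma t a) (rep y) ∧
        ∀ x : Cosets (Gy (y : AfH)), 0 ≤ energy x) ∧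
    -- the partition function `Trace (e^{-β H})` is `ζ(β) ζ(β - 1)`
    (∀ β : ℝ, 2 < β → ∀ (l : InvQLattice) (y : Y), l.1.IsTheta y →
      HasSum (fun x : Cosets (Gy (y : AfH)) => ((Real.exp (-β * energy x) : ℝ) : ℂ))
        (riemannZeta β * riemannZeta (β - 1))) ∧
    -- 2) and 3) the formula defines extremal KMS states, and `l ↦ φ_{β, l}` is bijective
    (∀ β : ℝ, 2 < β → ∃ Φ : InvQLatticeClass → extremalKMS (fun t (a : A) => sigma t a) β,
      (∀ (l : InvQLattice) (y : Y), l.1.IsTheta y → ∀ f : CcZ,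
        HasSum (fun m : Cosets M2Zplus =>
          (riemannZeta β * riemannZeta (β - 1))⁻¹ * gibbsTerm β f y m)
          ((Φ (Quotient.mk scalingSetoid l) : A →L[ℂ] ℂ) (toA f))) ∧
      Function.Bijective Φ) ∧
    -- the space of invertible `ℚ`-lattices up to scaling is `GL₂(ℚ) \ GL₂(𝔸) / ℂ^*`
    (∃ J : AdelicQuotient → InvQLatticeClass,
      (∀ (g : GL (Fin 2) Adele) (l : InvQLattice), 0 < (archPart g).1.det →
        l.1.IsTheta ((finPart g).1, archPart g • UpperHalfPlane.I) →
        J (Quotient.mk _ g) = Quotient.mk scalingSetoid l) ∧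
      Function.Bijective J) := by
  refine ⟨fun l => ?_, fun l y h => ?_, fun β hβ l y h => ?_, fun β hβ => ?_, ?_⟩
  · obtain ⟨y, hy⟩ := exists_isTheta l
    exact ⟨⟨y, (mem_Y0_of_isTheta hy).1⟩, hy⟩
  · exact ⟨isPositiveEnergy_rep y (mem_Y0_of_isTheta h), energy_nonneg (mem_Y0_of_isTheta h)⟩
  · exact hasSum_partition hβ (mem_Y0_of_isTheta h)
  · refine ⟨latticeState hβ, fun l y h f => ?_, bijective_latticeState hβ⟩
    rw [latticeState_mk hβ h]
    exact hasSum_gibbsState hβ _ f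
  · exact ⟨adelicLattice, fun g l hg h => adelicLattice_mk hg h, bijective_adelicLattice⟩
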